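/- **Generator matrices and Clebsch–Gordan coefficients of $PSL_2(7)$ in bases adapted to $S_4$ and to $\mathcal T_7$.** *Constants.* $\omega=e^{2\pi i/3}$, $\eta=e^{2\pi i/7}$, $b_7=\frac{-1+i\sqrt7}{2\sqrt2}$, $\bar b_7=b_7^*$, $c_k=\cos\frac{2\pi k}{7}$, $\alpha=\arctan\frac{\sqrt3}{2}$, $\beta=\arctan(3\sqrt3+2\sqrt6)$. $M^*$ is the entrywise complex conjugate, $M^\dagger$ its transpose. *The group.* $G=PSL_2(7)$ is generated by some pair $A,B$ with $A^2=B^3=(AB)^7=(ABA^{-1}B^{-1})^4=1$. Let $A,B$ be any such generating pair. Put $a=ABA^{-1}B^{-1}$, $b=(AB^2(AB)^2)^2$, $c=AB$, $d=AB(AB^2)^2(AB)^2AB^2$. Then $a^4=b^2=(ab)^3=1$ and $\langle a,b\rangle\cong S_4$; $c^7=d^3=1$, $d^{-1}cd=c^4$ and $\langle c,d\rangle=\mathcal T_7$ has order $21$. *Irreps of $S_4$*: $1_0: a=b=1$; $1_1: a=b=-1$; $2: a=\begin{pmatrix}0&1\\1&0\end{pmatrix}, b=\begin{pmatrix}0&\omega^2\\\omega&0\end{pmatrix}$;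 $3_1: a=\frac13\begin{pmatrix}-1&2\omega^2&2\omega\\2\omega^2&2\omega&-1\\2\omega&-1&2\omega^2\end{pmatrix}, b=\frac13\begin{pmatrix}-1&2\omega^2&2\omega\\2\omega&2&-\omega^2\\2\omega^2&-\omega&2\end{pmatrix}$; $3_2$: the negatives of these. All are self-conjugate ($\bar x=x$) with $\Gamma_{1_0}=\Gamma_{1_1}=1$, $\Gamma_2=\begin{pmatrix}0&1\\1&0\end{pmatrix}$, $\Gamma_{3_1}=\Gamma_{3_2}=\begin{pmatrix}1&0&0\\0&0&1\\0&1&0\end{pmatrix}$. *Contractions of $S_4$.* For triplets $x,y$ put $[xy]_1=\frac{x_1y_1+x_2y_3+x_3y_2}{\sqrt3}$, $[xy]_{1'}=\frac{x_3y_3+x_1y_2+x_2y_1}{\sqrt3}$, $[xy]_{\bar1'}=\frac{x_2y_2+x_1y_3+x_3y_1}{\sqrt3}$, $[xy]_s=\frac1{\sqrt6}(2x_1y_1-x_2y_3-x_3y_2,\;2x_3y_3-x_1y_2-x_2y_1,\;2x_2y_2-x_1y_3-x_3y_1)$, $[xy]_a=\frac1{\sqrt2}(x_2y_3-x_3y_2,\;x_1y_2-x_2y_1,\;x_3y_1-x_1y_3)$.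 Then $3_i\otimes3_i\to1_0,2,3_1,3_2$ are $[xy]_1$, $([xy]_{1'},[xy]_{\bar1'})$, $[xy]_s$, $i[xy]_a$; $3_i\otimes3_j\to1_1,2,3_1,3_2$ ($i\ne j$) are $[xy]_1$, $(i[xy]_{1'},-i[xy]_{\bar1'})$, $i[xy]_a$, $[xy]_s$. For a triplet $x$ and a doublet $z$, in either order: $3_i\otimes2\to3_i$ is $\frac1{\sqrt2}(z_1x_3+z_2x_2,\;z_1x_1+z_2x_3,\;z_1x_2+z_2x_1)$ and $3_i\otimes2\to3_j$ ($j\ne i$) is $\frac i{\sqrt2}(z_1x_3-z_2x_2,\;z_1x_1-z_2x_3,\;z_1x_2-z_2x_1)$. $2\otimes2\to1_0,1_1,2$ are $\frac{z_1w_2+z_2w_1}{\sqrt2}$, $\frac{i(z_1w_2-z_2w_1)}{\sqrt2}$, $(z_2w_2,z_1w_1)$. $2\otimes1_1\to2$, in either order, is $(iz_1s,-iz_2s)$. All other products with a singlet are the product with a number ($1_1\otimes1_1=1_0$, $1_1\otimes3_1=3_2$, $1_1\otimes3_2=3_1$). *Irreps of $\mathcal T_7$*: $1$: $c=d=1$;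 $1'$: $c=1,d=\omega$; $\bar1'$: $c=1,d=\omega^2$; $3$: $c=\mathrm{diag}(\eta,\eta^2,\eta^4)$, $d=\begin{pmatrix}0&1&0\\0&0&1\\1&0&0\end{pmatrix}$; $\bar3=3^*$. The bar exchanges $1'\leftrightarrow\bar1'$, $3\leftrightarrow\bar3$, and all $\Gamma_x=1$. *Contractions of $\mathcal T_7$.* $1'\otimes3\to3$: $s(x_1,\omega x_2,\omega^2x_3)$; $\bar1'\otimes3\to3$: $s(x_1,\omega^2x_2,\omega x_3)$; $3\otimes3\to3$: $(x_3y_3,x_1y_1,x_2y_2)$; $3\otimes3\to\bar3_s,\bar3_a$: $\frac1{\sqrt2}(x_3y_2\pm x_2y_3,\;x_1y_3\pm x_3y_1,\;x_2y_1\pm x_1y_2)$; $3\otimes\bar3\to3$: $(x_2y_1,x_3y_2,x_1y_3)$; $3\otimes\bar3\to\bar3$: $(x_1y_2,x_2y_3,x_3y_1)$; $3\otimes\bar3\to1,1',\bar1'$: $\frac{x_1y_1+x_2y_2+x_3y_3}{\sqrt3}$, $\frac{x_1y_1+\omega^2x_2y_2+\omega x_3y_3}{\sqrt3}$, $\frac{x_1y_1+\omega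 x_2y_2+\omega^2x_3y_3}{\sqrt3}$; products of singlets and products with $1$ are products with a number; the remaining ones follow by complex conjugation of all coefficients together with barring all irreps, and by exchanging the factors of a product of two different irreps. *Generator matrices of $G$, $S_4$ basis.* ($1$: $A=B=1$; $\bar 3=3^*$.) $A^{[3]}=\begin{pmatrix}-\frac{1}{3}&\frac{2}{3}\omega&\frac{2}{3}\omega^{2}\\\frac{2}{3}\omega^{2}&-\frac{1}{3}&\frac{2}{3}\omega\\\frac{2}{3}\omega&\frac{2}{3}\omega^{2}&-\frac{1}{3}\end{pmatrix}$, $B^{[3]}=\begin{pmatrix}\frac{2}{3}&-\frac{i(\sqrt{3}+\sqrt{7})}{6}\omega^{2}\bar b_7^{2}&\frac{i(\sqrt{3}-\sqrt{7})}{6}\omega \bar b_7^{2}\\\frac{i(\sqrt{7}-\sqrt{3})}{6}\omega b_7^{2}&-\frac{1}{3}&\frac{1+\sqrt{21}}{6}\omega^{2}\\\frac{i(\sqrt{3}+\sqrt{7})}{6}\omega^{2}b_7^{2}&\frac{1-\sqrt{21}}{6}\omega&-\frac{1}{3}\end{pmatrix}$; $A^{[6]}=\begin{pmatrix}1&0&0&0&0&0\\0&1&0&0&0&0\\0&0&1&0&0&0\\0&0&0&-\frac{1}{3}&\frac{2\omega}{3}&\frac{2\omega^{2}}{3}\\0&0&0&\frac{2\omega^{2}}{3}&-\frac{1}{3}&\frac{2\omega}{3}\\0&0&0&\frac{2\omega}{3}&\frac{2\omega^{2}}{3}&-\frac{1}{3}\end{pmatrix}$,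 $B^{[6]}=\begin{pmatrix}-\frac{1}{6}&-\frac{\sqrt{7}\omega}{6}&-\frac{\sqrt{7}\omega^{2}}{6}&\frac{\sqrt{7}}{6}&\frac{\sqrt{7}\omega}{6}&\frac{\sqrt{7}\omega^{2}}{6}\\-\frac{\sqrt{7}}{6}&\frac{\omega}{3}&\frac{\omega^{2}}{3}&-\frac{2\omega^{2}}{3}-\frac{1}{6}&-\frac{\omega^{2}}{3}&-\frac{1}{3}\\-\frac{\sqrt{7}}{6}&\frac{\omega}{3}&\frac{\omega^{2}}{3}&-\frac{2\omega}{3}-\frac{1}{6}&-\frac{1}{3}&-\frac{\omega}{3}\\\frac{\sqrt{7}}{6}&-\frac{\omega}{6}-\frac{2}{3}&-\frac{\omega^{2}}{6}-\frac{2}{3}&\frac{1}{6}&\frac{\omega}{6}&\frac{\omega^{2}}{6}\\\frac{\sqrt{7}}{6}&-\frac{\omega^{2}}{3}&-\frac{\omega}{3}&\frac{1}{6}&-\frac{\omega}{3}&\frac{2\omega^{2}}{3}\\\frac{\sqrt{7}}{6}&-\frac{\omega^{2}}{3}&-\frac{\omega}{3}&\frac{1}{6}&\frac{2\omega}{3}&-\frac{\omega^{2}}{3}\end{pmatrix}$;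 $A^{[7]}=\begin{pmatrix}1&0&0&0&0&0&0\\0&-\frac{1}{3}&\frac{2\omega}{3}&\frac{2\omega^{2}}{3}&0&0&0\\0&\frac{2\omega^{2}}{3}&-\frac{1}{3}&\frac{2\omega}{3}&0&0&0\\0&\frac{2\omega}{3}&\frac{2\omega^{2}}{3}&-\frac{1}{3}&0&0&0\\0&0&0&0&-\frac{1}{3}&\frac{2\omega}{3}&\frac{2\omega^{2}}{3}\\0&0&0&0&\frac{2\omega^{2}}{3}&-\frac{1}{3}&\frac{2\omega}{3}\\0&0&0&0&\frac{2\omega}{3}&\frac{2\omega^{2}}{3}&-\frac{1}{3}\end{pmatrix}$, $B^{[7]}=\begin{pmatrix}0&-\frac{i\bar b_7^{3}}{\sqrt{3}}&\frac{i\omega \bar b_7^{3}}{2\sqrt{3}}&\frac{i\omega^{2}\bar b_7^{3}}{2\sqrt{3}}&0&-\frac{i\omega \bar b_7^{2}}{2}&\frac{i\omega^{2}\bar b_7^{2}}{2}\\-\frac{ib_7^{3}}{\sqrt{3}}&-\frac{1}{3}&-\frac{\omega}{3}&-\frac{\omega^{2}}{3}&\frac{ib_7}{3}&\frac{i\omega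 b_7}{3}&\frac{i\omega^{2}b_7}{3}\\\frac{ib_7^{3}}{2\sqrt{3}}&-\frac{1}{3}&-\frac{\omega}{3}&-\frac{\omega^{2}}{3}&\frac{ib_7\omega^{2}}{3}+\frac{b_7}{2\sqrt{3}}&\frac{i\omega^{2}b_7}{3}&\frac{ib_7}{3}\\\frac{ib_7^{3}}{2\sqrt{3}}&-\frac{1}{3}&-\frac{\omega}{3}&-\frac{\omega^{2}}{3}&\frac{i\omega b_7}{3}-\frac{b_7}{2\sqrt{3}}&\frac{ib_7}{3}&\frac{i\omega b_7}{3}\\0&\frac{i\bar b_7}{3}&\frac{i\bar b_7}{3}+\frac{\omega \bar b_7}{2\sqrt{3}}&\frac{i\bar b_7}{3}-\frac{\omega^{2}\bar b_7}{2\sqrt{3}}&0&-\frac{i\omega}{2\sqrt{3}}&\frac{i\omega^{2}}{2\sqrt{3}}\\-\frac{ib_7^{2}}{2}&\frac{i\bar b_7}{3}&\frac{i\omega^{2}\bar b_7}{3}&\frac{i\omega \bar b_7}{3}&-\frac{i}{2\sqrt{3}}&-\frac{i\omega}{\sqrt{3}}&0\\\frac{ib_7^{2}}{2}&\frac{i\bar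 b_7}{3}&\frac{i\omega^{2}\bar b_7}{3}&\frac{i\omega \bar b_7}{3}&\frac{i}{2\sqrt{3}}&0&\frac{i\omega^{2}}{\sqrt{3}}\end{pmatrix}$; $A^{[8]}=\begin{pmatrix}1&0&0&0&0&0&0&0\\0&1&0&0&0&0&0&0\\0&0&-\frac{1}{3}&\frac{2\omega}{3}&\frac{2\omega^{2}}{3}&0&0&0\\0&0&\frac{2\omega^{2}}{3}&-\frac{1}{3}&\frac{2\omega}{3}&0&0&0\\0&0&\frac{2\omega}{3}&\frac{2\omega^{2}}{3}&-\frac{1}{3}&0&0&0\\0&0&0&0&0&-\frac{1}{3}&\frac{2\omega}{3}&\frac{2\omega^{2}}{3}\\0&0&0&0&0&\frac{2\omega^{2}}{3}&-\frac{1}{3}&\frac{2\omega}{3}\\0&0&0&0&0&\frac{2\omega}{3}&\frac{2\omega^{2}}{3}&-\frac{1}{3}\end{pmatrix}$, $B^{[8]}=\begin{pmatrix}-\frac{\omega}{4}&-\frac{\omega^{2}}{4}&-\frac{i\omega^{2}}{\sqrt{6}}&\frac{i(3\omega^{2}-1)}{4\sqrt{6}}&\frac{2i-\sqrt{3}\o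mega^{2}}{4\sqrt{6}}&0&-\frac{1}{4}\sqrt{\frac{7}{2}}\omega&\frac{1}{4}\sqrt{\frac{7}{2}}\omega^{2}\\-\frac{\omega}{4}&-\frac{\omega^{2}}{4}&\frac{i\omega}{\sqrt{6}}&-\frac{2i+\sqrt{3}\omega}{4\sqrt{6}}&\frac{i(1-3\omega)}{4\sqrt{6}}&0&\frac{1}{4}\sqrt{\frac{7}{2}}\omega&-\frac{1}{4}\sqrt{\frac{7}{2}}\omega^{2}\\-\frac{i}{\sqrt{6}}&\frac{i}{\sqrt{6}}&\frac{1}{6}&\frac{\omega}{6}&\frac{\omega^{2}}{6}&\frac{\sqrt{7}}{6}&\frac{\sqrt{7}\omega}{6}&\frac{\sqrt{7}\omega^{2}}{6}\\\frac{i(3\omega^{2}-1)}{4\sqrt{6}}&\frac{i(1-3\omega)}{4\sqrt{6}}&\frac{1}{6}&\frac{13\omega}{24}&-\frac{5\omega^{2}}{24}&\frac{\sqrt{7}\omega}{6}&\frac{i\sqrt{3}\omega^{2}+1}{\frac{24}{\sqrt{7}}}&\frac{3\omega+1}{\frac{24}{\sqrt{7}}}\\\frac{i(3\omega^{2}-1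)}{4\sqrt{6}}&\frac{i(1-3\omega)}{4\sqrt{6}}&\frac{1}{6}&-\frac{5\omega}{24}&\frac{13\omega^{2}}{24}&\frac{\sqrt{7}\omega^{2}}{6}&\frac{3\omega^{2}+1}{\frac{24}{\sqrt{7}}}&\frac{1-i\sqrt{3}\omega}{\frac{24}{\sqrt{7}}}\\0&0&-\frac{\sqrt{7}}{6}&-\frac{\sqrt{7}}{6}\omega^{2}&-\frac{\sqrt{7}\omega}{6}&-\frac{1}{2}&-\frac{i\omega^{2}}{2\sqrt{3}}&\frac{i\omega}{2\sqrt{3}}\\\frac{1}{4}\sqrt{\frac{7}{2}}\omega&-\frac{1}{4}\sqrt{\frac{7}{2}}\omega^{2}&-\frac{\sqrt{7}}{6}&-\frac{i\sqrt{3}\omega^{2}+1}{\frac{24}{\sqrt{7}}}&\frac{i\sqrt{3}\omega-1}{\frac{24}{\sqrt{7}}}&-\frac{i\omega}{2\sqrt{3}}&\frac{3\sqrt{3}\omega^{2}+i}{8\sqrt{3}}&-\frac{\omega^{2}}{8}\\-\frac{1}{4}\sqrt{\frac{7}{2}}\omega&\frac{1}{4}\sqrt{\frac{7}{2}}\omega^{2}&-\frac{\sqrt{7}}{6}&-\frac{i\sqrt{3}\omega^{2}+1}{\frac{24}{\sqrt{7}}}&\frac{i\sqrt{3}\omega-1}{\frac{24}{\sqrt{7}}}&\frac{i\omega^{2}}{2\sqrt{3}}&-\frac{\omega}{8}&\frac{3\sqrt{3}\omega-i}{8\sqrt{3}}\end{pmatrix}$.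 Projections $P_{X\to x}$ (onto consecutive coordinates, in the order of the decomposition, with the phase shown): $1=1_0$; $3=3_2$; $\bar3=3_2$ with $P_{\bar3\to3_2}=\Gamma_{3_2}$; $6=1_0\oplus2\oplus3_1$; $7=1_1\oplus3_1\oplus3_2$ with phases $1,\,i\bar b_7^3,\,\bar b_7^2$; $8=2\oplus3_1\oplus3_2$ with phases $1,1,-1$ (phases not shown are $1$). *Generator matrices of $G$, $\mathcal T_7$ basis.* ($1$: $A=B=1$; $\bar 3=3^*$.) $B^{[X]}=A^{[X]}(AB)^{[X]}$ with $(AB)^{[3]}=\mathcal P=\mathrm{diag}(\eta,\eta^2,\eta^4)$, $(AB)^{[6]}=\mathrm{diag}(\mathcal P,\mathcal P^*)$, $(AB)^{[7]}=\mathrm{diag}(1,\mathcal P,\mathcal P^*)$, $(AB)^{[8]}=\mathrm{diag}(1,1,\mathcal P,\mathcal P^*)$, so that in particular $B^{[3]}=\frac i{\sqrt7}\begin{pmatrix}\eta^3-\eta^6&\eta^3-\eta&\eta-1\\\eta^2-1&\eta^6-\eta^5&\eta^6-\eta^2\\\eta^5-\eta^4&\eta^4-1&\eta^5-\eta^3\end{pmatrix}$,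 and $A^{[3]}=\frac i{\sqrt7}\begin{pmatrix}\eta^2-\eta^5&\eta-\eta^6&\eta^4-\eta^3\\\eta-\eta^6&\eta^4-\eta^3&\eta^2-\eta^5\\\eta^4-\eta^3&\eta^2-\eta^5&\eta-\eta^6\end{pmatrix}$, $A^{[6]}=\frac27\begin{pmatrix}R_1&\sqrt2R_2\\\sqrt2R_2&R_1\end{pmatrix}$, $A^{[8]}=\frac27\begin{pmatrix}C_1&C_2&C_2\\C_2^\dagger&R_3&R_1\\C_2^\dagger&R_1&R_3\end{pmatrix}$, $A^{[7]}=\frac27\begin{pmatrix}-\frac12&\sqrt2\,u&\sqrt2\,u\\\sqrt2\,u^T&S&T\\\sqrt2\,u^T&T&S\end{pmatrix}$, $u=(1,1,1)$, $S=\begin{pmatrix}2c_1+c_2&c_1+2c_3&2c_2+c_3\\c_1+2c_3&2c_2+c_3&2c_1+c_2\\2c_2+c_3&2c_1+c_2&c_1+2c_3\end{pmatrix}$, $T=\begin{pmatrix}2c_2+1&2c_1+1&2c_3+1\\2c_1+1&2c_3+1&2c_2+1\\2c_3+1&2c_2+1&2c_1+1\end{pmatrix}$, $R_1=\begin{pmatrix}1-c_2&1-c_1&1-c_3\\1-c_1&1-c_3&1-c_2\\1-c_3&1-c_2&1-c_1\end{pmatrix}$,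 $R_2=\begin{pmatrix}c_1-c_3&c_3-c_2&c_2-c_1\\c_3-c_2&c_2-c_1&c_1-c_3\\c_2-c_1&c_1-c_3&c_3-c_2\end{pmatrix}$, $R_3=\begin{pmatrix}c_2-c_1&c_1-c_3&c_3-c_2\\c_1-c_3&c_3-c_2&c_2-c_1\\c_3-c_2&c_2-c_1&c_1-c_3\end{pmatrix}$, $C_1=\frac12\begin{pmatrix}0&\omega\\\omega^2&0\end{pmatrix}+i\sqrt3\begin{pmatrix}0&c_2-c_3\omega^2\\-c_2+c_3\omega&0\end{pmatrix}$, $C_2=\frac i2\begin{pmatrix}-\omega^2&-1&-\omega\\\omega&1&\omega^2\end{pmatrix}+\sqrt3\begin{pmatrix}c_2\omega-c_3&c_2\omega^2-c_3\omega&c_2-\omega^2c_3\\c_2\omega^2-c_3&c_2\omega-c_3\omega^2&c_2-\omega c_3\end{pmatrix}$. Projections (as before): $1=1$; $3=3$; $\bar3=\bar3$; $6=3\oplus\bar3$; $7=1\oplus3\oplus\bar3$ with phases $-1,1,1$; $8=1'\oplus\bar1'\oplus3\oplus\bar3$. *Notation for contractions of $G$.* A contraction $X\otimes Y\to Z$ is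 given by embedding factors $E_{c,ab}$: $P_{Z\to c}Z=\sum_{a,b}E_{c,ab}\{(P_{X\to a}X)\otimes(P_{Y\to b}Y)\}_{z_c}$, where $\{\cdot\otimes\cdot\}_{z_c}$ is the subgroup contraction. Its CG matrix is $M=\sum_cP_{Z\to c}^\dagger\sum_{a,b}E_{c,ab}\,M^{(ab\to c)}(P_{X\to a}\otimes P_{Y\to b})$, with $M^{(ab\to c)}$ the matrix of the subgroup contraction. Below, "$c=\dots+E\,[a,b]+\dots$" lists the nonzero $E=E_{c,ab}$; $[a,b]_s$, $[a,b]_a$ refer to the subgroup contractions to $c_s$, $c_a$ (for $\mathcal T_7$). Subscripts $s,a$ of $Z$ denote symmetric and antisymmetric contractions, superscripts $(\mu)$ number copies. In addition to the listed contractions: (i) $1\otimes Y\to Y$ is the trivial one; (ii) the contractions of $\bar3\otimes Y$ for $Y=\bar3,6,7,8$ are the complex conjugates of those of $3\otimes\bar Y$, i.e. $E^{(\bar X\bar Y\to\bar Z)}_{\bar c,\bar a\bar b}=(E^{(XY\to Z)}_{c,ab})^*$; (iii) each listed contraction $X\otimes Y\to3$ with $X,Y\in\{6,7,8\}$ is accompanied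 by its complex conjugate $X\otimes Y\to\bar3$; (iv) for $\mathcal T_7$ and $X,Y,Z\in\{6,7,8\}$ the components $\bar1'$, $\bar3$ that are not listed are the complex conjugates of the components $1'$, $3$; (v) products in the opposite order are obtained by exchanging the factors. *Embedding factors, $S_4$ basis.* - $3\otimes 3\to \bar3_a$: $3_2=[3_2,3_2]$. - $3\otimes 3\to 6_s$: $1_0=[3_2,3_2],\quad 2=-\frac{i}{b_7^{2}}[3_2,3_2],\quad 3_1=\frac{i}{b_7}[3_2,3_2]$. - $3\otimes \bar3\to 1$: $1_0=[3_2,3_2]$. - $3\otimes \bar3\to 8$: $2=[3_2,3_2],\quad 3_1=[3_2,3_2],\quad 3_2=i[3_2,3_2]$. - $3\otimes 6\to \bar3$: $3_2=\frac{1}{\sqrt{6}}[3_2,1_0]-\frac{i}{\sqrt{3}b_7^{2}}[3_2,2]+\frac{i}{\sqrt{2}b_7}[3_2,3_1]$. - $3\otimes 6\to 7$: $1_1=[3_2,3_1],\quad 3_1=\frac{1}{\sqrt{3}b_7^{3}}[3_2,2]+\frac{\sqrt{\frac{2}{3}}}{b_7^{4}}[3_2,3_1],\quad 3_2=\frac{\sqrt{\frac{7}{2}}}{3b_7}[3_2,1_0]+\frac{2}{3b_7^{5}}[3_2,2]-\frac{1}{\sqrt{6}b_7^{2}}[3_2,3_1]$.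 - $3\otimes 6\to 8$: $2=[3_2,3_1],\quad 3_1=-\sqrt{\frac{2}{3}}b_7[3_2,2]+\frac{1}{\sqrt{3}}[3_2,3_1],\quad 3_2=\frac{2}{3b_7}[3_2,1_0]-\frac{1}{3}i\sqrt{2}b_7[3_2,2]+\frac{i}{\sqrt{3}}[3_2,3_1]$. - $3\otimes 7\to 6$: $1_0=[3_2,3_2],\quad 2=-\frac{\sqrt{\frac{3}{7}}}{b_7^{2}}[3_2,3_1]+\frac{2}{\sqrt{7}b_7^{4}}[3_2,3_2],\quad 3_1=\sqrt{\frac{2}{7}}b_7[3_2,1_1]-\frac{2}{\sqrt{7}b_7^{3}}[3_2,3_1]-\frac{1}{\sqrt{7}b_7}[3_2,3_2]$. - $3\otimes 7\to 7$: $1_1=[3_2,3_1],\quad 3_1=-\frac{1}{\sqrt{3}}[3_2,1_1]-\frac{1}{\sqrt{3}b_7}[3_2,3_1]-\frac{1}{\sqrt{3}b_7}[3_2,3_2],\quad 3_2=\frac{1}{\sqrt{3}b_7}[3_2,3_1]+\frac{\sqrt{\frac{2}{3}}}{b_7^{2}}[3_2,3_2]$. - $3\otimes 7\to 8$: $2=\frac{2}{\sqrt{7}}[3_2,3_1]+\frac{\sqrt{\frac{3}{7}}}{b_7^{2}}[3_2,3_2],\quad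 3_1=\frac{2\sqrt{\frac{2}{21}}}{b_7^{4}}[3_2,1_1]+\frac{\sqrt{\frac{2}{21}}}{b_7}[3_2,3_1]+\frac{13\sqrt{7}+7i}{28\sqrt{3}}[3_2,3_2],\quad 3_2=\frac{\sqrt{\frac{2}{3}}}{b_7}[3_2,3_1]-\frac{1}{\sqrt{3}b_7^{2}}[3_2,3_2]$. - $3\otimes 8\to 3$: $3_2=\frac{1}{2}[3_2,2]+\frac{\sqrt{\frac{3}{2}}}{2}[3_2,3_1]-\frac{1}{2}i\sqrt{\frac{3}{2}}[3_2,3_2]$. - $3\otimes 8\to 6$: $1_0=[3_2,3_2],\quad 2=\frac{1}{2}\sqrt{3}b_7^{2}[3_2,3_1]-\frac{1}{2}ib_7^{2}[3_2,3_2],\quad 3_1=-\frac{b_7}{\sqrt{2}}[3_2,2]-\frac{b_7}{2}[3_2,3_1]+\frac{ib_7}{2}[3_2,3_2]$. - $3\otimes 8\to 7$: $1_1=[3_2,3_1],\quad 3_1=-\frac{b_7^{4}}{\sqrt{3}}[3_2,2]-\frac{b_7^{3}}{2\sqrt{3}}[3_2,3_1]+\frac{1}{2}\sqrt{\frac{7}{3}}b_7^{3}[3_2,3_2],\quad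 3_2=\frac{b_7^{2}}{2}[3_2,2]+\frac{i(5\sqrt{7}+i)}{8\sqrt{6}}[3_2,3_1]+\frac{1}{2}\sqrt{\frac{7}{6}}b_7^{2}[3_2,3_2]$. - $3\otimes 8\to 8$: $2=\frac{1}{2}[3_2,3_1]+\frac{i\sqrt{3}}{2}[3_2,3_2],\quad 3_1=\frac{1}{\sqrt{6}}[3_2,2]-\sqrt{\frac{2}{3}}b_7^{3}[3_2,3_1]+\frac{ib_7}{\sqrt{6}}[3_2,3_2],\quad 3_2=-\frac{i}{\sqrt{2}}[3_2,2]-\frac{ib_7}{\sqrt{6}}[3_2,3_1]-\frac{b_7^{2}}{\sqrt{3}}[3_2,3_2]$. - $6\otimes 6\to 1_s$: $1_0=\frac{1}{\sqrt{6}}[1_0,1_0]+\frac{1}{\sqrt{3}}[2,2]+\frac{1}{\sqrt{2}}[3_1,3_1]$. - $6\otimes 6\to 6_s^{(1)}$: $1_0=\frac{\sqrt{3}}{2}[1_0,1_0]-\frac{1}{2}[3_1,3_1],\quad 2=-\sqrt{\frac{3}{7}}[2,2]-\frac{2}{\sqrt{7}}[3_1,3_1],\quad 3_1=-\frac{1}{2\sqrt{3}}[1_0,3_1]-\frac{1}{2\sqrt{3}}[3_1,1_0]-2\sqrt{\frac{2}{21}}[2,3_1]-2\sqrt{\frac{2}{21}}[3_1,2]+\frac{1}{\sqrt{14}}[3_1,3_1]$.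 - $6\otimes 6\to 6_s^{(2)}$: $1_0=-\frac{1}{2\sqrt{3}}[1_0,1_0]+\sqrt{\frac{2}{3}}[2,2]-\frac{1}{2}[3_1,3_1],\quad 2=\frac{1}{\sqrt{3}}[1_0,2]+\frac{1}{\sqrt{3}}[2,1_0]-\frac{2}{\sqrt{21}}[2,2]+\frac{1}{\sqrt{7}}[3_1,3_1],\quad 3_1=-\frac{1}{2\sqrt{3}}[1_0,3_1]-\frac{1}{2\sqrt{3}}[3_1,1_0]+\sqrt{\frac{2}{21}}[2,3_1]+\sqrt{\frac{2}{21}}[3_1,2]+\frac{3}{\sqrt{14}}[3_1,3_1]$. - $6\otimes 6\to 8_s$: $2=\frac{1}{\sqrt{6}}[1_0,2]+\frac{1}{\sqrt{6}}[2,1_0]+2\sqrt{\frac{2}{21}}[2,2]-\sqrt{\frac{2}{7}}[3_1,3_1],\quad 3_1=\frac{1}{\sqrt{3}}[1_0,3_1]+\frac{1}{\sqrt{3}}[3_1,1_0]-\frac{1}{\sqrt{42}}[2,3_1]-\frac{1}{\sqrt{42}}[3_1,2]+\sqrt{\frac{2}{7}}[3_1,3_1],\quad 3_2=-\frac{1}{\sqrt{2}}[2,3_1]-\frac{1}{\sqrt{2}}[3_1,2]$.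 - $6\otimes 6\to 7_a$: $1_1=[2,2],\quad 3_1=\frac{\sqrt{\frac{7}{2}}}{3}[1_0,3_1]-\frac{\sqrt{\frac{7}{2}}}{3}[3_1,1_0]+\frac{1}{3}[2,3_1]-\frac{1}{3}[3_1,2],\quad 3_2=\frac{1}{\sqrt{3}}[2,3_1]-\frac{1}{\sqrt{3}}[3_1,2]-\frac{1}{\sqrt{3}}[3_1,3_1]$. - $6\otimes 6\to 8_a$: $2=\frac{1}{\sqrt{2}}[1_0,2]-\frac{1}{\sqrt{2}}[2,1_0],\quad 3_1=-\frac{1}{3}[1_0,3_1]+\frac{1}{3}[3_1,1_0]+\frac{\sqrt{\frac{7}{2}}}{3}[2,3_1]-\frac{\sqrt{\frac{7}{2}}}{3}[3_1,2],\quad 3_2=-\frac{1}{\sqrt{6}}[2,3_1]+\frac{1}{\sqrt{6}}[3_1,2]-\sqrt{\frac{2}{3}}[3_1,3_1]$. - $6\otimes 7\to 3$: $3_2=\frac{1}{\sqrt{6}}[1_0,3_2]+\frac{b_7^{2}}{\sqrt{7}}[2,3_1]+\frac{2b_7^{4}}{\sqrt{21}}[2,3_2]+\frac{1}{\sqrt{7}b_7}[3_1,1_1]+\sqrt{\frac{2}{7}}b_7^{3}[3_1,3_1]-\frac{b_7}{\sqrt{14}}[3_1,3_2]$.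 - $6\otimes 7\to 6$: $1_0=[3_1,3_1],\quad 2=-\sqrt{\frac{3}{7}}[2,1_1]+\frac{1}{\sqrt{7}}[3_1,3_1]-\sqrt{\frac{3}{7}}[3_1,3_2],\quad 3_1=-\frac{1}{\sqrt{3}}[1_0,3_1]-\sqrt{\frac{2}{21}}[2,3_1]-\sqrt{\frac{2}{7}}[2,3_2]-\sqrt{\frac{2}{7}}[3_1,3_2]$. - $6\otimes 7\to 7^{(1)}$: $1_1=[1_0,1_1],\quad 3_1=-\frac{1}{6}[1_0,3_1]+\frac{\sqrt{\frac{7}{2}}}{6}[2,3_1]+\frac{\sqrt{\frac{7}{6}}}{2}[2,3_2]+\frac{\sqrt{\frac{7}{6}}}{2}[3_1,3_1]-\frac{\sqrt{\frac{7}{6}}}{2}[3_1,3_2],\quad 3_2=-\frac{1}{6}[1_0,3_2]+\frac{\sqrt{\frac{7}{6}}}{2}[2,3_1]+\frac{\sqrt{\frac{7}{2}}}{6}[2,3_2]+\frac{\sqrt{\frac{7}{6}}}{2}[3_1,3_1]-\frac{\sqrt{\frac{7}{6}}}{2}[3_1,3_2]$. - $6\otimes 7\to 7^{(2)}$: $1_1=[3_1,3_2],\quad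 3_1=-\frac{\sqrt{7}}{6}[1_0,3_1]+\frac{7}{6\sqrt{2}}[2,3_1]-\frac{1}{2\sqrt{6}}[2,3_2]-\frac{1}{2\sqrt{6}}[3_1,3_1]+\frac{1}{2\sqrt{6}}[3_1,3_2],\quad 3_2=\frac{\sqrt{7}}{6}[1_0,3_2]-\frac{1}{2\sqrt{6}}[2,3_1]-\frac{1}{6\sqrt{2}}[2,3_2]+\frac{1}{\sqrt{3}}[3_1,1_1]-\frac{1}{2\sqrt{6}}[3_1,3_1]-\frac{\sqrt{\frac{3}{2}}}{2}[3_1,3_2]$. - $6\otimes 7\to 8^{(1)}$: $2=\frac{1}{\sqrt{2}}[2,1_1]-\frac{1}{\sqrt{2}}[3_1,3_2],\quad 3_1=\frac{1}{\sqrt{6}}[2,3_2]-\sqrt{\frac{2}{3}}[3_1,3_1]-\frac{1}{\sqrt{6}}[3_1,3_2],\quad 3_2=-\frac{2}{3}[1_0,3_2]-2\sqrt{\frac{2}{21}}[2,3_1]-\frac{1}{3\sqrt{14}}[2,3_2]+\frac{1}{\sqrt{21}}[3_1,1_1]+\sqrt{\frac{2}{21}}[3_1,3_1]-\frac{1}{\sqrt{42}}[3_1,3_2]$.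 - $6\otimes 7\to 8^{(2)}$: $2=\frac{1}{\sqrt{14}}[2,1_1]+\sqrt{\frac{6}{7}}[3_1,3_1]+\frac{1}{\sqrt{14}}[3_1,3_2],\quad 3_1=\frac{2}{3}[1_0,3_1]+\frac{2\sqrt{\frac{2}{7}}}{3}[2,3_1]-\sqrt{\frac{3}{14}}[2,3_2]-\sqrt{\frac{3}{14}}[3_1,3_2],\quad 3_2=-\frac{1}{\sqrt{2}}[2,3_2]-\frac{1}{\sqrt{3}}[3_1,1_1]-\frac{1}{\sqrt{6}}[3_1,3_2]$. - $6\otimes 8\to 3$: $3_2=\frac{1}{\sqrt{6}}[1_0,3_2]-\frac{1}{2b_7^{2}}[2,3_1]+\frac{i}{2\sqrt{3}b_7^{2}}[2,3_2]-\frac{1}{2b_7}[3_1,2]+\frac{1}{2\sqrt{2}b_7}[3_1,3_1]-\frac{i}{2\sqrt{2}b_7}[3_1,3_2]$. - $6\otimes 8\to 6^{(1)}$: $1_0=[2,2],\quad 2=-\frac{1}{2\sqrt{2}}[1_0,2]+\frac{1}{\sqrt{14}}[2,2]+\frac{3\sqrt{\frac{3}{7}}}{4}[3_1,3_1]+\frac{3}{4}[3_1,3_2],\quad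 3_1=\frac{1}{2}[1_0,3_1]-\sqrt{\frac{2}{7}}[2,3_1]-\frac{1}{2\sqrt{7}}[3_1,2]+\frac{\sqrt{\frac{3}{14}}}{2}[3_1,3_1]-\frac{\sqrt{\frac{3}{2}}}{2}[3_1,3_2]$. - $6\otimes 8\to 6^{(2)}$: $1_0=[3_1,3_1],\quad 2=\frac{\sqrt{\frac{3}{2}}}{2}[1_0,2]+\sqrt{\frac{3}{14}}[2,2]-\frac{5}{4\sqrt{7}}[3_1,3_1]+\frac{\sqrt{3}}{4}[3_1,3_2],\quad 3_1=\frac{1}{2\sqrt{3}}[1_0,3_1]+\frac{1}{\sqrt{42}}[2,3_1]-\frac{1}{\sqrt{2}}[2,3_2]-\frac{\sqrt{\frac{3}{7}}}{2}[3_1,2]+\frac{3}{2\sqrt{14}}[3_1,3_1]+\frac{1}{2\sqrt{2}}[3_1,3_2]$. - $6\otimes 8\to 7^{(1)}$: $1_1=[2,2],\quad 3_1=\frac{\sqrt{7}}{12}[1_0,3_1]+\frac{1}{6\sqrt{2}}[2,3_1]-\frac{\sqrt{\frac{7}{6}}}{2}[2,3_2]+\frac{1}{4}[3_1,2]-\frac{7}{4\sqrt{6}}[3_1,3_1]-\frac{\sqrt{\frac{7}{6}}}{4}[3_1,3_2],\quad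 3_2=-\frac{7}{12}[1_0,3_2]+\frac{1}{2\sqrt{6}}[2,3_1]-\frac{\sqrt{\frac{7}{2}}}{6}[2,3_2]+\frac{\sqrt{3}}{4}[3_1,2]+\frac{5}{4\sqrt{6}}[3_1,3_1]-\frac{\sqrt{\frac{7}{6}}}{4}[3_1,3_2]$. - $6\otimes 8\to 7^{(2)}$: $1_1=[3_1,3_2],\quad 3_1=-\frac{7}{12}[1_0,3_1]-\frac{\sqrt{\frac{7}{2}}}{6}[2,3_1]-\frac{1}{2\sqrt{6}}[2,3_2]-\frac{\sqrt{7}}{4}[3_1,2]-\frac{\sqrt{\frac{7}{6}}}{4}[3_1,3_1]-\frac{1}{4\sqrt{6}}[3_1,3_2],\quad 3_2=-\frac{\sqrt{7}}{12}[1_0,3_2]+\frac{\sqrt{\frac{7}{6}}}{2}[2,3_1]+\frac{5}{6\sqrt{2}}[2,3_2]+\frac{\sqrt{\frac{7}{3}}}{4}[3_1,2]-\frac{\sqrt{\frac{7}{6}}}{4}[3_1,3_1]+\frac{\sqrt{\frac{3}{2}}}{4}[3_1,3_2]$. - $6\otimes 8\to 8^{(1)}$: $2=\frac{1}{2}[1_0,2]-\frac{2}{\sqrt{7}}[2,2]+\frac{\sqrt{\frac{3}{14}}}{2}[3_1,3_1]+\frac{1}{2\sqrt{2}}[3_1,3_2],\quad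 3_1=\frac{1}{6}[1_0,3_1]-\frac{4\sqrt{\frac{2}{7}}}{3}[2,3_1]+\frac{1}{2\sqrt{7}}[3_1,2]-\frac{\sqrt{\frac{3}{14}}}{2}[3_1,3_1]+\frac{\sqrt{\frac{3}{2}}}{2}[3_1,3_2],\quad 3_2=-\frac{1}{2}[1_0,3_2]-\frac{1}{2\sqrt{3}}[3_1,2]-\frac{\sqrt{\frac{3}{2}}}{2}[3_1,3_1]-\frac{\sqrt{\frac{7}{6}}}{2}[3_1,3_2]$. - $6\otimes 8\to 8^{(2)}$: $2=-\frac{1}{2}[1_0,2]-\frac{1}{\sqrt{7}}[2,2]-\frac{3\sqrt{\frac{3}{14}}}{2}[3_1,3_1]+\frac{1}{2\sqrt{2}}[3_1,3_2],\quad 3_1=\frac{1}{2}[1_0,3_1]+\frac{1}{\sqrt{14}}[2,3_1]+\frac{1}{\sqrt{6}}[2,3_2]-\frac{3}{2\sqrt{7}}[3_1,2]-\frac{5}{2\sqrt{42}}[3_1,3_1]+\frac{1}{2\sqrt{6}}[3_1,3_2],\quad 3_2=-\frac{1}{6}[1_0,3_2]+\frac{1}{\sqrt{6}}[2,3_1]-\frac{\sqrt{\frac{7}{2}}}{3}[2,3_2]-\frac{1}{2\sqrt{3}}[3_1,2]-\frac{1}{2\sqrt{6}}[3_1,3_1]+\frac{\sqrt{\frac{7}{6}}}{2}[3_1,3_2]$.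 - $7\otimes 7\to 1_s$: $1_0=\frac{1}{\sqrt{7}}[1_1,1_1]+\sqrt{\frac{3}{7}}[3_1,3_1]+\sqrt{\frac{3}{7}}[3_2,3_2]$. - $7\otimes 7\to 6_s^{(1)}$: $1_0=\frac{\sqrt{3}}{2}[1_1,1_1]-\frac{1}{2}[3_2,3_2],\quad 2=-\sqrt{\frac{3}{7}}[3_1,3_2]-\sqrt{\frac{3}{7}}[3_2,3_1]+\frac{1}{\sqrt{7}}[3_2,3_2],\quad 3_1=-\frac{1}{2\sqrt{7}}[1_1,3_2]-\frac{1}{2\sqrt{7}}[3_2,1_1]+\sqrt{\frac{2}{7}}[3_1,3_1]+\sqrt{\frac{2}{7}}[3_1,3_2]-\sqrt{\frac{2}{7}}[3_2,3_1]-\frac{1}{\sqrt{14}}[3_2,3_2]$. - $7\otimes 7\to 6_s^{(2)}$: $1_0=-\frac{\sqrt{\frac{3}{7}}}{2}[1_1,1_1]+\frac{2}{\sqrt{7}}[3_1,3_1]-\frac{3}{2\sqrt{7}}[3_2,3_2],\quad 2=-[3_1,3_1],\quad 3_1=-\frac{1}{2}[1_1,3_2]-\frac{1}{2}[3_2,1_1]+\frac{1}{\sqrt{2}}[3_2,3_2]$.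 - $7\otimes 7\to 7_s$: $1_1=\frac{1}{\sqrt{2}}[3_1,3_2]+\frac{1}{\sqrt{2}}[3_2,3_1],\quad 3_1=\frac{1}{\sqrt{6}}[1_1,3_2]+\frac{1}{\sqrt{6}}[3_2,1_1]+\frac{1}{\sqrt{3}}[3_1,3_1]+\frac{1}{\sqrt{3}}[3_2,3_2],\quad 3_2=\frac{1}{\sqrt{6}}[1_1,3_1]+\frac{1}{\sqrt{6}}[3_1,1_1]+\frac{1}{\sqrt{3}}[3_1,3_2]+\frac{1}{\sqrt{3}}[3_2,3_1]$. - $7\otimes 7\to 8_s$: $2=\frac{1}{\sqrt{14}}[3_1,3_2]+\frac{1}{\sqrt{14}}[3_2,3_1]+\sqrt{\frac{6}{7}}[3_2,3_2],\quad 3_1=\frac{1}{\sqrt{21}}[1_1,3_2]+\frac{1}{\sqrt{21}}[3_2,1_1]-2\sqrt{\frac{2}{21}}[3_1,3_1]+\sqrt{\frac{3}{14}}[3_1,3_2]-\sqrt{\frac{3}{14}}[3_2,3_1]+\sqrt{\frac{2}{21}}[3_2,3_2],\quad 3_2=-\frac{1}{\sqrt{3}}[1_1,3_1]-\frac{1}{\sqrt{3}}[3_1,1_1]+\frac{1}{\sqrt{6}}[3_1,3_2]+\frac{1}{\sqrt{6}}[3_2,3_1]$.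 - $7\otimes 7\to 3_a$: $3_2=\frac{1}{\sqrt{7}}[1_1,3_1]-\frac{1}{\sqrt{7}}[3_1,1_1]+\frac{b_7}{\sqrt{7}}[3_1,3_1]-\frac{b_7}{\sqrt{7}}[3_1,3_2]+\frac{b_7}{\sqrt{7}}[3_2,3_1]-\sqrt{\frac{2}{7}}b_7^{2}[3_2,3_2]$. - $7\otimes 7\to 7_a$: $1_1=\frac{1}{\sqrt{2}}[3_1,3_2]-\frac{1}{\sqrt{2}}[3_2,3_1],\quad 3_1=-\frac{1}{\sqrt{6}}[1_1,3_2]+\frac{1}{\sqrt{6}}[3_2,1_1]+\frac{1}{\sqrt{3}}[3_1,3_2]+\frac{1}{\sqrt{3}}[3_2,3_1],\quad 3_2=\frac{1}{\sqrt{6}}[1_1,3_1]-\frac{1}{\sqrt{6}}[3_1,1_1]+\frac{1}{\sqrt{3}}[3_1,3_1]-\frac{1}{\sqrt{3}}[3_2,3_2]$. - $7\otimes 7\to 8_a$: $2=\frac{1}{\sqrt{2}}[3_1,3_2]-\frac{1}{\sqrt{2}}[3_2,3_1],\quad 3_1=-\frac{1}{\sqrt{3}}[1_1,3_2]+\frac{1}{\sqrt{3}}[3_2,1_1]-\frac{1}{\sqrt{6}}[3_1,3_2]-\frac{1}{\sqrt{6}}[3_2,3_1],\quad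 3_2=-\frac{1}{\sqrt{21}}[1_1,3_1]+\frac{1}{\sqrt{21}}[3_1,1_1]+2\sqrt{\frac{2}{21}}[3_1,3_1]+\sqrt{\frac{3}{14}}[3_1,3_2]-\sqrt{\frac{3}{14}}[3_2,3_1]+\sqrt{\frac{2}{21}}[3_2,3_2]$. - $7\otimes 8\to 3$: $3_2=\frac{1}{\sqrt{7}}[1_1,3_1]-\frac{1}{\sqrt{7}b_7^{4}}[3_1,2]+\frac{1}{2\sqrt{7}b_7^{3}}[3_1,3_1]+\frac{1}{2b_7^{3}}[3_1,3_2]+\frac{\sqrt{\frac{3}{7}}}{2b_7^{2}}[3_2,2]-\frac{\sqrt{7}+35i}{56\sqrt{2}}[3_2,3_1]-\frac{1}{2\sqrt{2}b_7^{2}}[3_2,3_2]$. - $7\otimes 8\to 6^{(1)}$: $1_0=[3_1,3_1],\quad 2=-\frac{\sqrt{\frac{3}{14}}}{2}[1_1,2]+\frac{1}{\sqrt{7}}[3_1,3_1]+\frac{3\sqrt{\frac{3}{7}}}{4}[3_2,3_1]-\frac{3}{4}[3_2,3_2],\quad 3_1=-\frac{1}{2}[1_1,3_2]+\sqrt{\frac{3}{7}}[3_1,2]-\frac{1}{2\sqrt{7}}[3_2,2]-\frac{3}{2\sqrt{14}}[3_2,3_1]-\frac{1}{2\sqrt{2}}[3_2,3_2]$.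 - $7\otimes 8\to 6^{(2)}$: $1_0=[3_2,3_2],\quad 2=\frac{\sqrt{\frac{3}{2}}}{2}[1_1,2]-\sqrt{\frac{3}{7}}[3_1,3_2]+\frac{\sqrt{3}}{4}[3_2,3_1]+\frac{1}{4\sqrt{7}}[3_2,3_2],\quad 3_1=-\frac{1}{2\sqrt{7}}[1_1,3_2]+\frac{1}{\sqrt{2}}[3_1,3_1]-\frac{1}{\sqrt{14}}[3_1,3_2]-\frac{1}{2}[3_2,2]+\frac{1}{2\sqrt{2}}[3_2,3_1]+\frac{1}{2\sqrt{14}}[3_2,3_2]$. - $7\otimes 8\to 7^{(1)}$: $1_1=[3_1,3_2],\quad 3_1=\frac{\sqrt{3}}{4}[1_1,3_2]+\frac{\sqrt{\frac{7}{6}}}{2}[3_1,3_1]-\frac{1}{2\sqrt{6}}[3_1,3_2]+\frac{\sqrt{\frac{7}{3}}}{4}[3_2,2]-\frac{\sqrt{\frac{7}{6}}}{4}[3_2,3_1]-\frac{5}{4\sqrt{6}}[3_2,3_2],\quad 3_2=-\frac{\sqrt{\frac{7}{3}}}{4}[1_1,3_1]+\frac{\sqrt{\frac{7}{6}}}{2}[3_1,3_1]-\frac{1}{2\sqrt{6}}[3_1,3_2]-\frac{\sqrt{7}}{4}[3_2,2]-\frac{\sqrt{\frac{7}{6}}}{4}[3_2,3_1]-\frac{1}{4\sqrt{6}}[3_2,3_2]$.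 - $7\otimes 8\to 7^{(2)}$: $1_1=[3_2,3_1],\quad 3_1=-\frac{\sqrt{\frac{7}{3}}}{4}[1_1,3_2]-\frac{1}{2\sqrt{6}}[3_1,3_1]-\frac{\sqrt{\frac{7}{6}}}{2}[3_1,3_2]+\frac{\sqrt{3}}{4}[3_2,2]+\frac{5}{4\sqrt{6}}[3_2,3_1]-\frac{\sqrt{\frac{7}{6}}}{4}[3_2,3_2],\quad 3_2=-\frac{\sqrt{3}}{4}[1_1,3_1]-\frac{1}{\sqrt{3}}[3_1,2]+\frac{1}{2\sqrt{6}}[3_1,3_1]+\frac{\sqrt{\frac{7}{6}}}{2}[3_1,3_2]+\frac{1}{4}[3_2,2]+\frac{1}{4\sqrt{6}}[3_2,3_1]-\frac{\sqrt{\frac{7}{6}}}{4}[3_2,3_2]$. - $7\otimes 8\to 8^{(1)}$: $2=\frac{3}{4\sqrt{2}}[1_1,2]-\frac{5}{8}[3_2,3_1]-\frac{\sqrt{21}}{8}[3_2,3_2],\quad 3_1=-\frac{\sqrt{\frac{7}{6}}}{4}[1_1,3_2]+\frac{1}{2\sqrt{3}}[3_1,3_1]+\frac{\sqrt{\frac{7}{3}}}{2}[3_1,3_2]+\frac{\sqrt{\frac{3}{2}}}{4}[3_2,2]+\frac{5}{8\sqrt{3}}[3_2,3_1]-\frac{\sqrt{\frac{7}{3}}}{8}[3_2,3_2],\quad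 3_2=-\frac{3\sqrt{\frac{3}{14}}}{4}[1_1,3_1]+2\sqrt{\frac{2}{21}}[3_1,2]+\frac{1}{2\sqrt{21}}[3_1,3_1]+\frac{1}{2\sqrt{3}}[3_1,3_2]-\frac{1}{4\sqrt{14}}[3_2,2]+\frac{23}{8\sqrt{21}}[3_2,3_1]+\frac{1}{8\sqrt{3}}[3_2,3_2]$. - $7\otimes 8\to 8^{(2)}$: $2=\frac{1}{4\sqrt{7}}[1_1,2]+\sqrt{\frac{6}{7}}[3_1,3_1]-\frac{3}{4\sqrt{14}}[3_2,3_1]+\frac{\sqrt{\frac{3}{2}}}{4}[3_2,3_2],\quad 3_1=-\frac{\sqrt{3}}{4}[1_1,3_2]-\frac{2}{\sqrt{7}}[3_1,2]-\frac{\sqrt{\frac{3}{7}}}{4}[3_2,2]-\frac{3\sqrt{\frac{3}{14}}}{4}[3_2,3_1]-\frac{\sqrt{\frac{3}{2}}}{4}[3_2,3_2],\quad 3_2=\frac{\sqrt{3}}{4}[1_1,3_1]-\frac{1}{4}[3_2,2]+\frac{\sqrt{\frac{3}{2}}}{4}[3_2,3_1]-\frac{\sqrt{\frac{21}{2}}}{4}[3_2,3_2]$.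 - $7\otimes 8\to 8^{(3)}$: $2=\frac{3}{4\sqrt{2}}[1_1,2]+\frac{2}{\sqrt{7}}[3_1,3_2]+\frac{3}{8}[3_2,3_1]+\frac{\sqrt{\frac{3}{7}}}{8}[3_2,3_2],\quad 3_1=\frac{3\sqrt{\frac{3}{14}}}{4}[1_1,3_2]-\frac{1}{2\sqrt{3}}[3_1,3_1]+\frac{1}{2\sqrt{21}}[3_1,3_2]-\frac{5}{4\sqrt{6}}[3_2,2]+\frac{5}{8\sqrt{3}}[3_2,3_1]-\frac{23}{8\sqrt{21}}[3_2,3_2],\quad 3_2=\frac{\sqrt{\frac{7}{6}}}{4}[1_1,3_1]+\frac{\sqrt{\frac{7}{3}}}{2}[3_1,3_1]-\frac{1}{2\sqrt{3}}[3_1,3_2]+\frac{\sqrt{\frac{7}{2}}}{4}[3_2,2]+\frac{\sqrt{\frac{7}{3}}}{8}[3_2,3_1]+\frac{1}{8\sqrt{3}}[3_2,3_2]$. - $8\otimes 8\to 1_s$: $1_0=\frac{1}{2}[2,2]+\frac{\sqrt{\frac{3}{2}}}{2}[3_1,3_1]+\frac{\sqrt{\frac{3}{2}}}{2}[3_2,3_2]$.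 - $8\otimes 8\to 6_s^{(1)}$: $1_0=\sqrt{\frac{3}{5}}[2,2]-\sqrt{\frac{2}{5}}[3_2,3_2],\quad 2=-\frac{\sqrt{\frac{15}{14}}}{2}[2,2]-\frac{27}{4\sqrt{70}}[3_1,3_1]+\frac{\sqrt{\frac{3}{10}}}{4}[3_1,3_2]+\frac{\sqrt{\frac{3}{10}}}{4}[3_2,3_1]+\frac{\sqrt{\frac{7}{10}}}{4}[3_2,3_2],\quad 3_1=\frac{3\sqrt{\frac{3}{70}}}{2}[2,3_1]+\frac{3\sqrt{\frac{3}{70}}}{2}[3_1,2]-\frac{1}{2\sqrt{10}}[2,3_2]-\frac{1}{2\sqrt{10}}[3_2,2]-\frac{1}{2\sqrt{35}}[3_1,3_1]-\frac{1}{\sqrt{5}}[3_1,3_2]+\frac{1}{\sqrt{5}}[3_2,3_1]-\frac{\sqrt{\frac{7}{5}}}{2}[3_2,3_2]$. - $8\otimes 8\to 6_s^{(2)}$: $1_0=-\frac{\sqrt{\frac{3}{5}}}{2}[2,2]+\frac{\sqrt{\frac{5}{2}}}{2}[3_1,3_1]-\frac{3}{2\sqrt{10}}[3_2,3_2],\quad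 2=-\frac{\sqrt{\frac{15}{14}}}{2}[2,2]+\frac{1}{4\sqrt{70}}[3_1,3_1]-\frac{3\sqrt{\frac{3}{10}}}{4}[3_1,3_2]-\frac{3\sqrt{\frac{3}{10}}}{4}[3_2,3_1]-\frac{3\sqrt{\frac{7}{10}}}{4}[3_2,3_2],\quad 3_1=-\sqrt{\frac{6}{35}}[2,3_1]-\sqrt{\frac{6}{35}}[3_1,2]-\frac{1}{\sqrt{10}}[2,3_2]-\frac{1}{\sqrt{10}}[3_2,2]-\frac{9}{4\sqrt{35}}[3_1,3_1]-\frac{3}{4\sqrt{5}}[3_1,3_2]+\frac{3}{4\sqrt{5}}[3_2,3_1]+\frac{\sqrt{\frac{7}{5}}}{4}[3_2,3_2]$. - $8\otimes 8\to 7_s$: $1_1=\frac{1}{\sqrt{2}}[3_1,3_2]+\frac{1}{\sqrt{2}}[3_2,3_1],\quad 3_1=-\frac{1}{\sqrt{6}}[2,3_2]-\frac{1}{\sqrt{6}}[3_2,2]-\frac{\sqrt{\frac{7}{3}}}{4}[3_1,3_1]+\frac{\sqrt{3}}{4}[3_1,3_2]-\frac{\sqrt{3}}{4}[3_2,3_1]-\frac{\sqrt{\frac{7}{3}}}{4}[3_2,3_2],\quad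 3_2=-\frac{\sqrt{\frac{7}{6}}}{2}[2,3_1]-\frac{\sqrt{\frac{7}{6}}}{2}[3_1,2]+\frac{1}{2\sqrt{2}}[2,3_2]+\frac{1}{2\sqrt{2}}[3_2,2]-\frac{1}{2\sqrt{3}}[3_1,3_2]-\frac{1}{2\sqrt{3}}[3_2,3_1]$. - $8\otimes 8\to 8_s^{(1)}$: $2=\sqrt{\frac{2}{5}}[2,2]-\sqrt{\frac{3}{10}}[3_1,3_1]-\sqrt{\frac{3}{10}}[3_2,3_2],\quad 3_1=-\frac{1}{\sqrt{5}}[2,3_1]-\frac{1}{\sqrt{5}}[3_1,2]+\sqrt{\frac{3}{10}}[3_1,3_1]-\sqrt{\frac{3}{10}}[3_2,3_2],\quad 3_2=-\frac{1}{\sqrt{5}}[2,3_2]-\frac{1}{\sqrt{5}}[3_2,2]-\sqrt{\frac{3}{10}}[3_1,3_2]-\sqrt{\frac{3}{10}}[3_2,3_1]$. - $8\otimes 8\to 8_s^{(2)}$: $2=-\frac{3}{2\sqrt{35}}[2,2]+\frac{3\sqrt{\frac{3}{35}}}{4}[3_1,3_1]+\frac{\sqrt{5}}{4}[3_1,3_2]+\frac{\sqrt{5}}{4}[3_2,3_1]-\frac{\sqrt{\frac{21}{5}}}{4}[3_2,3_2],\quad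 3_1=\frac{3}{2\sqrt{70}}[2,3_1]+\frac{3}{2\sqrt{70}}[3_1,2]-\frac{\sqrt{\frac{5}{6}}}{2}[2,3_2]-\frac{\sqrt{\frac{5}{6}}}{2}[3_2,2]+\frac{13}{2\sqrt{105}}[3_1,3_1]+\frac{\sqrt{\frac{7}{15}}}{2}[3_2,3_2],\quad 3_2=-\frac{\sqrt{\frac{5}{6}}}{2}[2,3_1]-\frac{\sqrt{\frac{5}{6}}}{2}[3_1,2]-\frac{\sqrt{\frac{7}{10}}}{2}[2,3_2]-\frac{\sqrt{\frac{7}{10}}}{2}[3_2,2]+\frac{\sqrt{\frac{7}{15}}}{2}[3_1,3_2]+\frac{\sqrt{\frac{7}{15}}}{2}[3_2,3_1]$. - $8\otimes 8\to 3_a$: $3_2=\frac{1}{4}[2,3_1]-\frac{1}{4}[3_1,2]+\frac{i\sqrt{3}}{4}[2,3_2]-\frac{i\sqrt{3}}{4}[3_2,2]-\frac{1}{2b_7^{3}}[3_1,3_1]+\frac{i}{4b_7}[3_1,3_2]-\frac{i}{4b_7}[3_2,3_1]-\frac{1}{2\sqrt{2}b_7^{2}}[3_2,3_2]$. - $8\otimes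 8\to 7_a^{(1)}$: $1_1=[2,2],\quad 3_1=-\frac{1}{8\sqrt{2}}[2,3_1]+\frac{1}{8\sqrt{2}}[3_1,2]+\frac{\sqrt{\frac{21}{2}}}{8}[2,3_2]-\frac{\sqrt{\frac{21}{2}}}{8}[3_2,2]+\frac{\sqrt{21}}{8}[3_1,3_2]+\frac{\sqrt{21}}{8}[3_2,3_1],\quad 3_2=-\frac{\sqrt{\frac{3}{2}}}{8}[2,3_1]+\frac{\sqrt{\frac{3}{2}}}{8}[3_1,2]+\frac{\sqrt{\frac{7}{2}}}{8}[2,3_2]-\frac{\sqrt{\frac{7}{2}}}{8}[3_2,2]+\frac{\sqrt{3}}{4}[3_1,3_1]+\frac{\sqrt{21}}{8}[3_1,3_2]-\frac{\sqrt{21}}{8}[3_2,3_1]$. - $8\otimes 8\to 7_a^{(2)}$: $1_1=\frac{1}{\sqrt{2}}[3_1,3_2]-\frac{1}{\sqrt{2}}[3_2,3_1],\quad 3_1=-\frac{3\sqrt{\frac{7}{2}}}{8}[2,3_1]+\frac{3\sqrt{\frac{7}{2}}}{8}[3_1,2]-\frac{1}{8\sqrt{6}}[2,3_2]+\frac{1}{8\sqrt{6}}[3_2,2]-\frac{1}{8\sqrt{3}}[3_1,3_2]-\frac{1}{8\sqrt{3}}[3_2,3_1],\quad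 3_2=-\frac{\sqrt{\frac{7}{6}}}{8}[2,3_1]+\frac{\sqrt{\frac{7}{6}}}{8}[3_1,2]-\frac{3}{8\sqrt{2}}[2,3_2]+\frac{3}{8\sqrt{2}}[3_2,2]-\frac{\sqrt{\frac{7}{3}}}{4}[3_1,3_1]+\frac{\sqrt{3}}{8}[3_1,3_2]-\frac{\sqrt{3}}{8}[3_2,3_1]-\frac{\sqrt{\frac{7}{3}}}{2}[3_2,3_2]$. - $8\otimes 8\to 8_a$: $2=\frac{1}{\sqrt{2}}[3_1,3_2]-\frac{1}{\sqrt{2}}[3_2,3_1],\quad 3_1=\frac{1}{\sqrt{3}}[2,3_2]-\frac{1}{\sqrt{3}}[3_2,2]-\frac{1}{\sqrt{6}}[3_1,3_2]-\frac{1}{\sqrt{6}}[3_2,3_1],\quad 3_2=-\frac{1}{\sqrt{3}}[2,3_1]+\frac{1}{\sqrt{3}}[3_1,2]-\frac{1}{\sqrt{6}}[3_1,3_1]+\frac{1}{\sqrt{6}}[3_2,3_2]$. *Embedding factors, $\mathcal T_7$ basis.* - $3\otimes 3\to \bar3_a$: $\bar3=[3,3]_a$. - $3\otimes 3\to 6_s$: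 $3=[3,3],\quad \bar3=[3,3]_s$. - $3\otimes \bar3\to 1$: $1=[3,\bar3]$. - $3\otimes \bar3\to 8$: $1'=[3,\bar3],\quad \bar1'=[3,\bar3],\quad 3=[3,\bar3],\quad \bar3=[3,\bar3]$. - $3\otimes 6\to \bar3$: $\bar3=\frac{1}{\sqrt{2}}[3,3]_s+\frac{1}{\sqrt{2}}[3,\bar3]$. - $3\otimes 6\to 7$: $1=[3,\bar3],\quad 3=\frac{1}{\sqrt{3}}[3,3]+\sqrt{\frac{2}{3}}[3,\bar3],\quad \bar3=-\frac{1}{\sqrt{6}}[3,3]_s+\sqrt{\frac{2}{3}}[3,3]_a+\frac{1}{\sqrt{6}}[3,\bar3]$. - $3\otimes 6\to 8$: $1'=[3,\bar3],\quad \bar1'=-[3,\bar3],\quad 3=i\sqrt{\frac{2}{3}}[3,3]-\frac{i}{\sqrt{3}}[3,\bar3],\quad \bar3=-\frac{i}{\sqrt{3}}[3,3]_s-\frac{i}{\sqrt{3}}[3,3]_a+\frac{i}{\sqrt{3}}[3,\bar3]$. - $3\otimes 7\to 6$: $3=\sqrt{\frac{2}{7}}[3,1]+\frac{1}{\sqrt{7}}[3,3]+\frac{2}{\sqrt{7}}[3,\bar3],\quad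 \bar3=-\frac{1}{\sqrt{7}}[3,3]_s-\frac{2}{\sqrt{7}}[3,3]_a+\sqrt{\frac{2}{7}}[3,\bar3]$. - $3\otimes 7\to 7$: $1=[3,\bar3],\quad 3=-\frac{1}{\sqrt{3}}[3,1]+\sqrt{\frac{2}{3}}[3,3],\quad \bar3=-\frac{1}{\sqrt{3}}[3,3]_a-\sqrt{\frac{2}{3}}[3,\bar3]$. - $3\otimes 7\to 8$: $1'=[3,\bar3],\quad \bar1'=-e^{2i\alpha}[3,\bar3],\quad 3=-2i\sqrt{\frac{2}{21}}e^{i\alpha}[3,1]-\frac{2ie^{i\alpha}}{\sqrt{21}}[3,3]+i\sqrt{\frac{3}{7}}e^{i\alpha}[3,\bar3],\quad \bar3=-i\sqrt{\frac{6}{7}}e^{i\alpha}[3,3]_s+i\sqrt{\frac{2}{21}}e^{i\alpha}[3,3]_a-\frac{ie^{i\alpha}}{\sqrt{21}}[3,\bar3]$. - $3\otimes 8\to 3$: $3=\frac{1}{2\sqrt{2}}[3,1']+\frac{1}{2\sqrt{2}}[3,\bar1']+\frac{\sqrt{\frac{3}{2}}}{2}[3,3]+\frac{\sqrt{\frac{3}{2}}}{2}[3,\bar3]$.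 - $3\otimes 8\to 6$: $3=\frac{1}{2}[3,1']-\frac{1}{2}[3,\bar1']-\frac{i}{2}[3,3]+\frac{i}{2}[3,\bar3],\quad \bar3=\frac{i}{2}[3,3]_s-\frac{i}{2}[3,3]_a-\frac{i}{\sqrt{2}}[3,\bar3]$. - $3\otimes 8\to 7$: $1=[3,\bar3],\quad 3=-\frac{1}{2}i\sqrt{\frac{7}{6}}e^{i\alpha}[3,1']+\frac{1}{2}i\sqrt{\frac{7}{6}}e^{-i\alpha}[3,\bar1']+\frac{1}{2\sqrt{6}}[3,3]-\frac{\sqrt{\frac{3}{2}}}{2}[3,\bar3],\quad \bar3=\frac{\sqrt{3}}{2}[3,3]_s+\frac{1}{2\sqrt{3}}[3,3]_a+\frac{1}{\sqrt{6}}[3,\bar3]$. - $3\otimes 8\to 8$: $1'=[3,\bar3],\quad \bar1'=-\omega^{2}[3,\bar3],\quad 3=\frac{\omega^{2}}{\sqrt{3}}[3,1']-\frac{1}{\sqrt{3}}[3,\bar1']-\frac{i\omega}{\sqrt{3}}[3,3],\quad \bar3=-i\sqrt{\frac{2}{3}}\omega[3,3]_a+\frac{i\omega}{\sqrt{3}}[3,\bar3]$.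 - $6\otimes 6\to 1_s$: $1=\frac{1}{\sqrt{2}}[3,\bar3]+\frac{1}{\sqrt{2}}[\bar3,3]$. - $6\otimes 6\to 6_s^{(1)}$: $3=\sqrt{\frac{1}{14}(3-\sqrt{2})}[3,3]+\sqrt{\frac{1}{14}(3-\sqrt{2})}[3,\bar3]+\sqrt{\frac{1}{14}(3-\sqrt{2})}[\bar3,3]-\sqrt{\frac{1}{14}(5+3\sqrt{2})}[\bar3,\bar3]_s$. - $6\otimes 6\to 6_s^{(2)}$: $3=i\sqrt{\frac{1}{14}(3+\sqrt{2})}[3,3]-i\sqrt{\frac{1}{14}(3+\sqrt{2})}[3,\bar3]-i\sqrt{\frac{1}{14}(3+\sqrt{2})}[\bar3,3]-i\sqrt{\frac{1}{14}(5-3\sqrt{2})}[\bar3,\bar3]_s$. - $6\otimes 6\to 8_s$: $1'=\frac{e^{-i\alpha}}{\sqrt{2}}[3,\bar3]+\frac{e^{-i\alpha}}{\sqrt{2}}[\bar3,3],\quad 3=-\frac{2}{\sqrt{7}}[3,3]-\frac{1}{\sqrt{14}}[3,\bar3]-\frac{1}{\sqrt{14}}[\bar3,3]-\sqrt{\frac{2}{7}}[\bar3,\bar3]_s$.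 - $6\otimes 6\to 7_a$: $1=\frac{i}{\sqrt{2}}[3,\bar3]-\frac{i}{\sqrt{2}}[\bar3,3],\quad 3=-\frac{i}{\sqrt{3}}[3,\bar3]+\frac{i}{\sqrt{3}}[\bar3,3]-\frac{i}{\sqrt{3}}[\bar3,\bar3]_a$. - $6\otimes 6\to 8_a$: $1'=\frac{1}{\sqrt{2}}[3,\bar3]-\frac{1}{\sqrt{2}}[\bar3,3],\quad 3=\frac{i}{\sqrt{6}}[3,\bar3]-\frac{i}{\sqrt{6}}[\bar3,3]-i\sqrt{\frac{2}{3}}[\bar3,\bar3]_a$. - $6\otimes 7\to 3$: $3=\frac{1}{\sqrt{7}}[3,1]+\sqrt{\frac{2}{7}}[3,3]+\frac{1}{\sqrt{14}}[3,\bar3]+\frac{1}{\sqrt{7}}[\bar3,3]-\frac{1}{\sqrt{14}}[\bar3,\bar3]_s+\sqrt{\frac{2}{7}}[\bar3,\bar3]_a$. - $6\otimes 7\to 6$: $3=\frac{i}{\sqrt{7}}[3,1]-i\sqrt{\frac{2}{7}}[3,3]-i\sqrt{\frac{2}{7}}[3,\bar3]+i\sqrt{\frac{2}{7}}[\bar3,\bar3]_a$.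 - $6\otimes 7\to 7^{(1)}$: $1=\frac{1}{\sqrt{2}}[3,\bar3]+\frac{1}{\sqrt{2}}[\bar3,3],\quad 3=\frac{1}{\sqrt{6}}[3,1]-\frac{1}{\sqrt{6}}[3,3]+\frac{1}{6}(\sqrt{3}+\sqrt{6})[3,\bar3]-\frac{1}{\sqrt{6}}[\bar3,3]+\frac{1}{6}(\sqrt{3}-\sqrt{6})[\bar3,\bar3]_s$. - $6\otimes 7\to 7^{(2)}$: $1=\frac{i}{\sqrt{2}}[3,\bar3]-\frac{i}{\sqrt{2}}[\bar3,3],\quad 3=\frac{i}{\sqrt{6}}[3,1]+\frac{i}{\sqrt{6}}[3,3]-\frac{i(\sqrt{2}-1)}{2\sqrt{3}}[3,\bar3]-\frac{i}{\sqrt{6}}[\bar3,3]+\frac{1}{6}i(\sqrt{3}+\sqrt{6})[\bar3,\bar3]_s$. - $6\otimes 7\to 8^{(1)}$: $1'=-\frac{i\omega e^{2i\beta-i\alpha}}{\sqrt{2}}[3,\bar3]-\frac{i\omega e^{2i\beta-i\alpha}}{\sqrt{2}}[\bar3,3],\quad 3=\frac{2}{\sqrt{21}}[3,1]+\frac{1}{\sqrt{21}}[3,3]-\frac{2+\sqrt{2}}{2\sqrt{21}}[3,\bar3]+\frac{2-3\sqrt{2}}{2\sqrt{21}}[\bar3,3]-\frac{4+\sqrt{2}}{2\sqrt{21}}[\bar3,\bar3]_s-\sqrt{\frac{3}{14}}[\bar3,\bar3]_a$.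 - $6\otimes 7\to 8^{(2)}$: $1'=-\frac{\omega^{2}e^{i\alpha-2i\beta}}{\sqrt{2}}[3,\bar3]+\frac{\omega^{2}e^{i\alpha-2i\beta}}{\sqrt{2}}[\bar3,3],\quad 3=-\frac{2i}{\sqrt{21}}[3,1]+\frac{i}{\sqrt{21}}[3,3]+\frac{i(\sqrt{2}-2)}{2\sqrt{21}}[3,\bar3]-\frac{i(2+3\sqrt{2})}{2\sqrt{21}}[\bar3,3]+\frac{i(\sqrt{2}-4)}{2\sqrt{21}}[\bar3,\bar3]_s+i\sqrt{\frac{3}{14}}[\bar3,\bar3]_a$. - $6\otimes 8\to 3$: $3=\frac{1}{2\sqrt{2}}[3,1']-\frac{1}{2\sqrt{2}}[3,\bar1']+\frac{i}{2\sqrt{2}}[3,3]-\frac{i}{2\sqrt{2}}[3,\bar3]-\frac{i}{2}[\bar3,3]+\frac{i}{2\sqrt{2}}[\bar3,\bar3]_s+\frac{i}{2\sqrt{2}}[\bar3,\bar3]_a$. - $6\otimes 8\to 6^{(1)}$: $3=-\frac{e^{i\alpha}}{2\sqrt{2}}[3,1']-\frac{e^{-i\alpha}}{2\sqrt{2}}[3,\bar1']+\frac{\sqrt{\frac{3}{14}}}{2}[3,3]+\frac{\sqrt{\frac{3}{14}}}{2}[3,\bar3]+\sqrt{\frac{3}{7}}[\bar3,3]+\sqrt{\frac{3}{14}}[\bar3,\bar3]_s$.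 - $6\otimes 8\to 6^{(2)}$: $3=-\frac{1}{2\sqrt{2}}[3,1']+\frac{1}{2\sqrt{2}}[3,\bar1']+\frac{i}{2\sqrt{2}}[3,3]+\frac{i}{2\sqrt{2}}[3,\bar3]+\frac{i}{\sqrt{2}}[\bar3,\bar3]_a$. - $6\otimes 8\to 7^{(1)}$: $1=\frac{1}{\sqrt{2}}[3,\bar3]+\frac{1}{\sqrt{2}}[\bar3,3],\quad 3=\frac{i\sqrt{7}\omega^{2}}{4\sqrt{3}}e^{i\alpha-2i\beta}[3,1']-\frac{i\sqrt{7}\omega}{4\sqrt{3}}e^{2i\beta-i\alpha}[3,\bar1']+\frac{\sqrt{2}-3}{4\sqrt{3}}[3,3]-\frac{1+\sqrt{2}}{4\sqrt{3}}[3,\bar3]+\frac{1}{2\sqrt{6}}[\bar3,3]-\frac{1+2\sqrt{2}}{4\sqrt{3}}[\bar3,\bar3]_s+\frac{\sqrt{3}}{4}[\bar3,\bar3]_a$. - $6\otimes 8\to 7^{(2)}$: $1=\frac{i}{\sqrt{2}}[3,\bar3]-\frac{i}{\sqrt{2}}[\bar3,3],\quad 3=-\frac{\sqrt{7}\omega}{4\sqrt{3}}e^{2i\beta-i\alpha}[3,1']+\frac{\sqrt{7}\omega^{2}}{4\sqrt{3}}e^{i\alpha-2i\beta}[3,\bar1']-\frac{i(3+\sqrt{2})}{4\sqrt{3}}[3,3]+\frac{i(\sqrt{2}-1)}{4\sqrt{3}}[3,\bar3]+\frac{i}{2\sqrt{6}}[\bar3,3]+\frac{1}{12}i(2\sqrt{6}-\sqrt{3})[\bar3,\bar3]_s+\frac{i\sqrt{3}}{4}[\bar3,\bar3]_a$.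 - $6\otimes 8\to 8^{(1)}$: $1'=-\frac{ie^{-i\beta}}{\sqrt{2}}[3,\bar3]-\frac{ie^{-i\beta}}{\sqrt{2}}[\bar3,3],\quad 3=\frac{ie^{i\beta}}{\sqrt{6}}[3,1']-\frac{ie^{-i\beta}}{\sqrt{6}}[3,\bar1']-\sqrt{\frac{5+3\sqrt{2}}{42}}[3,3]+\sqrt{\frac{6-2\sqrt{2}}{21}}[3,\bar3]-\sqrt{\frac{5+3\sqrt{2}}{42}}[\bar3,3]+\sqrt{\frac{3-\sqrt{2}}{21}}[\bar3,\bar3]_s$. - $6\otimes 8\to 8^{(2)}$: $1'=\frac{\omega e^{i\beta-i\alpha}}{\sqrt{2}}[3,\bar3]-\frac{\omega e^{i\beta-i\alpha}}{\sqrt{2}}[\bar3,3],\quad 3=-\frac{\omega^{2}e^{i\alpha-i\beta}}{\sqrt{6}}[3,1']+\frac{\omega e^{i\beta-i\alpha}}{\sqrt{6}}[3,\bar1']+i\sqrt{\frac{5-3\sqrt{2}}{42}}[3,3]+i\sqrt{\frac{6+2\sqrt{2}}{21}}[3,\bar3]-i\sqrt{\frac{5-3\sqrt{2}}{42}}[\bar3,3]-i\sqrt{\frac{3+\sqrt{2}}{21}}[\bar3,\bar3]_s$.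 - $7\otimes 7\to 1_s$: $1=\frac{1}{\sqrt{7}}[1,1]+\sqrt{\frac{3}{7}}[3,\bar3]+\sqrt{\frac{3}{7}}[\bar3,3]$. - $7\otimes 7\to 6_s^{(1)}$: $3=\frac{1}{\sqrt{7}}[1,3]+\frac{1}{\sqrt{7}}[3,1]+\frac{1}{14}(2\sqrt{7}+\sqrt{14})[3,3]-\frac{1}{\sqrt{7}}[3,\bar3]-\frac{1}{\sqrt{7}}[\bar3,3]+\frac{1}{14}(\sqrt{14}-2\sqrt{7})[\bar3,\bar3]_s$. - $7\otimes 7\to 6_s^{(2)}$: $3=\frac{i}{\sqrt{7}}[1,3]+\frac{i}{\sqrt{7}}[3,1]+\frac{i(\sqrt{2}-2)}{2\sqrt{7}}[3,3]+\frac{i}{\sqrt{7}}[3,\bar3]+\frac{i}{\sqrt{7}}[\bar3,3]-\frac{1}{14}i(2\sqrt{7}+\sqrt{14})[\bar3,\bar3]_s$. - $7\otimes 7\to 7_s$: $1=\sqrt{\frac{6}{7}}[1,1]-\frac{1}{\sqrt{14}}[3,\bar3]-\frac{1}{\sqrt{14}}[\bar3,3],\quad 3=-\frac{1}{\sqrt{42}}[1,3]-\frac{1}{\sqrt{42}}[3,1]-\frac{2}{\sqrt{21}}[3,3]-\frac{2}{\sqrt{21}}[3,\bar3]-\frac{2}{\sqrt{21}}[\bar3,3]-2\sqrt{\frac{2}{21}}[\bar3,\bar3]_s$.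 - $7\otimes 7\to 8_s$: $1'=\frac{ie^{-i\alpha}}{\sqrt{2}}[3,\bar3]+\frac{ie^{-i\alpha}}{\sqrt{2}}[\bar3,3],\quad 3=-\frac{2}{\sqrt{21}}[1,3]-\frac{2}{\sqrt{21}}[3,1]+2\sqrt{\frac{2}{21}}[3,3]+\frac{1}{\sqrt{42}}[3,\bar3]+\frac{1}{\sqrt{42}}[\bar3,3]-\frac{2}{\sqrt{21}}[\bar3,\bar3]_s$. - $7\otimes 7\to 3_a$: $3=\frac{1}{\sqrt{7}}[1,3]-\frac{1}{\sqrt{7}}[3,1]+\sqrt{\frac{2}{7}}[3,\bar3]-\sqrt{\frac{2}{7}}[\bar3,3]+\frac{1}{\sqrt{7}}[\bar3,\bar3]_a$. - $7\otimes 7\to 7_a$: $1=\frac{i}{\sqrt{2}}[3,\bar3]-\frac{i}{\sqrt{2}}[\bar3,3],\quad 3=\frac{i}{\sqrt{6}}[1,3]-\frac{i}{\sqrt{6}}[3,1]-i\sqrt{\frac{2}{3}}[\bar3,\bar3]_a$. - $7\otimes 7\to 8_a$: $1'=\frac{e^{i\alpha}}{\sqrt{2}}[3,\bar3]-\frac{e^{i\alpha}}{\sqrt{2}}[\bar3,3],\quad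 3=\frac{2i}{\sqrt{21}}[1,3]-\frac{2i}{\sqrt{21}}[3,1]-i\sqrt{\frac{3}{14}}[3,\bar3]+i\sqrt{\frac{3}{14}}[\bar3,3]+\frac{2i}{\sqrt{21}}[\bar3,\bar3]_a$. - $7\otimes 8\to 3$: $3=\frac{1}{\sqrt{7}}[1,3]-\frac{ie^{i\alpha}}{2\sqrt{2}}[3,1']+\frac{ie^{-i\alpha}}{2\sqrt{2}}[3,\bar1']-\frac{3}{2\sqrt{14}}[3,3]+\frac{1}{2\sqrt{14}}[3,\bar3]+\frac{1}{\sqrt{14}}[\bar3,3]+\frac{3}{2\sqrt{7}}[\bar3,\bar3]_s-\frac{1}{2\sqrt{7}}[\bar3,\bar3]_a$. - $7\otimes 8\to 6^{(1)}$: $3=\frac{1}{\sqrt{7}}[1,3]+\frac{i\omega^{2}e^{i\alpha-2i\beta}}{2\sqrt{2}}[3,1']-\frac{i\omega e^{2i\beta-i\alpha}}{2\sqrt{2}}[3,\bar1']-\frac{2+\sqrt{2}}{4\sqrt{7}}[3,3]-\frac{3\sqrt{2}-2}{4\sqrt{7}}[3,\bar3]+\frac{1}{2\sqrt{7}}[\bar3,3]-\frac{4+\sqrt{2}}{4\sqrt{7}}[\bar3,\bar3]_s-\frac{3}{2\sqrt{14}}[\bar3,\bar3]_a$.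 - $7\otimes 8\to 6^{(2)}$: $3=\frac{i}{\sqrt{7}}[1,3]-\frac{\omega e^{2i\beta-i\alpha}}{2\sqrt{2}}[3,1']+\frac{\omega^{2}e^{i\alpha-2i\beta}}{2\sqrt{2}}[3,\bar1']-\frac{i(\sqrt{2}-2)}{4\sqrt{7}}[3,3]-\frac{i(2+3\sqrt{2})}{4\sqrt{7}}[3,\bar3]-\frac{i}{2\sqrt{7}}[\bar3,3]+\frac{i(\sqrt{2}-4)}{4\sqrt{7}}[\bar3,\bar3]_s+\frac{3i}{2\sqrt{14}}[\bar3,\bar3]_a$. - $7\otimes 8\to 7^{(1)}$: $1=\frac{1}{\sqrt{2}}[3,\bar3]+\frac{1}{\sqrt{2}}[\bar3,3],\quad 3=\frac{1}{\sqrt{6}}[1,3]+\frac{1}{4}i\sqrt{\frac{7}{3}}e^{i\alpha}[3,1']-\frac{1}{4}i\sqrt{\frac{7}{3}}e^{-i\alpha}[3,\bar1']-\frac{1}{4\sqrt{3}}[3,3]-\frac{1}{4\sqrt{3}}[3,\bar3]-\frac{1}{\sqrt{3}}[\bar3,3]+\frac{1}{\sqrt{6}}[\bar3,\bar3]_s$.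 - $7\otimes 8\to 7^{(2)}$: $1=\frac{i}{\sqrt{2}}[3,\bar3]-\frac{i}{\sqrt{2}}[\bar3,3],\quad 3=\frac{i}{\sqrt{6}}[1,3]+\frac{1}{4}\sqrt{\frac{7}{3}}e^{-i\alpha}[3,1']-\frac{1}{4}\sqrt{\frac{7}{3}}e^{i\alpha}[3,\bar1']+\frac{i\sqrt{3}}{4}[3,3]+\frac{i\sqrt{3}}{4}[3,\bar3]+\frac{i}{\sqrt{6}}[\bar3,\bar3]_a$. - $7\otimes 8\to 8^{(1)}$: $1'=\frac{3\sqrt{3}-4i}{\sqrt{91}}[1,1']-2\sqrt{\frac{6}{91}}[3,\bar3]-2\sqrt{\frac{6}{91}}[\bar3,3],\quad 3=-\sqrt{\frac{3}{91}}[1,3]+2\sqrt{\frac{2}{91}}\omega^{2}[3,1']+2\sqrt{\frac{2}{91}}\omega[3,\bar1']+2\sqrt{\frac{6}{91}}[3,3]-2\sqrt{\frac{6}{91}}[3,\bar3]+2\sqrt{\frac{3}{91}}[\bar3,\bar3]_s-2\sqrt{\frac{3}{91}}[\bar3,\bar3]_a$. - $7\otimes 8\to 8^{(2)}$: $1'=-4\sqrt{\frac{3}{91}}\omega^{2}[1,1']-\frac{\sqrt{3}-13i}{2\sqrt{182}}[3,\bar3]-\frac{\sqrt{3}-13i}{2\sqrt{182}}[\bar3,3],\quad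 3=-\frac{2}{\sqrt{273}}[1,3]+\frac{i(5\sqrt{3}+21i)}{6\sqrt{182}}[3,1']-\frac{i(5\sqrt{3}-21i)}{6\sqrt{182}}[3,\bar1']-\frac{5}{\sqrt{546}}[3,3]-4\sqrt{\frac{2}{273}}[3,\bar3]+\sqrt{\frac{13}{42}}[\bar3,3]+\frac{4}{\sqrt{273}}[\bar3,\bar3]_s+3\sqrt{\frac{3}{91}}[\bar3,\bar3]_a$. - $7\otimes 8\to 8^{(3)}$: $1'=-\frac{e^{-i\alpha}\omega^{2}}{\sqrt{2}}[3,\bar3]+\frac{e^{-i\alpha}\omega^{2}}{\sqrt{2}}[\bar3,3],\quad 3=-\frac{2i}{\sqrt{21}}[1,3]-\frac{e^{i\alpha}\omega}{\sqrt{6}}[3,1']+\frac{e^{-i\alpha}\omega^{2}}{\sqrt{6}}[3,\bar1']-i\sqrt{\frac{3}{14}}[3,3]-i\sqrt{\frac{3}{14}}[\bar3,3]+\frac{i}{\sqrt{21}}[\bar3,\bar3]_a$. - $8\otimes 8\to 1_s$: $1=\frac{1}{2\sqrt{2}}[1',\bar1']+\frac{1}{2\sqrt{2}}[\bar1',1']+\frac{\sqrt{\frac{3}{2}}}{2}[3,\bar3]+\frac{\sqrt{\frac{3}{2}}}{2}[\bar3,3]$.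 - $8\otimes 8\to 6_s^{(1)}$: $3=\frac{ie^{i\beta}}{2\sqrt{2}}[1',3]+\frac{ie^{i\beta}}{2\sqrt{2}}[3,1']-\frac{ie^{-i\beta}}{2\sqrt{2}}[\bar1',3]-\frac{ie^{-i\beta}}{2\sqrt{2}}[3,\bar1']+\sqrt{\frac{1}{14}(3-\sqrt{2})}[3,3]-\frac{1}{2}\sqrt{\frac{1}{14}(5+3\sqrt{2})}[3,\bar3]-\frac{1}{2}\sqrt{\frac{1}{14}(5+3\sqrt{2})}[\bar3,3]+\frac{1}{2}\sqrt{\frac{1}{7}(3-\sqrt{2})}[\bar3,\bar3]_s$. - $8\otimes 8\to 6_s^{(2)}$: $3=-\frac{\omega^{2}e^{i\alpha-i\beta}}{2\sqrt{2}}[1',3]-\frac{\omega^{2}e^{i\alpha-i\beta}}{2\sqrt{2}}[3,1']+\frac{\omega e^{i\beta-i\alpha}}{2\sqrt{2}}[\bar1',3]+\frac{\omega e^{i\beta-i\alpha}}{2\sqrt{2}}[3,\bar1']+i\sqrt{\frac{1}{14}(3+\sqrt{2})}[3,3]+\frac{1}{2}i\sqrt{\frac{1}{14}(5-3\sqrt{2})}[3,\bar3]+\frac{1}{2}i\sqrt{\frac{1}{14}(5-3\sqrt{2})}[\bar3,3]+\frac{1}{2}i\sqrt{\frac{1}{7}(3+\sqrt{2})}[\bar3,\bar3]_s$.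 - $8\otimes 8\to 7_s$: $1=\frac{\sqrt{\frac{3}{2}}}{2}[1',\bar1']+\frac{\sqrt{\frac{3}{2}}}{2}[\bar1',1']-\frac{1}{2\sqrt{2}}[3,\bar3]-\frac{1}{2\sqrt{2}}[\bar3,3],\quad 3=\frac{i\omega}{2\sqrt{3}}[1',3]+\frac{i\omega}{2\sqrt{3}}[3,1']-\frac{i\omega^{2}}{2\sqrt{3}}[\bar1',3]-\frac{i\omega^{2}}{2\sqrt{3}}[3,\bar1']-\frac{1}{\sqrt{3}}[3,3]+\frac{1}{2\sqrt{3}}[3,\bar3]+\frac{1}{2\sqrt{3}}[\bar3,3]+\frac{1}{\sqrt{6}}[\bar3,\bar3]_s$. - $8\otimes 8\to 8_s^{(1)}$: $1'=-\frac{\omega^{2}}{\sqrt{3}}[\bar1',\bar1']-\frac{i}{\sqrt{3}}[3,\bar3]-\frac{i}{\sqrt{3}}[\bar3,3],\quad 3=\frac{i}{3}[1',3]+\frac{i}{3}[3,1']-\frac{i}{3}[\bar1',3]-\frac{i}{3}[3,\bar1']+\frac{1}{3}[3,3]+\frac{1}{3}[3,\bar3]+\frac{1}{3}[\bar3,3]+\frac{\sqrt{2}}{3}[\bar3,\bar3]_s$.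 - $8\otimes 8\to 8_s^{(2)}$: $1'=\sqrt{\frac{2}{3}}e^{-i\alpha}[\bar1',\bar1']-\frac{ie^{-i\alpha}\omega}{\sqrt{6}}[3,\bar3]-\frac{ie^{-i\alpha}\omega}{\sqrt{6}}[\bar3,3],\quad 3=\frac{ie^{i\alpha}\omega^{2}}{3\sqrt{2}}[1',3]+\frac{ie^{i\alpha}\omega^{2}}{3\sqrt{2}}[3,1']-\frac{ie^{-i\alpha}\omega}{3\sqrt{2}}[\bar1',3]-\frac{ie^{-i\alpha}\omega}{3\sqrt{2}}[3,\bar1']-\frac{2\sqrt{\frac{2}{7}}}{3}[3,3]-\frac{2\sqrt{\frac{2}{7}}}{3}[3,\bar3]-\frac{2\sqrt{\frac{2}{7}}}{3}[\bar3,3]+\frac{5}{3\sqrt{7}}[\bar3,\bar3]_s$. - $8\otimes 8\to 3_a$: $3=\frac{1}{2\sqrt{2}}[1',3]-\frac{1}{2\sqrt{2}}[3,1']-\frac{\omega}{2\sqrt{2}}[\bar1',3]+\frac{\omega}{2\sqrt{2}}[3,\bar1']+\frac{i\omega^{2}}{2\sqrt{2}}[3,\bar3]-\frac{i\omega^{2}}{2\sqrt{2}}[\bar3,3]-\frac{i\omega^{2}}{2}[\bar3,\bar3]_a$.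 - $8\otimes 8\to 7_a^{(1)}$: $1=\frac{i}{\sqrt{2}}[1',\bar1']-\frac{i}{\sqrt{2}}[\bar1',1'],\quad 3=\frac{\omega}{4}[1',3]-\frac{\omega}{4}[3,1']+\frac{\omega^{2}}{4}[\bar1',3]-\frac{\omega^{2}}{4}[3,\bar1']+\frac{\sqrt{3}}{4}[3,\bar3]-\frac{\sqrt{3}}{4}[\bar3,3]+\frac{\sqrt{\frac{3}{2}}}{2}[\bar3,\bar3]_a$. - $8\otimes 8\to 7_a^{(2)}$: $1=\frac{i}{\sqrt{2}}[3,\bar3]-\frac{i}{\sqrt{2}}[\bar3,3],\quad 3=-\frac{1}{4}\sqrt{\frac{7}{3}}e^{i\alpha}\omega[1',3]+\frac{1}{4}\sqrt{\frac{7}{3}}e^{i\alpha}\omega[3,1']+\frac{1}{4}\sqrt{\frac{7}{3}}e^{-i\alpha}\omega^{2}[\bar1',3]-\frac{1}{4}\sqrt{\frac{7}{3}}e^{-i\alpha}\omega^{2}[3,\bar1']+\frac{i\sqrt{3}}{4}[3,\bar3]-\frac{i\sqrt{3}}{4}[\bar3,3]-\frac{i}{2\sqrt{6}}[\bar3,\bar3]_a$.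 - $8\otimes 8\to 8_a$: $1'=-\frac{\omega}{\sqrt{2}}[3,\bar3]+\frac{\omega}{\sqrt{2}}[\bar3,3],\quad 3=\frac{\omega^{2}}{\sqrt{6}}[1',3]-\frac{\omega^{2}}{\sqrt{6}}[3,1']-\frac{\omega}{\sqrt{6}}[\bar1',3]+\frac{\omega}{\sqrt{6}}[3,\bar1']-\frac{i}{\sqrt{3}}[\bar3,\bar3]_a$. **Theorem.** For every generating pair $A,B$ as above the following hold, for $H=\langle a,b\rangle\cong S_4$ with the $S_4$ data and for $H=\langle c,d\rangle=\mathcal T_7$ with the $\mathcal T_7$ data. 1. There are unitary representations $\rho_X$ of $G$ ($X=1,3,\bar3,6,7,8$) in which $A,B$ have the listed matrices. They are irreducible, pairwise inequivalent, and every irreducible finite-dimensional complex representation of $G$ is equivalent to one of them. The listed matrices of the generators of $H$ likewise define unitary representations $\sigma_x$ that are all the irreps of $H$, each once. For each $X$ the representations $\rho_X$ in the $S_4$ basis and in the $\mathcal T_7$ basis are equivalent. 2. The bases are adapted to $H$: $P_{X\to a}\,\rho_X(h)\,P_{X\to b}^\dagger=\delta_{ab}\,\sigma_{a}(h)$ for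 $h\in H$ and $\sum_aP_{X\to a}^\dagger P_{X\to a}=1$. 3. The listed contractions of $H$ are CG coefficients of $H$ (equivariant, $MM^\dagger=1$) and for all $x,y$ give the complete decomposition of $x\otimes y$ ($\sum M^\dagger M=1$). 4. Every listed contraction $X\otimes Y\to Z$ satisfies the defining equations $$P_{Z\to c}\,\rho_Z(g)\,Z=\sum_{a,b}E_{c,ab}\{(P_{X\to a}\rho_X(g)X)\otimes(P_{Y\to b}\rho_Y(g)Y)\}_{z_c}\quad\text{for all }g\in G,$$ where $Z=M(X\otimes Y)$; equivalently $M(\rho_X(g)\otimes\rho_Y(g))=\rho_Z(g)M$. Moreover $\sum_{a,b}|E_{c,ab}|^2=1$ for every $c$ in $Z$, $MM^\dagger=1$, and a contraction of $X\otimes X$ with index $s$ ($a$) is symmetric (antisymmetric) under exchange of the factors. Only subgroup contractions that exist between irreps contained in $X$, $Y$, $Z$ occur. 5. The lists are complete: every product $X\otimes Y$ is covered in one of the two orders, the CG matrices of different contractions of a product are orthogonal, and $\sum M^\dagger M=1$ over all contractions of the product, so that together they form a unitary matrix that decomposes $X\otimes Y$. 6. The phase conventions for complex conjugation hold. The $\Gamma_x$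 are unitary, $\Gamma_x\sigma_x(h)^*\Gamma_x^\dagger=\sigma_{\bar x}(h)$, and $\Gamma_c M^{(ab\to c)*}=M^{(\bar a\bar b\to\bar c)}(\Gamma_a\otimes\Gamma_b)$. The matrix $\Gamma_X=\sum_xP_{\bar X\to\bar x}^\dagger\Gamma_xP_{X\to x}^*$ is unitary, $\Gamma_X\rho_X(g)^*\Gamma_X^\dagger=\rho_{\bar X}(g)$, $\Gamma_xP_{X\to x}^*=P_{\bar X\to\bar x}\Gamma_X$, $\rho_{\bar3}=\rho_3^*$ and $\Gamma_3=1$. The factors satisfy $E^{(\bar X\bar Y\to\bar Z)}_{\bar c,\bar a\bar b}=(E^{(XY\to Z)}_{c,ab})^*$ and the CG matrices $\Gamma_ZM^{(XY\to Z)*}=M^{(\bar X\bar Y\to\bar Z)}(\Gamma_X\otimes\Gamma_Y)$; the complex conjugate of each contraction of $3\otimes\bar3$ is, after exchange of the factors, the same contraction. -/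

import Mathlib

namespace PSL27

open Matrix
open scoped Kronecker MatrixGroups
open Complex (I exp)

noncomputable section

/-- The square root of a nonnegative real number, as a complex number. -/
def rt (x : ℝ) : ℂ := (Real.sqrt x : ℂ)

/-- `ω = exp (2πi/3)`. -/
def ω : ℂ := exp (2 * Real.pi * I / 3)

/-- `η = exp (2πi/7)`. -/
def η : ℂ := exp (2 * Real.pi * I / 7)

/-- The pure phase `b₇ = (η + η² + η⁴)/√2 = (-1 + i√7)/(2√2)`. -/
def b₇ : ℂ := (-1 + I * rt 7) / (2 * rt 2)

/-- The complex conjugate of `b₇`. -/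
def b₇c : ℂ := (-1 - I * rt 7) / (2 * rt 2)

/-- `α = arctan (√3/2)`. -/
def α : ℂ := (Real.arctan (√3 / 2) : ℂ)

/-- `β = arctan (3√3 + 2√6)`. -/
def β : ℂ := (Real.arctan (3 * √3 + 2 * √6) : ℂ)

/-- `c_k = cos (2πk/7)`. -/
def cosSeven (k : ℕ) : ℂ := (Real.cos (2 * k * Real.pi / 7) : ℂ)

end

/-! ### Labels -/

/-- Labels of the irreps `1, 3, 3̄, 6, 7, 8` of `PSL₂(7)`. -/
inductive GIrrep
  | g1 | g3 | g3b | g6 | g7 | g8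
  deriving DecidableEq

/-- Labels of the irreps `1₀, 1₁, 2, 3₁, 3₂` of `S₄`. -/
inductive S4Irrep
  | s1₀ | s1₁ | s2 | s3₁ | s3₂
  deriving DecidableEq

/-- Labels of the irreps `1, 1′, 1̄′, 3, 3̄` of `T₇`. -/
inductive T7Irrep
  | t1 | t1p | t1q | t3 | t3b
  deriving DecidableEq

/-- The index `s` or `a` of a contraction (symmetric or antisymmetric under exchange of the two
factors), or `n` for a contraction without such an index. -/
inductive Label
  | n | s | a
  deriving DecidableEq

open GIrrep S4Irrep T7Irrep

instance : Fintype GIrrep := ⟨{g1, g3, g3b, g6, g7, g8}, fun x => by cases x <;> simp⟩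

instance : Fintype S4Irrep := ⟨{s1₀, s1₁, s2, s3₁, s3₂}, fun x => by cases x <;> simp⟩

instance : Fintype T7Irrep := ⟨{t1, t1p, t1q, t3, t3b}, fun x => by cases x <;> simp⟩

instance : Fintype Label := ⟨{Label.n, Label.s, Label.a}, fun x => by cases x <;> simp⟩

/-- Dimensions of the irreps of `PSL₂(7)`. -/
@[reducible] def GIrrep.dim : GIrrep → ℕ
  | g1 => 1 | g3 => 3 | g3b => 3 | g6 => 6 | g7 => 7 | g8 => 8

/-- The complex conjugate irrep. -/
@[reducible] def GIrrep.bar : GIrrep → GIrrep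
  | g1 => g1 | g3 => g3b | g3b => g3 | g6 => g6 | g7 => g7 | g8 => g8

@[reducible] def S4Irrep.dim : S4Irrep → ℕ
  | s1₀ => 1 | s1₁ => 1 | s2 => 2 | s3₁ => 3 | s3₂ => 3

@[reducible] def T7Irrep.dim : T7Irrep → ℕ
  | t1 => 1 | t1p => 1 | t1q => 1 | t3 => 3 | t3b => 3

@[reducible] def T7Irrep.bar : T7Irrep → T7Irrep
  | t1 => t1 | t1p => t1q | t1q => t1p | t3 => t3b | t3b => t3

/-! ### Data of a basis of the irreps adapted to a subgroup -/

/-- One contraction `X ⊗ Y → Z` (for given `X`, `Y`): the target `Z`, the index `s` or `a`, the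
number `(μ)` that distinguishes copies of `Z` with the same index, and the embedding factors
`E c a b k`, the coefficient of the subgroup contraction `{x_a ⊗ y_b}_{z_c}` with index `k`, in the
`z_c` component of `Z`. -/
structure Channel (ι : Type) where
  target : GIrrep
  sym : Label
  mult : ℕ
  emb : ι → ι → ι → Label → ℂ

/-- The data of an adapted basis. `ι` labels the irreps of the subgroup `H`, generated by
two elements. -/
structure AdaptedBasis (ι : Type) where
  /-- dimension of an irrep of `H` -/
  dim : ι → ℕ
  /-- complex conjugate irrep of `H` -/
  bar : ι → ι
  /-- the matrices of the first generator of `H` -/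
  gen₁ : (x : ι) → Matrix (Fin (dim x)) (Fin (dim x)) ℂ
  /-- the matrices of the second generator of `H` -/
  gen₂ : (x : ι) → Matrix (Fin (dim x)) (Fin (dim x)) ℂ
  /-- the matrices `Γ_x` with `x̄ = Γ_x x^*` -/
  conjMat : (x : ι) → Matrix (Fin (dim (bar x))) (Fin (dim x)) ℂ
  /-- CG coefficients of `H`: `cg x y z k` is the matrix of `x ⊗ y → z_k`, zero if there is no
  such contraction -/
  cg : (x y z : ι) → Label → Matrix (Fin (dim z)) (Fin (dim x) × Fin (dim y)) ℂ
  /-- the matrices of the generator `A` of `PSL₂(7)` -/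
  matA : (X : GIrrep) → Matrix (Fin X.dim) (Fin X.dim) ℂ
  /-- the matrices of the generator `B` of `PSL₂(7)` -/
  matB : (X : GIrrep) → Matrix (Fin X.dim) (Fin X.dim) ℂ
  /-- the irreps of `H` contained in an irrep of `PSL₂(7)` (each of them once) -/
  content : GIrrep → List ι
  /-- the projection matrices `P_{X → x}`, zero if `x` is not contained in `X` -/
  proj : (X : GIrrep) → (x : ι) → Matrix (Fin (dim x)) (Fin X.dim) ℂ
  /-- the contractions of the tensor product `X ⊗ Y`; empty if `X ⊗ Y` is to be read off from
  `Y ⊗ X` -/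
  table : GIrrep → GIrrep → List (Channel ι)

noncomputable section

/-- The matrix of a bilinear map given by a formula in the components of two vectors. -/
def bilin {l m n : ℕ} (f : (Fin m → ℂ) → (Fin n → ℂ) → Fin l → ℂ) :
    Matrix (Fin l) (Fin m × Fin n) ℂ :=
  Matrix.of fun k p => f (Pi.single p.1 1) (Pi.single p.2 1) k

/-- The `m × n` matrix with `m` consecutive entries `z` on a diagonal that starts in column `o`: it
maps a vector to its components `o, …, o + m - 1`, multiplied by `z`. -/
def block {m n : ℕ} (o : ℕ) (z : ℂ) : Matrix (Fin m) (Fin n) ℂ :=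
  Matrix.of fun i j => if (j : ℕ) = o + i then z else 0

/-- An entry of a list of embedding factors: `z` is the coefficient of `{x ⊗ y}_c` in the
`c` component. -/
def e {ι : Type} (c x y : ι) (z : ℂ) : (ι × ι × ι × Label) × ℂ := ((c, x, y, Label.n), z)

/-- The same for the symmetric contraction `{x ⊗ y}_{c_s}`. -/
def es {ι : Type} (c x y : ι) (z : ℂ) : (ι × ι × ι × Label) × ℂ := ((c, x, y, Label.s), z)

/-- The same for the antisymmetric contraction `{x ⊗ y}_{c_a}`. -/
def ea {ι : Type} (c x y : ι) (z : ℂ) : (ι × ι × ι × Label) × ℂ := ((c, x, y, Label.a), z)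

/-- Multiplication of all entries of a list of embedding factors by a phase. -/
def rephase {ι : Type} (w : ℂ) (l : List ((ι × ι × ι × Label) × ℂ)) :
    List ((ι × ι × ι × Label) × ℂ) :=
  l.map fun t => (t.1, w * t.2)

/-- The embedding factors given by a list of entries; all others vanish. -/
def factors {ι : Type} [DecidableEq ι] (l : List ((ι × ι × ι × Label) × ℂ)) :
    ι → ι → ι → Label → ℂ :=
  fun c x y k => ((l.filter fun t => t.1 = (c, x, y, k)).map fun t => t.2).sum

/-- The complex conjugate contraction `X̄ ⊗ Ȳ → Z̄`, with conjugate embedding factors. `bar` is an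
involution. -/
def Channel.conj {ι : Type} (bar : ι → ι) (ch : Channel ι) : Channel ι where
  target := ch.target.bar
  sym := ch.sym
  mult := ch.mult
  emb c x y k := star (ch.emb (bar c) (bar x) (bar y) k)

/-- The contraction `1 ⊗ Y → Y`, where the irrep `1` of `PSL₂(7)` restricts to the irrep `i` of the
subgroup. -/
def trivialChannel {ι : Type} [DecidableEq ι] (i : ι) (content : GIrrep → List ι) (Y : GIrrep) :
    Channel ι where
  target := Y
  sym := Label.n
  mult := 1
  emb c x y k := if x = i ∧ y = c ∧ k = Label.n ∧ c ∈ content Y then 1 else 0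

namespace AdaptedBasis

variable {ι : Type} [Fintype ι] (D : AdaptedBasis ι)

/-- The right-hand side `∑_{a,b} E_{c,ab} {(P_{X→a} R X) ⊗ (P_{Y→b} S Y)}_{z_c}` of the defining
equation of the embedding factors, as a matrix acting on `X ⊗ Y`. -/
def contraction (X Y : GIrrep) (E : ι → ι → ι → Label → ℂ) (c : ι)
    (R : Matrix (Fin X.dim) (Fin X.dim) ℂ) (S : Matrix (Fin Y.dim) (Fin Y.dim) ℂ) :
    Matrix (Fin (D.dim c)) (Fin X.dim × Fin Y.dim) ℂ :=
  ∑ a, ∑ b, ∑ k, E c a b k • (D.cg a b c k * ((D.proj X a * R) ⊗ₖ (D.proj Y b * S)))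

/-- The matrix of CG coefficients of `X ⊗ Y → Z` determined by embedding factors: the `z_c`
component of `Z` is `∑_{a,b} E_{c,ab} {x_a ⊗ y_b}_{z_c}`. -/
def cgMat (X Y Z : GIrrep) (E : ι → ι → ι → Label → ℂ) :
    Matrix (Fin Z.dim) (Fin X.dim × Fin Y.dim) ℂ :=
  ∑ c, (D.proj Z c)ᴴ * D.contraction X Y E c 1 1

/-- The matrix `Γ_X` of an irrep of `PSL₂(7)`, assembled from the matrices `Γ_x` of the irreps
`x` of the subgroup contained in `X`. -/
def conjMatG (X : GIrrep) : Matrix (Fin X.bar.dim) (Fin X.dim) ℂ :=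
  ∑ x, (D.proj X.bar (D.bar x))ᴴ * D.conjMat x * (D.proj X x).map star

end AdaptedBasis

/-! ### The `S₄` basis -/

/-- `P_{X → x}` in the `S₄` basis: consecutive coordinates, multiplied by a phase in `7` and `8` (a
projection matrix is determined by its defining property only up to a phase). -/
def projS : (X : GIrrep) → (x : S4Irrep) → Matrix (Fin x.dim) (Fin X.dim) ℂ
  | g1, s1₀ => block 0 1
  | g3, s3₂ => block 0 1
  | g3b, s3₂ => !![1, 0, 0; 0, 0, 1; 0, 1, 0]
  | g6, s1₀ => block 0 1
  | g6, s2 => block 1 1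
  | g6, s3₁ => block 3 1
  | g7, s1₁ => block 0 1
  | g7, s3₁ => block 1 (I * b₇c ^ 3)
  | g7, s3₂ => block 4 (b₇c ^ 2)
  | g8, s2 => block 0 1
  | g8, s3₁ => block 2 1
  | g8, s3₂ => block 5 (-1)
  | _, _ => 0

def contentS : GIrrep → List S4Irrep
  | g1 => [s1₀]
  | g3 => [s3₂]
  | g3b => [s3₂]
  | g6 => [s1₀, s2, s3₁]
  | g7 => [s1₁, s3₁, s3₂]
  | g8 => [s2, s3₁, s3₂]

def matAS3 : Matrix (Fin 3) (Fin 3) ℂ :=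
  !![-1 / 3, 2 / 3 * ω, 2 / 3 * ω ^ 2;
    2 / 3 * ω ^ 2, -1 / 3, 2 / 3 * ω;
    2 / 3 * ω, 2 / 3 * ω ^ 2, -1 / 3]

def matBS3 : Matrix (Fin 3) (Fin 3) ℂ :=
  !![2 / 3, -I * (rt 3 + rt 7) / 6 * ω ^ 2 * b₇c ^ 2, I * (rt 3 - rt 7) / 6 * ω * b₇c ^ 2;
    I * (rt 7 - rt 3) / 6 * ω * b₇ ^ 2, -1 / 3, (1 + rt 21) / 6 * ω ^ 2;
    I * (rt 3 + rt 7) / 6 * ω ^ 2 * b₇ ^ 2, (1 - rt 21) / 6 * ω, -1 / 3]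

def matAS6 : Matrix (Fin 6) (Fin 6) ℂ :=
  !![1, 0, 0, 0, 0, 0;
    0, 1, 0, 0, 0, 0;
    0, 0, 1, 0, 0, 0;
    0, 0, 0, -1 / 3, 2 * ω / 3, 2 * ω ^ 2 / 3;
    0, 0, 0, 2 * ω ^ 2 / 3, -1 / 3, 2 * ω / 3;
    0, 0, 0, 2 * ω / 3, 2 * ω ^ 2 / 3, -1 / 3]

def matBS6 : Matrix (Fin 6) (Fin 6) ℂ :=
  !![-1 / 6, -rt 7 * ω / 6, -rt 7 * ω ^ 2 / 6, rt 7 / 6, rt 7 * ω / 6, rt 7 * ω ^ 2 / 6;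
    -rt 7 / 6, ω / 3, ω ^ 2 / 3, -2 * ω ^ 2 / 3 - 1 / 6, -ω ^ 2 / 3, -1 / 3;
    -rt 7 / 6, ω / 3, ω ^ 2 / 3, -2 * ω / 3 - 1 / 6, -1 / 3, -ω / 3;
    rt 7 / 6, -ω / 6 - 2 / 3, -ω ^ 2 / 6 - 2 / 3, 1 / 6, ω / 6, ω ^ 2 / 6;
    rt 7 / 6, -ω ^ 2 / 3, -ω / 3, 1 / 6, -ω / 3, 2 * ω ^ 2 / 3;
    rt 7 / 6, -ω ^ 2 / 3, -ω / 3, 1 / 6, 2 * ω / 3, -ω ^ 2 / 3]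

def matAS7 : Matrix (Fin 7) (Fin 7) ℂ :=
  !![1, 0, 0, 0, 0, 0, 0;
    0, -1 / 3, 2 * ω / 3, 2 * ω ^ 2 / 3, 0, 0, 0;
    0, 2 * ω ^ 2 / 3, -1 / 3, 2 * ω / 3, 0, 0, 0;
    0, 2 * ω / 3, 2 * ω ^ 2 / 3, -1 / 3, 0, 0, 0;
    0, 0, 0, 0, -1 / 3, 2 * ω / 3, 2 * ω ^ 2 / 3;
    0, 0, 0, 0, 2 * ω ^ 2 / 3, -1 / 3, 2 * ω / 3;
    0, 0, 0, 0, 2 * ω / 3, 2 * ω ^ 2 / 3, -1 / 3]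

def matBS7 : Matrix (Fin 7) (Fin 7) ℂ :=
  !![0, -I * b₇c ^ 3 / rt 3, I * ω * b₇c ^ 3 / (2 * rt 3), I * ω ^ 2 * b₇c ^ 3 / (2 * rt 3), 0, -I * ω * b₇c ^ 2 / 2, I * ω ^ 2 * b₇c ^ 2 / 2;
    -I * b₇ ^ 3 / rt 3, -1 / 3, -ω / 3, -ω ^ 2 / 3, I * b₇ / 3, I * ω * b₇ / 3, I * ω ^ 2 * b₇ / 3;
    I * b₇ ^ 3 / (2 * rt 3), -1 / 3, -ω / 3, -ω ^ 2 / 3, I * b₇ * ω ^ 2 / 3 + b₇ / (2 * rt 3), I * ω ^ 2 * b₇ / 3, I * b₇ / 3;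
    I * b₇ ^ 3 / (2 * rt 3), -1 / 3, -ω / 3, -ω ^ 2 / 3, I * ω * b₇ / 3 - b₇ / (2 * rt 3), I * b₇ / 3, I * ω * b₇ / 3;
    0, I * b₇c / 3, I * b₇c / 3 + ω * b₇c / (2 * rt 3), I * b₇c / 3 - ω ^ 2 * b₇c / (2 * rt 3), 0, -I * ω / (2 * rt 3), I * ω ^ 2 / (2 * rt 3);
    -I * b₇ ^ 2 / 2, I * b₇c / 3, I * ω ^ 2 * b₇c / 3, I * ω * b₇c / 3, -I / (2 * rt 3), -I * ω / rt 3, 0;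
    I * b₇ ^ 2 / 2, I * b₇c / 3, I * ω ^ 2 * b₇c / 3, I * ω * b₇c / 3, I / (2 * rt 3), 0, I * ω ^ 2 / rt 3]

def matAS8 : Matrix (Fin 8) (Fin 8) ℂ :=
  !![1, 0, 0, 0, 0, 0, 0, 0;
    0, 1, 0, 0, 0, 0, 0, 0;
    0, 0, -1 / 3, 2 * ω / 3, 2 * ω ^ 2 / 3, 0, 0, 0;
    0, 0, 2 * ω ^ 2 / 3, -1 / 3, 2 * ω / 3, 0, 0, 0;
    0, 0, 2 * ω / 3, 2 * ω ^ 2 / 3, -1 / 3, 0, 0, 0;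
    0, 0, 0, 0, 0, -1 / 3, 2 * ω / 3, 2 * ω ^ 2 / 3;
    0, 0, 0, 0, 0, 2 * ω ^ 2 / 3, -1 / 3, 2 * ω / 3;
    0, 0, 0, 0, 0, 2 * ω / 3, 2 * ω ^ 2 / 3, -1 / 3]

def matBS8 : Matrix (Fin 8) (Fin 8) ℂ :=
  !![-ω / 4, -ω ^ 2 / 4, -I * ω ^ 2 / rt 6, I * (3 * ω ^ 2 - 1) / (4 * rt 6), (2 * I - rt 3 * ω ^ 2) / (4 * rt 6), 0, -1 / 4 * rt (7 / 2) * ω, 1 / 4 * rt (7 / 2) * ω ^ 2;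
    -ω / 4, -ω ^ 2 / 4, I * ω / rt 6, -(2 * I + rt 3 * ω) / (4 * rt 6), I * (1 - 3 * ω) / (4 * rt 6), 0, 1 / 4 * rt (7 / 2) * ω, -1 / 4 * rt (7 / 2) * ω ^ 2;
    -I / rt 6, I / rt 6, 1 / 6, ω / 6, ω ^ 2 / 6, rt 7 / 6, rt 7 * ω / 6, rt 7 * ω ^ 2 / 6;
    I * (3 * ω ^ 2 - 1) / (4 * rt 6), I * (1 - 3 * ω) / (4 * rt 6), 1 / 6, 13 * ω / 24, -5 * ω ^ 2 / 24, rt 7 * ω / 6, (I * rt 3 * ω ^ 2 + 1) / (24 / rt 7), (3 * ω + 1) / (24 / rt 7);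
    I * (3 * ω ^ 2 - 1) / (4 * rt 6), I * (1 - 3 * ω) / (4 * rt 6), 1 / 6, -5 * ω / 24, 13 * ω ^ 2 / 24, rt 7 * ω ^ 2 / 6, (3 * ω ^ 2 + 1) / (24 / rt 7), (1 - I * rt 3 * ω) / (24 / rt 7);
    0, 0, -rt 7 / 6, -rt 7 / 6 * ω ^ 2, -rt 7 * ω / 6, -1 / 2, -I * ω ^ 2 / (2 * rt 3), I * ω / (2 * rt 3);
    1 / 4 * rt (7 / 2) * ω, -1 / 4 * rt (7 / 2) * ω ^ 2, -rt 7 / 6, -(I * rt 3 * ω ^ 2 + 1) / (24 / rt 7), (I * rt 3 * ω - 1) / (24 / rt 7), -I * ω / (2 * rt 3), (3 * rt 3 * ω ^ 2 + I) / (8 * rt 3), -ω ^ 2 / 8;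
    -1 / 4 * rt (7 / 2) * ω, 1 / 4 * rt (7 / 2) * ω ^ 2, -rt 7 / 6, -(I * rt 3 * ω ^ 2 + 1) / (24 / rt 7), (I * rt 3 * ω - 1) / (24 / rt 7), I * ω ^ 2 / (2 * rt 3), -ω / 8, (3 * rt 3 * ω - I) / (8 * rt 3)]

/-- The matrix of `A` in the `S₄` basis. -/
def matAS : (X : GIrrep) → Matrix (Fin X.dim) (Fin X.dim) ℂ
  | g1 => 1
  | g3 => matAS3
  | g3b => matAS3.map star
  | g6 => matAS6
  | g7 => matAS7
  | g8 => matAS8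

/-- The matrix of `B` in the `S₄` basis. -/
def matBS : (X : GIrrep) → Matrix (Fin X.dim) (Fin X.dim) ℂ
  | g1 => 1
  | g3 => matBS3
  | g3b => matBS3.map star
  | g6 => matBS6
  | g7 => matBS7
  | g8 => matBS8

def gen₁S : (x : S4Irrep) → Matrix (Fin x.dim) (Fin x.dim) ℂ
  | s1₀ => 1
  | s1₁ => -1
  | s2 => !![0, 1; 1, 0]
  | s3₁ => (1 / 3 : ℂ) • !![-1, 2 * ω ^ 2, 2 * ω; 2 * ω ^ 2, 2 * ω, -1; 2 * ω, -1, 2 * ω ^ 2]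
  | s3₂ => (-1 / 3 : ℂ) • !![-1, 2 * ω ^ 2, 2 * ω; 2 * ω ^ 2, 2 * ω, -1; 2 * ω, -1, 2 * ω ^ 2]

def gen₂S : (x : S4Irrep) → Matrix (Fin x.dim) (Fin x.dim) ℂ
  | s1₀ => 1
  | s1₁ => -1
  | s2 => !![0, ω ^ 2; ω, 0]
  | s3₁ => (1 / 3 : ℂ) • !![-1, 2 * ω ^ 2, 2 * ω; 2 * ω, 2, -ω ^ 2; 2 * ω ^ 2, -ω, 2]
  | s3₂ => (-1 / 3 : ℂ) • !![-1, 2 * ω ^ 2, 2 * ω; 2 * ω, 2, -ω ^ 2; 2 * ω ^ 2, -ω, 2]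

def conjMatS : (x : S4Irrep) → Matrix (Fin x.dim) (Fin x.dim) ℂ
  | s1₀ => 1
  | s1₁ => 1
  | s2 => !![0, 1; 1, 0]
  | s3₁ => !![1, 0, 0; 0, 0, 1; 0, 1, 0]
  | s3₂ => !![1, 0, 0; 0, 0, 1; 0, 1, 0]

/-- The `A₄` contractions `3 ⊗ 3 → 1, 1′, 1̄′`. -/
def tripletOne (x y : Fin 3 → ℂ) : ℂ := (x 0 * y 0 + x 1 * y 2 + x 2 * y 1) / rt 3

def tripletOneP (x y : Fin 3 → ℂ) : ℂ := (x 2 * y 2 + x 0 * y 1 + x 1 * y 0) / rt 3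

def tripletOneQ (x y : Fin 3 → ℂ) : ℂ := (x 1 * y 1 + x 0 * y 2 + x 2 * y 0) / rt 3

/-- The symmetric `A₄` contraction `3 ⊗ 3 → 3`. -/
def tripletSym (x y : Fin 3 → ℂ) : Fin 3 → ℂ :=
  ![(2 * x 0 * y 0 - x 1 * y 2 - x 2 * y 1) / rt 6, (2 * x 2 * y 2 - x 0 * y 1 - x 1 * y 0) / rt 6,
    (2 * x 1 * y 1 - x 0 * y 2 - x 2 * y 0) / rt 6]

/-- The antisymmetric `A₄` contraction `3 ⊗ 3 → 3`. -/
def tripletAnti (x y : Fin 3 → ℂ) : Fin 3 → ℂ :=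
  ![(x 1 * y 2 - x 2 * y 1) / rt 2, (x 0 * y 1 - x 1 * y 0) / rt 2,
    (x 2 * y 0 - x 0 * y 2) / rt 2]

/-- The contraction `3ᵢ ⊗ 2 → 3ᵢ` of `S₄`. -/
def tripletDoublet (x : Fin 3 → ℂ) (z : Fin 2 → ℂ) : Fin 3 → ℂ :=
  ![(z 0 * x 2 + z 1 * x 1) / rt 2, (z 0 * x 0 + z 1 * x 2) / rt 2,
    (z 0 * x 1 + z 1 * x 0) / rt 2]

/-- The contraction `3ᵢ ⊗ 2 → 3ⱼ`, `j ≠ i`, of `S₄`. -/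
def tripletDoublet' (x : Fin 3 → ℂ) (z : Fin 2 → ℂ) : Fin 3 → ℂ :=
  ![I * (z 0 * x 2 - z 1 * x 1) / rt 2, I * (z 0 * x 0 - z 1 * x 2) / rt 2,
    I * (z 0 * x 1 - z 1 * x 0) / rt 2]

/-- The contractions of `S₄`. -/
def contrS : (x y z : S4Irrep) → (Fin x.dim → ℂ) → (Fin y.dim → ℂ) → Fin z.dim → ℂ
  | s1₀, s1₀, s1₀ => fun x y => x 0 • y
  | s1₀, s1₁, s1₁ => fun x y => x 0 • y
  | s1₀, s2, s2 => fun x y => x 0 • y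
  | s1₀, s3₁, s3₁ => fun x y => x 0 • y
  | s1₀, s3₂, s3₂ => fun x y => x 0 • y
  | s1₁, s1₀, s1₁ => fun x y => y 0 • x
  | s2, s1₀, s2 => fun x y => y 0 • x
  | s3₁, s1₀, s3₁ => fun x y => y 0 • x
  | s3₂, s1₀, s3₂ => fun x y => y 0 • x
  | s1₁, s1₁, s1₀ => fun x y => x 0 • y
  | s1₁, s3₁, s3₂ => fun x y => x 0 • y
  | s1₁, s3₂, s3₁ => fun x y => x 0 • y
  | s3₁, s1₁, s3₂ => fun x y => y 0 • x
  | s3₂, s1₁, s3₁ => fun x y => y 0 • x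
  | s2, s1₁, s2 => fun z s => ![I * z 0 * s 0, -I * z 1 * s 0]
  | s1₁, s2, s2 => fun s z => ![I * z 0 * s 0, -I * z 1 * s 0]
  | s2, s2, s1₀ => fun z w => ![(z 0 * w 1 + z 1 * w 0) / rt 2]
  | s2, s2, s1₁ => fun z w => ![I * (z 0 * w 1 - z 1 * w 0) / rt 2]
  | s2, s2, s2 => fun z w => ![z 1 * w 1, z 0 * w 0]
  | s3₁, s2, s3₁ => fun x z => tripletDoublet x z
  | s3₁, s2, s3₂ => fun x z => tripletDoublet' x z
  | s3₂, s2, s3₂ => fun x z => tripletDoublet x z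
  | s3₂, s2, s3₁ => fun x z => tripletDoublet' x z
  | s2, s3₁, s3₁ => fun z x => tripletDoublet x z
  | s2, s3₁, s3₂ => fun z x => tripletDoublet' x z
  | s2, s3₂, s3₂ => fun z x => tripletDoublet x z
  | s2, s3₂, s3₁ => fun z x => tripletDoublet' x z
  | s3₁, s3₁, s1₀ => fun x y => ![tripletOne x y]
  | s3₁, s3₁, s2 => fun x y => ![tripletOneP x y, tripletOneQ x y]
  | s3₁, s3₁, s3₁ => fun x y => tripletSym x y
  | s3₁, s3₁, s3₂ => fun x y => I • tripletAnti x y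
  | s3₂, s3₂, s1₀ => fun x y => ![tripletOne x y]
  | s3₂, s3₂, s2 => fun x y => ![tripletOneP x y, tripletOneQ x y]
  | s3₂, s3₂, s3₁ => fun x y => tripletSym x y
  | s3₂, s3₂, s3₂ => fun x y => I • tripletAnti x y
  | s3₁, s3₂, s1₁ => fun x y => ![tripletOne x y]
  | s3₁, s3₂, s2 => fun x y => ![I * tripletOneP x y, -I * tripletOneQ x y]
  | s3₁, s3₂, s3₁ => fun x y => I • tripletAnti x y
  | s3₁, s3₂, s3₂ => fun x y => tripletSym x y
  | s3₂, s3₁, s1₁ => fun x y => ![tripletOne x y]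
  | s3₂, s3₁, s2 => fun x y => ![I * tripletOneP x y, -I * tripletOneQ x y]
  | s3₂, s3₁, s3₁ => fun x y => I • tripletAnti x y
  | s3₂, s3₁, s3₂ => fun x y => tripletSym x y
  | _, _, _ => 0

/-- The CG coefficients of `S₄`. -/
def cgS (x y z : S4Irrep) : Label → Matrix (Fin z.dim) (Fin x.dim × Fin y.dim) ℂ
  | .n => bilin (contrS x y z)
  | _ => 0

def tableS33 : List (Channel S4Irrep) := [
  ⟨g3b, .a, 1, factors [e s3₂ s3₂ s3₂ 1]⟩,
  ⟨g6, .s, 1, factors [e s1₀ s3₂ s3₂ 1, e s2 s3₂ s3₂ (-I / b₇ ^ 2), e s3₁ s3₂ s3₂ (I / b₇)]⟩]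

def tableS33b : List (Channel S4Irrep) := [
  ⟨g1, .n, 1, factors [e s1₀ s3₂ s3₂ 1]⟩,
  ⟨g8, .n, 1, factors [e s2 s3₂ s3₂ 1, e s3₁ s3₂ s3₂ 1, e s3₂ s3₂ s3₂ I]⟩]

def tableS36 : List (Channel S4Irrep) := [
  ⟨g3b, .n, 1, factors [e s3₂ s3₂ s1₀ (1 / rt 6), e s3₂ s3₂ s2 (-I / (rt 3 * b₇ ^ 2)),
      e s3₂ s3₂ s3₁ (I / (rt 2 * b₇))]⟩,
  ⟨g7, .n, 1, factors [e s1₁ s3₂ s3₁ 1, e s3₁ s3₂ s2 (1 / (rt 3 * b₇ ^ 3)), e s3₁ s3₂ s3₁ (rt (2 / 3) / b₇ ^ 4),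
      e s3₂ s3₂ s1₀ (rt (7 / 2) / (3 * b₇)), e s3₂ s3₂ s2 (2 / (3 * b₇ ^ 5)),
      e s3₂ s3₂ s3₁ (-1 / (rt 6 * b₇ ^ 2))]⟩,
  ⟨g8, .n, 1, factors [e s2 s3₂ s3₁ 1, e s3₁ s3₂ s2 (-rt (2 / 3) * b₇), e s3₁ s3₂ s3₁ (1 / rt 3),
      e s3₂ s3₂ s1₀ (2 / (3 * b₇)), e s3₂ s3₂ s2 (-1 / 3 * I * rt 2 * b₇),
      e s3₂ s3₂ s3₁ (I / rt 3)]⟩]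

def tableS37 : List (Channel S4Irrep) := [
  ⟨g6, .n, 1, factors [e s1₀ s3₂ s3₂ 1, e s2 s3₂ s3₁ (-rt (3 / 7) / b₇ ^ 2), e s2 s3₂ s3₂ (2 / (rt 7 * b₇ ^ 4)),
      e s3₁ s3₂ s1₁ (rt (2 / 7) * b₇), e s3₁ s3₂ s3₁ (-2 / (rt 7 * b₇ ^ 3)),
      e s3₁ s3₂ s3₂ (-1 / (rt 7 * b₇))]⟩,
  ⟨g7, .n, 1, factors [e s1₁ s3₂ s3₁ 1, e s3₁ s3₂ s1₁ (-1 / rt 3), e s3₁ s3₂ s3₁ (-1 / (rt 3 * b₇)),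
      e s3₁ s3₂ s3₂ (-1 / (rt 3 * b₇)), e s3₂ s3₂ s3₁ (1 / (rt 3 * b₇)),
      e s3₂ s3₂ s3₂ (rt (2 / 3) / b₇ ^ 2)]⟩,
  ⟨g8, .n, 1, factors [e s2 s3₂ s3₁ (2 / rt 7), e s2 s3₂ s3₂ (rt (3 / 7) / b₇ ^ 2),
      e s3₁ s3₂ s1₁ (2 * rt (2 / 21) / b₇ ^ 4), e s3₁ s3₂ s3₁ (rt (2 / 21) / b₇),
      e s3₁ s3₂ s3₂ ((13 * rt 7 + 7 * I) / (28 * rt 3)), e s3₂ s3₂ s3₁ (rt (2 / 3) / b₇),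
      e s3₂ s3₂ s3₂ (-1 / (rt 3 * b₇ ^ 2))]⟩]

def tableS38 : List (Channel S4Irrep) := [
  ⟨g3, .n, 1, factors [e s3₂ s3₂ s2 (1 / 2), e s3₂ s3₂ s3₁ (rt (3 / 2) / 2),
      e s3₂ s3₂ s3₂ (-1 / 2 * I * rt (3 / 2))]⟩,
  ⟨g6, .n, 1, factors [e s1₀ s3₂ s3₂ 1, e s2 s3₂ s3₁ (1 / 2 * rt 3 * b₇ ^ 2), e s2 s3₂ s3₂ (-1 / 2 * I * b₇ ^ 2),
      e s3₁ s3₂ s2 (-b₇ / rt 2), e s3₁ s3₂ s3₁ (-b₇ / 2), e s3₁ s3₂ s3₂ (I * b₇ / 2)]⟩,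
  ⟨g7, .n, 1, factors [e s1₁ s3₂ s3₁ 1, e s3₁ s3₂ s2 (-b₇ ^ 4 / rt 3), e s3₁ s3₂ s3₁ (-b₇ ^ 3 / (2 * rt 3)),
      e s3₁ s3₂ s3₂ (1 / 2 * rt (7 / 3) * b₇ ^ 3), e s3₂ s3₂ s2 (b₇ ^ 2 / 2),
      e s3₂ s3₂ s3₁ (I * (5 * rt 7 + I) / (8 * rt 6)), e s3₂ s3₂ s3₂ (1 / 2 * rt (7 / 6) * b₇ ^ 2)]⟩,
  ⟨g8, .n, 1, factors [e s2 s3₂ s3₁ (1 / 2), e s2 s3₂ s3₂ (I * rt 3 / 2), e s3₁ s3₂ s2 (1 / rt 6),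
      e s3₁ s3₂ s3₁ (-rt (2 / 3) * b₇ ^ 3), e s3₁ s3₂ s3₂ (I * b₇ / rt 6),
      e s3₂ s3₂ s2 (-I / rt 2), e s3₂ s3₂ s3₁ (-I * b₇ / rt 6), e s3₂ s3₂ s3₂ (-b₇ ^ 2 / rt 3)]⟩]

def tableS66 : List (Channel S4Irrep) := [
  ⟨g1, .s, 1, factors [e s1₀ s1₀ s1₀ (1 / rt 6), e s1₀ s2 s2 (1 / rt 3), e s1₀ s3₁ s3₁ (1 / rt 2)]⟩,
  ⟨g6, .s, 1, factors [e s1₀ s1₀ s1₀ (rt 3 / 2), e s1₀ s3₁ s3₁ (-1 / 2), e s2 s2 s2 (-rt (3 / 7)),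
      e s2 s3₁ s3₁ (-2 / rt 7), e s3₁ s1₀ s3₁ (-1 / (2 * rt 3)), e s3₁ s3₁ s1₀ (-1 / (2 * rt 3)),
      e s3₁ s2 s3₁ (-2 * rt (2 / 21)), e s3₁ s3₁ s2 (-2 * rt (2 / 21)), e s3₁ s3₁ s3₁ (1 / rt 14)]⟩,
  ⟨g6, .s, 2, factors [e s1₀ s1₀ s1₀ (-1 / (2 * rt 3)), e s1₀ s2 s2 (rt (2 / 3)), e s1₀ s3₁ s3₁ (-1 / 2),
      e s2 s1₀ s2 (1 / rt 3), e s2 s2 s1₀ (1 / rt 3), e s2 s2 s2 (-2 / rt 21),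
      e s2 s3₁ s3₁ (1 / rt 7), e s3₁ s1₀ s3₁ (-1 / (2 * rt 3)), e s3₁ s3₁ s1₀ (-1 / (2 * rt 3)),
      e s3₁ s2 s3₁ (rt (2 / 21)), e s3₁ s3₁ s2 (rt (2 / 21)), e s3₁ s3₁ s3₁ (3 / rt 14)]⟩,
  ⟨g8, .s, 1, factors [e s2 s1₀ s2 (1 / rt 6), e s2 s2 s1₀ (1 / rt 6), e s2 s2 s2 (2 * rt (2 / 21)),
      e s2 s3₁ s3₁ (-rt (2 / 7)), e s3₁ s1₀ s3₁ (1 / rt 3), e s3₁ s3₁ s1₀ (1 / rt 3),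
      e s3₁ s2 s3₁ (-1 / rt 42), e s3₁ s3₁ s2 (-1 / rt 42), e s3₁ s3₁ s3₁ (rt (2 / 7)),
      e s3₂ s2 s3₁ (-1 / rt 2), e s3₂ s3₁ s2 (-1 / rt 2)]⟩,
  ⟨g7, .a, 1, factors [e s1₁ s2 s2 1, e s3₁ s1₀ s3₁ (rt (7 / 2) / 3), e s3₁ s3₁ s1₀ (-rt (7 / 2) / 3),
      e s3₁ s2 s3₁ (1 / 3), e s3₁ s3₁ s2 (-1 / 3), e s3₂ s2 s3₁ (1 / rt 3),
      e s3₂ s3₁ s2 (-1 / rt 3), e s3₂ s3₁ s3₁ (-1 / rt 3)]⟩,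
  ⟨g8, .a, 1, factors [e s2 s1₀ s2 (1 / rt 2), e s2 s2 s1₀ (-1 / rt 2), e s3₁ s1₀ s3₁ (-1 / 3),
      e s3₁ s3₁ s1₀ (1 / 3), e s3₁ s2 s3₁ (rt (7 / 2) / 3), e s3₁ s3₁ s2 (-rt (7 / 2) / 3),
      e s3₂ s2 s3₁ (-1 / rt 6), e s3₂ s3₁ s2 (1 / rt 6), e s3₂ s3₁ s3₁ (-rt (2 / 3))]⟩]

def tableS67 : List (Channel S4Irrep) := [
  ⟨g3, .n, 1, factors [e s3₂ s1₀ s3₂ (1 / rt 6), e s3₂ s2 s3₁ (b₇ ^ 2 / rt 7), e s3₂ s2 s3₂ (2 * b₇ ^ 4 / rt 21),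
      e s3₂ s3₁ s1₁ (1 / (rt 7 * b₇)), e s3₂ s3₁ s3₁ (rt (2 / 7) * b₇ ^ 3),
      e s3₂ s3₁ s3₂ (-b₇ / rt 14)]⟩,
  ⟨g3b, .n, 1, factors [e s3₂ s1₀ s3₂ (1 / rt 6), e s3₂ s2 s3₁ (1 / (rt 7 * b₇ ^ 2)),
      e s3₂ s2 s3₂ (2 / (rt 21 * b₇ ^ 4)), e s3₂ s3₁ s1₁ (b₇ / rt 7),
      e s3₂ s3₁ s3₁ (rt (2 / 7) / b₇ ^ 3), e s3₂ s3₁ s3₂ (-1 / (rt 14 * b₇))]⟩,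
  ⟨g6, .n, 1, factors [e s1₀ s3₁ s3₁ 1, e s2 s2 s1₁ (-rt (3 / 7)), e s2 s3₁ s3₁ (1 / rt 7),
      e s2 s3₁ s3₂ (-rt (3 / 7)), e s3₁ s1₀ s3₁ (-1 / rt 3), e s3₁ s2 s3₁ (-rt (2 / 21)),
      e s3₁ s2 s3₂ (-rt (2 / 7)), e s3₁ s3₁ s3₂ (-rt (2 / 7))]⟩,
  ⟨g7, .n, 1, factors [e s1₁ s1₀ s1₁ 1, e s3₁ s1₀ s3₁ (-1 / 6), e s3₁ s2 s3₁ (rt (7 / 2) / 6),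
      e s3₁ s2 s3₂ (rt (7 / 6) / 2), e s3₁ s3₁ s3₁ (rt (7 / 6) / 2),
      e s3₁ s3₁ s3₂ (-rt (7 / 6) / 2), e s3₂ s1₀ s3₂ (-1 / 6), e s3₂ s2 s3₁ (rt (7 / 6) / 2),
      e s3₂ s2 s3₂ (rt (7 / 2) / 6), e s3₂ s3₁ s3₁ (rt (7 / 6) / 2),
      e s3₂ s3₁ s3₂ (-rt (7 / 6) / 2)]⟩,
  ⟨g7, .n, 2, factors [e s1₁ s3₁ s3₂ 1, e s3₁ s1₀ s3₁ (-rt 7 / 6), e s3₁ s2 s3₁ (7 / (6 * rt 2)),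
      e s3₁ s2 s3₂ (-1 / (2 * rt 6)), e s3₁ s3₁ s3₁ (-1 / (2 * rt 6)),
      e s3₁ s3₁ s3₂ (1 / (2 * rt 6)), e s3₂ s1₀ s3₂ (rt 7 / 6), e s3₂ s2 s3₁ (-1 / (2 * rt 6)),
      e s3₂ s2 s3₂ (-1 / (6 * rt 2)), e s3₂ s3₁ s1₁ (1 / rt 3), e s3₂ s3₁ s3₁ (-1 / (2 * rt 6)),
      e s3₂ s3₁ s3₂ (-rt (3 / 2) / 2)]⟩,
  ⟨g8, .n, 1, factors [e s2 s2 s1₁ (1 / rt 2), e s2 s3₁ s3₂ (-1 / rt 2), e s3₁ s2 s3₂ (1 / rt 6),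
      e s3₁ s3₁ s3₁ (-rt (2 / 3)), e s3₁ s3₁ s3₂ (-1 / rt 6), e s3₂ s1₀ s3₂ (-2 / 3),
      e s3₂ s2 s3₁ (-2 * rt (2 / 21)), e s3₂ s2 s3₂ (-1 / (3 * rt 14)),
      e s3₂ s3₁ s1₁ (1 / rt 21), e s3₂ s3₁ s3₁ (rt (2 / 21)), e s3₂ s3₁ s3₂ (-1 / rt 42)]⟩,
  ⟨g8, .n, 2, factors [e s2 s2 s1₁ (1 / rt 14), e s2 s3₁ s3₁ (rt (6 / 7)), e s2 s3₁ s3₂ (1 / rt 14),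
      e s3₁ s1₀ s3₁ (2 / 3), e s3₁ s2 s3₁ (2 * rt (2 / 7) / 3), e s3₁ s2 s3₂ (-rt (3 / 14)),
      e s3₁ s3₁ s3₂ (-rt (3 / 14)), e s3₂ s2 s3₂ (-1 / rt 2), e s3₂ s3₁ s1₁ (-1 / rt 3),
      e s3₂ s3₁ s3₂ (-1 / rt 6)]⟩]

def tableS68 : List (Channel S4Irrep) := [
  ⟨g3, .n, 1, factors [e s3₂ s1₀ s3₂ (1 / rt 6), e s3₂ s2 s3₁ (-1 / (2 * b₇ ^ 2)),
      e s3₂ s2 s3₂ (I / (2 * rt 3 * b₇ ^ 2)), e s3₂ s3₁ s2 (-1 / (2 * b₇)),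
      e s3₂ s3₁ s3₁ (1 / (2 * rt 2 * b₇)), e s3₂ s3₁ s3₂ (-I / (2 * rt 2 * b₇))]⟩,
  ⟨g3b, .n, 1, factors [e s3₂ s1₀ s3₂ (1 / rt 6), e s3₂ s2 s3₁ (-b₇ ^ 2 / 2),
      e s3₂ s2 s3₂ (-I * b₇ ^ 2 / (2 * rt 3)), e s3₂ s3₁ s2 (-b₇ / 2),
      e s3₂ s3₁ s3₁ (b₇ / (2 * rt 2)), e s3₂ s3₁ s3₂ (I * b₇ / (2 * rt 2))]⟩,
  ⟨g6, .n, 1, factors [e s1₀ s2 s2 1, e s2 s1₀ s2 (-1 / (2 * rt 2)), e s2 s2 s2 (1 / rt 14),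
      e s2 s3₁ s3₁ (3 * rt (3 / 7) / 4), e s2 s3₁ s3₂ (3 / 4), e s3₁ s1₀ s3₁ (1 / 2),
      e s3₁ s2 s3₁ (-rt (2 / 7)), e s3₁ s3₁ s2 (-1 / (2 * rt 7)),
      e s3₁ s3₁ s3₁ (rt (3 / 14) / 2), e s3₁ s3₁ s3₂ (-rt (3 / 2) / 2)]⟩,
  ⟨g6, .n, 2, factors [e s1₀ s3₁ s3₁ 1, e s2 s1₀ s2 (rt (3 / 2) / 2), e s2 s2 s2 (rt (3 / 14)),
      e s2 s3₁ s3₁ (-5 / (4 * rt 7)), e s2 s3₁ s3₂ (rt 3 / 4), e s3₁ s1₀ s3₁ (1 / (2 * rt 3)),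
      e s3₁ s2 s3₁ (1 / rt 42), e s3₁ s2 s3₂ (-1 / rt 2), e s3₁ s3₁ s2 (-rt (3 / 7) / 2),
      e s3₁ s3₁ s3₁ (3 / (2 * rt 14)), e s3₁ s3₁ s3₂ (1 / (2 * rt 2))]⟩,
  ⟨g7, .n, 1, factors [e s1₁ s2 s2 1, e s3₁ s1₀ s3₁ (rt 7 / 12), e s3₁ s2 s3₁ (1 / (6 * rt 2)),
      e s3₁ s2 s3₂ (-rt (7 / 6) / 2), e s3₁ s3₁ s2 (1 / 4), e s3₁ s3₁ s3₁ (-7 / (4 * rt 6)),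
      e s3₁ s3₁ s3₂ (-rt (7 / 6) / 4), e s3₂ s1₀ s3₂ (-7 / 12), e s3₂ s2 s3₁ (1 / (2 * rt 6)),
      e s3₂ s2 s3₂ (-rt (7 / 2) / 6), e s3₂ s3₁ s2 (rt 3 / 4), e s3₂ s3₁ s3₁ (5 / (4 * rt 6)),
      e s3₂ s3₁ s3₂ (-rt (7 / 6) / 4)]⟩,
  ⟨g7, .n, 2, factors [e s1₁ s3₁ s3₂ 1, e s3₁ s1₀ s3₁ (-7 / 12), e s3₁ s2 s3₁ (-rt (7 / 2) / 6),
      e s3₁ s2 s3₂ (-1 / (2 * rt 6)), e s3₁ s3₁ s2 (-rt 7 / 4), e s3₁ s3₁ s3₁ (-rt (7 / 6) / 4),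
      e s3₁ s3₁ s3₂ (-1 / (4 * rt 6)), e s3₂ s1₀ s3₂ (-rt 7 / 12), e s3₂ s2 s3₁ (rt (7 / 6) / 2),
      e s3₂ s2 s3₂ (5 / (6 * rt 2)), e s3₂ s3₁ s2 (rt (7 / 3) / 4),
      e s3₂ s3₁ s3₁ (-rt (7 / 6) / 4), e s3₂ s3₁ s3₂ (rt (3 / 2) / 4)]⟩,
  ⟨g8, .n, 1, factors [e s2 s1₀ s2 (1 / 2), e s2 s2 s2 (-2 / rt 7), e s2 s3₁ s3₁ (rt (3 / 14) / 2),
      e s2 s3₁ s3₂ (1 / (2 * rt 2)), e s3₁ s1₀ s3₁ (1 / 6), e s3₁ s2 s3₁ (-4 * rt (2 / 7) / 3),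
      e s3₁ s3₁ s2 (1 / (2 * rt 7)), e s3₁ s3₁ s3₁ (-rt (3 / 14) / 2),
      e s3₁ s3₁ s3₂ (rt (3 / 2) / 2), e s3₂ s1₀ s3₂ (-1 / 2), e s3₂ s3₁ s2 (-1 / (2 * rt 3)),
      e s3₂ s3₁ s3₁ (-rt (3 / 2) / 2), e s3₂ s3₁ s3₂ (-rt (7 / 6) / 2)]⟩,
  ⟨g8, .n, 2, factors [e s2 s1₀ s2 (-1 / 2), e s2 s2 s2 (-1 / rt 7), e s2 s3₁ s3₁ (-3 * rt (3 / 14) / 2),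
      e s2 s3₁ s3₂ (1 / (2 * rt 2)), e s3₁ s1₀ s3₁ (1 / 2), e s3₁ s2 s3₁ (1 / rt 14),
      e s3₁ s2 s3₂ (1 / rt 6), e s3₁ s3₁ s2 (-3 / (2 * rt 7)), e s3₁ s3₁ s3₁ (-5 / (2 * rt 42)),
      e s3₁ s3₁ s3₂ (1 / (2 * rt 6)), e s3₂ s1₀ s3₂ (-1 / 6), e s3₂ s2 s3₁ (1 / rt 6),
      e s3₂ s2 s3₂ (-rt (7 / 2) / 3), e s3₂ s3₁ s2 (-1 / (2 * rt 3)),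
      e s3₂ s3₁ s3₁ (-1 / (2 * rt 6)), e s3₂ s3₁ s3₂ (rt (7 / 6) / 2)]⟩]

def tableS77 : List (Channel S4Irrep) := [
  ⟨g1, .s, 1, factors [e s1₀ s1₁ s1₁ (1 / rt 7), e s1₀ s3₁ s3₁ (rt (3 / 7)), e s1₀ s3₂ s3₂ (rt (3 / 7))]⟩,
  ⟨g6, .s, 1, factors [e s1₀ s1₁ s1₁ (rt 3 / 2), e s1₀ s3₂ s3₂ (-1 / 2), e s2 s3₁ s3₂ (-rt (3 / 7)),
      e s2 s3₂ s3₁ (-rt (3 / 7)), e s2 s3₂ s3₂ (1 / rt 7), e s3₁ s1₁ s3₂ (-1 / (2 * rt 7)),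
      e s3₁ s3₂ s1₁ (-1 / (2 * rt 7)), e s3₁ s3₁ s3₁ (rt (2 / 7)), e s3₁ s3₁ s3₂ (rt (2 / 7)),
      e s3₁ s3₂ s3₁ (-rt (2 / 7)), e s3₁ s3₂ s3₂ (-1 / rt 14)]⟩,
  ⟨g6, .s, 2, factors [e s1₀ s1₁ s1₁ (-rt (3 / 7) / 2), e s1₀ s3₁ s3₁ (2 / rt 7), e s1₀ s3₂ s3₂ (-3 / (2 * rt 7)),
      e s2 s3₁ s3₁ (-1), e s3₁ s1₁ s3₂ (-1 / 2), e s3₁ s3₂ s1₁ (-1 / 2), e s3₁ s3₂ s3₂ (1 / rt 2)]⟩,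
  ⟨g7, .s, 1, factors [e s1₁ s3₁ s3₂ (1 / rt 2), e s1₁ s3₂ s3₁ (1 / rt 2), e s3₁ s1₁ s3₂ (1 / rt 6),
      e s3₁ s3₂ s1₁ (1 / rt 6), e s3₁ s3₁ s3₁ (1 / rt 3), e s3₁ s3₂ s3₂ (1 / rt 3),
      e s3₂ s1₁ s3₁ (1 / rt 6), e s3₂ s3₁ s1₁ (1 / rt 6), e s3₂ s3₁ s3₂ (1 / rt 3),
      e s3₂ s3₂ s3₁ (1 / rt 3)]⟩,
  ⟨g8, .s, 1, factors [e s2 s3₁ s3₂ (1 / rt 14), e s2 s3₂ s3₁ (1 / rt 14), e s2 s3₂ s3₂ (rt (6 / 7)),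
      e s3₁ s1₁ s3₂ (1 / rt 21), e s3₁ s3₂ s1₁ (1 / rt 21), e s3₁ s3₁ s3₁ (-2 * rt (2 / 21)),
      e s3₁ s3₁ s3₂ (rt (3 / 14)), e s3₁ s3₂ s3₁ (-rt (3 / 14)), e s3₁ s3₂ s3₂ (rt (2 / 21)),
      e s3₂ s1₁ s3₁ (-1 / rt 3), e s3₂ s3₁ s1₁ (-1 / rt 3), e s3₂ s3₁ s3₂ (1 / rt 6),
      e s3₂ s3₂ s3₁ (1 / rt 6)]⟩,
  ⟨g3, .a, 1, factors [e s3₂ s1₁ s3₁ (1 / rt 7), e s3₂ s3₁ s1₁ (-1 / rt 7), e s3₂ s3₁ s3₁ (b₇ / rt 7),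
      e s3₂ s3₁ s3₂ (-b₇ / rt 7), e s3₂ s3₂ s3₁ (b₇ / rt 7), e s3₂ s3₂ s3₂ (-rt (2 / 7) * b₇ ^ 2)]⟩,
  ⟨g3b, .a, 1, factors [e s3₂ s1₁ s3₁ (1 / rt 7), e s3₂ s3₁ s1₁ (-1 / rt 7), e s3₂ s3₁ s3₁ (1 / (rt 7 * b₇)),
      e s3₂ s3₁ s3₂ (-1 / (rt 7 * b₇)), e s3₂ s3₂ s3₁ (1 / (rt 7 * b₇)),
      e s3₂ s3₂ s3₂ (-rt (2 / 7) / b₇ ^ 2)]⟩,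
  ⟨g7, .a, 1, factors [e s1₁ s3₁ s3₂ (1 / rt 2), e s1₁ s3₂ s3₁ (-1 / rt 2), e s3₁ s1₁ s3₂ (-1 / rt 6),
      e s3₁ s3₂ s1₁ (1 / rt 6), e s3₁ s3₁ s3₂ (1 / rt 3), e s3₁ s3₂ s3₁ (1 / rt 3),
      e s3₂ s1₁ s3₁ (1 / rt 6), e s3₂ s3₁ s1₁ (-1 / rt 6), e s3₂ s3₁ s3₁ (1 / rt 3),
      e s3₂ s3₂ s3₂ (-1 / rt 3)]⟩,
  ⟨g8, .a, 1, factors [e s2 s3₁ s3₂ (1 / rt 2), e s2 s3₂ s3₁ (-1 / rt 2), e s3₁ s1₁ s3₂ (-1 / rt 3),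
      e s3₁ s3₂ s1₁ (1 / rt 3), e s3₁ s3₁ s3₂ (-1 / rt 6), e s3₁ s3₂ s3₁ (-1 / rt 6),
      e s3₂ s1₁ s3₁ (-1 / rt 21), e s3₂ s3₁ s1₁ (1 / rt 21), e s3₂ s3₁ s3₁ (2 * rt (2 / 21)),
      e s3₂ s3₁ s3₂ (rt (3 / 14)), e s3₂ s3₂ s3₁ (-rt (3 / 14)), e s3₂ s3₂ s3₂ (rt (2 / 21))]⟩]

def tableS78 : List (Channel S4Irrep) := [
  ⟨g3, .n, 1, factors [e s3₂ s1₁ s3₁ (1 / rt 7), e s3₂ s3₁ s2 (-1 / (rt 7 * b₇ ^ 4)),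
      e s3₂ s3₁ s3₁ (1 / (2 * rt 7 * b₇ ^ 3)), e s3₂ s3₁ s3₂ (1 / (2 * b₇ ^ 3)),
      e s3₂ s3₂ s2 (rt (3 / 7) / (2 * b₇ ^ 2)), e s3₂ s3₂ s3₁ (-(rt 7 + 35 * I) / (56 * rt 2)),
      e s3₂ s3₂ s3₂ (-1 / (2 * rt 2 * b₇ ^ 2))]⟩,
  ⟨g3b, .n, 1, factors [e s3₂ s1₁ s3₁ (1 / rt 7), e s3₂ s3₁ s2 (-b₇ ^ 4 / rt 7),
      e s3₂ s3₁ s3₁ (b₇ ^ 3 / (2 * rt 7)), e s3₂ s3₁ s3₂ (b₇ ^ 3 / 2),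
      e s3₂ s3₂ s2 (1 / 2 * rt (3 / 7) * b₇ ^ 2), e s3₂ s3₂ s3₁ (-(rt 7 - 35 * I) / (56 * rt 2)),
      e s3₂ s3₂ s3₂ (-b₇ ^ 2 / (2 * rt 2))]⟩,
  ⟨g6, .n, 1, factors [e s1₀ s3₁ s3₁ 1, e s2 s1₁ s2 (-rt (3 / 14) / 2), e s2 s3₁ s3₁ (1 / rt 7),
      e s2 s3₂ s3₁ (3 * rt (3 / 7) / 4), e s2 s3₂ s3₂ (-3 / 4), e s3₁ s1₁ s3₂ (-1 / 2),
      e s3₁ s3₁ s2 (rt (3 / 7)), e s3₁ s3₂ s2 (-1 / (2 * rt 7)),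
      e s3₁ s3₂ s3₁ (-3 / (2 * rt 14)), e s3₁ s3₂ s3₂ (-1 / (2 * rt 2))]⟩,
  ⟨g6, .n, 2, factors [e s1₀ s3₂ s3₂ 1, e s2 s1₁ s2 (rt (3 / 2) / 2), e s2 s3₁ s3₂ (-rt (3 / 7)),
      e s2 s3₂ s3₁ (rt 3 / 4), e s2 s3₂ s3₂ (1 / (4 * rt 7)), e s3₁ s1₁ s3₂ (-1 / (2 * rt 7)),
      e s3₁ s3₁ s3₁ (1 / rt 2), e s3₁ s3₁ s3₂ (-1 / rt 14), e s3₁ s3₂ s2 (-1 / 2),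
      e s3₁ s3₂ s3₁ (1 / (2 * rt 2)), e s3₁ s3₂ s3₂ (1 / (2 * rt 14))]⟩,
  ⟨g7, .n, 1, factors [e s1₁ s3₁ s3₂ 1, e s3₁ s1₁ s3₂ (rt 3 / 4), e s3₁ s3₁ s3₁ (rt (7 / 6) / 2),
      e s3₁ s3₁ s3₂ (-1 / (2 * rt 6)), e s3₁ s3₂ s2 (rt (7 / 3) / 4),
      e s3₁ s3₂ s3₁ (-rt (7 / 6) / 4), e s3₁ s3₂ s3₂ (-5 / (4 * rt 6)),
      e s3₂ s1₁ s3₁ (-rt (7 / 3) / 4), e s3₂ s3₁ s3₁ (rt (7 / 6) / 2),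
      e s3₂ s3₁ s3₂ (-1 / (2 * rt 6)), e s3₂ s3₂ s2 (-rt 7 / 4), e s3₂ s3₂ s3₁ (-rt (7 / 6) / 4),
      e s3₂ s3₂ s3₂ (-1 / (4 * rt 6))]⟩,
  ⟨g7, .n, 2, factors [e s1₁ s3₂ s3₁ 1, e s3₁ s1₁ s3₂ (-rt (7 / 3) / 4), e s3₁ s3₁ s3₁ (-1 / (2 * rt 6)),
      e s3₁ s3₁ s3₂ (-rt (7 / 6) / 2), e s3₁ s3₂ s2 (rt 3 / 4), e s3₁ s3₂ s3₁ (5 / (4 * rt 6)),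
      e s3₁ s3₂ s3₂ (-rt (7 / 6) / 4), e s3₂ s1₁ s3₁ (-rt 3 / 4), e s3₂ s3₁ s2 (-1 / rt 3),
      e s3₂ s3₁ s3₁ (1 / (2 * rt 6)), e s3₂ s3₁ s3₂ (rt (7 / 6) / 2), e s3₂ s3₂ s2 (1 / 4),
      e s3₂ s3₂ s3₁ (1 / (4 * rt 6)), e s3₂ s3₂ s3₂ (-rt (7 / 6) / 4)]⟩,
  ⟨g8, .n, 1, factors [e s2 s1₁ s2 (3 / (4 * rt 2)), e s2 s3₂ s3₁ (-5 / 8), e s2 s3₂ s3₂ (-rt 21 / 8),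
      e s3₁ s1₁ s3₂ (-rt (7 / 6) / 4), e s3₁ s3₁ s3₁ (1 / (2 * rt 3)),
      e s3₁ s3₁ s3₂ (rt (7 / 3) / 2), e s3₁ s3₂ s2 (rt (3 / 2) / 4),
      e s3₁ s3₂ s3₁ (5 / (8 * rt 3)), e s3₁ s3₂ s3₂ (-rt (7 / 3) / 8),
      e s3₂ s1₁ s3₁ (-3 * rt (3 / 14) / 4), e s3₂ s3₁ s2 (2 * rt (2 / 21)),
      e s3₂ s3₁ s3₁ (1 / (2 * rt 21)), e s3₂ s3₁ s3₂ (1 / (2 * rt 3)),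
      e s3₂ s3₂ s2 (-1 / (4 * rt 14)), e s3₂ s3₂ s3₁ (23 / (8 * rt 21)),
      e s3₂ s3₂ s3₂ (1 / (8 * rt 3))]⟩,
  ⟨g8, .n, 2, factors [e s2 s1₁ s2 (1 / (4 * rt 7)), e s2 s3₁ s3₁ (rt (6 / 7)), e s2 s3₂ s3₁ (-3 / (4 * rt 14)),
      e s2 s3₂ s3₂ (rt (3 / 2) / 4), e s3₁ s1₁ s3₂ (-rt 3 / 4), e s3₁ s3₁ s2 (-2 / rt 7),
      e s3₁ s3₂ s2 (-rt (3 / 7) / 4), e s3₁ s3₂ s3₁ (-3 * rt (3 / 14) / 4),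
      e s3₁ s3₂ s3₂ (-rt (3 / 2) / 4), e s3₂ s1₁ s3₁ (rt 3 / 4), e s3₂ s3₂ s2 (-1 / 4),
      e s3₂ s3₂ s3₁ (rt (3 / 2) / 4), e s3₂ s3₂ s3₂ (-rt (21 / 2) / 4)]⟩,
  ⟨g8, .n, 3, factors [e s2 s1₁ s2 (3 / (4 * rt 2)), e s2 s3₁ s3₂ (2 / rt 7), e s2 s3₂ s3₁ (3 / 8),
      e s2 s3₂ s3₂ (rt (3 / 7) / 8), e s3₁ s1₁ s3₂ (3 * rt (3 / 14) / 4),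
      e s3₁ s3₁ s3₁ (-1 / (2 * rt 3)), e s3₁ s3₁ s3₂ (1 / (2 * rt 21)),
      e s3₁ s3₂ s2 (-5 / (4 * rt 6)), e s3₁ s3₂ s3₁ (5 / (8 * rt 3)),
      e s3₁ s3₂ s3₂ (-23 / (8 * rt 21)), e s3₂ s1₁ s3₁ (rt (7 / 6) / 4),
      e s3₂ s3₁ s3₁ (rt (7 / 3) / 2), e s3₂ s3₁ s3₂ (-1 / (2 * rt 3)),
      e s3₂ s3₂ s2 (rt (7 / 2) / 4), e s3₂ s3₂ s3₁ (rt (7 / 3) / 8),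
      e s3₂ s3₂ s3₂ (1 / (8 * rt 3))]⟩]

def tableS88 : List (Channel S4Irrep) := [
  ⟨g1, .s, 1, factors [e s1₀ s2 s2 (1 / 2), e s1₀ s3₁ s3₁ (rt (3 / 2) / 2), e s1₀ s3₂ s3₂ (rt (3 / 2) / 2)]⟩,
  ⟨g6, .s, 1, factors [e s1₀ s2 s2 (rt (3 / 5)), e s1₀ s3₂ s3₂ (-rt (2 / 5)), e s2 s2 s2 (-rt (15 / 14) / 2),
      e s2 s3₁ s3₁ (-27 / (4 * rt 70)), e s2 s3₁ s3₂ (rt (3 / 10) / 4),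
      e s2 s3₂ s3₁ (rt (3 / 10) / 4), e s2 s3₂ s3₂ (rt (7 / 10) / 4),
      e s3₁ s2 s3₁ (3 * rt (3 / 70) / 2), e s3₁ s3₁ s2 (3 * rt (3 / 70) / 2),
      e s3₁ s2 s3₂ (-1 / (2 * rt 10)), e s3₁ s3₂ s2 (-1 / (2 * rt 10)),
      e s3₁ s3₁ s3₁ (-1 / (2 * rt 35)), e s3₁ s3₁ s3₂ (-1 / rt 5), e s3₁ s3₂ s3₁ (1 / rt 5),
      e s3₁ s3₂ s3₂ (-rt (7 / 5) / 2)]⟩,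
  ⟨g6, .s, 2, factors [e s1₀ s2 s2 (-rt (3 / 5) / 2), e s1₀ s3₁ s3₁ (rt (5 / 2) / 2),
      e s1₀ s3₂ s3₂ (-3 / (2 * rt 10)), e s2 s2 s2 (-rt (15 / 14) / 2),
      e s2 s3₁ s3₁ (1 / (4 * rt 70)), e s2 s3₁ s3₂ (-3 * rt (3 / 10) / 4),
      e s2 s3₂ s3₁ (-3 * rt (3 / 10) / 4), e s2 s3₂ s3₂ (-3 * rt (7 / 10) / 4),
      e s3₁ s2 s3₁ (-rt (6 / 35)), e s3₁ s3₁ s2 (-rt (6 / 35)), e s3₁ s2 s3₂ (-1 / rt 10),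
      e s3₁ s3₂ s2 (-1 / rt 10), e s3₁ s3₁ s3₁ (-9 / (4 * rt 35)),
      e s3₁ s3₁ s3₂ (-3 / (4 * rt 5)), e s3₁ s3₂ s3₁ (3 / (4 * rt 5)),
      e s3₁ s3₂ s3₂ (rt (7 / 5) / 4)]⟩,
  ⟨g7, .s, 1, factors [e s1₁ s3₁ s3₂ (1 / rt 2), e s1₁ s3₂ s3₁ (1 / rt 2), e s3₁ s2 s3₂ (-1 / rt 6),
      e s3₁ s3₂ s2 (-1 / rt 6), e s3₁ s3₁ s3₁ (-rt (7 / 3) / 4), e s3₁ s3₁ s3₂ (rt 3 / 4),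
      e s3₁ s3₂ s3₁ (-rt 3 / 4), e s3₁ s3₂ s3₂ (-rt (7 / 3) / 4), e s3₂ s2 s3₁ (-rt (7 / 6) / 2),
      e s3₂ s3₁ s2 (-rt (7 / 6) / 2), e s3₂ s2 s3₂ (1 / (2 * rt 2)),
      e s3₂ s3₂ s2 (1 / (2 * rt 2)), e s3₂ s3₁ s3₂ (-1 / (2 * rt 3)),
      e s3₂ s3₂ s3₁ (-1 / (2 * rt 3))]⟩,
  ⟨g8, .s, 1, factors [e s2 s2 s2 (rt (2 / 5)), e s2 s3₁ s3₁ (-rt (3 / 10)), e s2 s3₂ s3₂ (-rt (3 / 10)),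
      e s3₁ s2 s3₁ (-1 / rt 5), e s3₁ s3₁ s2 (-1 / rt 5), e s3₁ s3₁ s3₁ (rt (3 / 10)),
      e s3₁ s3₂ s3₂ (-rt (3 / 10)), e s3₂ s2 s3₂ (-1 / rt 5), e s3₂ s3₂ s2 (-1 / rt 5),
      e s3₂ s3₁ s3₂ (-rt (3 / 10)), e s3₂ s3₂ s3₁ (-rt (3 / 10))]⟩,
  ⟨g8, .s, 2, factors [e s2 s2 s2 (-3 / (2 * rt 35)), e s2 s3₁ s3₁ (3 * rt (3 / 35) / 4), e s2 s3₁ s3₂ (rt 5 / 4),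
      e s2 s3₂ s3₁ (rt 5 / 4), e s2 s3₂ s3₂ (-rt (21 / 5) / 4), e s3₁ s2 s3₁ (3 / (2 * rt 70)),
      e s3₁ s3₁ s2 (3 / (2 * rt 70)), e s3₁ s2 s3₂ (-rt (5 / 6) / 2),
      e s3₁ s3₂ s2 (-rt (5 / 6) / 2), e s3₁ s3₁ s3₁ (13 / (2 * rt 105)),
      e s3₁ s3₂ s3₂ (rt (7 / 15) / 2), e s3₂ s2 s3₁ (-rt (5 / 6) / 2),
      e s3₂ s3₁ s2 (-rt (5 / 6) / 2), e s3₂ s2 s3₂ (-rt (7 / 10) / 2),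
      e s3₂ s3₂ s2 (-rt (7 / 10) / 2), e s3₂ s3₁ s3₂ (rt (7 / 15) / 2),
      e s3₂ s3₂ s3₁ (rt (7 / 15) / 2)]⟩,
  ⟨g3, .a, 1, factors [e s3₂ s2 s3₁ (1 / 4), e s3₂ s3₁ s2 (-1 / 4), e s3₂ s2 s3₂ (I * rt 3 / 4),
      e s3₂ s3₂ s2 (-I * rt 3 / 4), e s3₂ s3₁ s3₁ (-1 / (2 * b₇ ^ 3)),
      e s3₂ s3₁ s3₂ (I / (4 * b₇)), e s3₂ s3₂ s3₁ (-I / (4 * b₇)),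
      e s3₂ s3₂ s3₂ (-1 / (2 * rt 2 * b₇ ^ 2))]⟩,
  ⟨g3b, .a, 1, factors [e s3₂ s2 s3₁ (1 / 4), e s3₂ s3₁ s2 (-1 / 4), e s3₂ s2 s3₂ (-I * rt 3 / 4),
      e s3₂ s3₂ s2 (I * rt 3 / 4), e s3₂ s3₁ s3₁ (-b₇ ^ 3 / 2), e s3₂ s3₁ s3₂ (-I * b₇ / 4),
      e s3₂ s3₂ s3₁ (I * b₇ / 4), e s3₂ s3₂ s3₂ (-b₇ ^ 2 / (2 * rt 2))]⟩,
  ⟨g7, .a, 1, factors [e s1₁ s2 s2 1, e s3₁ s2 s3₁ (-1 / (8 * rt 2)), e s3₁ s3₁ s2 (1 / (8 * rt 2)),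
      e s3₁ s2 s3₂ (rt (21 / 2) / 8), e s3₁ s3₂ s2 (-rt (21 / 2) / 8), e s3₁ s3₁ s3₂ (rt 21 / 8),
      e s3₁ s3₂ s3₁ (rt 21 / 8), e s3₂ s2 s3₁ (-rt (3 / 2) / 8), e s3₂ s3₁ s2 (rt (3 / 2) / 8),
      e s3₂ s2 s3₂ (rt (7 / 2) / 8), e s3₂ s3₂ s2 (-rt (7 / 2) / 8), e s3₂ s3₁ s3₁ (rt 3 / 4),
      e s3₂ s3₁ s3₂ (rt 21 / 8), e s3₂ s3₂ s3₁ (-rt 21 / 8)]⟩,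
  ⟨g7, .a, 2, factors [e s1₁ s3₁ s3₂ (1 / rt 2), e s1₁ s3₂ s3₁ (-1 / rt 2), e s3₁ s2 s3₁ (-3 * rt (7 / 2) / 8),
      e s3₁ s3₁ s2 (3 * rt (7 / 2) / 8), e s3₁ s2 s3₂ (-1 / (8 * rt 6)),
      e s3₁ s3₂ s2 (1 / (8 * rt 6)), e s3₁ s3₁ s3₂ (-1 / (8 * rt 3)),
      e s3₁ s3₂ s3₁ (-1 / (8 * rt 3)), e s3₂ s2 s3₁ (-rt (7 / 6) / 8),
      e s3₂ s3₁ s2 (rt (7 / 6) / 8), e s3₂ s2 s3₂ (-3 / (8 * rt 2)),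
      e s3₂ s3₂ s2 (3 / (8 * rt 2)), e s3₂ s3₁ s3₁ (-rt (7 / 3) / 4), e s3₂ s3₁ s3₂ (rt 3 / 8),
      e s3₂ s3₂ s3₁ (-rt 3 / 8), e s3₂ s3₂ s3₂ (-rt (7 / 3) / 2)]⟩,
  ⟨g8, .a, 1, factors [e s2 s3₁ s3₂ (1 / rt 2), e s2 s3₂ s3₁ (-1 / rt 2), e s3₁ s2 s3₂ (1 / rt 3),
      e s3₁ s3₂ s2 (-1 / rt 3), e s3₁ s3₁ s3₂ (-1 / rt 6), e s3₁ s3₂ s3₁ (-1 / rt 6),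
      e s3₂ s2 s3₁ (-1 / rt 3), e s3₂ s3₁ s2 (1 / rt 3), e s3₂ s3₁ s3₁ (-1 / rt 6),
      e s3₂ s3₂ s3₂ (1 / rt 6)]⟩]

/-- The contractions of `X ⊗ Y` in the `S₄` basis. -/
def tableS : GIrrep → GIrrep → List (Channel S4Irrep)
  | g1, Y => [trivialChannel s1₀ contentS Y]
  | g3, g3 => tableS33
  | g3b, g3b => tableS33.map (Channel.conj id)
  | g3, g3b => tableS33b
  | g3, g6 => tableS36
  | g3b, g6 => tableS36.map (Channel.conj id)
  | g3, g7 => tableS37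
  | g3b, g7 => tableS37.map (Channel.conj id)
  | g3, g8 => tableS38
  | g3b, g8 => tableS38.map (Channel.conj id)
  | g6, g6 => tableS66
  | g6, g7 => tableS67
  | g6, g8 => tableS68
  | g7, g7 => tableS77
  | g7, g8 => tableS78
  | g8, g8 => tableS88
  | _, _ => []

/-- The basis of the irreps of `PSL₂(7)` adapted to `S₄`. -/
def basisS : AdaptedBasis S4Irrep where
  dim := S4Irrep.dim
  bar := id
  gen₁ := gen₁S
  gen₂ := gen₂S
  conjMat := conjMatS
  cg := cgS
  matA := matAS
  matB := matBS
  content := contentS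
  proj := projS
  table := tableS

/-! ### The `T₇` basis -/

/-- `P_{X → x}` in the `T₇` basis: consecutive coordinates, with a sign in `7`. -/
def projT : (X : GIrrep) → (x : T7Irrep) → Matrix (Fin x.dim) (Fin X.dim) ℂ
  | g1, t1 => block 0 1
  | g3, t3 => block 0 1
  | g3b, t3b => block 0 1
  | g6, t3 => block 0 1
  | g6, t3b => block 3 1
  | g7, t1 => block 0 (-1)
  | g7, t3 => block 1 1
  | g7, t3b => block 4 1
  | g8, t1p => block 0 1
  | g8, t1q => block 1 1
  | g8, t3 => block 2 1
  | g8, t3b => block 5 1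
  | _, _ => 0

def contentT : GIrrep → List T7Irrep
  | g1 => [t1]
  | g3 => [t3]
  | g3b => [t3b]
  | g6 => [t3, t3b]
  | g7 => [t1, t3, t3b]
  | g8 => [t1p, t1q, t3, t3b]

def matAT3 : Matrix (Fin 3) (Fin 3) ℂ :=
  (I / rt 7) • !![η ^ 2 - η ^ 5, η - η ^ 6, η ^ 4 - η ^ 3;
    η - η ^ 6, η ^ 4 - η ^ 3, η ^ 2 - η ^ 5;
    η ^ 4 - η ^ 3, η ^ 2 - η ^ 5, η - η ^ 6]

def matBT3 : Matrix (Fin 3) (Fin 3) ℂ :=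
  (I / rt 7) • !![η ^ 3 - η ^ 6, η ^ 3 - η, η - 1;
    η ^ 2 - 1, η ^ 6 - η ^ 5, η ^ 6 - η ^ 2;
    η ^ 5 - η ^ 4, η ^ 4 - 1, η ^ 5 - η ^ 3]

/-- The matrices `R₁`, `R₂`, `R₃`, as functions of `c₁, c₂, c₃`. -/
def matR₁ (c₁ c₂ c₃ : ℂ) : Matrix (Fin 3) (Fin 3) ℂ :=
  !![1 - c₂, 1 - c₁, 1 - c₃; 1 - c₁, 1 - c₃, 1 - c₂; 1 - c₃, 1 - c₂, 1 - c₁]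

def matR₂ (c₁ c₂ c₃ : ℂ) : Matrix (Fin 3) (Fin 3) ℂ :=
  !![c₁ - c₃, c₃ - c₂, c₂ - c₁; c₃ - c₂, c₂ - c₁, c₁ - c₃; c₂ - c₁, c₁ - c₃, c₃ - c₂]

def matR₃ (c₁ c₂ c₃ : ℂ) : Matrix (Fin 3) (Fin 3) ℂ :=
  !![c₂ - c₁, c₁ - c₃, c₃ - c₂; c₁ - c₃, c₃ - c₂, c₂ - c₁; c₃ - c₂, c₂ - c₁, c₁ - c₃]

/-- The matrices `C₁`, `C₂`. -/
def matC₁ (c₂ c₃ : ℂ) : Matrix (Fin 2) (Fin 2) ℂ :=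
  !![0, ω / 2 + I * rt 3 * (c₂ - c₃ * ω ^ 2); ω ^ 2 / 2 + I * rt 3 * (-c₂ + c₃ * ω), 0]

def matC₂ (c₂ c₃ : ℂ) : Matrix (Fin 2) (Fin 3) ℂ :=
  !![-I / 2 * ω ^ 2 + rt 3 * (c₂ * ω - c₃), -I / 2 + rt 3 * (c₂ * ω ^ 2 - c₃ * ω),
      -I / 2 * ω + rt 3 * (c₂ - ω ^ 2 * c₃);
    I / 2 * ω + rt 3 * (c₂ * ω ^ 2 - c₃), I / 2 + rt 3 * (c₂ * ω - c₃ * ω ^ 2),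
      I / 2 * ω ^ 2 + rt 3 * (c₂ - ω * c₃)]

def matAT6 : Matrix (Fin 6) (Fin 6) ℂ :=
  let R := matR₁ (cosSeven 1) (cosSeven 2) (cosSeven 3)
  let S := rt 2 • matR₂ (cosSeven 1) (cosSeven 2) (cosSeven 3)
  (2 / 7 : ℂ) • !![
    R 0 0, R 0 1, R 0 2, S 0 0, S 0 1, S 0 2;
    R 1 0, R 1 1, R 1 2, S 1 0, S 1 1, S 1 2;
    R 2 0, R 2 1, R 2 2, S 2 0, S 2 1, S 2 2;
    S 0 0, S 0 1, S 0 2, R 0 0, R 0 1, R 0 2;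
    S 1 0, S 1 1, S 1 2, R 1 0, R 1 1, R 1 2;
    S 2 0, S 2 1, S 2 2, R 2 0, R 2 1, R 2 2]

def matAT7 : Matrix (Fin 7) (Fin 7) ℂ :=
  let c₁ := cosSeven 1
  let c₂ := cosSeven 2
  let c₃ := cosSeven 3
  (2 / 7 : ℂ) • !![
    -1 / 2, rt 2, rt 2, rt 2, rt 2, rt 2, rt 2;
    rt 2, 2 * c₁ + c₂, c₁ + 2 * c₃, 2 * c₂ + c₃, 2 * c₂ + 1, 2 * c₁ + 1, 2 * c₃ + 1;
    rt 2, c₁ + 2 * c₃, 2 * c₂ + c₃, 2 * c₁ + c₂, 2 * c₁ + 1, 2 * c₃ + 1, 2 * c₂ + 1;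
    rt 2, 2 * c₂ + c₃, 2 * c₁ + c₂, c₁ + 2 * c₃, 2 * c₃ + 1, 2 * c₂ + 1, 2 * c₁ + 1;
    rt 2, 2 * c₂ + 1, 2 * c₁ + 1, 2 * c₃ + 1, 2 * c₁ + c₂, c₁ + 2 * c₃, 2 * c₂ + c₃;
    rt 2, 2 * c₁ + 1, 2 * c₃ + 1, 2 * c₂ + 1, c₁ + 2 * c₃, 2 * c₂ + c₃, 2 * c₁ + c₂;
    rt 2, 2 * c₃ + 1, 2 * c₂ + 1, 2 * c₁ + 1, 2 * c₂ + c₃, 2 * c₁ + c₂, c₁ + 2 * c₃]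

def matAT8 : Matrix (Fin 8) (Fin 8) ℂ :=
  let C := matC₁ (cosSeven 2) (cosSeven 3)
  let D := matC₂ (cosSeven 2) (cosSeven 3)
  let E := (matC₂ (cosSeven 2) (cosSeven 3))ᴴ
  let Q := matR₃ (cosSeven 1) (cosSeven 2) (cosSeven 3)
  let R := matR₁ (cosSeven 1) (cosSeven 2) (cosSeven 3)
  (2 / 7 : ℂ) • !![
    C 0 0, C 0 1, D 0 0, D 0 1, D 0 2, D 0 0, D 0 1, D 0 2;
    C 1 0, C 1 1, D 1 0, D 1 1, D 1 2, D 1 0, D 1 1, D 1 2;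
    E 0 0, E 0 1, Q 0 0, Q 0 1, Q 0 2, R 0 0, R 0 1, R 0 2;
    E 1 0, E 1 1, Q 1 0, Q 1 1, Q 1 2, R 1 0, R 1 1, R 1 2;
    E 2 0, E 2 1, Q 2 0, Q 2 1, Q 2 2, R 2 0, R 2 1, R 2 2;
    E 0 0, E 0 1, R 0 0, R 0 1, R 0 2, Q 0 0, Q 0 1, Q 0 2;
    E 1 0, E 1 1, R 1 0, R 1 1, R 1 2, Q 1 0, Q 1 1, Q 1 2;
    E 2 0, E 2 1, R 2 0, R 2 1, R 2 2, Q 2 0, Q 2 1, Q 2 2]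

/-- The matrix of `A` in the `T₇` basis. -/
def matAT : (X : GIrrep) → Matrix (Fin X.dim) (Fin X.dim) ℂ
  | g1 => 1
  | g3 => matAT3
  | g3b => matAT3.map star
  | g6 => matAT6
  | g7 => matAT7
  | g8 => matAT8

/-- The matrix of `B` in the `T₇` basis; for `6, 7, 8` it is `A (AB)` with a diagonal
matrix `AB`. -/
def matBT : (X : GIrrep) → Matrix (Fin X.dim) (Fin X.dim) ℂ
  | g1 => 1
  | g3 => matBT3
  | g3b => matBT3.map star
  | g6 => matAT6 * diagonal ![η, η ^ 2, η ^ 4, η ^ 6, η ^ 5, η ^ 3]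
  | g7 => matAT7 * diagonal ![1, η, η ^ 2, η ^ 4, η ^ 6, η ^ 5, η ^ 3]
  | g8 => matAT8 * diagonal ![1, 1, η, η ^ 2, η ^ 4, η ^ 6, η ^ 5, η ^ 3]

def gen₁T : (x : T7Irrep) → Matrix (Fin x.dim) (Fin x.dim) ℂ
  | t1 => 1
  | t1p => 1
  | t1q => 1
  | t3 => diagonal ![η, η ^ 2, η ^ 4]
  | t3b => diagonal ![η ^ 6, η ^ 5, η ^ 3]

def gen₂T : (x : T7Irrep) → Matrix (Fin x.dim) (Fin x.dim) ℂ
  | t1 => 1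
  | t1p => !![ω]
  | t1q => !![ω ^ 2]
  | t3 => !![0, 1, 0; 0, 0, 1; 1, 0, 0]
  | t3b => !![0, 1, 0; 0, 0, 1; 1, 0, 0]

def conjMatT : (x : T7Irrep) → Matrix (Fin x.bar.dim) (Fin x.dim) ℂ
  | t1 => (1 : Matrix (Fin 1) (Fin 1) ℂ)
  | t1p => (1 : Matrix (Fin 1) (Fin 1) ℂ)
  | t1q => (1 : Matrix (Fin 1) (Fin 1) ℂ)
  | t3 => (1 : Matrix (Fin 3) (Fin 3) ℂ)
  | t3b => (1 : Matrix (Fin 3) (Fin 3) ℂ)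

/-- The contractions of `T₇`. -/
def contrT : (x y z : T7Irrep) → Label → (Fin x.dim → ℂ) → (Fin y.dim → ℂ) → Fin z.dim → ℂ
  | t1, t1, t1, .n => fun x y => x 0 • y
  | t1, t1p, t1p, .n => fun x y => x 0 • y
  | t1, t1q, t1q, .n => fun x y => x 0 • y
  | t1, t3, t3, .n => fun x y => x 0 • y
  | t1, t3b, t3b, .n => fun x y => x 0 • y
  | t1p, t1, t1p, .n => fun x y => y 0 • x
  | t1q, t1, t1q, .n => fun x y => y 0 • x
  | t3, t1, t3, .n => fun x y => y 0 • x
  | t3b, t1, t3b, .n => fun x y => y 0 • x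
  | t1p, t1p, t1q, .n => fun x y => x 0 • y
  | t1q, t1q, t1p, .n => fun x y => x 0 • y
  | t1p, t1q, t1, .n => fun x y => x 0 • y
  | t1q, t1p, t1, .n => fun x y => x 0 • y
  | t1p, t3, t3, .n => fun s x => s 0 • ![x 0, ω * x 1, ω ^ 2 * x 2]
  | t3, t1p, t3, .n => fun x s => s 0 • ![x 0, ω * x 1, ω ^ 2 * x 2]
  | t1q, t3, t3, .n => fun s x => s 0 • ![x 0, ω ^ 2 * x 1, ω * x 2]
  | t3, t1q, t3, .n => fun x s => s 0 • ![x 0, ω ^ 2 * x 1, ω * x 2]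
  | t1p, t3b, t3b, .n => fun s x => s 0 • ![x 0, ω * x 1, ω ^ 2 * x 2]
  | t3b, t1p, t3b, .n => fun x s => s 0 • ![x 0, ω * x 1, ω ^ 2 * x 2]
  | t1q, t3b, t3b, .n => fun s x => s 0 • ![x 0, ω ^ 2 * x 1, ω * x 2]
  | t3b, t1q, t3b, .n => fun x s => s 0 • ![x 0, ω ^ 2 * x 1, ω * x 2]
  | t3, t3, t3, .n => fun x y => ![x 2 * y 2, x 0 * y 0, x 1 * y 1]
  | t3b, t3b, t3b, .n => fun x y => ![x 2 * y 2, x 0 * y 0, x 1 * y 1]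
  | t3, t3, t3b, .s => fun x y => ![(x 2 * y 1 + x 1 * y 2) / rt 2, (x 0 * y 2 + x 2 * y 0) / rt 2,
      (x 1 * y 0 + x 0 * y 1) / rt 2]
  | t3b, t3b, t3, .s => fun x y => ![(x 2 * y 1 + x 1 * y 2) / rt 2, (x 0 * y 2 + x 2 * y 0) / rt 2,
      (x 1 * y 0 + x 0 * y 1) / rt 2]
  | t3, t3, t3b, .a => fun x y => ![(x 2 * y 1 - x 1 * y 2) / rt 2, (x 0 * y 2 - x 2 * y 0) / rt 2,
      (x 1 * y 0 - x 0 * y 1) / rt 2]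
  | t3b, t3b, t3, .a => fun x y => ![(x 2 * y 1 - x 1 * y 2) / rt 2, (x 0 * y 2 - x 2 * y 0) / rt 2,
      (x 1 * y 0 - x 0 * y 1) / rt 2]
  | t3, t3b, t3, .n => fun x y => ![x 1 * y 0, x 2 * y 1, x 0 * y 2]
  | t3b, t3, t3, .n => fun y x => ![x 1 * y 0, x 2 * y 1, x 0 * y 2]
  | t3, t3b, t3b, .n => fun x y => ![x 0 * y 1, x 1 * y 2, x 2 * y 0]
  | t3b, t3, t3b, .n => fun y x => ![x 0 * y 1, x 1 * y 2, x 2 * y 0]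
  | t3, t3b, t1, .n => fun x y => ![(x 0 * y 0 + x 1 * y 1 + x 2 * y 2) / rt 3]
  | t3b, t3, t1, .n => fun x y => ![(x 0 * y 0 + x 1 * y 1 + x 2 * y 2) / rt 3]
  | t3, t3b, t1p, .n => fun x y => ![(x 0 * y 0 + ω ^ 2 * x 1 * y 1 + ω * x 2 * y 2) / rt 3]
  | t3b, t3, t1p, .n => fun x y => ![(x 0 * y 0 + ω ^ 2 * x 1 * y 1 + ω * x 2 * y 2) / rt 3]
  | t3, t3b, t1q, .n => fun x y => ![(x 0 * y 0 + ω * x 1 * y 1 + ω ^ 2 * x 2 * y 2) / rt 3]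
  | t3b, t3, t1q, .n => fun x y => ![(x 0 * y 0 + ω * x 1 * y 1 + ω ^ 2 * x 2 * y 2) / rt 3]
  | _, _, _, _ => 0

/-- The CG coefficients of `T₇`. -/
def cgT (x y z : T7Irrep) (k : Label) : Matrix (Fin z.dim) (Fin x.dim × Fin y.dim) ℂ :=
  bilin (contrT x y z k)

def tableT33 : List (Channel T7Irrep) := [
  ⟨g3b, .a, 1, factors [ea t3b t3 t3 1]⟩,
  ⟨g6, .s, 1, factors [e t3 t3 t3 1, es t3b t3 t3 1]⟩]

def tableT33b : List (Channel T7Irrep) := [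
  ⟨g1, .n, 1, factors [e t1 t3 t3b 1]⟩,
  ⟨g8, .n, 1, factors [e t1p t3 t3b 1, e t1q t3 t3b 1, e t3 t3 t3b 1, e t3b t3 t3b 1]⟩]

def tableT36 : List (Channel T7Irrep) := [
  ⟨g3b, .n, 1, factors [es t3b t3 t3 (1 / rt 2), e t3b t3 t3b (1 / rt 2)]⟩,
  ⟨g7, .n, 1, factors [e t1 t3 t3b 1, e t3 t3 t3 (1 / rt 3), e t3 t3 t3b (rt (2 / 3)), es t3b t3 t3 (-1 / rt 6),
      ea t3b t3 t3 (rt (2 / 3)), e t3b t3 t3b (1 / rt 6)]⟩,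
  ⟨g8, .n, 1, factors [e t1p t3 t3b 1, e t1q t3 t3b (-1), e t3 t3 t3 (I * rt (2 / 3)), e t3 t3 t3b (-I / rt 3),
      es t3b t3 t3 (-I / rt 3), ea t3b t3 t3 (-I / rt 3), e t3b t3 t3b (I / rt 3)]⟩]

def tableT37 : List (Channel T7Irrep) := [
  ⟨g6, .n, 1, factors [e t3 t3 t1 (rt (2 / 7)), e t3 t3 t3 (1 / rt 7), e t3 t3 t3b (2 / rt 7),
      es t3b t3 t3 (-1 / rt 7), ea t3b t3 t3 (-2 / rt 7), e t3b t3 t3b (rt (2 / 7))]⟩,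
  ⟨g7, .n, 1, factors [e t1 t3 t3b 1, e t3 t3 t1 (-1 / rt 3), e t3 t3 t3 (rt (2 / 3)), ea t3b t3 t3 (-1 / rt 3),
      e t3b t3 t3b (-rt (2 / 3))]⟩,
  ⟨g8, .n, 1, factors [e t1p t3 t3b 1, e t1q t3 t3b (-exp (2 * I * α)),
      e t3 t3 t1 (-2 * I * rt (2 / 21) * exp (I * α)), e t3 t3 t3 (-2 * I * exp (I * α) / rt 21),
      e t3 t3 t3b (I * rt (3 / 7) * exp (I * α)), es t3b t3 t3 (-I * rt (6 / 7) * exp (I * α)),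
      ea t3b t3 t3 (I * rt (2 / 21) * exp (I * α)), e t3b t3 t3b (-I * exp (I * α) / rt 21)]⟩]

def tableT38 : List (Channel T7Irrep) := [
  ⟨g3, .n, 1, factors [e t3 t3 t1p (1 / (2 * rt 2)), e t3 t3 t1q (1 / (2 * rt 2)), e t3 t3 t3 (rt (3 / 2) / 2),
      e t3 t3 t3b (rt (3 / 2) / 2)]⟩,
  ⟨g6, .n, 1, factors [e t3 t3 t1p (1 / 2), e t3 t3 t1q (-1 / 2), e t3 t3 t3 (-I / 2), e t3 t3 t3b (I / 2),
      es t3b t3 t3 (I / 2), ea t3b t3 t3 (-I / 2), e t3b t3 t3b (-I / rt 2)]⟩,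
  ⟨g7, .n, 1, factors [e t1 t3 t3b 1, e t3 t3 t1p (-1 / 2 * I * rt (7 / 6) * exp (I * α)),
      e t3 t3 t1q (1 / 2 * I * rt (7 / 6) * exp (-I * α)), e t3 t3 t3 (1 / (2 * rt 6)),
      e t3 t3 t3b (-rt (3 / 2) / 2), es t3b t3 t3 (rt 3 / 2), ea t3b t3 t3 (1 / (2 * rt 3)),
      e t3b t3 t3b (1 / rt 6)]⟩,
  ⟨g8, .n, 1, factors [e t1p t3 t3b 1, e t1q t3 t3b (-ω ^ 2), e t3 t3 t1p (ω ^ 2 / rt 3), e t3 t3 t1q (-1 / rt 3),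
      e t3 t3 t3 (-I * ω / rt 3), ea t3b t3 t3 (-I * rt (2 / 3) * ω), e t3b t3 t3b (I * ω / rt 3)]⟩]

def tableT66 : List (Channel T7Irrep) := [
  ⟨g1, .s, 1, factors [e t1 t3 t3b (1 / rt 2), e t1 t3b t3 (1 / rt 2)]⟩,
  ⟨g6, .s, 1, factors [e t3 t3 t3 (rt (1 / 14 * (3 - √2))), e t3 t3 t3b (rt (1 / 14 * (3 - √2))),
      e t3 t3b t3 (rt (1 / 14 * (3 - √2))), es t3 t3b t3b (-rt (1 / 14 * (5 + 3 * √2))),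
      es t3b t3 t3 (-rt (1 / 14 * (5 + 3 * √2))), e t3b t3 t3b (rt (1 / 14 * (3 - √2))),
      e t3b t3b t3 (rt (1 / 14 * (3 - √2))), e t3b t3b t3b (rt (1 / 14 * (3 - √2)))]⟩,
  ⟨g6, .s, 2, factors [e t3 t3 t3 (I * rt (1 / 14 * (3 + √2))), e t3 t3 t3b (-I * rt (1 / 14 * (3 + √2))),
      e t3 t3b t3 (-I * rt (1 / 14 * (3 + √2))), es t3 t3b t3b (-I * rt (1 / 14 * (5 - 3 * √2))),
      es t3b t3 t3 (I * rt (1 / 14 * (5 - 3 * √2))), e t3b t3 t3b (I * rt (1 / 14 * (3 + √2))),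
      e t3b t3b t3 (I * rt (1 / 14 * (3 + √2))), e t3b t3b t3b (-I * rt (1 / 14 * (3 + √2)))]⟩,
  ⟨g8, .s, 1, factors [e t1p t3 t3b (exp (-I * α) / rt 2), e t1p t3b t3 (exp (-I * α) / rt 2),
      e t1q t3 t3b (exp (I * α) / rt 2), e t1q t3b t3 (exp (I * α) / rt 2),
      e t3 t3 t3 (-2 / rt 7), e t3 t3 t3b (-1 / rt 14), e t3 t3b t3 (-1 / rt 14),
      es t3 t3b t3b (-rt (2 / 7)), es t3b t3 t3 (-rt (2 / 7)), e t3b t3 t3b (-1 / rt 14),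
      e t3b t3b t3 (-1 / rt 14), e t3b t3b t3b (-2 / rt 7)]⟩,
  ⟨g7, .a, 1, factors [e t1 t3 t3b (I / rt 2), e t1 t3b t3 (-I / rt 2), e t3 t3 t3b (-I / rt 3),
      e t3 t3b t3 (I / rt 3), ea t3 t3b t3b (-I / rt 3), ea t3b t3 t3 (I / rt 3),
      e t3b t3 t3b (-I / rt 3), e t3b t3b t3 (I / rt 3)]⟩,
  ⟨g8, .a, 1, factors [e t1p t3 t3b (1 / rt 2), e t1p t3b t3 (-1 / rt 2), e t1q t3 t3b (-1 / rt 2),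
      e t1q t3b t3 (1 / rt 2), e t3 t3 t3b (I / rt 6), e t3 t3b t3 (-I / rt 6),
      ea t3 t3b t3b (-I * rt (2 / 3)), ea t3b t3 t3 (I * rt (2 / 3)), e t3b t3 t3b (I / rt 6),
      e t3b t3b t3 (-I / rt 6)]⟩]

def tableT67 : List (Channel T7Irrep) := [
  ⟨g3, .n, 1, factors [e t3 t3 t1 (1 / rt 7), e t3 t3 t3 (rt (2 / 7)), e t3 t3 t3b (1 / rt 14),
      e t3 t3b t3 (1 / rt 7), es t3 t3b t3b (-1 / rt 14), ea t3 t3b t3b (rt (2 / 7))]⟩,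
  ⟨g3b, .n, 1, factors (rephase (-1) [es t3b t3 t3 (1 / rt 14), ea t3b t3 t3 (-rt (2 / 7)), e t3b t3 t3b (-1 / rt 7),
      e t3b t3b t1 (-1 / rt 7), e t3b t3b t3 (-1 / rt 14), e t3b t3b t3b (-rt (2 / 7))])⟩,
  ⟨g6, .n, 1, factors [e t3 t3 t1 (I / rt 7), e t3 t3 t3 (-I * rt (2 / 7)), e t3 t3 t3b (-I * rt (2 / 7)),
      ea t3 t3b t3b (I * rt (2 / 7)), ea t3b t3 t3 (-I * rt (2 / 7)), e t3b t3b t1 (-I / rt 7),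
      e t3b t3b t3 (I * rt (2 / 7)), e t3b t3b t3b (I * rt (2 / 7))]⟩,
  ⟨g7, .n, 1, factors [e t1 t3 t3b (1 / rt 2), e t1 t3b t3 (1 / rt 2), e t3 t3 t1 (1 / rt 6),
      e t3 t3 t3 (-1 / rt 6), e t3 t3 t3b (1 / 6 * (rt 3 + rt 6)), e t3 t3b t3 (-1 / rt 6),
      es t3 t3b t3b (1 / 6 * (rt 3 - rt 6)), es t3b t3 t3 (1 / 6 * (rt 3 - rt 6)),
      e t3b t3 t3b (-1 / rt 6), e t3b t3b t1 (1 / rt 6), e t3b t3b t3 (1 / 6 * (rt 3 + rt 6)),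
      e t3b t3b t3b (-1 / rt 6)]⟩,
  ⟨g7, .n, 2, factors [e t1 t3 t3b (I / rt 2), e t1 t3b t3 (-I / rt 2), e t3 t3 t1 (I / rt 6),
      e t3 t3 t3 (I / rt 6), e t3 t3 t3b (-I * (rt 2 - 1) / (2 * rt 3)), e t3 t3b t3 (-I / rt 6),
      es t3 t3b t3b (1 / 6 * I * (rt 3 + rt 6)), es t3b t3 t3 (-1 / 6 * I * (rt 3 + rt 6)),
      e t3b t3 t3b (I / rt 6), e t3b t3b t1 (-I / rt 6),
      e t3b t3b t3 (I * (rt 2 - 1) / (2 * rt 3)), e t3b t3b t3b (-I / rt 6)]⟩,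
  ⟨g8, .n, 1, factors [e t1p t3 t3b (-I * ω * exp (2 * I * β - I * α) / rt 2),
      e t1p t3b t3 (-I * ω * exp (2 * I * β - I * α) / rt 2),
      e t1q t3 t3b (I * ω ^ 2 * exp (I * α - 2 * I * β) / rt 2),
      e t1q t3b t3 (I * ω ^ 2 * exp (I * α - 2 * I * β) / rt 2), e t3 t3 t1 (2 / rt 21),
      e t3 t3 t3 (1 / rt 21), e t3 t3 t3b (-(2 + rt 2) / (2 * rt 21)),
      e t3 t3b t3 ((2 - 3 * rt 2) / (2 * rt 21)), es t3 t3b t3b (-(4 + rt 2) / (2 * rt 21)),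
      ea t3 t3b t3b (-rt (3 / 14)), es t3b t3 t3 (-(4 + rt 2) / (2 * rt 21)),
      ea t3b t3 t3 (-rt (3 / 14)), e t3b t3 t3b ((2 - 3 * rt 2) / (2 * rt 21)),
      e t3b t3b t1 (2 / rt 21), e t3b t3b t3 (-(2 + rt 2) / (2 * rt 21)),
      e t3b t3b t3b (1 / rt 21)]⟩,
  ⟨g8, .n, 2, factors [e t1p t3 t3b (-ω ^ 2 * exp (I * α - 2 * I * β) / rt 2),
      e t1p t3b t3 (ω ^ 2 * exp (I * α - 2 * I * β) / rt 2),
      e t1q t3 t3b (ω * exp (2 * I * β - I * α) / rt 2),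
      e t1q t3b t3 (-ω * exp (2 * I * β - I * α) / rt 2), e t3 t3 t1 (-2 * I / rt 21),
      e t3 t3 t3 (I / rt 21), e t3 t3 t3b (I * (rt 2 - 2) / (2 * rt 21)),
      e t3 t3b t3 (-I * (2 + 3 * rt 2) / (2 * rt 21)),
      es t3 t3b t3b (I * (rt 2 - 4) / (2 * rt 21)), ea t3 t3b t3b (I * rt (3 / 14)),
      es t3b t3 t3 (-I * (rt 2 - 4) / (2 * rt 21)), ea t3b t3 t3 (-I * rt (3 / 14)),
      e t3b t3 t3b (I * (2 + 3 * rt 2) / (2 * rt 21)), e t3b t3b t1 (2 * I / rt 21),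
      e t3b t3b t3 (-I * (rt 2 - 2) / (2 * rt 21)), e t3b t3b t3b (-I / rt 21)]⟩]

def tableT68 : List (Channel T7Irrep) := [
  ⟨g3, .n, 1, factors [e t3 t3 t1p (1 / (2 * rt 2)), e t3 t3 t1q (-1 / (2 * rt 2)), e t3 t3 t3 (I / (2 * rt 2)),
      e t3 t3 t3b (-I / (2 * rt 2)), e t3 t3b t3 (-I / 2), es t3 t3b t3b (I / (2 * rt 2)),
      ea t3 t3b t3b (I / (2 * rt 2))]⟩,
  ⟨g3b, .n, 1, factors (rephase (-I) [es t3b t3 t3 (1 / (2 * rt 2)), ea t3b t3 t3 (1 / (2 * rt 2)), e t3b t3 t3b (-1 / 2),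
      e t3b t3b t1p (-I / (2 * rt 2)), e t3b t3b t1q (I / (2 * rt 2)),
      e t3b t3b t3 (-1 / (2 * rt 2)), e t3b t3b t3b (1 / (2 * rt 2))])⟩,
  ⟨g6, .n, 1, factors [e t3 t3 t1p (-exp (I * α) / (2 * rt 2)), e t3 t3 t1q (-exp (-I * α) / (2 * rt 2)),
      e t3 t3 t3 (rt (3 / 14) / 2), e t3 t3 t3b (rt (3 / 14) / 2), e t3 t3b t3 (rt (3 / 7)),
      es t3 t3b t3b (rt (3 / 14)), es t3b t3 t3 (rt (3 / 14)), e t3b t3 t3b (rt (3 / 7)),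
      e t3b t3b t1p (-exp (I * α) / (2 * rt 2)), e t3b t3b t1q (-exp (-I * α) / (2 * rt 2)),
      e t3b t3b t3 (rt (3 / 14) / 2), e t3b t3b t3b (rt (3 / 14) / 2)]⟩,
  ⟨g6, .n, 2, factors [e t3 t3 t1p (-1 / (2 * rt 2)), e t3 t3 t1q (1 / (2 * rt 2)), e t3 t3 t3 (I / (2 * rt 2)),
      e t3 t3 t3b (I / (2 * rt 2)), ea t3 t3b t3b (I / rt 2), ea t3b t3 t3 (-I / rt 2),
      e t3b t3b t1p (1 / (2 * rt 2)), e t3b t3b t1q (-1 / (2 * rt 2)),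
      e t3b t3b t3 (-I / (2 * rt 2)), e t3b t3b t3b (-I / (2 * rt 2))]⟩,
  ⟨g7, .n, 1, factors [e t1 t3 t3b (1 / rt 2), e t1 t3b t3 (1 / rt 2),
      e t3 t3 t1p (I * rt 7 * ω ^ 2 / (4 * rt 3) * exp (I * α - 2 * I * β)),
      e t3 t3 t1q (-I * rt 7 * ω / (4 * rt 3) * exp (2 * I * β - I * α)),
      e t3 t3 t3 ((rt 2 - 3) / (4 * rt 3)), e t3 t3 t3b (-(1 + rt 2) / (4 * rt 3)),
      e t3 t3b t3 (1 / (2 * rt 6)), es t3 t3b t3b (-(1 + 2 * rt 2) / (4 * rt 3)),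
      ea t3 t3b t3b (rt 3 / 4), es t3b t3 t3 (-(1 + 2 * rt 2) / (4 * rt 3)),
      ea t3b t3 t3 (rt 3 / 4), e t3b t3 t3b (1 / (2 * rt 6)),
      e t3b t3b t1p (1 / 4 * I * rt (7 / 3) * ω ^ 2 * exp (I * α - 2 * I * β)),
      e t3b t3b t1q (-1 / 4 * I * rt (7 / 3) * ω * exp (2 * I * β - I * α)),
      e t3b t3b t3 (-(1 + rt 2) / (4 * rt 3)), e t3b t3b t3b ((rt 2 - 3) / (4 * rt 3))]⟩,
  ⟨g7, .n, 2, factors [e t1 t3 t3b (I / rt 2), e t1 t3b t3 (-I / rt 2),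
      e t3 t3 t1p (-rt 7 * ω / (4 * rt 3) * exp (2 * I * β - I * α)),
      e t3 t3 t1q (rt 7 * ω ^ 2 / (4 * rt 3) * exp (I * α - 2 * I * β)),
      e t3 t3 t3 (-I * (3 + rt 2) / (4 * rt 3)), e t3 t3 t3b (I * (rt 2 - 1) / (4 * rt 3)),
      e t3 t3b t3 (I / (2 * rt 6)), es t3 t3b t3b (1 / 12 * I * (2 * rt 6 - rt 3)),
      ea t3 t3b t3b (I * rt 3 / 4), es t3b t3 t3 (-I * (2 * rt 2 - 1) / (4 * rt 3)),
      ea t3b t3 t3 (-I * rt 3 / 4), e t3b t3 t3b (-I / (2 * rt 6)),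
      e t3b t3b t1p (1 / 4 * rt (7 / 3) * ω * exp (2 * I * β - I * α)),
      e t3b t3b t1q (-1 / 4 * rt (7 / 3) * ω ^ 2 * exp (I * α - 2 * I * β)),
      e t3b t3b t3 (-I * (rt 2 - 1) / (4 * rt 3)), e t3b t3b t3b (I * (3 + rt 2) / (4 * rt 3))]⟩,
  ⟨g8, .n, 1, factors [e t1p t3 t3b (-I * exp (-I * β) / rt 2), e t1p t3b t3 (-I * exp (-I * β) / rt 2),
      e t1q t3 t3b (I * exp (I * β) / rt 2), e t1q t3b t3 (I * exp (I * β) / rt 2),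
      e t3 t3 t1p (I * exp (I * β) / rt 6), e t3 t3 t1q (-I * exp (-I * β) / rt 6),
      e t3 t3 t3 (-rt ((5 + 3 * √2) / 42)), e t3 t3 t3b (rt ((6 - 2 * √2) / 21)),
      e t3 t3b t3 (-rt ((5 + 3 * √2) / 42)), es t3 t3b t3b (rt ((3 - √2) / 21)),
      es t3b t3 t3 (rt ((3 - √2) / 21)), e t3b t3 t3b (-rt ((5 + 3 * √2) / 42)),
      e t3b t3b t1p (I * exp (I * β) / rt 6), e t3b t3b t1q (-I * exp (-I * β) / rt 6),
      e t3b t3b t3 (rt ((6 - 2 * √2) / 21)), e t3b t3b t3b (-rt ((5 + 3 * √2) / 42))]⟩,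
  ⟨g8, .n, 2, factors [e t1p t3 t3b (ω * exp (I * β - I * α) / rt 2),
      e t1p t3b t3 (-ω * exp (I * β - I * α) / rt 2),
      e t1q t3 t3b (-ω ^ 2 * exp (I * α - I * β) / rt 2),
      e t1q t3b t3 (ω ^ 2 * exp (I * α - I * β) / rt 2),
      e t3 t3 t1p (-ω ^ 2 * exp (I * α - I * β) / rt 6),
      e t3 t3 t1q (ω * exp (I * β - I * α) / rt 6), e t3 t3 t3 (I * rt ((5 - 3 * √2) / 42)),
      e t3 t3 t3b (I * rt ((6 + 2 * √2) / 21)), e t3 t3b t3 (-I * rt ((5 - 3 * √2) / 42)),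
      es t3 t3b t3b (-I * rt ((3 + √2) / 21)), es t3b t3 t3 (I * rt ((3 + √2) / 21)),
      e t3b t3 t3b (I * rt ((5 - 3 * √2) / 42)),
      e t3b t3b t1p (ω ^ 2 * exp (I * α - I * β) / rt 6),
      e t3b t3b t1q (-ω * exp (I * β - I * α) / rt 6),
      e t3b t3b t3 (-I * rt ((6 + 2 * √2) / 21)), e t3b t3b t3b (-I * rt ((5 - 3 * √2) / 42))]⟩]

def tableT77 : List (Channel T7Irrep) := [
  ⟨g1, .s, 1, factors [e t1 t1 t1 (1 / rt 7), e t1 t3 t3b (rt (3 / 7)), e t1 t3b t3 (rt (3 / 7))]⟩,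
  ⟨g6, .s, 1, factors [e t3 t1 t3 (1 / rt 7), e t3 t3 t1 (1 / rt 7), e t3 t3 t3 (1 / 14 * (2 * rt 7 + rt 14)),
      e t3 t3 t3b (-1 / rt 7), e t3 t3b t3 (-1 / rt 7),
      es t3 t3b t3b (1 / 14 * (rt 14 - 2 * rt 7)), e t3b t1 t3b (1 / rt 7),
      e t3b t3b t1 (1 / rt 7), es t3b t3 t3 (1 / 14 * (rt 14 - 2 * rt 7)),
      e t3b t3 t3b (-1 / rt 7), e t3b t3b t3 (-1 / rt 7),
      e t3b t3b t3b (1 / 14 * (2 * rt 7 + rt 14))]⟩,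
  ⟨g6, .s, 2, factors [e t3 t1 t3 (I / rt 7), e t3 t3 t1 (I / rt 7), e t3 t3 t3 (I * (rt 2 - 2) / (2 * rt 7)),
      e t3 t3 t3b (I / rt 7), e t3 t3b t3 (I / rt 7),
      es t3 t3b t3b (-1 / 14 * I * (2 * rt 7 + rt 14)), e t3b t1 t3b (-I / rt 7),
      e t3b t3b t1 (-I / rt 7), es t3b t3 t3 (1 / 14 * I * (2 * rt 7 + rt 14)),
      e t3b t3 t3b (-I / rt 7), e t3b t3b t3 (-I / rt 7),
      e t3b t3b t3b (-1 / 14 * I * (rt 14 - 2 * rt 7))]⟩,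
  ⟨g7, .s, 1, factors [e t1 t1 t1 (rt (6 / 7)), e t1 t3 t3b (-1 / rt 14), e t1 t3b t3 (-1 / rt 14),
      e t3 t1 t3 (-1 / rt 42), e t3 t3 t1 (-1 / rt 42), e t3 t3 t3 (-2 / rt 21),
      e t3 t3 t3b (-2 / rt 21), e t3 t3b t3 (-2 / rt 21), es t3 t3b t3b (-2 * rt (2 / 21)),
      e t3b t1 t3b (-1 / rt 42), e t3b t3b t1 (-1 / rt 42), es t3b t3 t3 (-2 * rt (2 / 21)),
      e t3b t3 t3b (-2 / rt 21), e t3b t3b t3 (-2 / rt 21), e t3b t3b t3b (-2 / rt 21)]⟩,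
  ⟨g8, .s, 1, factors [e t1p t3 t3b (I * exp (-I * α) / rt 2), e t1p t3b t3 (I * exp (-I * α) / rt 2),
      e t1q t3 t3b (-I * exp (I * α) / rt 2), e t1q t3b t3 (-I * exp (I * α) / rt 2),
      e t3 t1 t3 (-2 / rt 21), e t3 t3 t1 (-2 / rt 21), e t3 t3 t3 (2 * rt (2 / 21)),
      e t3 t3 t3b (1 / rt 42), e t3 t3b t3 (1 / rt 42), es t3 t3b t3b (-2 / rt 21),
      e t3b t1 t3b (-2 / rt 21), e t3b t3b t1 (-2 / rt 21), es t3b t3 t3 (-2 / rt 21),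
      e t3b t3 t3b (1 / rt 42), e t3b t3b t3 (1 / rt 42), e t3b t3b t3b (2 * rt (2 / 21))]⟩,
  ⟨g3, .a, 1, factors [e t3 t1 t3 (1 / rt 7), e t3 t3 t1 (-1 / rt 7), e t3 t3 t3b (rt (2 / 7)),
      e t3 t3b t3 (-rt (2 / 7)), ea t3 t3b t3b (1 / rt 7)]⟩,
  ⟨g3b, .a, 1, factors [e t3b t1 t3b (1 / rt 7), e t3b t3b t1 (-1 / rt 7), ea t3b t3 t3 (1 / rt 7),
      e t3b t3 t3b (-rt (2 / 7)), e t3b t3b t3 (rt (2 / 7))]⟩,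
  ⟨g7, .a, 1, factors [e t1 t3 t3b (I / rt 2), e t1 t3b t3 (-I / rt 2), e t3 t1 t3 (I / rt 6),
      e t3 t3 t1 (-I / rt 6), ea t3 t3b t3b (-I * rt (2 / 3)), e t3b t1 t3b (-I / rt 6),
      e t3b t3b t1 (I / rt 6), ea t3b t3 t3 (I * rt (2 / 3))]⟩,
  ⟨g8, .a, 1, factors [e t1p t3 t3b (exp (I * α) / rt 2), e t1p t3b t3 (-exp (I * α) / rt 2),
      e t1q t3 t3b (-exp (-I * α) / rt 2), e t1q t3b t3 (exp (-I * α) / rt 2),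
      e t3 t1 t3 (2 * I / rt 21), e t3 t3 t1 (-2 * I / rt 21), e t3 t3 t3b (-I * rt (3 / 14)),
      e t3 t3b t3 (I * rt (3 / 14)), ea t3 t3b t3b (2 * I / rt 21),
      e t3b t1 t3b (-2 * I / rt 21), e t3b t3b t1 (2 * I / rt 21), ea t3b t3 t3 (-2 * I / rt 21),
      e t3b t3 t3b (-I * rt (3 / 14)), e t3b t3b t3 (I * rt (3 / 14))]⟩]

def tableT78 : List (Channel T7Irrep) := [
  ⟨g3, .n, 1, factors [e t3 t1 t3 (1 / rt 7), e t3 t3 t1p (-I * exp (I * α) / (2 * rt 2)),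
      e t3 t3 t1q (I * exp (-I * α) / (2 * rt 2)), e t3 t3 t3 (-3 / (2 * rt 14)),
      e t3 t3 t3b (1 / (2 * rt 14)), e t3 t3b t3 (1 / rt 14), es t3 t3b t3b (3 / (2 * rt 7)),
      ea t3 t3b t3b (-1 / (2 * rt 7))]⟩,
  ⟨g3b, .n, 1, factors [e t3b t1 t3b (1 / rt 7), es t3b t3 t3 (3 / (2 * rt 7)), ea t3b t3 t3 (-1 / (2 * rt 7)),
      e t3b t3 t3b (1 / rt 14), e t3b t3b t1p (-I * exp (I * α) / (2 * rt 2)),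
      e t3b t3b t1q (I * exp (-I * α) / (2 * rt 2)), e t3b t3b t3 (1 / (2 * rt 14)),
      e t3b t3b t3b (-3 / (2 * rt 14))]⟩,
  ⟨g6, .n, 1, factors [e t3 t1 t3 (1 / rt 7), e t3 t3 t1p (I * ω ^ 2 * exp (I * α - 2 * I * β) / (2 * rt 2)),
      e t3 t3 t1q (-I * ω * exp (2 * I * β - I * α) / (2 * rt 2)),
      e t3 t3 t3 (-(2 + rt 2) / (4 * rt 7)), e t3 t3 t3b (-(3 * rt 2 - 2) / (4 * rt 7)),
      e t3 t3b t3 (1 / (2 * rt 7)), es t3 t3b t3b (-(4 + rt 2) / (4 * rt 7)),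
      ea t3 t3b t3b (-3 / (2 * rt 14)), e t3b t1 t3b (1 / rt 7),
      es t3b t3 t3 (-(4 + rt 2) / (4 * rt 7)), ea t3b t3 t3 (-3 / (2 * rt 14)),
      e t3b t3 t3b (1 / (2 * rt 7)),
      e t3b t3b t1p (I * ω ^ 2 * exp (I * α - 2 * I * β) / (2 * rt 2)),
      e t3b t3b t1q (-I * ω * exp (2 * I * β - I * α) / (2 * rt 2)),
      e t3b t3b t3 (-(3 * rt 2 - 2) / (4 * rt 7)), e t3b t3b t3b (-(2 + rt 2) / (4 * rt 7))]⟩,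
  ⟨g6, .n, 2, factors [e t3 t1 t3 (I / rt 7), e t3 t3 t1p (-ω * exp (2 * I * β - I * α) / (2 * rt 2)),
      e t3 t3 t1q (ω ^ 2 * exp (I * α - 2 * I * β) / (2 * rt 2)),
      e t3 t3 t3 (-I * (rt 2 - 2) / (4 * rt 7)), e t3 t3 t3b (-I * (2 + 3 * rt 2) / (4 * rt 7)),
      e t3 t3b t3 (-I / (2 * rt 7)), es t3 t3b t3b (I * (rt 2 - 4) / (4 * rt 7)),
      ea t3 t3b t3b (3 * I / (2 * rt 14)), e t3b t1 t3b (-I / rt 7),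
      es t3b t3 t3 (-I * (rt 2 - 4) / (4 * rt 7)), ea t3b t3 t3 (-3 * I / (2 * rt 14)),
      e t3b t3 t3b (I / (2 * rt 7)), e t3b t3b t1p (ω * exp (2 * I * β - I * α) / (2 * rt 2)),
      e t3b t3b t1q (-ω ^ 2 * exp (I * α - 2 * I * β) / (2 * rt 2)),
      e t3b t3b t3 (I * (2 + 3 * rt 2) / (4 * rt 7)), e t3b t3b t3b (I * (rt 2 - 2) / (4 * rt 7))]⟩,
  ⟨g7, .n, 1, factors [e t1 t3 t3b (1 / rt 2), e t1 t3b t3 (1 / rt 2), e t3 t1 t3 (1 / rt 6),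
      e t3 t3 t1p (1 / 4 * I * rt (7 / 3) * exp (I * α)),
      e t3 t3 t1q (-1 / 4 * I * rt (7 / 3) * exp (-I * α)), e t3 t3 t3 (-1 / (4 * rt 3)),
      e t3 t3 t3b (-1 / (4 * rt 3)), e t3 t3b t3 (-1 / rt 3), es t3 t3b t3b (1 / rt 6),
      e t3b t1 t3b (1 / rt 6), es t3b t3 t3 (1 / rt 6), e t3b t3 t3b (-1 / rt 3),
      e t3b t3b t1p (1 / 4 * I * rt (7 / 3) * exp (I * α)),
      e t3b t3b t1q (-1 / 4 * I * rt (7 / 3) * exp (-I * α)), e t3b t3b t3 (-1 / (4 * rt 3)),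
      e t3b t3b t3b (-1 / (4 * rt 3))]⟩,
  ⟨g7, .n, 2, factors [e t1 t3 t3b (I / rt 2), e t1 t3b t3 (-I / rt 2), e t3 t1 t3 (I / rt 6),
      e t3 t3 t1p (1 / 4 * rt (7 / 3) * exp (-I * α)),
      e t3 t3 t1q (-1 / 4 * rt (7 / 3) * exp (I * α)), e t3 t3 t3 (I * rt 3 / 4),
      e t3 t3 t3b (I * rt 3 / 4), ea t3 t3b t3b (I / rt 6), e t3b t1 t3b (-I / rt 6),
      ea t3b t3 t3 (-I / rt 6), e t3b t3b t1p (-1 / 4 * rt (7 / 3) * exp (-I * α)),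
      e t3b t3b t1q (1 / 4 * rt (7 / 3) * exp (I * α)), e t3b t3b t3 (-I * rt 3 / 4),
      e t3b t3b t3b (-I * rt 3 / 4)]⟩,
  ⟨g8, .n, 1, factors [e t1p t1 t1p ((3 * rt 3 - 4 * I) / rt 91), e t1p t3 t3b (-2 * rt (6 / 91)),
      e t1p t3b t3 (-2 * rt (6 / 91)), e t1q t1 t1q ((3 * rt 3 + 4 * I) / rt 91),
      e t1q t3 t3b (-2 * rt (6 / 91)), e t1q t3b t3 (-2 * rt (6 / 91)),
      e t3 t1 t3 (-rt (3 / 91)), e t3 t3 t1p (2 * rt (2 / 91) * ω ^ 2),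
      e t3 t3 t1q (2 * rt (2 / 91) * ω), e t3 t3 t3 (2 * rt (6 / 91)),
      e t3 t3 t3b (-2 * rt (6 / 91)), es t3 t3b t3b (2 * rt (3 / 91)),
      ea t3 t3b t3b (-2 * rt (3 / 91)), e t3b t1 t3b (-rt (3 / 91)),
      es t3b t3 t3 (2 * rt (3 / 91)), ea t3b t3 t3 (-2 * rt (3 / 91)),
      e t3b t3b t1p (2 * rt (2 / 91) * ω ^ 2), e t3b t3b t1q (2 * rt (2 / 91) * ω),
      e t3b t3b t3 (-2 * rt (6 / 91)), e t3b t3b t3b (2 * rt (6 / 91))]⟩,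
  ⟨g8, .n, 2, factors [e t1p t1 t1p (-4 * rt (3 / 91) * ω ^ 2), e t1p t3 t3b (-(rt 3 - 13 * I) / (2 * rt 182)),
      e t1p t3b t3 (-(rt 3 - 13 * I) / (2 * rt 182)), e t1q t1 t1q (-4 * rt (3 / 91) * ω),
      e t1q t3 t3b (-(rt 3 + 13 * I) / (2 * rt 182)),
      e t1q t3b t3 (-(rt 3 + 13 * I) / (2 * rt 182)), e t3 t1 t3 (-2 / rt 273),
      e t3 t3 t1p (I * (5 * rt 3 + 21 * I) / (6 * rt 182)),
      e t3 t3 t1q (-I * (5 * rt 3 - 21 * I) / (6 * rt 182)), e t3 t3 t3 (-5 / rt 546),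
      e t3 t3 t3b (-4 * rt (2 / 273)), e t3 t3b t3 (rt (13 / 42)), es t3 t3b t3b (4 / rt 273),
      ea t3 t3b t3b (3 * rt (3 / 91)), e t3b t1 t3b (-2 / rt 273), es t3b t3 t3 (4 / rt 273),
      ea t3b t3 t3 (3 * rt (3 / 91)), e t3b t3 t3b (rt (13 / 42)),
      e t3b t3b t1p (I * (5 * rt 3 + 21 * I) / (6 * rt 182)),
      e t3b t3b t1q (-I * (5 * rt 3 - 21 * I) / (6 * rt 182)), e t3b t3b t3 (-4 * rt (2 / 273)),
      e t3b t3b t3b (-5 / rt 546)]⟩,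
  ⟨g8, .n, 3, factors [e t1p t3 t3b (-exp (-I * α) * ω ^ 2 / rt 2), e t1p t3b t3 (exp (-I * α) * ω ^ 2 / rt 2),
      e t1q t3 t3b (exp (I * α) * ω / rt 2), e t1q t3b t3 (-exp (I * α) * ω / rt 2),
      e t3 t1 t3 (-2 * I / rt 21), e t3 t3 t1p (-exp (I * α) * ω / rt 6),
      e t3 t3 t1q (exp (-I * α) * ω ^ 2 / rt 6), e t3 t3 t3 (-I * rt (3 / 14)),
      e t3 t3b t3 (-I * rt (3 / 14)), ea t3 t3b t3b (I / rt 21), e t3b t1 t3b (2 * I / rt 21),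
      ea t3b t3 t3 (-I / rt 21), e t3b t3 t3b (I * rt (3 / 14)),
      e t3b t3b t1p (exp (I * α) * ω / rt 6), e t3b t3b t1q (-exp (-I * α) * ω ^ 2 / rt 6),
      e t3b t3b t3b (I * rt (3 / 14))]⟩]

def tableT88 : List (Channel T7Irrep) := [
  ⟨g1, .s, 1, factors [e t1 t1p t1q (1 / (2 * rt 2)), e t1 t1q t1p (1 / (2 * rt 2)), e t1 t3 t3b (rt (3 / 2) / 2),
      e t1 t3b t3 (rt (3 / 2) / 2)]⟩,
  ⟨g6, .s, 1, factors [e t3 t1p t3 (I * exp (I * β) / (2 * rt 2)), e t3 t3 t1p (I * exp (I * β) / (2 * rt 2)),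
      e t3 t1q t3 (-I * exp (-I * β) / (2 * rt 2)), e t3 t3 t1q (-I * exp (-I * β) / (2 * rt 2)),
      e t3 t3 t3 (rt (1 / 14 * (3 - √2))), e t3 t3 t3b (-1 / 2 * rt (1 / 14 * (5 + 3 * √2))),
      e t3 t3b t3 (-1 / 2 * rt (1 / 14 * (5 + 3 * √2))),
      es t3 t3b t3b (1 / 2 * rt (1 / 7 * (3 - √2))),
      e t3b t1p t3b (I * exp (I * β) / (2 * rt 2)), e t3b t3b t1p (I * exp (I * β) / (2 * rt 2)),
      e t3b t1q t3b (-I * exp (-I * β) / (2 * rt 2)),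
      e t3b t3b t1q (-I * exp (-I * β) / (2 * rt 2)),
      es t3b t3 t3 (1 / 2 * rt (1 / 7 * (3 - √2))),
      e t3b t3 t3b (-1 / 2 * rt (1 / 14 * (5 + 3 * √2))),
      e t3b t3b t3 (-1 / 2 * rt (1 / 14 * (5 + 3 * √2))), e t3b t3b t3b (rt (1 / 14 * (3 - √2)))]⟩,
  ⟨g6, .s, 2, factors [e t3 t1p t3 (-ω ^ 2 * exp (I * α - I * β) / (2 * rt 2)),
      e t3 t3 t1p (-ω ^ 2 * exp (I * α - I * β) / (2 * rt 2)),
      e t3 t1q t3 (ω * exp (I * β - I * α) / (2 * rt 2)),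
      e t3 t3 t1q (ω * exp (I * β - I * α) / (2 * rt 2)),
      e t3 t3 t3 (I * rt (1 / 14 * (3 + √2))),
      e t3 t3 t3b (1 / 2 * I * rt (1 / 14 * (5 - 3 * √2))),
      e t3 t3b t3 (1 / 2 * I * rt (1 / 14 * (5 - 3 * √2))),
      es t3 t3b t3b (1 / 2 * I * rt (1 / 7 * (3 + √2))),
      e t3b t1p t3b (ω ^ 2 * exp (I * α - I * β) / (2 * rt 2)),
      e t3b t3b t1p (ω ^ 2 * exp (I * α - I * β) / (2 * rt 2)),
      e t3b t1q t3b (-ω * exp (I * β - I * α) / (2 * rt 2)),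
      e t3b t3b t1q (-ω * exp (I * β - I * α) / (2 * rt 2)),
      es t3b t3 t3 (-1 / 2 * I * rt (1 / 7 * (3 + √2))),
      e t3b t3 t3b (-1 / 2 * I * rt (1 / 14 * (5 - 3 * √2))),
      e t3b t3b t3 (-1 / 2 * I * rt (1 / 14 * (5 - 3 * √2))),
      e t3b t3b t3b (-I * rt (1 / 14 * (3 + √2)))]⟩,
  ⟨g7, .s, 1, factors [e t1 t1p t1q (rt (3 / 2) / 2), e t1 t1q t1p (rt (3 / 2) / 2),
      e t1 t3 t3b (-1 / (2 * rt 2)), e t1 t3b t3 (-1 / (2 * rt 2)),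
      e t3 t1p t3 (I * ω / (2 * rt 3)), e t3 t3 t1p (I * ω / (2 * rt 3)),
      e t3 t1q t3 (-I * ω ^ 2 / (2 * rt 3)), e t3 t3 t1q (-I * ω ^ 2 / (2 * rt 3)),
      e t3 t3 t3 (-1 / rt 3), e t3 t3 t3b (1 / (2 * rt 3)), e t3 t3b t3 (1 / (2 * rt 3)),
      es t3 t3b t3b (1 / rt 6), e t3b t1p t3b (I * ω / (2 * rt 3)),
      e t3b t3b t1p (I * ω / (2 * rt 3)), e t3b t1q t3b (-I * ω ^ 2 / (2 * rt 3)),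
      e t3b t3b t1q (-I * ω ^ 2 / (2 * rt 3)), es t3b t3 t3 (1 / rt 6),
      e t3b t3 t3b (1 / (2 * rt 3)), e t3b t3b t3 (1 / (2 * rt 3)), e t3b t3b t3b (-1 / rt 3)]⟩,
  ⟨g8, .s, 1, factors [e t1p t1q t1q (-ω ^ 2 / rt 3), e t1p t3 t3b (-I / rt 3), e t1p t3b t3 (-I / rt 3),
      e t1q t1p t1p (-ω / rt 3), e t1q t3 t3b (I / rt 3), e t1q t3b t3 (I / rt 3),
      e t3 t1p t3 (I / 3), e t3 t3 t1p (I / 3), e t3 t1q t3 (-I / 3), e t3 t3 t1q (-I / 3),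
      e t3 t3 t3 (1 / 3), e t3 t3 t3b (1 / 3), e t3 t3b t3 (1 / 3), es t3 t3b t3b (rt 2 / 3),
      e t3b t1p t3b (I / 3), e t3b t3b t1p (I / 3), e t3b t1q t3b (-I / 3),
      e t3b t3b t1q (-I / 3), es t3b t3 t3 (rt 2 / 3), e t3b t3 t3b (1 / 3),
      e t3b t3b t3 (1 / 3), e t3b t3b t3b (1 / 3)]⟩,
  ⟨g8, .s, 2, factors [e t1p t1q t1q (rt (2 / 3) * exp (-I * α)), e t1p t3 t3b (-I * exp (-I * α) * ω / rt 6),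
      e t1p t3b t3 (-I * exp (-I * α) * ω / rt 6), e t1q t1p t1p (rt (2 / 3) * exp (I * α)),
      e t1q t3 t3b (I * exp (I * α) * ω ^ 2 / rt 6),
      e t1q t3b t3 (I * exp (I * α) * ω ^ 2 / rt 6),
      e t3 t1p t3 (I * exp (I * α) * ω ^ 2 / (3 * rt 2)),
      e t3 t3 t1p (I * exp (I * α) * ω ^ 2 / (3 * rt 2)),
      e t3 t1q t3 (-I * exp (-I * α) * ω / (3 * rt 2)),
      e t3 t3 t1q (-I * exp (-I * α) * ω / (3 * rt 2)), e t3 t3 t3 (-2 * rt (2 / 7) / 3),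
      e t3 t3 t3b (-2 * rt (2 / 7) / 3), e t3 t3b t3 (-2 * rt (2 / 7) / 3),
      es t3 t3b t3b (5 / (3 * rt 7)), e t3b t1p t3b (I * exp (I * α) * ω ^ 2 / (3 * rt 2)),
      e t3b t3b t1p (I * exp (I * α) * ω ^ 2 / (3 * rt 2)),
      e t3b t1q t3b (-I * exp (-I * α) * ω / (3 * rt 2)),
      e t3b t3b t1q (-I * exp (-I * α) * ω / (3 * rt 2)), es t3b t3 t3 (5 / (3 * rt 7)),
      e t3b t3 t3b (-2 * rt (2 / 7) / 3), e t3b t3b t3 (-2 * rt (2 / 7) / 3),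
      e t3b t3b t3b (-2 * rt (2 / 7) / 3)]⟩,
  ⟨g3, .a, 1, factors [e t3 t1p t3 (1 / (2 * rt 2)), e t3 t3 t1p (-1 / (2 * rt 2)), e t3 t1q t3 (-ω / (2 * rt 2)),
      e t3 t3 t1q (ω / (2 * rt 2)), e t3 t3 t3b (I * ω ^ 2 / (2 * rt 2)),
      e t3 t3b t3 (-I * ω ^ 2 / (2 * rt 2)), ea t3 t3b t3b (-I * ω ^ 2 / 2)]⟩,
  ⟨g3b, .a, 1, factors (rephase (-ω ^ 2) [e t3b t1p t3b (1 / (2 * rt 2)), e t3b t3b t1p (-1 / (2 * rt 2)),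
      e t3b t1q t3b (-ω / (2 * rt 2)), e t3b t3b t1q (ω / (2 * rt 2)),
      ea t3b t3 t3 (-I * ω ^ 2 / 2), e t3b t3 t3b (-I * ω ^ 2 / (2 * rt 2)),
      e t3b t3b t3 (I * ω ^ 2 / (2 * rt 2))])⟩,
  ⟨g7, .a, 1, factors [e t1 t1p t1q (I / rt 2), e t1 t1q t1p (-I / rt 2), e t3 t1p t3 (ω / 4),
      e t3 t3 t1p (-ω / 4), e t3 t1q t3 (ω ^ 2 / 4), e t3 t3 t1q (-ω ^ 2 / 4),
      e t3 t3 t3b (rt 3 / 4), e t3 t3b t3 (-rt 3 / 4), ea t3 t3b t3b (rt (3 / 2) / 2),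
      e t3b t1p t3b (ω / 4), e t3b t3b t1p (-ω / 4), e t3b t1q t3b (ω ^ 2 / 4),
      e t3b t3b t1q (-ω ^ 2 / 4), ea t3b t3 t3 (rt (3 / 2) / 2), e t3b t3 t3b (-rt 3 / 4),
      e t3b t3b t3 (rt 3 / 4)]⟩,
  ⟨g7, .a, 2, factors [e t1 t3 t3b (I / rt 2), e t1 t3b t3 (-I / rt 2),
      e t3 t1p t3 (-1 / 4 * rt (7 / 3) * exp (I * α) * ω),
      e t3 t3 t1p (1 / 4 * rt (7 / 3) * exp (I * α) * ω),
      e t3 t1q t3 (1 / 4 * rt (7 / 3) * exp (-I * α) * ω ^ 2),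
      e t3 t3 t1q (-1 / 4 * rt (7 / 3) * exp (-I * α) * ω ^ 2), e t3 t3 t3b (I * rt 3 / 4),
      e t3 t3b t3 (-I * rt 3 / 4), ea t3 t3b t3b (-I / (2 * rt 6)),
      e t3b t1p t3b (1 / 4 * rt (7 / 3) * exp (I * α) * ω),
      e t3b t3b t1p (-1 / 4 * rt (7 / 3) * exp (I * α) * ω),
      e t3b t1q t3b (-1 / 4 * rt (7 / 3) * exp (-I * α) * ω ^ 2),
      e t3b t3b t1q (1 / 4 * rt (7 / 3) * exp (-I * α) * ω ^ 2), ea t3b t3 t3 (I / (2 * rt 6)),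
      e t3b t3 t3b (I * rt 3 / 4), e t3b t3b t3 (-I * rt 3 / 4)]⟩,
  ⟨g8, .a, 1, factors [e t1p t3 t3b (-ω / rt 2), e t1p t3b t3 (ω / rt 2), e t1q t3 t3b (ω ^ 2 / rt 2),
      e t1q t3b t3 (-ω ^ 2 / rt 2), e t3 t1p t3 (ω ^ 2 / rt 6), e t3 t3 t1p (-ω ^ 2 / rt 6),
      e t3 t1q t3 (-ω / rt 6), e t3 t3 t1q (ω / rt 6), ea t3 t3b t3b (-I / rt 3),
      e t3b t1p t3b (-ω ^ 2 / rt 6), e t3b t3b t1p (ω ^ 2 / rt 6), e t3b t1q t3b (ω / rt 6),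
      e t3b t3b t1q (-ω / rt 6), ea t3b t3 t3 (I / rt 3)]⟩]

/-- The contractions of `X ⊗ Y` in the `T₇` basis. -/
def tableT : GIrrep → GIrrep → List (Channel T7Irrep)
  | g1, Y => [trivialChannel t1 contentT Y]
  | g3, g3 => tableT33
  | g3b, g3b => tableT33.map (Channel.conj T7Irrep.bar)
  | g3, g3b => tableT33b
  | g3, g6 => tableT36
  | g3b, g6 => tableT36.map (Channel.conj T7Irrep.bar)
  | g3, g7 => tableT37
  | g3b, g7 => tableT37.map (Channel.conj T7Irrep.bar)
  | g3, g8 => tableT38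
  | g3b, g8 => tableT38.map (Channel.conj T7Irrep.bar)
  | g6, g6 => tableT66
  | g6, g7 => tableT67
  | g6, g8 => tableT68
  | g7, g7 => tableT77
  | g7, g8 => tableT78
  | g8, g8 => tableT88
  | _, _ => []

/-- The basis of the irreps of `PSL₂(7)` adapted to `T₇`. -/
def basisT : AdaptedBasis T7Irrep where
  dim := T7Irrep.dim
  bar := T7Irrep.bar
  gen₁ := gen₁T
  gen₂ := gen₂T
  conjMat := conjMatT
  cg := cgT
  matA := matAT
  matB := matBT
  content := contentT
  proj := projT
  table := tableT

/-! ### Representations -/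

/-- The representation on `ℂⁿ` given by matrices. -/
def toRep {G : Type} [Group G] {n : ℕ} (ρ : G →* Matrix (Fin n) (Fin n) ℂ) :
    Representation ℂ G (Fin n → ℂ) :=
  (MonoidHomClass.toMonoidHom
    (Matrix.toLinAlgEquiv' : Matrix (Fin n) (Fin n) ℂ ≃ₐ[ℂ] ((Fin n → ℂ) →ₗ[ℂ] (Fin n → ℂ)))).comp ρ

end

/-- The matrix representations `ρ k` are unitary and are, up to equivalence, all the irreducible
finite-dimensional complex representations of `G`, each of them once. -/
structure IsIrrepList {G : Type} [Group G] {κ : Type} {dim : κ → ℕ}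
    (ρ : (k : κ) → G →* Matrix (Fin (dim k)) (Fin (dim k)) ℂ) : Prop where
  unitary : ∀ k g, ρ k g ∈ Matrix.unitaryGroup (Fin (dim k)) ℂ
  irreducible : ∀ k, (toRep (ρ k)).IsIrreducible
  inequivalent : ∀ k l, Nonempty ((toRep (ρ k)).Equiv (toRep (ρ l))) → k = l
  exhaustive : ∀ (V : Type) [AddCommGroup V] [Module ℂ V] [FiniteDimensional ℂ V]
    (τ : Representation ℂ G V), τ.IsIrreducible → ∃ k, Nonempty (τ.Equiv (toRep (ρ k)))

namespace AdaptedBasis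

variable {ι : Type} [Fintype ι] (D : AdaptedBasis ι) {G : Type} [Group G] {H : Subgroup G}

/-- `ρ` and `σ` are the irreps of `G` and of its subgroup `H` in the given basis: the generators
`A`, `B` of `G` and `h₁`, `h₂` of `H` are represented by the given matrices. -/
structure IsRealizedBy (A B : G) (h₁ h₂ : H)
    (ρ : (X : GIrrep) → G →* Matrix (Fin X.dim) (Fin X.dim) ℂ)
    (σ : (x : ι) → H →* Matrix (Fin (D.dim x)) (Fin (D.dim x)) ℂ) : Prop where
  map_A : ∀ X, ρ X A = D.matA X
  map_B : ∀ X, ρ X B = D.matB X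
  map_gen₁ : ∀ x, σ x h₁ = D.gen₁ x
  map_gen₂ : ∀ x, σ x h₂ = D.gen₂ x
  irreps : IsIrrepList ρ
  irreps_sub : IsIrrepList σ

/-- The basis of each `X` is adapted to `H`: the projection matrices bring the restriction of `X`
to `H` into block form, the blocks being the irreps `x` of `H` contained in `X`. -/
structure IsAdapted (ρ : (X : GIrrep) → G →* Matrix (Fin X.dim) (Fin X.dim) ℂ)
    (σ : (x : ι) → H →* Matrix (Fin (D.dim x)) (Fin (D.dim x)) ℂ) : Prop where
  nodup : ∀ X, (D.content X).Nodup
  proj_eq_zero : ∀ X, ∀ x, x ∉ D.content X → D.proj X x = 0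
  diag : ∀ X, ∀ x ∈ D.content X, ∀ h : H, D.proj X x * ρ X h * (D.proj X x)ᴴ = σ x h
  offdiag : ∀ X x y, x ≠ y → ∀ h : H, D.proj X x * ρ X h * (D.proj X y)ᴴ = 0
  complete : ∀ X, ∑ x, (D.proj X x)ᴴ * D.proj X x = 1

/-- The matrices `cg` are CG coefficients of `H`: they intertwine, each of them is orthonormal,
and for every pair `x`, `y` they give the complete decomposition of `x ⊗ y`. -/
structure IsSubgroupCG (σ : (x : ι) → H →* Matrix (Fin (D.dim x)) (Fin (D.dim x)) ℂ) :
    Prop where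
  intertwine : ∀ x y z k, ∀ h : H, D.cg x y z k * (σ x h ⊗ₖ σ y h) = σ z h * D.cg x y z k
  orthonormal : ∀ x y z k, D.cg x y z k ≠ 0 → D.cg x y z k * (D.cg x y z k)ᴴ = 1
  complete : ∀ x y, ∑ z, ∑ k, (D.cg x y z k)ᴴ * D.cg x y z k = 1

/-- The embedding factors of a contraction `X ⊗ Y → Z` satisfy the defining equations. -/
structure IsContraction (ρ : (X : GIrrep) → G →* Matrix (Fin X.dim) (Fin X.dim) ℂ)
    (X Y Z : GIrrep) (E : ι → ι → ι → Label → ℂ) : Prop where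
  /-- Only subgroup contractions that occur have nonzero coefficients. -/
  support : ∀ c a b k, E c a b k ≠ 0 →
    c ∈ D.content Z ∧ a ∈ D.content X ∧ b ∈ D.content Y ∧ D.cg a b c k ≠ 0
  /-- `P_{Z→c} ρ_Z(g) Z = ∑ E_{c,ab} {(P_{X→a} ρ_X(g) X) ⊗ (P_{Y→b} ρ_Y(g) Y)}_{z_c}`, where `Z` is
  the contraction of `X` and `Y`. -/
  defining : ∀ c, ∀ g : G,
    D.proj Z c * ρ Z g * D.cgMat X Y Z E = D.contraction X Y E c (ρ X g) (ρ Y g)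
  /-- `∑_{a,b} |E_{c,ab}|² = 1` for every `c`. -/
  normalized : ∀ c ∈ D.content Z, ∑ a, ∑ b, ∑ k, ‖E c a b k‖ ^ 2 = 1
  /-- `M (ρ_X(g) ⊗ ρ_Y(g)) = ρ_Z(g) M` for the resulting CG coefficients `M`. -/
  intertwine : ∀ g : G, D.cgMat X Y Z E * (ρ X g ⊗ₖ ρ Y g) = ρ Z g * D.cgMat X Y Z E
  /-- `M M† = 1` -/
  orthonormal : D.cgMat X Y Z E * (D.cgMat X Y Z E)ᴴ = 1

/-- The lists of embedding factors are correct and complete for every tensor product. -/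
structure IsCompleteTable (ρ : (X : GIrrep) → G →* Matrix (Fin X.dim) (Fin X.dim) ℂ) :
    Prop where
  contraction : ∀ X Y, ∀ ch ∈ D.table X Y, D.IsContraction ρ X Y ch.target ch.emb
  /-- Different contractions of the same product are orthogonal. -/
  orthogonal : ∀ X Y, (D.table X Y).Pairwise fun ch ch' =>
    D.cgMat X Y ch.target ch.emb * (D.cgMat X Y ch'.target ch'.emb)ᴴ = 0
  /-- Every product is listed, in one of the two orders of the factors. -/
  covers : ∀ X Y, D.table X Y ≠ [] ∨ D.table Y X ≠ []
  /-- The contractions of a product together are a unitary matrix: nothing is missing. -/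
  complete : ∀ X Y, D.table X Y ≠ [] →
    ((D.table X Y).map fun ch =>
      (D.cgMat X Y ch.target ch.emb)ᴴ * D.cgMat X Y ch.target ch.emb).sum = 1
  symmetric : ∀ X, ∀ ch ∈ D.table X X, ch.sym = Label.s →
    (D.cgMat X X ch.target ch.emb).submatrix id Prod.swap = D.cgMat X X ch.target ch.emb
  antisymmetric : ∀ X, ∀ ch ∈ D.table X X, ch.sym = Label.a →
    (D.cgMat X X ch.target ch.emb).submatrix id Prod.swap = -D.cgMat X X ch.target ch.emb

/-- The phase conventions for complex conjugation. -/
structure IsConjugationCompatible (ρ : (X : GIrrep) → G →* Matrix (Fin X.dim) (Fin X.dim) ℂ)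
    (σ : (x : ι) → H →* Matrix (Fin (D.dim x)) (Fin (D.dim x)) ℂ) : Prop where
  bar_bar : ∀ x, D.bar (D.bar x) = x
  /-- `Γ_x` is unitary and `Γ_x σ_x(h)^* Γ_x† = σ_x̄(h)`. -/
  unitary_sub : ∀ x, D.conjMat x * (D.conjMat x)ᴴ = 1 ∧ (D.conjMat x)ᴴ * D.conjMat x = 1
  conj_sub : ∀ x, ∀ h : H, D.conjMat x * (σ x h).map star * (D.conjMat x)ᴴ = σ (D.bar x) h
  /-- `Γ_c ({x ⊗ y}_c)^* = {x̄ ⊗ ȳ}_c̄` -/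
  conj_cg : ∀ x y z k, D.conjMat z * (D.cg x y z k).map star =
    D.cg (D.bar x) (D.bar y) (D.bar z) k * (D.conjMat x ⊗ₖ D.conjMat y)
  /-- `Γ_X` is unitary and `Γ_X ρ_X(g)^* Γ_X† = ρ_X̄(g)`. -/
  unitary : ∀ X, D.conjMatG X * (D.conjMatG X)ᴴ = 1 ∧ (D.conjMatG X)ᴴ * D.conjMatG X = 1
  conj : ∀ X, ∀ g : G, D.conjMatG X * (ρ X g).map star * (D.conjMatG X)ᴴ = ρ X.bar g
  /-- The matrices of `3̄` are the complex conjugates of those of `3`. -/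
  conj_three : ∀ g : G, ρ .g3b g = (ρ .g3 g).map star
  conjMatG_three : D.conjMatG .g3 = (1 : Matrix (Fin 3) (Fin 3) ℂ)
  /-- `Γ_x P_{X→x}^* = P_{X̄→x̄} Γ_X` -/
  conj_proj : ∀ X x, D.conjMat x * (D.proj X x).map star = D.proj X.bar (D.bar x) * D.conjMatG X
  /-- The embedding factors of `X̄ ⊗ Ȳ → Z̄` are the complex conjugates of those of `X ⊗ Y → Z`. -/
  conj_emb : ∀ X Y, D.table X Y ≠ [] → D.table X.bar Y.bar ≠ [] → ∀ ch ∈ D.table X Y,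
    ∃ ch' ∈ D.table X.bar Y.bar, ch'.target = ch.target.bar ∧ ch'.sym = ch.sym ∧
      ch'.mult = ch.mult ∧
      ∀ c a b k, ch'.emb (D.bar c) (D.bar a) (D.bar b) k = star (ch.emb c a b k)
  /-- `Γ_Z ({X ⊗ Y}_Z)^* = {X̄ ⊗ Ȳ}_Z̄` -/
  conj_cgMat : ∀ X Y, ∀ ch ∈ D.table X Y,
    D.conjMatG ch.target * (D.cgMat X Y ch.target ch.emb).map star =
      D.cgMat X.bar Y.bar (ch.conj D.bar).target (ch.conj D.bar).emb *
        (D.conjMatG X ⊗ₖ D.conjMatG Y)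
  /-- The complex conjugate of a contraction of `3 ⊗ 3̄` is the same contraction. -/
  self_conj : ∀ ch ∈ D.table .g3 .g3b,
    ∃ ch' ∈ D.table .g3 .g3b, ch'.target = ch.target.bar ∧
      (D.cgMat .g3b .g3 ch'.target (ch.conj D.bar).emb).submatrix id Prod.swap =
        D.cgMat .g3 .g3b ch'.target ch'.emb

end AdaptedBasis

/-! ### The group -/

/-- The group `PSL₂(7)`. -/
abbrev PSL₂7 : Type := PSL(2, ZMod 7)

/-- `A` and `B` generate `G` and satisfy `A² = B³ = (AB)⁷ = [A, B]⁴ = 1`. -/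
structure IsStandardPair {G : Type} [Group G] (A B : G) : Prop where
  generate : Subgroup.closure {A, B} = ⊤
  sq : A ^ 2 = 1
  cube : B ^ 3 = 1
  mul_pow : (A * B) ^ 7 = 1
  commutator : (A * B * A⁻¹ * B⁻¹) ^ 4 = 1

section

variable {G : Type} [Group G]

/-- The generator `a = [A, B] = A B A⁻¹ B⁻¹` of the subgroup `S₄`. -/
def elta (A B : G) : G := A * B * A⁻¹ * B⁻¹

/-- The generator `b = (A B² (A B)²)²` of the subgroup `S₄`. -/
def eltb (A B : G) : G := (A * B ^ 2 * (A * B) ^ 2) ^ 2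

/-- The generator `c = A B` of the subgroup `T₇`. -/
def eltc (A B : G) : G := A * B

/-- The generator `d = A B (A B²)² (A B)² A B²` of the subgroup `T₇`. -/
def eltd (A B : G) : G := A * B * (A * B ^ 2) ^ 2 * (A * B) ^ 2 * (A * B ^ 2)

/-- The subgroup `S₄`, generated by `a` and `b`. -/
def subS4 (A B : G) : Subgroup G := Subgroup.closure {elta A B, eltb A B}

/-- The subgroup `T₇`, generated by `c` and `d`. -/
def subT7 (A B : G) : Subgroup G := Subgroup.closure {eltc A B, eltd A B}

/-- `a`, `b` as elements of the subgroup `S₄`, `c`, `d` as elements of the subgroup `T₇`. -/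
def genA (A B : G) : subS4 A B := ⟨elta A B, Subgroup.subset_closure (by simp)⟩

def genB (A B : G) : subS4 A B := ⟨eltb A B, Subgroup.subset_closure (by simp)⟩

def genC (A B : G) : subT7 A B := ⟨eltc A B, Subgroup.subset_closure (by simp)⟩

def genD (A B : G) : subT7 A B := ⟨eltd A B, Subgroup.subset_closure (by simp)⟩

end

end PSL27

namespace PSL27
open Matrix
open scoped Kronecker MatrixGroups
open Complex (I exp)
open Polynomial in
/-- The integer at which cyclotomic integers of conductor `168` are evaluated. -/
def evalPoint : ℕ := 2730 * 2 ^ 244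

/-- The value of the cyclotomic polynomial `Φ₁₆₈` at `evalPoint`. -/
def modulus : ℕ :=
  Nat.sub (evalPoint ^ 48 + evalPoint ^ 44 + evalPoint ^ 24 + evalPoint ^ 4 + 1)
    (evalPoint ^ 36 + evalPoint ^ 32 + evalPoint ^ 16 + evalPoint ^ 12)

section cyclotomic
open Polynomial

theorem eval_cyclotomic_three (t : ℤ) : (cyclotomic 3 ℤ).eval t = t ^ 2 + t + 1 := by
  rw [cyclotomic_three]; simp

theorem eval_cyclotomic_twentyone (t : ℤ) : (cyclotomic 21 ℤ).eval t =
    t ^ 12 - t ^ 11 + t ^ 9 - t ^ 8 + t ^ 6 - t ^ 4 + t ^ 3 - t + 1 := by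
  have h := congrArg (Polynomial.eval t)
    (cyclotomic_expand_eq_cyclotomic_mul (p := 7) (n := 3) (by norm_num) (by norm_num) ℤ)
  rw [expand_eval, eval_mul, eval_cyclotomic_three, eval_cyclotomic_three] at h
  have h3 : t ^ 2 + t + 1 ≠ 0 := by nlinarith [sq_nonneg (2 * t + 1)]
  apply mul_right_cancel₀ h3
  norm_num at h
  rw [← h]; ring

theorem eval_cyclotomic_fortytwo (t : ℤ) : (cyclotomic 42 ℤ).eval t =
    t ^ 12 + t ^ 11 - t ^ 9 - t ^ 8 + t ^ 6 - t ^ 4 - t ^ 3 + t + 1 := by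
  have h := congrArg (Polynomial.eval t)
    (cyclotomic_expand_eq_cyclotomic_mul (p := 2) (n := 21) (by norm_num) (by norm_num) ℤ)
  rw [expand_eval, eval_mul, eval_cyclotomic_twentyone] at h
  have h3 : (cyclotomic 21 ℤ).eval t ≠ 0 := (cyclotomic_pos (by norm_num) t).ne'
  apply mul_right_cancel₀ h3
  norm_num at h
  rw [← h, eval_cyclotomic_twentyone]; ring

theorem eval_cyclotomic_168 (t : ℤ) : (cyclotomic 168 ℤ).eval t =
    t ^ 48 + t ^ 44 - t ^ 36 - t ^ 32 + t ^ 24 - t ^ 16 - t ^ 12 + t ^ 4 + 1 := by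
  have h1 : expand ℤ 2 (cyclotomic 42 ℤ) = cyclotomic 84 ℤ :=
    cyclotomic_expand_eq_cyclotomic (p := 2) (n := 42) (by norm_num) (by norm_num) ℤ
  have h2 : expand ℤ 2 (cyclotomic 84 ℤ) = cyclotomic 168 ℤ :=
    cyclotomic_expand_eq_cyclotomic (p := 2) (n := 84) (by norm_num) (by norm_num) ℤ
  rw [← h2, expand_eval, ← h1, expand_eval, eval_cyclotomic_fortytwo]; ring

theorem modulus_eq : (modulus : ℤ) = (cyclotomic 168 ℤ).eval (evalPoint : ℤ) := by
  rw [eval_cyclotomic_168, modulus]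
  have : evalPoint ^ 36 + evalPoint ^ 32 + evalPoint ^ 16 + evalPoint ^ 12 ≤
      evalPoint ^ 48 + evalPoint ^ 44 + evalPoint ^ 24 + evalPoint ^ 4 + 1 := by decide +kernel
  rw [Nat.sub_eq, Nat.cast_sub this]
  push_cast; ring

/-- `exp (2πi/168)` -/
noncomputable def ζ : ℂ := exp (2 * Real.pi * I / 168)

theorem isPrimitiveRoot_ζ : IsPrimitiveRoot ζ 168 := by
  have := Complex.isPrimitiveRoot_exp 168 (by norm_num)
  simpa [ζ] using this

theorem exists_one_le_norm_aeval {K : Type*} [Field K] [NumberField K] {z : K} {n : ℕ}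
    (hn : 0 < n) (hz : IsPrimitiveRoot z n) (h : ℤ[X]) (hdvd : ¬ cyclotomic n ℤ ∣ h) :
    ∃ ξ : ℂ, IsPrimitiveRoot ξ n ∧ 1 ≤ ‖aeval ξ h‖ := by
  have h0 : aeval z h ≠ 0 := by
    intro h0
    apply hdvd
    rw [Polynomial.cyclotomic_eq_minpoly hz hn]
    exact minpoly.isIntegrallyClosed_dvd (hz.isIntegral hn) h0
  have hzint := hz.isIntegral hn
  have hint : IsIntegral ℤ (aeval z h) :=
    (Subalgebra.aeval_coe (integralClosure ℤ K) ⟨z, hzint⟩ h) ▸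
      (aeval (⟨z, hzint⟩ : integralClosure ℤ K) h).2
  obtain ⟨φ, hφ⟩ := NumberField.exists_conjugate_one_le_norm (K := K)
    (α := ⟨aeval z h, hint⟩) (by
      intro h1; apply h0; exact congrArg Subtype.val h1)
  refine ⟨φ z, hz.map_of_injective φ.injective, ?_⟩
  have hφ' : 1 ≤ ‖φ (aeval z h)‖ := hφ
  have hcomm : φ (aeval z h) = aeval (φ z) h := by
    rw [aeval_def, aeval_def, hom_eval₂]
    congr 1
    exact RingHom.ext_int _ _
  rwa [hcomm] at hφ'

/-- A cyclotomic integer all of whose conjugates are smaller than `t - 1` vanishes if it is in the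
ideal generated by `X - t`. -/
theorem aeval_ζ_eq_zero (g : ℤ[X]) (t : ℕ) (B : ℝ)
    (hB : ∀ ξ : ℂ, IsPrimitiveRoot ξ 168 → ‖aeval ξ g‖ ≤ B) (hBt : B < t - 1)
    (hg : (cyclotomic 168 ℤ).eval (t : ℤ) ∣ g.eval (t : ℤ)) : aeval ζ g = 0 := by
  obtain ⟨m, hm⟩ := hg
  have hroot : (g - C m * cyclotomic 168 ℤ).IsRoot (t : ℤ) := by
    simp [IsRoot, hm, mul_comm]
  obtain ⟨h, hh⟩ := dvd_iff_isRoot.mpr hroot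
  have hcyc : ∀ ξ : ℂ, IsPrimitiveRoot ξ 168 → aeval ξ (cyclotomic 168 ℤ) = 0 := by
    intro ξ hξ
    have := hξ.isRoot_cyclotomic (by norm_num)
    rw [IsRoot, ← map_cyclotomic_int, eval_map] at this
    simpa [aeval_def] using this
  have hval : ∀ ξ : ℂ, IsPrimitiveRoot ξ 168 → aeval ξ g = (ξ - t) * aeval ξ h := by
    intro ξ hξ
    have := congrArg (aeval ξ) hh
    simpa [hcyc ξ hξ] using this
  by_contra hne
  have hh0 : aeval ζ h ≠ 0 := by
    intro h0; exact hne (by rw [hval ζ isPrimitiveRoot_ζ, h0, mul_zero])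
  have : NeZero ((168 : ℕ) : ℚ) := ⟨by norm_num⟩
  have : IsCyclotomicExtension {168} ℚ (CyclotomicField 168 ℚ) :=
    CyclotomicField.isCyclotomicExtension 168 ℚ
  have : NumberField (CyclotomicField 168 ℚ) := IsCyclotomicExtension.numberField {168} ℚ _
  have hzK := IsCyclotomicExtension.zeta_spec 168 ℚ (CyclotomicField 168 ℚ)
  generalize IsCyclotomicExtension.zeta 168 ℚ (CyclotomicField 168 ℚ) = z at hzK
  have hdvd : ¬ cyclotomic 168 ℤ ∣ h := by
    rintro ⟨k, rfl⟩
    apply hh0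
    simp [hcyc ζ isPrimitiveRoot_ζ]
  obtain ⟨ξ, hprim, hφ'⟩ := exists_one_le_norm_aeval (by norm_num) hzK h hdvd
  have h1 := hB _ hprim
  rw [hval _ hprim, norm_mul] at h1
  have h2 : (t : ℝ) - 1 ≤ ‖ξ - t‖ := by
    have h3 := norm_sub_norm_le (t : ℂ) ξ
    rw [hprim.norm'_eq_one (by norm_num), norm_sub_rev] at h3
    simpa using h3
  have h0 : (0:ℝ) ≤ B := (norm_nonneg _).trans (hB _ hprim)
  nlinarith [norm_nonneg (ξ - t)]

/-- `v` is the residue modulo `modulus`, and `b` a bound for the conjugates, of `d z`,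
where `d z` is a cyclotomic integer (residues of denominators are inverted). -/
def Rep (z : ℂ) (d b v : ℕ) : Prop :=
  0 < d ∧ ∃ f : ℤ[X], aeval ζ f = d * z ∧ (∀ ξ : ℂ, IsPrimitiveRoot ξ 168 → ‖aeval ξ f‖ ≤ b) ∧
    f.eval (evalPoint : ℤ) ≡ d * v [ZMOD modulus]

namespace Rep

theorem eq {z z' : ℂ} {d b v d' b' v' : ℕ} (h : Rep z d b v) (h' : Rep z' d' b' v')
    (hv : v % modulus = v' % modulus) (hb : b * d' + b' * d + 1 < evalPoint) : z = z' := by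
  obtain ⟨hd, f, hf, hfb, hfv⟩ := h
  obtain ⟨hd', f', hf', hfb', hfv'⟩ := h'
  have key := aeval_ζ_eq_zero ((d' : ℤ[X]) * f - (d : ℤ[X]) * f') evalPoint (b * d' + b' * d) ?_ ?_ ?_
  · simp only [map_sub, map_mul, map_natCast, hf, hf'] at key
    have h1 : (d : ℂ) * d' * (z - z') = 0 := by rw [← key]; ring
    have hd0 : (d : ℂ) ≠ 0 := by exact_mod_cast hd.ne'
    have hd0' : (d' : ℂ) ≠ 0 := by exact_mod_cast hd'.ne'
    simpa [hd0, hd0', sub_eq_zero] using h1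
  · intro ξ hξ
    simp only [map_sub, map_mul, map_natCast]
    refine (norm_sub_le _ _).trans ?_
    rw [norm_mul, norm_mul, Complex.norm_natCast, Complex.norm_natCast]
    have := hfb ξ hξ
    have := hfb' ξ hξ
    nlinarith [(Nat.cast_nonneg d : (0:ℝ) ≤ d), (Nat.cast_nonneg d' : (0:ℝ) ≤ d')]
  · have : ((b * d' + b' * d + 1 : ℕ) : ℝ) < evalPoint := by exact_mod_cast hb
    push_cast at this; linarith
  · rw [← modulus_eq]
    simp only [eval_sub, eval_mul, eval_natCast]
    apply Int.ModEq.dvd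
    have e1 := hfv.mul_left (d' : ℤ)
    have e2 := hfv'.mul_left (d : ℤ)
    have e3 : (v : ℤ) ≡ v' [ZMOD modulus] := (Int.natCast_modEq_iff).2 hv
    refine e2.trans (Int.ModEq.trans ?_ e1.symm)
    have e4 := (e3.symm.mul_left ((d : ℤ) * d'))
    convert e4 using 1 <;> ring

theorem ne_zero {z : ℂ} {d b v : ℕ} (h : Rep z d b v) (hv : (d * v) % modulus ≠ 0) : z ≠ 0 := by
  rintro rfl
  obtain ⟨hd, f, hf, hfb, hfv⟩ := h
  rw [mul_zero] at hf
  have hdvd : minpoly ℤ ζ ∣ f :=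
    minpoly.isIntegrallyClosed_dvd (isPrimitiveRoot_ζ.isIntegral (by norm_num)) hf
  rw [← Polynomial.cyclotomic_eq_minpoly isPrimitiveRoot_ζ (by norm_num)] at hdvd
  obtain ⟨k, rfl⟩ := hdvd
  rw [eval_mul, ← modulus_eq] at hfv
  have h1 : (0 : ℤ) ≡ d * v [ZMOD modulus] :=
    Int.ModEq.trans (by simp [Int.ModEq]) hfv
  apply hv
  have h2 : ((0 : ℕ) : ℤ) ≡ ((d * v : ℕ) : ℤ) [ZMOD modulus] := by exact_mod_cast h1
  have := (Int.natCast_modEq_iff).1 h2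
  simpa [Nat.ModEq] using this.symm

theorem congr {z : ℂ} {d b v v' : ℕ} (h : Rep z d b v) (hv : v % modulus = v' % modulus) :
    Rep z d b v' := by
  obtain ⟨hd, f, hf, hfb, hfv⟩ := h
  exact ⟨hd, f, hf, hfb, hfv.trans (((Int.natCast_modEq_iff).2 hv).mul_left _)⟩

theorem mod {z : ℂ} {d b v : ℕ} (h : Rep z d b v) : Rep z d b (v % modulus) :=
  h.congr (Nat.mod_mod _ _).symm

theorem mono {z : ℂ} {d b b' v : ℕ} (h : Rep z d b v) (hb : b ≤ b') : Rep z d b' v := by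
  obtain ⟨hd, f, hf, hfb, hfv⟩ := h
  exact ⟨hd, f, hf, fun ξ hξ => (hfb ξ hξ).trans (by exact_mod_cast hb), hfv⟩

theorem scale {z : ℂ} {d b v : ℕ} (h : Rep z d b v) {k : ℕ} (hk : 0 < k) :
    Rep z (d * k) (b * k) v := by
  obtain ⟨hd, f, hf, hfb, hfv⟩ := h
  refine ⟨Nat.mul_pos hd hk, f * (k : ℤ[X]), ?_, ?_, ?_⟩
  · simp [hf]; ring
  · intro ξ hξ
    rw [map_mul, map_natCast, norm_mul, Complex.norm_natCast]
    push_cast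
    exact mul_le_mul_of_nonneg_right (hfb ξ hξ) (Nat.cast_nonneg _)
  · rw [eval_mul, eval_natCast]
    have := hfv.mul_right (k : ℤ)
    convert this using 1; push_cast; ring

theorem add' {z z' : ℂ} {d b v b' v' : ℕ} (h : Rep z d b v) (h' : Rep z' d b' v') :
    Rep (z + z') d (b + b') (v + v') := by
  obtain ⟨hd, f, hf, hfb, hfv⟩ := h
  obtain ⟨hd', f', hf', hfb', hfv'⟩ := h'
  refine ⟨hd, f + f', by simp [hf, hf']; ring, ?_, ?_⟩
  · intro ξ hξ
    rw [map_add]; push_cast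
    exact (norm_add_le _ _).trans (add_le_add (hfb ξ hξ) (hfb' ξ hξ))
  · rw [eval_add]
    have := hfv.add hfv'
    convert this using 1; push_cast; ring

theorem mul {z z' : ℂ} {d b v d' b' v' : ℕ} (h : Rep z d b v) (h' : Rep z' d' b' v') :
    Rep (z * z') (d * d') (b * b') (v * v') := by
  obtain ⟨hd, f, hf, hfb, hfv⟩ := h
  obtain ⟨hd', f', hf', hfb', hfv'⟩ := h'
  refine ⟨Nat.mul_pos hd hd', f * f', by simp [hf, hf']; ring, ?_, ?_⟩
  · intro ξ hξ
    rw [map_mul, norm_mul]; push_cast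
    exact mul_le_mul (hfb ξ hξ) (hfb' ξ hξ) (norm_nonneg _) (Nat.cast_nonneg _)
  · rw [eval_mul]
    have := hfv.mul hfv'
    convert this using 1; push_cast; ring

theorem neg {z : ℂ} {d b v : ℕ} (h : Rep z d b v) :
    Rep (-z) d b (modulus - v % modulus) := by
  have hm := h.mod
  obtain ⟨hd, f, hf, hfb, hfv⟩ := hm
  refine ⟨hd, -f, by simp [hf], ?_, ?_⟩
  · intro ξ hξ
    rw [map_neg, norm_neg]; exact hfb ξ hξ
  · rw [eval_neg]
    have hlt : v % modulus ≤ modulus := (Nat.mod_lt _ (by decide +kernel)).le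
    rw [Nat.cast_sub hlt]
    refine hfv.neg.trans ?_
    apply Int.ModEq.symm
    rw [Int.modEq_iff_dvd]
    exact ⟨-d, by ring⟩

theorem natCast (n : ℕ) : Rep n 1 n n :=
  ⟨one_pos, (n : ℤ[X]), by simp, fun ξ _ => by simp, by simp [Int.ModEq]⟩

theorem ζ_pow (n : ℕ) : Rep (ζ ^ n) 1 1 (evalPoint ^ n) :=
  ⟨one_pos, X ^ n, by simp, fun ξ h => by simp [h.norm'_eq_one], by simp [Int.ModEq]⟩

theorem inv_natCast {n v : ℕ} (hn : 0 < n) (hv : (n * v) % modulus = 1) : Rep (n : ℂ)⁻¹ n 1 v := by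
  refine ⟨hn, 1, ?_, fun ξ _ => by simp, ?_⟩
  · have : (n : ℂ) ≠ 0 := by exact_mod_cast hn.ne'
    simp [this]
  · have h1 : 1 % modulus = 1 := by decide +kernel
    have : ((1 : ℕ) : ℤ) ≡ ((n * v : ℕ) : ℤ) [ZMOD modulus] :=
      (Int.natCast_modEq_iff).2 (by rw [Nat.ModEq, hv, h1])
    simpa using this

end Rep
end cyclotomic
end PSL27

namespace PSL27
open Matrix
open scoped Kronecker MatrixGroups
open Complex (I exp)

theorem rt_mul {x : ℝ} (hx : 0 ≤ x) (y : ℝ) : rt (x * y) = rt x * rt y := by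
  simp [rt, Real.sqrt_mul hx]

theorem rt_div (x : ℝ) {y : ℝ} (hy : 0 ≤ y) : rt (x / y) = rt x / rt y := by
  simp [rt, Real.sqrt_div' x hy]

theorem rt_sq {x : ℝ} (hx : 0 ≤ x) : rt x ^ 2 = x := by
  rw [rt, ← Complex.ofReal_pow, Real.sq_sqrt hx]

theorem star_rt (x : ℝ) : star (rt x) = rt x := by simp [rt]

theorem rt_eq_ofReal {x y : ℝ} (hy : 0 ≤ y) (h : y * y = x) : rt x = (y : ℂ) := by
  rw [rt, ← h, Real.sqrt_mul_self hy]

theorem rt_ne_zero {x : ℝ} (hx : 0 < x) : rt x ≠ 0 := by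
  simp [rt, Real.sqrt_eq_zero', hx]

theorem ζ_pow_eq (k : ℕ) : ζ ^ k = exp (2 * Real.pi * I * k / 168) := by
  rw [ζ, ← Complex.exp_nat_mul]; congr 1; ring

theorem star_ζ_pow {k : ℕ} (hk : k ≤ 168) : star (ζ ^ k) = ζ ^ (168 - k) := by
  have h1 : star (ζ ^ k) = exp (-(2 * Real.pi * I * k / 168)) := by
    rw [ζ_pow_eq, Complex.star_def, ← Complex.exp_conj]; congr 1
    rw [show (2 * Real.pi * I * k / 168 : ℂ) = ((2 * Real.pi * k / 168 : ℝ) : ℂ) * I by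
      push_cast; ring]
    simp only [map_mul, Complex.conj_ofReal, Complex.conj_I]
    ring
  rw [h1, ζ_pow_eq, Nat.cast_sub hk]
  rw [show (2 * Real.pi * I * ((168 : ℕ) - (k : ℂ)) / 168 : ℂ) =
    -(2 * Real.pi * I * k / 168) + 2 * Real.pi * I by push_cast; ring]
  rw [Complex.exp_add, Complex.exp_two_pi_mul_I, mul_one]

theorem I_eq_ζ_pow : I = ζ ^ 42 := by
  rw [ζ_pow_eq, show (2 * Real.pi * I * (42 : ℕ) / 168 : ℂ) = Real.pi / 2 * I by push_cast; ring,
    Complex.exp_pi_div_two_mul_I]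

theorem ω_eq_ζ_pow : ω = ζ ^ 56 := by
  rw [ζ_pow_eq, ω]; congr 1; push_cast; ring

theorem η_eq_ζ_pow : η = ζ ^ 24 := by
  rw [ζ_pow_eq, η]; congr 1; push_cast; ring

theorem two_cos_eq (k : ℕ) (hk : k ≤ 168) :
    ((2 * Real.cos (2 * Real.pi * k / 168) : ℝ) : ℂ) = ζ ^ k + ζ ^ (168 - k) := by
  rw [← star_ζ_pow hk, ζ_pow_eq]
  rw [show (2 * Real.pi * I * k / 168 : ℂ) = ((2 * Real.pi * k / 168 : ℝ) : ℂ) * I by push_cast; ring,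
    Complex.star_def, Complex.add_conj, Complex.exp_ofReal_mul_I_re]

theorem rt_two_eq : rt 2 = ζ ^ 21 + ζ ^ 147 := by
  rw [← two_cos_eq 21 (by norm_num), show 2 * Real.pi * (21 : ℕ) / 168 = Real.pi / 4 by
    push_cast; ring, Real.cos_pi_div_four, rt]
  congr 1; ring

theorem rt_three_eq : rt 3 = ζ ^ 14 + ζ ^ 154 := by
  rw [← two_cos_eq 14 (by norm_num), show 2 * Real.pi * (14 : ℕ) / 168 = Real.pi / 6 by
    push_cast; ring, Real.cos_pi_div_six, rt]
  congr 1; ring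

theorem I_mul_rt_seven : I * rt 7 = η + η ^ 2 + η ^ 4 - η ^ 3 - η ^ 5 - η ^ 6 := by
  have hη : IsPrimitiveRoot η 7 := by
    have := Complex.isPrimitiveRoot_exp 7 (by norm_num)
    simpa [η] using this
  have h7 : η ^ 7 = 1 := hη.pow_eq_one
  have hs : 1 + η + η ^ 2 + η ^ 3 + η ^ 4 + η ^ 5 + η ^ 6 = 0 := by
    have := hη.geom_sum_eq_zero (by norm_num)
    simpa [Finset.sum_range_succ] using this
  have him : ∀ k : ℕ, (η ^ k) = ((Real.cos (2 * Real.pi * k / 7) : ℝ) : ℂ) +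
      ((Real.sin (2 * Real.pi * k / 7) : ℝ) : ℂ) * I := by
    intro k
    rw [η, ← Complex.exp_nat_mul, Complex.ofReal_cos, Complex.ofReal_sin, ← Complex.exp_mul_I]
    congr 1; push_cast; ring
  set y : ℝ := 2 * (Real.sin (2 * Real.pi / 7) + Real.sin (4 * Real.pi / 7) - Real.sin (Real.pi / 7)) with hy
  have hpi := Real.pi_pos
  have hy0 : 0 ≤ y := by
    have h1 : 0 ≤ Real.sin (4 * Real.pi / 7) := Real.sin_nonneg_of_nonneg_of_le_pi (by positivity) (by linarith)
    have h2 : Real.sin (Real.pi / 7) ≤ Real.sin (2 * Real.pi / 7) :=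
      Real.sin_le_sin_of_le_of_le_pi_div_two (by linarith) (by linarith) (by linarith)
    rw [hy]; linarith
  have hstar : ∀ j k : ℕ, j + k = 7 → η ^ j = star (η ^ k) := by
    intro j k hjk
    rw [him j, him k]
    have : (j : ℝ) = 7 - k := by
      have : ((j + k : ℕ) : ℝ) = (7 : ℕ) := by rw [hjk]
      push_cast at this; linarith
    rw [this, show 2 * Real.pi * (7 - (k:ℝ)) / 7 = 2 * Real.pi - 2 * Real.pi * k / 7 by ring,
      Real.cos_two_pi_sub, Real.sin_two_pi_sub]
    simp only [Complex.star_def, map_add, map_mul, Complex.conj_ofReal, Complex.conj_I]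
    push_cast; ring
  have hval : η + η ^ 2 + η ^ 4 - η ^ 3 - η ^ 5 - η ^ 6 = I * (y : ℂ) := by
    have e1 : Real.sin (2 * Real.pi * (4:ℕ) / 7) = - Real.sin (Real.pi / 7) := by
      rw [show 2 * Real.pi * ((4:ℕ):ℝ) / 7 = Real.pi / 7 + Real.pi by push_cast; ring, Real.sin_add_pi]
    have e0 : η = η ^ 1 := (pow_one η).symm
    rw [hstar 3 4 rfl, hstar 5 2 rfl, hstar 6 1 rfl]
    nth_rewrite 1 [e0]
    rw [him 1, him 2, him 4, e1, hy]
    have e2 : 2 * Real.pi * ((2:ℕ):ℝ) / 7 = 4 * Real.pi / 7 := by push_cast; ring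
    have e3 : 2 * Real.pi * ((1:ℕ):ℝ) / 7 = 2 * Real.pi / 7 := by push_cast; ring
    rw [e2, e3]
    simp only [Complex.star_def, map_add, map_mul, Complex.conj_ofReal, Complex.conj_I]
    push_cast; ring
  have hsq : (η + η ^ 2 + η ^ 4 - η ^ 3 - η ^ 5 - η ^ 6) ^ 2 = -7 := by
    linear_combination (7 - 7 * η + η ^ 2 + η ^ 3 - 3 * η ^ 4 + η ^ 5 + η ^ 6) * hs
  have : rt 7 = (y : ℂ) := by
    apply rt_eq_ofReal hy0
    rw [hval] at hsq
    have h1 : ((y * y : ℝ) : ℂ) = (7 : ℝ) := by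
      push_cast
      linear_combination -hsq + (y:ℂ) ^ 2 * Complex.I_sq
    exact_mod_cast h1
  rw [this, hval]

theorem rt_seven_eq : rt 7 = -I * (η + η ^ 2 + η ^ 4 - η ^ 3 - η ^ 5 - η ^ 6) := by
  rw [← I_mul_rt_seven]; linear_combination rt 7 * Complex.I_sq

theorem cosSeven_eq (k : ℕ) (hk : k ≤ 7) :
    cosSeven k = (ζ ^ (24 * k) + ζ ^ (168 - 24 * k)) / 2 := by
  rw [← two_cos_eq (24 * k) (by omega), cosSeven]
  push_cast
  rw [show (2 * Real.pi * (24 * (k : ℂ)) / 168 : ℂ) = 2 * k * Real.pi / 7 by ring]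
  ring

theorem b₇_inv : b₇⁻¹ = b₇c := by
  have h7 := rt_sq (x := 7) (by norm_num)
  have h2 := rt_sq (x := 2) (by norm_num)
  push_cast at h7 h2
  have h : b₇ * b₇c = 1 := by
    rw [b₇, b₇c, div_mul_div_comm, div_eq_one_iff_eq]
    · linear_combination -rt 7 ^ 2 * Complex.I_sq + h7 - 4 * h2
    · have := rt_ne_zero (x := 2) (by norm_num)
      simp [this]
  exact inv_eq_of_mul_eq_one_right h

/-- `√(3 + √2)` -/
noncomputable def rootA : ℂ := rt (3 + √2)

theorem rootA_sq : rootA ^ 2 = 3 + rt 2 := by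
  rw [rootA, rt_sq (by positivity)]; push_cast; rfl

theorem sqrt_two_lt : √2 < 3 / 2 := by
  rw [Real.sqrt_lt' (by norm_num)]; norm_num

theorem one_lt_sqrt_two : 1 < √2 := by
  rw [Real.lt_sqrt (by norm_num)]; norm_num

theorem seven_div_eight_lt : 5 / 4 < √2 := by
  rw [Real.lt_sqrt (by norm_num)]; norm_num

theorem rt_three_sub : rt (3 - √2) = rootA * (3 - rt 2) / rt 7 := by
  have h2 : √2 * √2 = 2 := Real.mul_self_sqrt (by norm_num)
  have h7 : √7 * √7 = 7 := Real.mul_self_sqrt (by norm_num)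
  have h3 : √(3 + √2) * √(3 + √2) = 3 + √2 := Real.mul_self_sqrt (by positivity)
  have := sqrt_two_lt
  rw [rt_eq_ofReal (y := √(3 + √2) * (3 - √2) / √7)]
  · push_cast; rfl
  · apply div_nonneg (mul_nonneg (by positivity) (by linarith)) (by positivity)
  · field_simp
    linear_combination (3 - √2) ^ 2 * h3 + (√2 - 3) * h7 + (√2 - 3) * h2

theorem rt_five_add : rt (5 + 3 * √2) = rootA * (1 + 2 * rt 2) / rt 7 := by
  have h2 : √2 * √2 = 2 := Real.mul_self_sqrt (by norm_num)
  have h7 : √7 * √7 = 7 := Real.mul_self_sqrt (by norm_num)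
  have h3 : √(3 + √2) * √(3 + √2) = 3 + √2 := Real.mul_self_sqrt (by positivity)
  rw [rt_eq_ofReal (y := √(3 + √2) * (1 + 2 * √2) / √7)]
  · push_cast; rfl
  · positivity
  · field_simp
    linear_combination (1 + 2 * √2) ^ 2 * h3 - (5 + 3 * √2) * h7 + (16 + 4 * √2) * h2

theorem rt_five_sub : rt (5 - 3 * √2) = rootA * ((3 - rt 2) * (2 * rt 2 - 1)) / 7 := by
  have h2 : √2 * √2 = 2 := Real.mul_self_sqrt (by norm_num)
  have h3 : √(3 + √2) * √(3 + √2) = 3 + √2 := Real.mul_self_sqrt (by positivity)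
  have := sqrt_two_lt
  have := one_lt_sqrt_two
  rw [rt_eq_ofReal (y := √(3 + √2) * ((3 - √2) * (2 * √2 - 1)) / 7)]
  · push_cast; rfl
  · apply div_nonneg (mul_nonneg (by positivity) (mul_nonneg (by linarith) (by linarith))) (by positivity)
  · field_simp
    linear_combination ((3 - √2) * (2 * √2 - 1)) ^ 2 * h3 + (4 * √2 ^ 3 - 16 * √2 ^ 2 - 15 * √2 + 109) * h2

theorem rt_six_add : rt (6 + 2 * √2) = rt 2 * rootA := by
  rw [rootA, ← rt_mul (by norm_num)]; congr 1; ring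

theorem rt_six_sub : rt (6 - 2 * √2) = rt 2 * rt (3 - √2) := by
  rw [← rt_mul (by norm_num)]; congr 1; ring

theorem exp_I_mul_arctan (x : ℝ) : exp (I * (Real.arctan x : ℂ)) = (1 + I * x) / rt (1 + x ^ 2) := by
  rw [mul_comm, Complex.exp_mul_I, ← Complex.ofReal_cos, ← Complex.ofReal_sin, Real.cos_arctan,
    Real.sin_arctan, rt]
  push_cast; ring

theorem exp_α : exp (I * α) = (2 + I * rt 3) / rt 7 := by
  have h3 := Real.sq_sqrt (show (0 : ℝ) ≤ 3 by norm_num)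
  rw [α, exp_I_mul_arctan, show 1 + (√3 / 2) ^ 2 = (7 : ℝ) / 4 by rw [div_pow, h3]; norm_num,
    rt_div _ (by norm_num), show rt 4 = 2 by
      rw [rt_eq_ofReal (y := 2)] <;> norm_num]
  have := rt_ne_zero (x := 7) (by norm_num)
  push_cast
  rw [rt, rt] at *
  field_simp

theorem exp_neg_α : exp (-I * α) = (2 - I * rt 3) / rt 7 := by
  have h1 : exp (-I * α) = star (exp (I * α)) := by
    rw [Complex.star_def, ← Complex.exp_conj]
    simp only [α, map_mul, Complex.conj_ofReal, Complex.conj_I]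
  rw [h1, exp_α]
  simp [rt, Complex.conj_ofReal]
  ring

theorem cosβ_eq : (Real.cos (Real.arctan (3 * √3 + 2 * √6)) : ℂ) = rootA * (4 * rt 2 - 5) / 14 := by
  have h6 : √6 = √2 * √3 := by rw [← Real.sqrt_mul (by norm_num)]; norm_num
  have h2 : √2 * √2 = 2 := Real.mul_self_sqrt (by norm_num)
  have h3 : √3 * √3 = 3 := Real.mul_self_sqrt (by norm_num)
  have hA : √(3 + √2) * √(3 + √2) = 3 + √2 := Real.mul_self_sqrt (by positivity)
  have hlt := seven_div_eight_lt
  have : Real.cos (Real.arctan (3 * √3 + 2 * √6)) = √(3 + √2) * (4 * √2 - 5) / 14 := by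
    rw [Real.cos_arctan]
    have e : 1 + (3 * √3 + 2 * √6) ^ 2 = 52 + 36 * √2 := by
      rw [h6]; linear_combination (9 + 12 * √2 + 4 * √2 ^ 2) * h3 + 12 * h2
    have hpos : (0 : ℝ) ≤ √(3 + √2) * (4 * √2 - 5) / 14 :=
      div_nonneg (mul_nonneg (by positivity) (by linarith)) (by norm_num)
    rw [e, ← Real.sqrt_sq hpos, ← Real.sqrt_one, ← Real.sqrt_div (by norm_num)]
    congr 1
    rw [div_eq_iff (by positivity)]
    linear_combination (-(4 * √2 - 5) ^ 2 * (52 + 36 * √2) / 196) * hA +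
      (-(576 * √2 ^ 2 + 1120 * √2 - 1796) / 196 + 2 / 7) * h2
  rw [this, rootA, rt, rt]; push_cast; rfl

theorem exp_β : exp (I * β) = rootA * ((4 * rt 2 - 5) * (1 + I * (rt 3 * (3 + 2 * rt 2)))) / 14 := by
  have h6 : √6 = √2 * √3 := by rw [← Real.sqrt_mul (by norm_num)]; norm_num
  have hc := cosβ_eq
  have ht := Real.tan_arctan (3 * √3 + 2 * √6)
  have hs : Real.sin (Real.arctan (3 * √3 + 2 * √6)) =
      (3 * √3 + 2 * √6) * Real.cos (Real.arctan (3 * √3 + 2 * √6)) := by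
    rw [Real.tan_eq_sin_div_cos, div_eq_iff (Real.cos_arctan_pos _).ne'] at ht
    exact ht
  rw [β, mul_comm, Complex.exp_mul_I, ← Complex.ofReal_cos, ← Complex.ofReal_sin, hs,
    Complex.ofReal_mul, hc, h6, rt, rt]
  push_cast; ring

theorem exp_neg_β : exp (-I * β) =
    rootA * ((4 * rt 2 - 5) * (1 - I * (rt 3 * (3 + 2 * rt 2)))) / 14 := by
  have h1 : exp (-I * β) = star (exp (I * β)) := by
    rw [Complex.star_def, ← Complex.exp_conj]
    simp only [β, map_mul, Complex.conj_ofReal, Complex.conj_I]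
  rw [h1, exp_β]
  simp only [Complex.star_def, map_mul, map_div₀, map_sub, map_add, map_one, map_ofNat,
    Complex.conj_I, rt, rootA, Complex.conj_ofReal]
  ring

theorem exp_two_α : exp (2 * I * α) = exp (I * α) * exp (I * α) := by
  rw [← Complex.exp_add]; congr 1; ring

theorem exp_β_sub_α : exp (I * β - I * α) = exp (I * β) * exp (-I * α) := by
  rw [← Complex.exp_add]; congr 1; ring

theorem exp_α_sub_β : exp (I * α - I * β) = exp (I * α) * exp (-I * β) := by
  rw [← Complex.exp_add]; congr 1; ring

theorem exp_two_β : exp (I * β) * exp (I * β) =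
    (3 + rt 2) * ((4 * rt 2 - 5) * (1 + I * (rt 3 * (3 + 2 * rt 2))) / 14) ^ 2 := by
  rw [exp_β, ← rootA_sq]; ring

theorem exp_neg_two_β : exp (-I * β) * exp (-I * β) =
    (3 + rt 2) * ((4 * rt 2 - 5) * (1 - I * (rt 3 * (3 + 2 * rt 2))) / 14) ^ 2 := by
  rw [exp_neg_β, ← rootA_sq]; ring

theorem exp_two_β_sub_α : exp (2 * I * β - I * α) =
    (3 + rt 2) * ((4 * rt 2 - 5) * (1 + I * (rt 3 * (3 + 2 * rt 2))) / 14) ^ 2 *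
      ((2 - I * rt 3) / rt 7) := by
  rw [← exp_two_β, ← exp_neg_α, ← Complex.exp_add, ← Complex.exp_add]; congr 1; ring

theorem exp_α_sub_two_β : exp (I * α - 2 * I * β) =
    (3 + rt 2) * ((4 * rt 2 - 5) * (1 - I * (rt 3 * (3 + 2 * rt 2))) / 14) ^ 2 *
      ((2 + I * rt 3) / rt 7) := by
  rw [← exp_neg_two_β, ← exp_α, ← Complex.exp_add, ← Complex.exp_add]; congr 1; ring

end PSL27

namespace PSL27
open Matrix
open scoped Kronecker MatrixGroups
open Complex (I exp)

/-- The radicals adjoined to the cyclotomic field, by grade. -/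
noncomputable def radical : ℕ → ℂ
  | 0 => 1
  | 1 => rt 5
  | 2 => rt 13
  | _ => rootA

/-- Numerical data of an element of the cyclotomic field, multiplied by a radical: its grade, a
denominator, a bound, and the residues of the element and of its complex conjugate. -/
structure Q where
  g : ℕ
  d : ℕ
  b : ℕ
  v : ℕ
  w : ℕ

/-- `q` represents `z`. Grades above `3` stand for a failed computation. -/
def QRep (z : ℂ) (q : Q) : Prop :=
  q.g ≤ 3 → ∃ z', z = radical q.g * z' ∧ Rep z' q.d q.b q.v ∧ Rep (star z') q.d q.b q.w

namespace Q

def nat (n : ℕ) : Q := ⟨0, 1, n, n, n⟩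

def add (p q : Q) : Q where
  g := cond (Nat.beq p.g q.g) p.g 9
  d := Nat.mul p.d q.d
  b := Nat.add (Nat.mul p.b q.d) (Nat.mul q.b p.d)
  v := Nat.mod (Nat.add p.v q.v) modulus
  w := Nat.mod (Nat.add p.w q.w) modulus

def neg (p : Q) : Q where
  g := p.g
  d := p.d
  b := p.b
  v := Nat.sub modulus (Nat.mod p.v modulus)
  w := Nat.sub modulus (Nat.mod p.w modulus)

def mul (p q : Q) : Q where
  g := cond (Nat.beq p.g 0) q.g (cond (Nat.beq q.g 0) p.g 9)
  d := Nat.mul p.d q.d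
  b := Nat.mul p.b q.b
  v := Nat.mod (Nat.mul p.v q.v) modulus
  w := Nat.mod (Nat.mul p.w q.w) modulus

def conj (p : Q) : Q := ⟨p.g, p.d, p.b, p.w, p.v⟩

def pow (p : Q) (n : ℕ) : Q := Nat.rec (nat 1) (fun _ q => mul q p) n

def inv (n : ℕ) : Q :=
  let v := Nat.div (Nat.add (Nat.mul (Nat.sub n 1) modulus) 1) n
  ⟨cond (Nat.beq (Nat.mod (Nat.mul n v) modulus) 1) 0 9, n, 1, v, v⟩

def root (k : ℕ) : Q :=
  ⟨0, 1, 1, Nat.mod (Nat.pow evalPoint k) modulus,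
    Nat.mod (Nat.pow evalPoint (Nat.sub 168 k)) modulus⟩

def ofGrade (g : ℕ) : Q := ⟨g, 1, 1, 1, 1⟩

def single (i j : ℕ) : Q := cond (Nat.beq i j) (nat 1) (nat 0)

end Q

theorem natBeq_eq_decide (a b : ℕ) : Nat.beq a b = decide (a = b) := by
  by_cases h : a = b
  · subst h; simp
  · rw [decide_eq_false h]; exact Bool.eq_false_iff.2 fun h' => h (Nat.eq_of_beq_eq_true h')

theorem star_radical (g : ℕ) : star (radical g) = radical g := by
  unfold radical; split <;> simp [star_rt, rootA]

namespace QRep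

theorem nat (n : ℕ) : QRep n (Q.nat n) := fun _ =>
  ⟨n, by simp [Q.nat, radical], Rep.natCast n, (star_natCast (R := ℂ) n).symm ▸ Rep.natCast n⟩

theorem nat_zero : QRep 0 (Q.nat 0) := by simpa using nat 0

theorem nat_one : QRep 1 (Q.nat 1) := by simpa using nat 1

theorem add {z z' : ℂ} {p q : Q} (h : QRep z p) (h' : QRep z' q) : QRep (z + z') (p.add q) := by
  intro hg
  by_cases e : p.g = q.g
  · have e1 : (p.add q).g = p.g := by simp [Q.add, natBeq_eq_decide, e]
    rw [e1] at hg ⊢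
    obtain ⟨x, rfl, hx, hx'⟩ := h hg
    obtain ⟨y, rfl, hy, hy'⟩ := h' (e ▸ hg)
    have hp := hx.1
    have hq := hy.1
    refine ⟨x + y, by rw [e]; ring, ?_, ?_⟩
    · have := (hx.scale hq).add' (Nat.mul_comm q.d p.d ▸ hy.scale hp)
      exact this.mod
    · have := (hx'.scale hq).add' (Nat.mul_comm q.d p.d ▸ hy'.scale hp)
      rw [star_add]; exact this.mod
  · exfalso; revert hg
    simp [Q.add, natBeq_eq_decide, e]

theorem neg {z : ℂ} {p : Q} (h : QRep z p) : QRep (-z) p.neg := by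
  intro hg
  obtain ⟨x, rfl, hx, hx'⟩ := h hg
  exact ⟨-x, by simp [Q.neg], hx.neg, by rw [star_neg]; exact hx'.neg⟩

theorem mul {z z' : ℂ} {p q : Q} (h : QRep z p) (h' : QRep z' q) : QRep (z * z') (p.mul q) := by
  intro hg
  have key : p.g ≤ 3 ∧ q.g ≤ 3 ∧ radical p.g * radical q.g = radical (p.mul q).g := by
    by_cases e : p.g = 0
    · simp only [Q.mul, e] at hg ⊢
      simp [radical] at hg ⊢
      exact hg
    · by_cases e' : q.g = 0
      · have : (p.mul q).g = p.g := by simp [Q.mul, natBeq_eq_decide, e, e']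
        rw [this] at hg ⊢
        simp [e', hg, radical]
      · exfalso; revert hg; simp [Q.mul, natBeq_eq_decide, e, e']
  obtain ⟨h1, h2, h3⟩ := key
  obtain ⟨x, rfl, hx, hx'⟩ := h h1
  obtain ⟨y, rfl, hy, hy'⟩ := h' h2
  refine ⟨x * y, by rw [← h3]; ring, (hx.mul hy).mod, ?_⟩
  rw [star_mul']; exact (hx'.mul hy').mod

theorem conj {z : ℂ} {p : Q} (h : QRep z p) : QRep (star z) p.conj := by
  intro hg
  obtain ⟨x, rfl, hx, hx'⟩ := h hg
  exact ⟨star x, by simp [Q.conj, star_radical], hx', by rw [star_star]; exact hx⟩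

theorem pow {z : ℂ} {p : Q} (h : QRep z p) (n : ℕ) : QRep (z ^ n) (p.pow n) := by
  induction n with
  | zero => rw [pow_zero]; exact nat_one
  | succ n ih => rw [pow_succ]; exact ih.mul h

theorem inv {n : ℕ} (hn : 0 < n) : QRep (n : ℂ)⁻¹ (Q.inv n) := by
  intro hg
  have hv : (n * (Q.inv n).v) % modulus = 1 := by
    by_contra h
    revert hg
    have : (Q.inv n).g = 9 := by
      simp only [Q.inv]
      rw [natBeq_eq_decide, decide_eq_false]
      · rfl
      · exact h
    rw [this]; decide
  have hg0 : (Q.inv n).g = 0 := by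
    simp only [Q.inv]
    rw [natBeq_eq_decide, decide_eq_true]
    · rfl
    · exact hv
  refine ⟨(n : ℂ)⁻¹, by simp [hg0, radical], Rep.inv_natCast hn hv, ?_⟩
  rw [star_inv₀, star_natCast]; exact Rep.inv_natCast hn hv

theorem root {k : ℕ} (hk : k ≤ 168) : QRep (ζ ^ k) (Q.root k) := fun _ =>
  ⟨ζ ^ k, by simp [Q.root, radical], (Rep.ζ_pow k).mod, by
    rw [star_ζ_pow hk]; exact (Rep.ζ_pow (168 - k)).mod⟩

theorem ofGrade (g : ℕ) : QRep (radical g) (Q.ofGrade g) := fun _ =>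
  ⟨1, by simp [Q.ofGrade], Nat.cast_one (R := ℂ) ▸ Rep.natCast 1, by
    rw [star_one, ← Nat.cast_one (R := ℂ)]; exact Rep.natCast 1⟩

theorem single {n : ℕ} (i j : Fin n) : QRep ((Pi.single i 1 : Fin n → ℂ) j) (Q.single i.val j.val) := by
  by_cases h : i = j
  · subst h
    rw [Pi.single_eq_same, Q.single, natBeq_eq_decide, decide_eq_true rfl]; exact nat_one
  · have h' : ¬ i.val = j.val := by simpa [Fin.ext_iff] using h
    rw [Pi.single_eq_of_ne (Ne.symm h), Q.single, natBeq_eq_decide, decide_eq_false h']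
    exact nat_zero

end QRep

/-- Reification of a complex number. -/
class HasQ (z : ℂ) where
  q : Q
  h : QRep z q

/-- Reification of the inverse of a complex number. -/
class HasInv (z : ℂ) where
  q : Q
  h : QRep z⁻¹ q

@[reducible] def HasQ.congr {z z' : ℂ} (i : HasQ z') (h : z = z') : HasQ z := ⟨i.q, h ▸ i.h⟩

noncomputable section instances
variable (x y : ℂ)

instance : HasQ 0 := ⟨Q.nat 0, QRep.nat_zero⟩
instance : HasQ 1 := ⟨Q.nat 1, QRep.nat_one⟩
instance (n : ℕ) [n.AtLeastTwo] : HasQ ofNat(n) := ⟨Q.nat n, QRep.nat n⟩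
instance [i : HasQ x] [j : HasQ y] : HasQ (x + y) := ⟨i.q.add j.q, i.h.add j.h⟩
instance [i : HasQ x] [j : HasQ y] : HasQ (x - y) :=
  ⟨i.q.add j.q.neg, by rw [sub_eq_add_neg]; exact i.h.add j.h.neg⟩
instance [i : HasQ x] [j : HasQ y] : HasQ (x * y) := ⟨i.q.mul j.q, i.h.mul j.h⟩
instance [i : HasQ x] : HasQ (-x) := ⟨i.q.neg, i.h.neg⟩
instance [i : HasQ x] (n : ℕ) : HasQ (x ^ n) := ⟨i.q.pow n, i.h.pow n⟩
instance [i : HasQ x] [j : HasInv y] : HasQ (x / y) :=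
  ⟨i.q.mul j.q, by rw [div_eq_mul_inv]; exact i.h.mul j.h⟩

instance (n : ℕ) [n.AtLeastTwo] : HasInv ofNat(n) :=
  ⟨Q.inv n, QRep.inv (Nat.pos_of_neZero n)⟩
instance [i : HasInv x] [j : HasInv y] : HasInv (x * y) :=
  ⟨i.q.mul j.q, by rw [mul_inv]; exact i.h.mul j.h⟩
instance [i : HasInv x] (n : ℕ) : HasInv (x ^ n) :=
  ⟨i.q.pow n, by rw [← inv_pow]; exact i.h.pow n⟩
instance [i : HasInv x] [j : HasQ y] : HasInv (x / y) :=
  ⟨j.q.mul i.q, by rw [inv_div, div_eq_mul_inv]; exact j.h.mul i.h⟩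

instance : HasQ I := HasQ.congr ⟨_, QRep.root (k := 42) (by norm_num)⟩ I_eq_ζ_pow
instance : HasQ ω := HasQ.congr ⟨_, QRep.root (k := 56) (by norm_num)⟩ ω_eq_ζ_pow
instance : HasQ η := HasQ.congr ⟨_, QRep.root (k := 24) (by norm_num)⟩ η_eq_ζ_pow
instance : HasQ (rt 2) := HasQ.congr
  ⟨_, (QRep.root (k := 21) (by norm_num)).add (QRep.root (k := 147) (by norm_num))⟩ rt_two_eq
instance : HasQ (rt 3) := HasQ.congr
  ⟨_, (QRep.root (k := 14) (by norm_num)).add (QRep.root (k := 154) (by norm_num))⟩ rt_three_eq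
instance : HasQ (rt 7) := HasQ.congr inferInstance rt_seven_eq
instance : HasQ (rt 5) := ⟨_, QRep.ofGrade 1⟩
instance : HasQ (rt 13) := ⟨_, QRep.ofGrade 2⟩
instance : HasQ rootA := ⟨_, QRep.ofGrade 3⟩
instance : HasQ b₇ := HasQ.congr (z' := (-1 + I * rt 7) * rt 2 / 4) inferInstance (by
  have := rt_ne_zero (x := 2) (by norm_num)
  have h2 := rt_sq (x := 2) (by norm_num)
  push_cast at h2
  rw [b₇]; field_simp; linear_combination (- 2 * (-1 + I * rt 7)) * h2)
instance : HasQ b₇c := HasQ.congr (z' := (-1 - I * rt 7) * rt 2 / 4) inferInstance (by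
  have := rt_ne_zero (x := 2) (by norm_num)
  have h2 := rt_sq (x := 2) (by norm_num)
  push_cast at h2
  rw [b₇c]; field_simp; linear_combination (2 * (1 + I * rt 7)) * h2)
instance : HasInv b₇ := ⟨HasQ.q b₇c, by rw [b₇_inv]; exact HasQ.h⟩

theorem rt_ofNat_mul (m n : ℕ) (k : ℝ) (h : (m : ℝ) * n = k) : rt k = rt m * rt n := by
  rw [← h, rt_mul (by positivity)]

instance : HasQ (rt 6) := HasQ.congr (z' := rt 2 * rt 3) inferInstance (rt_ofNat_mul 2 3 6 (by norm_num))
instance : HasQ (rt 10) := HasQ.congr (z' := rt 2 * rt 5) inferInstance (rt_ofNat_mul 2 5 10 (by norm_num))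
instance : HasQ (rt 14) := HasQ.congr (z' := rt 2 * rt 7) inferInstance (rt_ofNat_mul 2 7 14 (by norm_num))
instance : HasQ (rt 15) := HasQ.congr (z' := rt 3 * rt 5) inferInstance (rt_ofNat_mul 3 5 15 (by norm_num))
instance : HasQ (rt 21) := HasQ.congr (z' := rt 3 * rt 7) inferInstance (rt_ofNat_mul 3 7 21 (by norm_num))
instance : HasQ (rt 35) := HasQ.congr (z' := rt 5 * rt 7) inferInstance (rt_ofNat_mul 5 7 35 (by norm_num))
instance : HasQ (rt 42) := HasQ.congr (z' := rt 6 * rt 7) inferInstance (rt_ofNat_mul 6 7 42 (by norm_num))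
instance : HasQ (rt 70) := HasQ.congr (z' := rt 10 * rt 7) inferInstance (rt_ofNat_mul 10 7 70 (by norm_num))
instance : HasQ (rt 91) := HasQ.congr (z' := rt 7 * rt 13) inferInstance (rt_ofNat_mul 7 13 91 (by norm_num))
instance : HasQ (rt 105) := HasQ.congr (z' := rt 15 * rt 7) inferInstance (rt_ofNat_mul 15 7 105 (by norm_num))
instance : HasQ (rt 182) := HasQ.congr (z' := rt 14 * rt 13) inferInstance (rt_ofNat_mul 14 13 182 (by norm_num))
instance : HasQ (rt 273) := HasQ.congr (z' := rt 21 * rt 13) inferInstance (rt_ofNat_mul 21 13 273 (by norm_num))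
instance : HasQ (rt 546) := HasQ.congr (z' := rt 42 * rt 13) inferInstance (rt_ofNat_mul 42 13 546 (by norm_num))

instance (n : ℕ) [n.AtLeastTwo] [i : HasQ (rt ofNat(n))] : HasInv (rt ofNat(n)) :=
  ⟨i.q.mul (Q.inv n), by
    have h : (rt ofNat(n))⁻¹ = rt ofNat(n) * (n : ℂ)⁻¹ := by
      have h1 : (0 : ℝ) < OfNat.ofNat n := Nat.ofNat_pos
      have h0 := rt_ne_zero h1
      have h2 := rt_sq h1.le
      have h3 : ((OfNat.ofNat n : ℝ) : ℂ) = n := by simp; rfl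
      rw [h3] at h2
      rw [← h2]; field_simp
    rw [h]; exact i.h.mul (QRep.inv (Nat.pos_of_neZero n))⟩

instance (a : ℝ) (n : ℕ) [n.AtLeastTwo] [i : HasQ (rt a)] [j : HasInv (rt ofNat(n))] :
    HasQ (rt (a / ofNat(n))) :=
  ⟨i.q.mul j.q, by rw [rt_div _ (Nat.ofNat_pos (α := ℝ)).le, div_eq_mul_inv]; exact i.h.mul j.h⟩

instance (a : ℝ) (n : ℕ) [n.AtLeastTwo] [i : HasQ (rt a)] [j : HasInv (rt ofNat(n))] :
    HasQ (rt (1 / ofNat(n) * a)) :=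
  ⟨i.q.mul j.q, by
    rw [one_div_mul_eq_div, rt_div _ (Nat.ofNat_pos (α := ℝ)).le, div_eq_mul_inv]
    exact i.h.mul j.h⟩

instance : HasQ (rt (3 + √2)) := ⟨_, QRep.ofGrade 3⟩
instance : HasQ (rt (3 - √2)) := HasQ.congr inferInstance rt_three_sub
instance : HasQ (rt (5 + 3 * √2)) := HasQ.congr inferInstance rt_five_add
instance : HasQ (rt (5 - 3 * √2)) := HasQ.congr inferInstance rt_five_sub
instance : HasQ (rt (6 + 2 * √2)) := HasQ.congr inferInstance rt_six_add
instance : HasQ (rt (6 - 2 * √2)) := HasQ.congr inferInstance rt_six_sub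

instance : HasQ (exp (I * α)) := HasQ.congr inferInstance exp_α
instance : HasQ (exp (-I * α)) := HasQ.congr inferInstance exp_neg_α
instance : HasQ (exp (2 * I * α)) := HasQ.congr inferInstance exp_two_α
instance : HasQ (exp (I * β)) := HasQ.congr inferInstance exp_β
instance : HasQ (exp (-I * β)) := HasQ.congr inferInstance exp_neg_β
instance : HasQ (exp (I * β - I * α)) := HasQ.congr inferInstance exp_β_sub_α
instance : HasQ (exp (I * α - I * β)) := HasQ.congr inferInstance exp_α_sub_β
instance : HasQ (exp (2 * I * β - I * α)) := HasQ.congr inferInstance exp_two_β_sub_α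
instance : HasQ (exp (I * α - 2 * I * β)) := HasQ.congr inferInstance exp_α_sub_two_β

theorem qrep_cosSeven (k : ℕ) (hk : k ≤ 7) : QRep (cosSeven k)
    (((Q.root (24 * k)).add (Q.root (168 - 24 * k))).mul (Q.inv 2)) := by
  rw [cosSeven_eq k hk, div_eq_mul_inv]
  exact ((QRep.root (by omega)).add (QRep.root (by omega))).mul (by simpa using QRep.inv two_pos)

instance : HasQ (cosSeven 1) := ⟨_, qrep_cosSeven 1 (by norm_num)⟩
instance : HasQ (cosSeven 2) := ⟨_, qrep_cosSeven 2 (by norm_num)⟩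
instance : HasQ (cosSeven 3) := ⟨_, qrep_cosSeven 3 (by norm_num)⟩

end instances
end PSL27

namespace PSL27
open Matrix
open scoped Kronecker MatrixGroups
open Complex (I exp)

noncomputable section

/-! ### Loops -/

/-- Evaluates the argument of a function before the function. -/
def force {τ : Type} (n : ℕ) (f : ℕ → τ) : τ := Nat.rec (f 0) (fun k _ => f (Nat.succ k)) n

theorem force_eq {τ : Type} (n : ℕ) (f : ℕ → τ) : force n f = f n := by cases n <;> rfl

def sumN (n : ℕ) (f : ℕ → ℕ) : ℕ := Nat.rec 0 (fun k s => Nat.add (f k) s) n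

def allN (n : ℕ) (p : ℕ → Bool) : Bool := Nat.rec true (fun k s => cond (p k) s false) n

def sumL {τ : Type} (l : List τ) (f : τ → ℕ) : ℕ := List.rec 0 (fun t _ s => Nat.add (f t) s) l

def allL {τ : Type} (l : List τ) (p : τ → Bool) : Bool :=
  List.rec true (fun t _ s => cond (p t) s false) l

def anyL {τ : Type} (l : List τ) (p : τ → Bool) : Bool :=
  List.rec false (fun t _ s => cond (p t) true s) l

theorem allN_iff {n : ℕ} {p : ℕ → Bool} : allN n p = true ↔ ∀ k < n, p k = true := by
  induction n with
  | zero => simp [allN]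
  | succ n ih =>
    have : allN (n + 1) p = cond (p n) (allN n p) false := rfl
    rw [this]
    cases h : p n
    · simp only [cond_false, Bool.false_eq_true, false_iff]
      intro h'; simpa [h] using h' n (Nat.lt_succ_self n)
    · simp only [cond_true, ih]
      constructor
      · intro h' k hk
        rcases Nat.lt_succ_iff_lt_or_eq.1 hk with hk | rfl
        · exact h' k hk
        · exact h
      · exact fun h' k hk => h' k (Nat.lt_succ_of_lt hk)

theorem allL_iff {τ : Type} {l : List τ} {p : τ → Bool} : allL l p = true ↔ ∀ t ∈ l, p t = true := by
  induction l with
  | nil => simp [allL]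
  | cons t l ih =>
    have : allL (t :: l) p = cond (p t) (allL l p) false := rfl
    rw [this]
    cases h : p t <;> simp [h, ih]

theorem anyL_iff {τ : Type} {l : List τ} {p : τ → Bool} : anyL l p = true ↔ ∃ t ∈ l, p t = true := by
  induction l with
  | nil => simp [anyL]
  | cons t l ih =>
    have : anyL (t :: l) p = cond (p t) true (anyL l p) := rfl
    rw [this]
    cases h : p t <;> simp [h, ih]

theorem cond_false_eq_true_iff {a b : Bool} : cond a b false = true ↔ a = true ∧ b = true := by
  cases a <;> simp

theorem cond_true_eq_true_iff {a b : Bool} : cond a b true = true ↔ (a = true → b = true) := by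
  cases a <;> simp

theorem natBeq_iff {a b : ℕ} : Nat.beq a b = true ↔ a = b := by
  rw [natBeq_eq_decide, decide_eq_true_iff]

theorem natBle_iff {a b : ℕ} : Nat.ble a b = true ↔ a ≤ b := ⟨Nat.le_of_ble_eq_true, Nat.ble_eq_true_of_le⟩

/-- The congruence of residues. -/
def congN (a b : ℕ) : Bool := Nat.beq (Nat.mod a modulus) (Nat.mod b modulus)

/-- The condition under which bounds permit to conclude from a congruence to an equality. -/
def smallN (d b d' b' : ℕ) : Bool :=
  Nat.ble (Nat.add (Nat.add (Nat.mul b d') (Nat.mul b' d)) 2) evalPoint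

theorem congN_iff {a b : ℕ} : congN a b = true ↔ a % modulus = b % modulus := natBeq_iff

theorem Rep.eq_of_check {z z' : ℂ} {d b v d' b' v' : ℕ} (h : Rep z d b v) (h' : Rep z' d' b' v')
    (hb : smallN d b d' b' = true) (hv : congN v v' = true) : z = z' :=
  h.eq h' (congN_iff.1 hv) (natBle_iff.1 hb)

theorem Rep.zero {d : ℕ} (hd : 0 < d) (b : ℕ) : Rep 0 d b 0 :=
  ⟨hd, 0, by simp, fun ξ _ => by simp, by simp [Int.ModEq]⟩

theorem Rep.sumN {n D B : ℕ} (hD : 0 < D) {f : Fin n → ℂ} {g : ℕ → ℕ}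
    (h : ∀ i : Fin n, Rep (f i) D B (g i)) : Rep (∑ i, f i) D (Nat.mul n B) (sumN n g) := by
  induction n with
  | zero => exact Rep.zero hD _
  | succ n ih =>
    rw [Fin.sum_univ_castSucc, add_comm]
    have h1 := ih (f := fun i => f i.castSucc) (fun i => h i.castSucc)
    have h2 := (h (Fin.last n)).add' h1
    have e : B + Nat.mul n B = Nat.mul (n + 1) B := by simp only [Nat.mul_eq]; ring
    rw [e] at h2
    exact h2

theorem Rep.sumL {τ : Type} {D B : ℕ} (hD : 0 < D) {l : List τ} {f : τ → ℂ} {g : τ → ℕ}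
    (h : ∀ t ∈ l, Rep (f t) D B (g t)) :
    Rep (l.map f).sum D (Nat.mul l.length B) (sumL l g) := by
  induction l with
  | nil => exact Rep.zero hD _
  | cons t l ih =>
    have h2 := (h t (by simp)).add' (ih fun t ht => h t (by simp [ht]))
    have e : B + Nat.mul l.length B = Nat.mul (t :: l).length B := by
      simp only [Nat.mul_eq, List.length_cons]; ring
    rw [e] at h2
    rw [List.map_cons, List.sum_cons]
    exact h2

/-- A number and its complex conjugate. -/
def Rep2 (z : ℂ) (d b v w : ℕ) : Prop := Rep z d b v ∧ Rep (star z) d b w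

theorem Rep2.star {z : ℂ} {d b v w : ℕ} (h : Rep2 z d b v w) : Rep2 (star z) d b w v :=
  ⟨h.2, by rw [star_star]; exact h.1⟩

theorem Rep2.mod {z : ℂ} {d b v w : ℕ} (h : Rep2 z d b v w) :
    Rep2 z d b (Nat.mod v modulus) (Nat.mod w modulus) := ⟨h.1.mod, h.2.mod⟩

theorem Rep2.zero {d : ℕ} (hd : 0 < d) (b : ℕ) : Rep2 0 d b 0 0 :=
  ⟨Rep.zero hd b, by rw [star_zero]; exact Rep.zero hd b⟩

theorem Rep2.one : Rep2 1 1 1 1 1 :=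
  ⟨Nat.cast_one (R := ℂ) ▸ Rep.natCast 1, by
    rw [star_one, ← Nat.cast_one (R := ℂ)]; exact Rep.natCast 1⟩

theorem Rep2.sumN {n D B : ℕ} (hD : 0 < D) {f : Fin n → ℂ} {g g' : ℕ → ℕ}
    (h : ∀ i : Fin n, Rep2 (f i) D B (g i) (g' i)) :
    Rep2 (∑ i, f i) D (Nat.mul n B) (PSL27.sumN n g) (PSL27.sumN n g') :=
  ⟨Rep.sumN hD fun i => (h i).1, by rw [star_sum]; exact Rep.sumN hD fun i => (h i).2⟩

theorem Rep2.sumL {τ : Type} {D B : ℕ} (hD : 0 < D) {l : List τ} {f : τ → ℂ} {g g' : τ → ℕ}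
    (h : ∀ t ∈ l, Rep2 (f t) D B (g t) (g' t)) :
    Rep2 (l.map f).sum D (Nat.mul l.length B) (PSL27.sumL l g) (PSL27.sumL l g') := by
  refine ⟨Rep.sumL hD fun i hi => (h i hi).1, ?_⟩
  have : Star.star (l.map f).sum = (l.map fun t => Star.star (f t)).sum := by
    induction l with
    | nil => simp
    | cons t l ih =>
      simp only [List.map_cons, List.sum_cons, star_add]
      rw [ih fun i hi => h i (by simp [hi])]
  rw [this]
  exact Rep.sumL hD fun i hi => (h i hi).2

theorem QRep.rep2 {z : ℂ} {q : Q} (h : QRep z q) (hg : q.g ≤ 3) :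
    ∃ z', z = radical q.g * z' ∧ Rep2 z' q.d q.b q.v q.w := h hg

theorem QRep.rep2_of_grade_zero {z : ℂ} {q : Q} (h : QRep z q) (hg : q.g = 0) :
    Rep2 z q.d q.b q.v q.w := by
  obtain ⟨z', rfl, hz⟩ := h (by omega)
  rw [hg, show radical 0 = 1 from rfl, one_mul]; exact hz

theorem Rep2.rescale {z : ℂ} {d b v w D B : ℕ} (h : Rep2 z d b v w) (hd : D % d = 0) (hD : 0 < D)
    (hB : b * (D / d) ≤ B) : Rep2 z D B v w := by
  have hd0 : 0 < d := h.1.1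
  have e : d * (D / d) = D := Nat.mul_div_cancel' (Nat.dvd_of_mod_eq_zero hd)
  have hq : 0 < D / d := Nat.pos_of_ne_zero (by rintro h0; rw [h0] at e; omega)
  have h1 := (h.1.scale hq).mono hB
  have h2 := (h.2.scale hq).mono hB
  rw [e] at h1 h2
  exact ⟨h1, h2⟩

/-! ### Matrices -/

/-- Reification of a vector. -/
class HasVec {n : ℕ} (u : Fin n → ℂ) where
  q : ℕ → Q
  h : ∀ i, QRep (u i) (q i)

/-- Reification of a family of rows. -/
class HasRows {m n : ℕ} (u : Fin m → Fin n → ℂ) where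
  q : ℕ → ℕ → Q
  h : ∀ i j, QRep (u i j) (q i j)

/-- Reification of a matrix. -/
class HasMat {m n : ℕ} (M : Matrix (Fin m) (Fin n) ℂ) where
  q : ℕ → ℕ → Q
  h : ∀ i j, QRep (M i j) (q i j)

@[reducible] def HasMat.congr {m n : ℕ} {M M' : Matrix (Fin m) (Fin n) ℂ} (i : HasMat M') (h : M = M') :
    HasMat M := ⟨i.q, h ▸ i.h⟩

instance (u : Fin 0 → ℂ) : HasVec u := ⟨fun _ => Q.nat 0, fun i => i.elim0⟩

instance {n : ℕ} (a : ℂ) (u : Fin n → ℂ) [x : HasQ a] [y : HasVec u] : HasVec (vecCons a u) :=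
  ⟨fun i => Nat.rec x.q (fun k _ => y.q k) i, fun i => by
    refine Fin.cases ?_ (fun k => ?_) i
    · exact x.h
    · exact y.h k⟩

instance {n : ℕ} (u : Fin 0 → Fin n → ℂ) : HasRows u := ⟨fun _ _ => Q.nat 0, fun i => i.elim0⟩

instance {m n : ℕ} (a : Fin n → ℂ) (u : Fin m → Fin n → ℂ) [x : HasVec a] [y : HasRows u] :
    HasRows (vecCons a u) :=
  ⟨fun i => Nat.rec x.q (fun k _ => y.q k) i, fun i => by
    refine Fin.cases ?_ (fun k => ?_) i
    · exact x.h
    · exact y.h k⟩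

instance {m n : ℕ} (u : Fin m → Fin n → ℂ) [x : HasRows u] : HasMat (Matrix.of u) := ⟨x.q, x.h⟩

theorem qrep_one_apply {n : ℕ} (i j : Fin n) :
    QRep ((1 : Matrix (Fin n) (Fin n) ℂ) i j) (Q.single i j) := by
  have := QRep.single i j
  rwa [show (Pi.single i 1 : Fin n → ℂ) j = (1 : Matrix (Fin n) (Fin n) ℂ) i j by
    rw [Matrix.one_apply, Pi.single_apply]; simp [eq_comm]] at this

instance {n : ℕ} : HasMat (1 : Matrix (Fin n) (Fin n) ℂ) :=
  ⟨fun i j => Q.single i j, qrep_one_apply⟩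

instance {m n : ℕ} (M : Matrix (Fin m) (Fin n) ℂ) (u : Fin n → ℂ) [x : HasMat M] [y : HasVec u] :
    HasMat (M * diagonal u) :=
  ⟨fun i j => (x.q i j).mul (y.q j), fun i j => by
    rw [mul_diagonal]; exact (x.h i j).mul (y.h j)⟩

instance {n : ℕ} (u : Fin n → ℂ) [x : HasVec u] : HasMat (diagonal u) :=
  ⟨fun i j => (Q.single i j).mul (x.q i), fun i j => by
    have := (qrep_one_apply i j).mul (x.h i)
    rwa [show (1 : Matrix (Fin n) (Fin n) ℂ) i j * u i = diagonal u i j by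
      by_cases h : i = j
      · subst h; simp
      · simp [h]] at this⟩

instance {m n : ℕ} (M : Matrix (Fin m) (Fin n) ℂ) [x : HasMat M] : HasMat (M.map star) :=
  ⟨fun i j => (x.q i j).conj, fun i j => (x.h i j).conj⟩

instance {m n : ℕ} (M : Matrix (Fin m) (Fin n) ℂ) [x : HasMat M] : HasMat (-M) :=
  ⟨fun i j => (x.q i j).neg, fun i j => (x.h i j).neg⟩

instance {m n : ℕ} (c : ℂ) (M : Matrix (Fin m) (Fin n) ℂ) [a : HasQ c] [x : HasMat M] :
    HasMat (c • M) :=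
  ⟨fun i j => a.q.mul (x.q i j), fun i j => a.h.mul (x.h i j)⟩

instance {m n : ℕ} (c : ℂ) (M : Matrix (Fin m) (Fin n) ℂ) (i : Fin m) (j : Fin n) [a : HasQ c]
    [x : HasMat M] : HasQ ((c • M) i j) := ⟨a.q.mul (x.q i j), a.h.mul (x.h i j)⟩

instance {m n : ℕ} (M : Matrix (Fin m) (Fin n) ℂ) (i : Fin n) (j : Fin m)
    [x : HasMat M] : HasQ (Mᴴ i j) := ⟨(x.q j i).conj, (x.h j i).conj⟩

section
variable (a b c : ℂ) [HasQ a] [HasQ b] [HasQ c]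

instance : HasMat (matR₁ a b c) := HasMat.congr inferInstance (by delta matR₁; rfl)
instance : HasMat (matR₂ a b c) := HasMat.congr inferInstance (by delta matR₂; rfl)
instance : HasMat (matR₃ a b c) := HasMat.congr inferInstance (by delta matR₃; rfl)
instance : HasMat (matC₁ a b) := HasMat.congr inferInstance (by delta matC₁; rfl)
instance : HasMat (matC₂ a b) := HasMat.congr inferInstance (by delta matC₂; rfl)
instance (i j : Fin 3) : HasQ (matR₁ a b c i j) := ⟨_, HasMat.h i j⟩
instance (i j : Fin 3) : HasQ (matR₃ a b c i j) := ⟨_, HasMat.h i j⟩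
instance (i j : Fin 2) : HasQ (matC₁ a b i j) := ⟨_, HasMat.h i j⟩
instance (i : Fin 2) (j : Fin 3) : HasQ (matC₂ a b i j) := ⟨_, HasMat.h i j⟩
end

set_option synthInstance.maxHeartbeats 400000
set_option synthInstance.maxSize 100000

instance : HasMat matAS3 := by delta matAS3; infer_instance
instance : HasMat matAS6 := by delta matAS6; infer_instance
instance : HasMat matAS7 := by delta matAS7; infer_instance
instance : HasMat matAS8 := by delta matAS8; infer_instance
instance : HasMat matBS3 := by delta matBS3; infer_instance
instance : HasMat matBS6 := by delta matBS6; infer_instance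
instance : HasMat matBS7 := by delta matBS7; infer_instance
instance : HasMat matBS8 := by delta matBS8; infer_instance
instance : HasMat matAT3 := by delta matAT3; infer_instance
instance : HasMat matBT3 := by delta matBT3; infer_instance
instance : HasMat matAT6 := by delta matAT6; dsimp only; infer_instance
instance : HasMat matAT7 := by delta matAT7; dsimp only; infer_instance
instance : HasMat matAT8 := by delta matAT8; dsimp only; infer_instance

@[reducible] def hasMatAS : (X : GIrrep) → HasMat (matAS X)
  | .g1 => inferInstanceAs (HasMat (1 : Matrix (Fin 1) (Fin 1) ℂ))
  | .g3 => inferInstanceAs (HasMat matAS3)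
  | .g3b => inferInstanceAs (HasMat (matAS3.map star))
  | .g6 => inferInstanceAs (HasMat matAS6)
  | .g7 => inferInstanceAs (HasMat matAS7)
  | .g8 => inferInstanceAs (HasMat matAS8)

@[reducible] def hasMatBS : (X : GIrrep) → HasMat (matBS X)
  | .g1 => inferInstanceAs (HasMat (1 : Matrix (Fin 1) (Fin 1) ℂ))
  | .g3 => inferInstanceAs (HasMat matBS3)
  | .g3b => inferInstanceAs (HasMat (matBS3.map star))
  | .g6 => inferInstanceAs (HasMat matBS6)
  | .g7 => inferInstanceAs (HasMat matBS7)
  | .g8 => inferInstanceAs (HasMat matBS8)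

@[reducible] def hasMatAT : (X : GIrrep) → HasMat (matAT X)
  | .g1 => inferInstanceAs (HasMat (1 : Matrix (Fin 1) (Fin 1) ℂ))
  | .g3 => inferInstanceAs (HasMat matAT3)
  | .g3b => inferInstanceAs (HasMat (matAT3.map star))
  | .g6 => inferInstanceAs (HasMat matAT6)
  | .g7 => inferInstanceAs (HasMat matAT7)
  | .g8 => inferInstanceAs (HasMat matAT8)

@[reducible] def hasMatBT : (X : GIrrep) → HasMat (matBT X)
  | .g1 => inferInstanceAs (HasMat (1 : Matrix (Fin 1) (Fin 1) ℂ))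
  | .g3 => inferInstanceAs (HasMat matBT3)
  | .g3b => inferInstanceAs (HasMat (matBT3.map star))
  | .g6 => inferInstanceAs (HasMat (matAT6 * diagonal ![η, η ^ 2, η ^ 4, η ^ 6, η ^ 5, η ^ 3]))
  | .g7 => inferInstanceAs (HasMat (matAT7 * diagonal ![1, η, η ^ 2, η ^ 4, η ^ 6, η ^ 5, η ^ 3]))
  | .g8 => inferInstanceAs (HasMat (matAT8 * diagonal ![1, 1, η, η ^ 2, η ^ 4, η ^ 6, η ^ 5, η ^ 3]))

@[reducible] def hasGen₁S : (x : S4Irrep) → HasMat (gen₁S x)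
  | .s1₀ => inferInstanceAs (HasMat (1 : Matrix (Fin 1) (Fin 1) ℂ))
  | .s1₁ => inferInstanceAs (HasMat (-1 : Matrix (Fin 1) (Fin 1) ℂ))
  | .s2 => inferInstanceAs (HasMat (!![0, 1; 1, 0] : Matrix (Fin 2) (Fin 2) ℂ))
  | .s3₁ => inferInstanceAs (HasMat ((1 / 3 : ℂ) • !![-1, 2 * ω ^ 2, 2 * ω; 2 * ω ^ 2, 2 * ω, -1; 2 * ω, -1, 2 * ω ^ 2]))
  | .s3₂ => inferInstanceAs (HasMat ((-1 / 3 : ℂ) • !![-1, 2 * ω ^ 2, 2 * ω; 2 * ω ^ 2, 2 * ω, -1; 2 * ω, -1, 2 * ω ^ 2]))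

@[reducible] def hasGen₂S : (x : S4Irrep) → HasMat (gen₂S x)
  | .s1₀ => inferInstanceAs (HasMat (1 : Matrix (Fin 1) (Fin 1) ℂ))
  | .s1₁ => inferInstanceAs (HasMat (-1 : Matrix (Fin 1) (Fin 1) ℂ))
  | .s2 => inferInstanceAs (HasMat (!![0, ω ^ 2; ω, 0] : Matrix (Fin 2) (Fin 2) ℂ))
  | .s3₁ => inferInstanceAs (HasMat ((1 / 3 : ℂ) • !![-1, 2 * ω ^ 2, 2 * ω; 2 * ω, 2, -ω ^ 2; 2 * ω ^ 2, -ω, 2]))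
  | .s3₂ => inferInstanceAs (HasMat ((-1 / 3 : ℂ) • !![-1, 2 * ω ^ 2, 2 * ω; 2 * ω, 2, -ω ^ 2; 2 * ω ^ 2, -ω, 2]))

@[reducible] def hasGen₁T : (x : T7Irrep) → HasMat (gen₁T x)
  | .t1 => inferInstanceAs (HasMat (1 : Matrix (Fin 1) (Fin 1) ℂ))
  | .t1p => inferInstanceAs (HasMat (1 : Matrix (Fin 1) (Fin 1) ℂ))
  | .t1q => inferInstanceAs (HasMat (1 : Matrix (Fin 1) (Fin 1) ℂ))
  | .t3 => inferInstanceAs (HasMat (diagonal ![η, η ^ 2, η ^ 4]))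
  | .t3b => inferInstanceAs (HasMat (diagonal ![η ^ 6, η ^ 5, η ^ 3]))

@[reducible] def hasGen₂T : (x : T7Irrep) → HasMat (gen₂T x)
  | .t1 => inferInstanceAs (HasMat (1 : Matrix (Fin 1) (Fin 1) ℂ))
  | .t1p => inferInstanceAs (HasMat (!![ω] : Matrix (Fin 1) (Fin 1) ℂ))
  | .t1q => inferInstanceAs (HasMat (!![ω ^ 2] : Matrix (Fin 1) (Fin 1) ℂ))
  | .t3 => inferInstanceAs (HasMat (!![0, 1, 0; 0, 0, 1; 1, 0, 0] : Matrix (Fin 3) (Fin 3) ℂ))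
  | .t3b => inferInstanceAs (HasMat (!![0, 1, 0; 0, 0, 1; 1, 0, 0] : Matrix (Fin 3) (Fin 3) ℂ))

@[reducible] def hasConjMatS : (x : S4Irrep) → HasMat (conjMatS x)
  | .s1₀ => inferInstanceAs (HasMat (1 : Matrix (Fin 1) (Fin 1) ℂ))
  | .s1₁ => inferInstanceAs (HasMat (1 : Matrix (Fin 1) (Fin 1) ℂ))
  | .s2 => inferInstanceAs (HasMat (!![0, 1; 1, 0] : Matrix (Fin 2) (Fin 2) ℂ))
  | .s3₁ => inferInstanceAs (HasMat (!![1, 0, 0; 0, 0, 1; 0, 1, 0] : Matrix (Fin 3) (Fin 3) ℂ))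
  | .s3₂ => inferInstanceAs (HasMat (!![1, 0, 0; 0, 0, 1; 0, 1, 0] : Matrix (Fin 3) (Fin 3) ℂ))

@[reducible] def hasConjMatT : (x : T7Irrep) → HasMat (conjMatT x)
  | .t1 => inferInstanceAs (HasMat (1 : Matrix (Fin 1) (Fin 1) ℂ))
  | .t1p => inferInstanceAs (HasMat (1 : Matrix (Fin 1) (Fin 1) ℂ))
  | .t1q => inferInstanceAs (HasMat (1 : Matrix (Fin 1) (Fin 1) ℂ))
  | .t3 => inferInstanceAs (HasMat (1 : Matrix (Fin 3) (Fin 3) ℂ))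
  | .t3b => inferInstanceAs (HasMat (1 : Matrix (Fin 3) (Fin 3) ℂ))

end
end PSL27

namespace PSL27
open Matrix
open scoped Kronecker MatrixGroups
open Complex (I exp)
open GIrrep S4Irrep T7Irrep
noncomputable section
set_option synthInstance.maxHeartbeats 400000
set_option synthInstance.maxSize 100000

/-! ### Contractions of the subgroup -/

/-- The `i`-th unit vector, zero if `i` is out of range. -/
def unitVec (n i : ℕ) : Fin n → ℂ := fun k => if i = k.val then 1 else 0

theorem single_eq_unitVec {n : ℕ} (i : Fin n) : (Pi.single i 1 : Fin n → ℂ) = unitVec n i.val := by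
  funext k
  rw [Pi.single_apply, unitVec]
  simp [Fin.ext_iff, eq_comm]

theorem qrep_unitVec (n i : ℕ) (k : Fin n) : QRep (unitVec n i k) (Q.single i k.val) := by
  rw [unitVec, Q.single, natBeq_eq_decide]
  split
  · rename_i h; rw [decide_eq_true h]; exact QRep.nat_one
  · rename_i h; rw [decide_eq_false h]; exact QRep.nat_zero

instance (n i : ℕ) (k : Fin n) : HasQ (unitVec n i k) := ⟨Q.single i k.val, qrep_unitVec n i k⟩

instance (n i : ℕ) : HasVec (unitVec n i) := ⟨fun k => Q.single i k, qrep_unitVec n i⟩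

instance {n : ℕ} (c : ℂ) (u : Fin n → ℂ) [a : HasQ c] [x : HasVec u] : HasVec (c • u) :=
  ⟨fun k => a.q.mul (x.q k), fun k => a.h.mul (x.h k)⟩

/-- Reification of the matrix of a bilinear map. -/
class HasBil {l m n : ℕ} (M : Matrix (Fin l) (Fin m × Fin n) ℂ) where
  q : ℕ → ℕ → ℕ → Q
  h : ∀ k i j, QRep (M k (i, j)) (q k i j)

instance {l m n : ℕ} : HasBil (0 : Matrix (Fin l) (Fin m × Fin n) ℂ) :=
  ⟨fun _ _ _ => Q.nat 0, fun _ _ _ => QRep.nat_zero⟩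

instance {l m n : ℕ} : HasBil (bilin (0 : (Fin m → ℂ) → (Fin n → ℂ) → Fin l → ℂ)) :=
  ⟨fun _ _ _ => Q.nat 0, fun _ _ _ => QRep.nat_zero⟩

instance {l m n : ℕ} (f : (Fin m → ℂ) → (Fin n → ℂ) → Fin l → ℂ)
    [x : ∀ i j : ℕ, HasVec (f (unitVec m i) (unitVec n j))] : HasBil (bilin f) :=
  ⟨fun k i j => (x i j).q k, fun k i j => by
    have h : bilin f k (i, j) = f (unitVec m i.val) (unitVec n j.val) k := by
      rw [← single_eq_unitVec i, ← single_eq_unitVec j]; rfl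
    rw [h]; exact (x i.val j.val).h k⟩

section
variable (m n i j : ℕ)
instance : HasQ (tripletOne (unitVec 3 i) (unitVec 3 j)) := by delta tripletOne; infer_instance
instance : HasQ (tripletOneP (unitVec 3 i) (unitVec 3 j)) := by delta tripletOneP; infer_instance
instance : HasQ (tripletOneQ (unitVec 3 i) (unitVec 3 j)) := by delta tripletOneQ; infer_instance
instance : HasVec (tripletSym (unitVec 3 i) (unitVec 3 j)) := by delta tripletSym; infer_instance
instance : HasVec (tripletAnti (unitVec 3 i) (unitVec 3 j)) := by delta tripletAnti; infer_instance
instance : HasVec (tripletDoublet (unitVec 3 i) (unitVec 2 j)) := by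
  delta tripletDoublet; infer_instance
instance : HasVec (tripletDoublet' (unitVec 3 i) (unitVec 2 j)) := by
  delta tripletDoublet'; infer_instance
end

@[reducible] def hasCGS (x y z : S4Irrep) (k : Label) : HasBil (cgS x y z k) := by
  cases k
  · cases x <;> cases y <;> cases z <;> (dsimp only [cgS, contrS]; infer_instance)
  all_goals exact inferInstanceAs (HasBil 0)

@[reducible] def hasCGT (x y z : T7Irrep) (k : Label) : HasBil (cgT x y z k) := by
  cases x <;> cases y <;> cases z <;> cases k <;> (dsimp only [cgT, contrT]; infer_instance)

/-! ### Embedding factors -/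

/-- An injective coding of the irreps of the subgroup by numbers less than `5`. -/
class IrrepCode (ι : Type) where
  code : ι → ℕ
  code_lt : ∀ x, code x < 5
  code_inj : ∀ x y, code x = code y → x = y
  /-- evaluates the argument of a function before the function -/
  forceI : {τ : Type} → ι → (ι → τ) → τ
  forceI_eq : ∀ {τ : Type} (x : ι) (f : ι → τ), forceI x f = f x

def S4Irrep.code : S4Irrep → ℕ
  | s1₀ => 0 | s1₁ => 1 | s2 => 2 | s3₁ => 3 | s3₂ => 4

def T7Irrep.code : T7Irrep → ℕ
  | t1 => 0 | t1p => 1 | t1q => 2 | t3 => 3 | t3b => 4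

def Label.code : Label → ℕ
  | .n => 0 | .s => 1 | .a => 2

instance : IrrepCode S4Irrep := ⟨S4Irrep.code, by intro x; cases x <;> decide,
  by intro x y; cases x <;> cases y <;> decide,
  fun {τ} x f => S4Irrep.rec (motive := fun _ => τ) (f .s1₀) (f .s1₁) (f .s2) (f .s3₁) (f .s3₂) x,
  by intro τ x f; cases x <;> rfl⟩

instance : IrrepCode T7Irrep := ⟨T7Irrep.code, by intro x; cases x <;> decide,
  by intro x y; cases x <;> cases y <;> decide,
  fun {τ} x f => T7Irrep.rec (motive := fun _ => τ) (f .t1) (f .t1p) (f .t1q) (f .t3) (f .t3b) x,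
  by intro τ x f; cases x <;> rfl⟩

/-- The key of an embedding factor. -/
abbrev Key (ι : Type) := ι × ι × ι × Label

section
variable {ι : Type} [IrrepCode ι]
open IrrepCode

def mixCode (c x y k : ℕ) : ℕ :=
  Nat.add (Nat.mul (Nat.add (Nat.mul (Nat.add (Nat.mul c 5) x) 5) y) 3) k

def keyCode (t : Key ι) : ℕ := mixCode (code t.1) (code t.2.1) (code t.2.2.1) t.2.2.2.code

theorem keyCode_inj {s t : Key ι} : keyCode s = keyCode t ↔ s = t := by
  refine ⟨fun h => ?_, fun h => h ▸ rfl⟩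
  obtain ⟨c, x, y, k⟩ := s
  obtain ⟨c', x', y', k'⟩ := t
  have h1 := code_lt x; have h2 := code_lt y; have h3 := code_lt x'; have h4 := code_lt y'
  have h5 : k.code < 3 := by cases k <;> decide
  have h6 : k'.code < 3 := by cases k' <;> decide
  simp only [keyCode, mixCode, Nat.mul_eq, Nat.add_eq] at h
  have e1 : code c = code c' := by omega
  have e2 : code x = code x' := by omega
  have e3 : code y = code y' := by omega
  have e4 : k.code = k'.code := by omega
  rw [code_inj _ _ e1, code_inj _ _ e2, code_inj _ _ e3]
  have : k = k' := by revert e4; cases k <;> cases k' <;> decide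
  rw [this]

/-- Reification of a list of embedding factors. -/
class HasFac (l : List (Key ι × ℂ)) where
  L : List (Key ι × Q)
  h : List.Forall₂ (fun t s => t.1 = s.1 ∧ QRep t.2 s.2) l L

instance : HasFac ([] : List (Key ι × ℂ)) := ⟨[], .nil⟩

instance (c x y : ι) (z : ℂ) (l : List (Key ι × ℂ)) [a : HasQ z] [b : HasFac l] :
    HasFac (e c x y z :: l) := ⟨((c, x, y, Label.n), a.q) :: b.L, .cons ⟨rfl, a.h⟩ b.h⟩

instance (c x y : ι) (z : ℂ) (l : List (Key ι × ℂ)) [a : HasQ z] [b : HasFac l] :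
    HasFac (es c x y z :: l) := ⟨((c, x, y, Label.s), a.q) :: b.L, .cons ⟨rfl, a.h⟩ b.h⟩

instance (c x y : ι) (z : ℂ) (l : List (Key ι × ℂ)) [a : HasQ z] [b : HasFac l] :
    HasFac (ea c x y z :: l) := ⟨((c, x, y, Label.a), a.q) :: b.L, .cons ⟨rfl, a.h⟩ b.h⟩

instance (w : ℂ) (l : List (Key ι × ℂ)) [a : HasQ w] [b : HasFac l] : HasFac (rephase w l) :=
  ⟨b.L.map fun s => (s.1, a.q.mul s.2), by
    rw [rephase, List.forall₂_map_left_iff, List.forall₂_map_right_iff]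
    exact b.h.imp fun t s h => ⟨h.1, a.h.mul h.2⟩⟩

/-- `z` is the radical of grade `g` times a number represented by the data. -/
def GRep (z : ℂ) (g d b v w : ℕ) : Prop := ∃ z', z = radical g * z' ∧ Rep2 z' d b v w

def facV (L : List (Key ι × Q)) (key : ℕ) : ℕ :=
  List.rec 0 (fun s _ r => cond (Nat.beq (keyCode s.1) key) (Nat.add s.2.v r) r) L

def facW (L : List (Key ι × Q)) (key : ℕ) : ℕ :=
  List.rec 0 (fun s _ r => cond (Nat.beq (keyCode s.1) key) (Nat.add s.2.w r) r) L

def facD (L : List (Key ι × Q)) : ℕ :=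
  List.rec 1 (fun s _ r => Nat.div (Nat.mul s.2.d r) (Nat.gcd s.2.d r)) L

def facB (D : ℕ) (L : List (Key ι × Q)) : ℕ :=
  List.rec 0 (fun s _ r => Nat.add (Nat.mul s.2.b (Nat.div D s.2.d)) r) L

def facG (L : List (Key ι × Q)) : ℕ := List.rec 0 (fun s _ _ => s.2.g) L

def facOk (g D : ℕ) (L : List (Key ι × Q)) : Bool :=
  cond (cond (Nat.ble g 3) (Nat.ble 1 D) false)
    (allL L fun s => cond (Nat.beq s.2.g g) (Nat.beq (Nat.mod D s.2.d) 0) false) false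

theorem gRep_factors_aux [DecidableEq ι] {g D : ℕ} (hg : g ≤ 3) (hD : 0 < D)
    {l : List (Key ι × ℂ)} {L : List (Key ι × Q)}
    (h : List.Forall₂ (fun t s => t.1 = s.1 ∧ QRep t.2 s.2) l L)
    (hL : ∀ s ∈ L, s.2.g = g ∧ D % s.2.d = 0) (c x y : ι) (k : Label) :
    GRep (factors l c x y k) g D (facB D L) (facV L (keyCode (c, x, y, k)))
      (facW L (keyCode (c, x, y, k))) := by
  induction h with
  | nil => exact ⟨0, by simp [factors], Rep2.zero hD _⟩
  | @cons t s l L hts h ih =>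
    obtain ⟨z, hz, hz'⟩ := ih fun s hs => hL s (by simp [hs])
    have eV : facV (s :: L) (keyCode (c, x, y, k)) =
      cond (Nat.beq (keyCode s.1) (keyCode (c, x, y, k)))
        (Nat.add s.2.v (facV L (keyCode (c, x, y, k)))) (facV L (keyCode (c, x, y, k))) := rfl
    have eW : facW (s :: L) (keyCode (c, x, y, k)) =
      cond (Nat.beq (keyCode s.1) (keyCode (c, x, y, k)))
        (Nat.add s.2.w (facW L (keyCode (c, x, y, k)))) (facW L (keyCode (c, x, y, k))) := rfl
    have eB : facB D (s :: L) = s.2.b * (D / s.2.d) + facB D L := rfl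
    rw [eV, eW, eB, natBeq_eq_decide]
    by_cases e : s.1 = (c, x, y, k)
    · rw [decide_eq_true (keyCode_inj.2 e), cond_true, cond_true]
      obtain ⟨h1, h2⟩ := hL s (by simp)
      obtain ⟨z₁, e₁, hz₁⟩ := hts.2.rep2 (h1 ▸ hg)
      have hz₂ := hz₁.rescale h2 hD le_rfl
      refine ⟨z₁ + z, ?_, hz₂.1.add' hz'.1, ?_⟩
      · have : factors (t :: l) c x y k = t.2 + factors l c x y k := by
          simp [factors, hts.1, e]
        rw [this, hz, e₁, h1]; ring
      · rw [star_add]; exact hz₂.2.add' hz'.2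
    · rw [decide_eq_false (fun h => e (keyCode_inj.1 h)), cond_false, cond_false]
      refine ⟨z, ?_, hz'.1.mono (Nat.le_add_left _ _), hz'.2.mono (Nat.le_add_left _ _)⟩
      have : factors (t :: l) c x y k = factors l c x y k := by
        have : ¬ t.1 = (c, x, y, k) := hts.1 ▸ e
        simp [factors, this]
      rw [this, hz]

/-- The numerical data of a contraction. -/
structure ChanQ (ι : Type) where
  target : GIrrep
  sym : Label
  mult : ℕ
  ok : Bool
  g : ℕ
  d : ℕ
  b : ℕ
  v : ι → ι → ι → Label → ℕ
  w : ι → ι → ι → Label → ℕ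
  keys : List (Key ι)

/-- The data `q` represent the contraction `ch`. -/
structure ChanRep [DecidableEq ι] (ch : Channel ι) (q : ChanQ ι) : Prop where
  target : ch.target = q.target
  sym : ch.sym = q.sym
  mult : ch.mult = q.mult
  rep : q.ok = true → ∀ c x y k, GRep (ch.emb c x y k) q.g q.d q.b (q.v c x y k) (q.w c x y k)
  grade : q.ok = true → q.g ≤ 3
  keys : ∀ c x y k, ch.emb c x y k ≠ 0 → (c, x, y, k) ∈ q.keys

class HasChan [DecidableEq ι] (ch : Channel ι) where
  q : ChanQ ι
  h : ChanRep ch q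

class HasTable [DecidableEq ι] (l : List (Channel ι)) where
  L : List (ChanQ ι)
  h : List.Forall₂ ChanRep l L

theorem exists_mem_of_factors_ne_zero [DecidableEq ι] {l : List (Key ι × ℂ)}
    {L : List (Key ι × Q)} (h : List.Forall₂ (fun t s => t.1 = s.1 ∧ QRep t.2 s.2) l L)
    {c x y : ι} {k : Label} (hne : factors l c x y k ≠ 0) : (c, x, y, k) ∈ L.map Prod.fst := by
  induction h with
  | nil => exact absurd (by simp [factors]) hne
  | @cons t s l L hts h ih =>
    by_cases e : s.1 = (c, x, y, k)
    · simp [e]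
    · have : factors (t :: l) c x y k = factors l c x y k := by
        have : ¬ t.1 = (c, x, y, k) := hts.1 ▸ e
        simp [factors, this]
      rw [this] at hne
      rw [List.map_cons, List.mem_cons]; exact Or.inr (ih hne)

instance [DecidableEq ι] (t : GIrrep) (u : Label) (m : ℕ) (l : List (Key ι × ℂ)) [a : HasFac l] :
    HasChan (⟨t, u, m, factors l⟩ : Channel ι) where
  q := ⟨t, u, m, facOk (facG a.L) (facD a.L) a.L, facG a.L, facD a.L, facB (facD a.L) a.L,
    fun c x y k => force (keyCode (c, x, y, k)) fun key => Nat.mod (facV a.L key) modulus,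
    fun c x y k => force (keyCode (c, x, y, k)) fun key => Nat.mod (facW a.L key) modulus,
    a.L.map Prod.fst⟩
  h := by
    refine ⟨rfl, rfl, rfl, fun hok c x y k => ?_, fun hok => ?_, fun c x y k =>
      exists_mem_of_factors_ne_zero a.h⟩
    · simp only [facOk, cond_false_eq_true_iff, natBle_iff, allL_iff, natBeq_iff] at hok
      obtain ⟨z, hz, hz'⟩ := gRep_factors_aux hok.1.1 hok.1.2 a.h hok.2 c x y k
      exact ⟨z, hz, by simpa only [force_eq] using hz'.mod⟩
    · simp only [facOk, cond_false_eq_true_iff, natBle_iff] at hok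
      exact hok.1.1

instance [DecidableEq ι] : HasTable ([] : List (Channel ι)) := ⟨[], .nil⟩

instance [DecidableEq ι] (ch : Channel ι) (l : List (Channel ι)) [a : HasChan ch] [b : HasTable l] :
    HasTable (ch :: l) := ⟨a.q :: b.L, .cons a.h b.h⟩

def ChanQ.conj (bar : ι → ι) (q : ChanQ ι) : ChanQ ι where
  target := q.target.bar
  sym := q.sym
  mult := q.mult
  ok := q.ok
  g := q.g
  d := q.d
  b := q.b
  v c x y k := q.w (bar c) (bar x) (bar y) k
  w c x y k := q.v (bar c) (bar x) (bar y) k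
  keys := q.keys.map fun t => (bar t.1, bar t.2.1, bar t.2.2.1, t.2.2.2)

theorem ChanRep.conj [DecidableEq ι] {bar : ι → ι} (hbar : ∀ x, bar (bar x) = x) {ch : Channel ι}
    {q : ChanQ ι} (h : ChanRep ch q) : ChanRep (ch.conj bar) (q.conj bar) where
  target := congrArg GIrrep.bar h.target
  sym := h.sym
  mult := h.mult
  rep hok c x y k := by
    obtain ⟨z, hz, hz'⟩ := h.rep hok (bar c) (bar x) (bar y) k
    refine ⟨star z, ?_, hz'.star⟩
    simp only [Channel.conj, ChanQ.conj, hz, star_mul', star_radical]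
  grade := h.grade
  keys c x y k hne := by
    have : ch.emb (bar c) (bar x) (bar y) k ≠ 0 := by
      intro h0; exact hne (by simp [Channel.conj, h0])
    have := h.keys _ _ _ _ this
    simp only [ChanQ.conj, List.mem_map]
    exact ⟨_, this, by simp [hbar]⟩

@[reducible] def HasTable.conj [DecidableEq ι] {bar : ι → ι} (hbar : ∀ x, bar (bar x) = x)
    {l : List (Channel ι)} (a : HasTable l) : HasTable (l.map (Channel.conj bar)) :=
  ⟨a.L.map (ChanQ.conj bar), by
    rw [List.forall₂_map_left_iff, List.forall₂_map_right_iff]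
    exact a.h.imp fun t s h => h.conj hbar⟩

@[reducible] def HasTable.congr [DecidableEq ι] {l l' : List (Channel ι)} (a : HasTable l')
    (h : l = l') : HasTable l := ⟨a.L, h ▸ a.h⟩

theorem trivialChannel_eq [DecidableEq ι] (i : ι) (content : GIrrep → List ι) (Y : GIrrep)
    (hnd : (content Y).Nodup) : trivialChannel i content Y =
      ⟨Y, Label.n, 1, factors ((content Y).map fun c => e c i c 1)⟩ := by
  unfold trivialChannel
  congr 1
  funext c x y k
  generalize content Y = l at hnd
  induction l with
  | nil => simp [factors]
  | cons d l ih =>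
    rw [List.nodup_cons] at hnd
    have h := ih hnd.2
    rw [List.map_cons]
    by_cases hd : (d, i, d, Label.n) = (c, x, y, k)
    · simp only [Prod.mk.injEq] at hd
      obtain ⟨rfl, rfl, rfl, rfl⟩ := hd
      have h0 : factors (l.map fun c => e c i c 1) d i d Label.n = 0 := by
        rw [← h]; simp [hnd.1]
      have h1 : factors (e d i d 1 :: l.map fun c => e c i c 1) d i d Label.n =
        1 + factors (l.map fun c => e c i c 1) d i d Label.n := by simp [factors, e]
      rw [h1, h0]; simp
    · have h1 : factors (e d i d 1 :: l.map fun c => e c i c 1) c x y k =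
        factors (l.map fun c => e c i c 1) c x y k := by
        simp [factors, e, hd]
      rw [h1, ← h]
      simp only [Prod.mk.injEq] at hd
      have : (x = i ∧ y = c ∧ k = Label.n ∧ c ∈ d :: l) ↔ (x = i ∧ y = c ∧ k = Label.n ∧ c ∈ l) := by
        rw [List.mem_cons]
        constructor
        · rintro ⟨rfl, rfl, rfl, rfl | h⟩
          · exact absurd ⟨rfl, rfl, rfl, rfl⟩ hd
          · exact ⟨rfl, rfl, rfl, h⟩
        · rintro ⟨h1, h2, h3, h4⟩; exact ⟨h1, h2, h3, Or.inr h4⟩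
      simp only [this]

end

instance : HasTable tableS33 := by delta tableS33; infer_instance
instance : HasTable tableS33b := by delta tableS33b; infer_instance
instance : HasTable tableS36 := by delta tableS36; infer_instance
instance : HasTable tableS37 := by delta tableS37; infer_instance
instance : HasTable tableS38 := by delta tableS38; infer_instance
instance : HasTable tableS66 := by delta tableS66; infer_instance
instance : HasTable tableS67 := by delta tableS67; infer_instance
instance : HasTable tableS68 := by delta tableS68; infer_instance
instance : HasTable tableS77 := by delta tableS77; infer_instance
instance : HasTable tableS78 := by delta tableS78; infer_instance
instance : HasTable tableS88 := by delta tableS88; infer_instance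

instance : HasTable tableT33 := by delta tableT33; infer_instance
instance : HasTable tableT33b := by delta tableT33b; infer_instance
instance : HasTable tableT36 := by delta tableT36; infer_instance
instance : HasTable tableT37 := by delta tableT37; infer_instance
instance : HasTable tableT38 := by delta tableT38; infer_instance
instance : HasTable tableT66 := by delta tableT66; infer_instance
instance : HasTable tableT67 := by delta tableT67; infer_instance
instance : HasTable tableT68 := by delta tableT68; infer_instance
instance : HasTable tableT77 := by delta tableT77; infer_instance
instance : HasTable tableT78 := by delta tableT78; infer_instance
instance : HasTable tableT88 := by delta tableT88; infer_instance

instance (l : List (Channel S4Irrep)) [a : HasTable l] : HasTable (l.map (Channel.conj id)) :=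
  a.conj (fun _ => rfl)

theorem nodup_contentS (X : GIrrep) : (contentS X).Nodup := by cases X <;> decide

@[reducible] def hasTableS₁ (Y : GIrrep) : HasTable [trivialChannel s1₀ contentS Y] :=
  HasTable.congr (l' := [⟨Y, Label.n, 1, factors ((contentS Y).map fun c => e c s1₀ c 1)⟩])
    (by cases Y <;> (dsimp only [contentS, List.map]; infer_instance))
    (by rw [trivialChannel_eq _ _ _ (nodup_contentS Y)])

@[reducible] def hasTableS : (X Y : GIrrep) → HasTable (tableS X Y)
  | .g1, Y => hasTableS₁ Y
  | .g3, .g1 => inferInstanceAs (HasTable ([] : List (Channel S4Irrep)))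
  | .g3, .g3 => inferInstanceAs (HasTable tableS33)
  | .g3, .g3b => inferInstanceAs (HasTable tableS33b)
  | .g3, .g6 => inferInstanceAs (HasTable tableS36)
  | .g3, .g7 => inferInstanceAs (HasTable tableS37)
  | .g3, .g8 => inferInstanceAs (HasTable tableS38)
  | .g3b, .g1 => inferInstanceAs (HasTable ([] : List (Channel S4Irrep)))
  | .g3b, .g3 => inferInstanceAs (HasTable ([] : List (Channel S4Irrep)))
  | .g3b, .g3b => inferInstanceAs (HasTable (tableS33.map (Channel.conj id)))
  | .g3b, .g6 => inferInstanceAs (HasTable (tableS36.map (Channel.conj id)))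
  | .g3b, .g7 => inferInstanceAs (HasTable (tableS37.map (Channel.conj id)))
  | .g3b, .g8 => inferInstanceAs (HasTable (tableS38.map (Channel.conj id)))
  | .g6, .g1 => inferInstanceAs (HasTable ([] : List (Channel S4Irrep)))
  | .g6, .g3 => inferInstanceAs (HasTable ([] : List (Channel S4Irrep)))
  | .g6, .g3b => inferInstanceAs (HasTable ([] : List (Channel S4Irrep)))
  | .g6, .g6 => inferInstanceAs (HasTable tableS66)
  | .g6, .g7 => inferInstanceAs (HasTable tableS67)
  | .g6, .g8 => inferInstanceAs (HasTable tableS68)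
  | .g7, .g1 => inferInstanceAs (HasTable ([] : List (Channel S4Irrep)))
  | .g7, .g3 => inferInstanceAs (HasTable ([] : List (Channel S4Irrep)))
  | .g7, .g3b => inferInstanceAs (HasTable ([] : List (Channel S4Irrep)))
  | .g7, .g6 => inferInstanceAs (HasTable ([] : List (Channel S4Irrep)))
  | .g7, .g7 => inferInstanceAs (HasTable tableS77)
  | .g7, .g8 => inferInstanceAs (HasTable tableS78)
  | .g8, .g1 => inferInstanceAs (HasTable ([] : List (Channel S4Irrep)))
  | .g8, .g3 => inferInstanceAs (HasTable ([] : List (Channel S4Irrep)))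
  | .g8, .g3b => inferInstanceAs (HasTable ([] : List (Channel S4Irrep)))
  | .g8, .g6 => inferInstanceAs (HasTable ([] : List (Channel S4Irrep)))
  | .g8, .g7 => inferInstanceAs (HasTable ([] : List (Channel S4Irrep)))
  | .g8, .g8 => inferInstanceAs (HasTable tableS88)

theorem T7Irrep.bar_bar (x : T7Irrep) : x.bar.bar = x := by cases x <;> rfl

instance (l : List (Channel T7Irrep)) [a : HasTable l] : HasTable (l.map (Channel.conj T7Irrep.bar)) :=
  a.conj T7Irrep.bar_bar

theorem nodup_contentT (X : GIrrep) : (contentT X).Nodup := by cases X <;> decide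

@[reducible] def hasTableT₁ (Y : GIrrep) : HasTable [trivialChannel t1 contentT Y] :=
  HasTable.congr (l' := [⟨Y, Label.n, 1, factors ((contentT Y).map fun c => e c t1 c 1)⟩])
    (by cases Y <;> (dsimp only [contentT, List.map]; infer_instance))
    (by rw [trivialChannel_eq _ _ _ (nodup_contentT Y)])

@[reducible] def hasTableT : (X Y : GIrrep) → HasTable (tableT X Y)
  | .g1, Y => hasTableT₁ Y
  | .g3, .g1 => inferInstanceAs (HasTable ([] : List (Channel T7Irrep)))
  | .g3, .g3 => inferInstanceAs (HasTable tableT33)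
  | .g3, .g3b => inferInstanceAs (HasTable tableT33b)
  | .g3, .g6 => inferInstanceAs (HasTable tableT36)
  | .g3, .g7 => inferInstanceAs (HasTable tableT37)
  | .g3, .g8 => inferInstanceAs (HasTable tableT38)
  | .g3b, .g1 => inferInstanceAs (HasTable ([] : List (Channel T7Irrep)))
  | .g3b, .g3 => inferInstanceAs (HasTable ([] : List (Channel T7Irrep)))
  | .g3b, .g3b => inferInstanceAs (HasTable (tableT33.map (Channel.conj T7Irrep.bar)))
  | .g3b, .g6 => inferInstanceAs (HasTable (tableT36.map (Channel.conj T7Irrep.bar)))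
  | .g3b, .g7 => inferInstanceAs (HasTable (tableT37.map (Channel.conj T7Irrep.bar)))
  | .g3b, .g8 => inferInstanceAs (HasTable (tableT38.map (Channel.conj T7Irrep.bar)))
  | .g6, .g1 => inferInstanceAs (HasTable ([] : List (Channel T7Irrep)))
  | .g6, .g3 => inferInstanceAs (HasTable ([] : List (Channel T7Irrep)))
  | .g6, .g3b => inferInstanceAs (HasTable ([] : List (Channel T7Irrep)))
  | .g6, .g6 => inferInstanceAs (HasTable tableT66)
  | .g6, .g7 => inferInstanceAs (HasTable tableT67)
  | .g6, .g8 => inferInstanceAs (HasTable tableT68)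
  | .g7, .g1 => inferInstanceAs (HasTable ([] : List (Channel T7Irrep)))
  | .g7, .g3 => inferInstanceAs (HasTable ([] : List (Channel T7Irrep)))
  | .g7, .g3b => inferInstanceAs (HasTable ([] : List (Channel T7Irrep)))
  | .g7, .g6 => inferInstanceAs (HasTable ([] : List (Channel T7Irrep)))
  | .g7, .g7 => inferInstanceAs (HasTable tableT77)
  | .g7, .g8 => inferInstanceAs (HasTable tableT78)
  | .g8, .g1 => inferInstanceAs (HasTable ([] : List (Channel T7Irrep)))
  | .g8, .g3 => inferInstanceAs (HasTable ([] : List (Channel T7Irrep)))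
  | .g8, .g3b => inferInstanceAs (HasTable ([] : List (Channel T7Irrep)))
  | .g8, .g6 => inferInstanceAs (HasTable ([] : List (Channel T7Irrep)))
  | .g8, .g7 => inferInstanceAs (HasTable ([] : List (Channel T7Irrep)))
  | .g8, .g8 => inferInstanceAs (HasTable tableT88)

end
end PSL27

namespace PSL27
open Matrix
open scoped Kronecker MatrixGroups
open Complex (I exp)

noncomputable section

/-! ### Computation with matrices -/

def allN2 (m n : ℕ) (p : ℕ → ℕ → Bool) : Bool := allN m fun i => allN n fun j => p i j

theorem allN2_iff {m n : ℕ} {p : ℕ → ℕ → Bool} :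
    allN2 m n p = true ↔ ∀ i < m, ∀ j < n, p i j = true := by
  simp only [allN2, allN_iff]

/-- Numerical data of a matrix with entries in the cyclotomic field. -/
structure MatQ where
  ok : Bool
  D : ℕ
  B : ℕ
  v : ℕ → ℕ → ℕ
  w : ℕ → ℕ → ℕ

/-- `a` represents `M`, unless the computation failed. -/
def MatRep {m n : ℕ} (M : Matrix (Fin m) (Fin n) ℂ) (a : MatQ) : Prop :=
  a.ok = true → 0 < a.D ∧ ∀ i j, Rep2 (M i j) a.D a.B (a.v i j) (a.w i j)

namespace MatQ

def lcmN (n : ℕ) (f : ℕ → ℕ) : ℕ :=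
  Nat.rec 1 (fun k r => Nat.div (Nat.mul (f k) r) (Nat.gcd (f k) r)) n

def maxN (n : ℕ) (f : ℕ → ℕ) : ℕ :=
  Nat.rec 0 (fun k r => cond (Nat.ble (f k) r) r (f k)) n

def entryOk (D B : ℕ) (q : Q) : Bool :=
  cond (Nat.beq q.g 0) (cond (Nat.beq (Nat.mod D q.d) 0)
    (Nat.ble (Nat.mul q.b (Nat.div D q.d)) B) false) false

def ofDB (m n D B : ℕ) (q : ℕ → ℕ → Q) : MatQ where
  ok := cond (Nat.ble 1 D) (allN2 m n fun i j => entryOk D B (q i j)) false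
  D := D
  B := B
  v i j := (q i j).v
  w i j := (q i j).w

def ofQ (m n : ℕ) (q : ℕ → ℕ → Q) : MatQ :=
  force (lcmN m fun i => lcmN n fun j => (q i j).d) fun D =>
    force (maxN m fun i => maxN n fun j => Nat.mul (q i j).b (Nat.div D (q i j).d)) fun B =>
      ofDB m n D B q

def mul (n : ℕ) (a b : MatQ) : MatQ where
  ok := cond a.ok b.ok false
  D := Nat.mul a.D b.D
  B := Nat.mul n (Nat.mul a.B b.B)
  v i j := Nat.mod (sumN n fun k => Nat.mul (a.v i k) (b.v k j)) modulus
  w i j := Nat.mod (sumN n fun k => Nat.mul (a.w i k) (b.w k j)) modulus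

def conj (a : MatQ) : MatQ := ⟨a.ok, a.D, a.B, a.w, a.v⟩

def adj (a : MatQ) : MatQ := ⟨a.ok, a.D, a.B, fun i j => a.w j i, fun i j => a.v j i⟩

def one : MatQ :=
  ⟨true, 1, 1, fun i j => cond (Nat.beq i j) 1 0, fun i j => cond (Nat.beq i j) 1 0⟩

def zero : MatQ := ⟨true, 1, 0, fun _ _ => 0, fun _ _ => 0⟩

def add (a b : MatQ) : MatQ where
  ok := cond a.ok b.ok false
  D := Nat.mul a.D b.D
  B := Nat.add (Nat.mul b.D a.B) (Nat.mul a.D b.B)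
  v i j := Nat.mod (Nat.add (a.v i j) (b.v i j)) modulus
  w i j := Nat.mod (Nat.add (a.w i j) (b.w i j)) modulus

def sum {τ : Type} (l : List τ) (f : τ → MatQ) : MatQ := List.rec zero (fun t _ s => add (f t) s) l

def eqv (m n : ℕ) (a b : MatQ) : Bool :=
  cond (cond a.ok b.ok false) (cond (smallN a.D a.B b.D b.B)
    (allN2 m n fun i j => congN (a.v i j) (b.v i j)) false) false

end MatQ

namespace MatRep

variable {l m n : ℕ}

theorem ofDB {M : Matrix (Fin m) (Fin n) ℂ} {q : ℕ → ℕ → Q} (h : ∀ i j, QRep (M i j) (q i j))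
    (D B : ℕ) : MatRep M (MatQ.ofDB m n D B q) := by
  intro hok
  simp only [MatQ.ofDB, cond_false_eq_true_iff, allN2_iff, natBle_iff] at hok
  refine ⟨hok.1, fun i j => ?_⟩
  have h1 := hok.2 i i.2 j j.2
  simp only [MatQ.entryOk, cond_false_eq_true_iff, natBle_iff, natBeq_iff] at h1
  exact ((h i j).rep2_of_grade_zero h1.1).rescale h1.2.1 hok.1 h1.2.2

theorem ofQ {M : Matrix (Fin m) (Fin n) ℂ} {q : ℕ → ℕ → Q} (h : ∀ i j, QRep (M i j) (q i j)) :
    MatRep M (MatQ.ofQ m n q) := by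
  rw [MatQ.ofQ, force_eq, force_eq]
  exact ofDB h _ _

theorem mul {M : Matrix (Fin l) (Fin m) ℂ} {N : Matrix (Fin m) (Fin n) ℂ} {a b : MatQ}
    (hM : MatRep M a) (hN : MatRep N b) : MatRep (M * N) (a.mul m b) := by
  intro hok
  simp only [MatQ.mul, cond_false_eq_true_iff] at hok
  obtain ⟨h1, h2⟩ := hM hok.1
  obtain ⟨h3, h4⟩ := hN hok.2
  have hD : 0 < Nat.mul a.D b.D := Nat.mul_pos h1 h3
  refine ⟨hD, fun i j => ?_⟩
  rw [Matrix.mul_apply]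
  refine (Rep2.sumN (B := Nat.mul a.B b.B) (g := fun k => Nat.mul (a.v i k) (b.v k j))
    (g' := fun k => Nat.mul (a.w i k) (b.w k j)) hD fun k => ?_).mod
  exact ⟨(h2 i k).1.mul (h4 k j).1, by rw [star_mul']; exact (h2 i k).2.mul (h4 k j).2⟩

theorem conj {M : Matrix (Fin m) (Fin n) ℂ} {a : MatQ} (hM : MatRep M a) :
    MatRep (M.map star) a.conj := fun hok =>
  ⟨(hM hok).1, fun i j => ((hM hok).2 i j).star⟩

theorem adj {M : Matrix (Fin m) (Fin n) ℂ} {a : MatQ} (hM : MatRep M a) : MatRep Mᴴ a.adj :=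
  fun hok => ⟨(hM hok).1, fun i j => ((hM hok).2 j i).star⟩

theorem zero : MatRep (0 : Matrix (Fin m) (Fin n) ℂ) MatQ.zero := fun _ =>
  ⟨Nat.one_pos, fun _ _ => Rep2.zero Nat.one_pos 0⟩

theorem one : MatRep (1 : Matrix (Fin n) (Fin n) ℂ) MatQ.one := fun _ =>
  ⟨Nat.one_pos, fun i j => by
    simp only [MatQ.one, natBeq_eq_decide, Matrix.one_apply]
    by_cases h : i = j
    · simp [h, Rep2.one]
    · simp [h, Fin.val_inj, Rep2.zero]⟩

theorem add {M N : Matrix (Fin m) (Fin n) ℂ} {a b : MatQ}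
    (hM : MatRep M a) (hN : MatRep N b) : MatRep (M + N) (a.add b) := by
  intro hok
  simp only [MatQ.add, cond_false_eq_true_iff] at hok
  obtain ⟨h1, h2⟩ := hM hok.1
  obtain ⟨h3, h4⟩ := hN hok.2
  have hD : 0 < Nat.mul a.D b.D := Nat.mul_pos h1 h3
  refine ⟨hD, fun i j => ?_⟩
  have key : ∀ {x y : ℂ} {v v' : ℕ}, Rep x a.D a.B v → Rep y b.D b.B v' →
      Rep (x + y) (Nat.mul a.D b.D) (Nat.add (Nat.mul b.D a.B) (Nat.mul a.D b.B)) (v + v') := by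
    intro x y v v' hx hy
    have h5 := hx.scale h3
    have h6 := hy.scale h1
    rw [Nat.mul_comm a.B] at h5
    rw [Nat.mul_comm b.D, Nat.mul_comm b.B] at h6
    exact h5.add' h6
  refine ⟨(key (h2 i j).1 (h4 i j).1).mod, ?_⟩
  rw [Matrix.add_apply, star_add]
  exact (key (h2 i j).2 (h4 i j).2).mod

theorem sum {τ : Type} {f : τ → Matrix (Fin m) (Fin n) ℂ} {g : τ → MatQ} (l : List τ)
    (h : ∀ t, MatRep (f t) (g t)) : MatRep (l.map f).sum (MatQ.sum l g) := by
  induction l with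
  | nil => exact zero
  | cons t l ih => rw [List.map_cons, List.sum_cons]; exact (h t).add ih

theorem eq {M N : Matrix (Fin m) (Fin n) ℂ} {a b : MatQ} (hM : MatRep M a) (hN : MatRep N b)
    (h : a.eqv m n b = true) : M = N := by
  simp only [MatQ.eqv, cond_false_eq_true_iff, allN2_iff] at h
  ext i j
  exact ((hM h.1.1).2 i j).1.eq_of_check ((hN h.1.2).2 i j).1 h.2.1 (h.2.2 i i.2 j j.2)

end MatRep

/-! ### Computation with matrices of bilinear maps -/

/-- Numerical data of the matrix of a bilinear map. -/
structure TenQ where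
  ok : Bool
  D : ℕ
  B : ℕ
  v : ℕ → ℕ → ℕ → ℕ
  w : ℕ → ℕ → ℕ → ℕ

def TenRep {l m n : ℕ} (M : Matrix (Fin l) (Fin m × Fin n) ℂ) (a : TenQ) : Prop :=
  a.ok = true → 0 < a.D ∧ ∀ k i j, Rep2 (M k (i, j)) a.D a.B (a.v k i j) (a.w k i j)

namespace TenQ

def ofDB (l m n D B : ℕ) (q : ℕ → ℕ → ℕ → Q) : TenQ where
  ok := cond (Nat.ble 1 D)
    (allN l fun k => allN2 m n fun i j => MatQ.entryOk D B (q k i j)) false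
  D := D
  B := B
  v k i j := (q k i j).v
  w k i j := (q k i j).w

def conj (a : TenQ) : TenQ := ⟨a.ok, a.D, a.B, a.w, a.v⟩

def mulLeft (l : ℕ) (a : MatQ) (t : TenQ) : TenQ where
  ok := cond a.ok t.ok false
  D := Nat.mul a.D t.D
  B := Nat.mul l (Nat.mul a.B t.B)
  v k i j := Nat.mod (sumN l fun k' => Nat.mul (a.v k k') (t.v k' i j)) modulus
  w k i j := Nat.mod (sumN l fun k' => Nat.mul (a.w k k') (t.w k' i j)) modulus

def mulFst (m : ℕ) (t : TenQ) (a : MatQ) : TenQ where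
  ok := cond t.ok a.ok false
  D := Nat.mul t.D a.D
  B := Nat.mul m (Nat.mul t.B a.B)
  v k i j := Nat.mod (sumN m fun i' => Nat.mul (t.v k i' j) (a.v i' i)) modulus
  w k i j := Nat.mod (sumN m fun i' => Nat.mul (t.w k i' j) (a.w i' i)) modulus

def mulSnd (n : ℕ) (t : TenQ) (a : MatQ) : TenQ where
  ok := cond t.ok a.ok false
  D := Nat.mul t.D a.D
  B := Nat.mul n (Nat.mul t.B a.B)
  v k i j := Nat.mod (sumN n fun j' => Nat.mul (t.v k i j') (a.v j' j)) modulus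
  w k i j := Nat.mod (sumN n fun j' => Nat.mul (t.w k i j') (a.w j' j)) modulus

def gram (m n : ℕ) (t s : TenQ) : MatQ where
  ok := cond t.ok s.ok false
  D := Nat.mul t.D s.D
  B := Nat.mul m (Nat.mul n (Nat.mul t.B s.B))
  v k k' := Nat.mod (sumN m fun i => sumN n fun j => Nat.mul (t.v k i j) (s.w k' i j)) modulus
  w k k' := Nat.mod (sumN m fun i => sumN n fun j => Nat.mul (t.w k i j) (s.v k' i j)) modulus

def swap (t : TenQ) : TenQ := ⟨t.ok, t.D, t.B, fun k i j => t.v k j i, fun k i j => t.w k j i⟩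

def neg (t : TenQ) : TenQ :=
  ⟨t.ok, t.D, t.B, fun k i j => Nat.sub modulus (Nat.mod (t.v k i j) modulus),
    fun k i j => Nat.sub modulus (Nat.mod (t.w k i j) modulus)⟩

def zero : TenQ := ⟨true, 1, 0, fun _ _ _ => 0, fun _ _ _ => 0⟩

def eqv (l m n : ℕ) (a b : TenQ) : Bool :=
  cond (cond a.ok b.ok false) (cond (smallN a.D a.B b.D b.B)
    (allN l fun k => allN2 m n fun i j => congN (a.v k i j) (b.v k i j)) false) false

end TenQ

namespace TenRep

variable {l m n : ℕ}

theorem ofDB {M : Matrix (Fin l) (Fin m × Fin n) ℂ} {q : ℕ → ℕ → ℕ → Q}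
    (h : ∀ k i j, QRep (M k (i, j)) (q k i j)) (D B : ℕ) : TenRep M (TenQ.ofDB l m n D B q) := by
  intro hok
  simp only [TenQ.ofDB, cond_false_eq_true_iff, allN_iff, allN2_iff, natBle_iff] at hok
  refine ⟨hok.1, fun k i j => ?_⟩
  have h1 := hok.2 k k.2 i i.2 j j.2
  simp only [MatQ.entryOk, cond_false_eq_true_iff, natBle_iff, natBeq_iff] at h1
  exact ((h k i j).rep2_of_grade_zero h1.1).rescale h1.2.1 hok.1 h1.2.2

theorem conj {M : Matrix (Fin l) (Fin m × Fin n) ℂ} {a : TenQ} (hM : TenRep M a) :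
    TenRep (M.map star) a.conj := fun hok =>
  ⟨(hM hok).1, fun k i j => ((hM hok).2 k i j).star⟩

theorem mulLeft {l' : ℕ} {A : Matrix (Fin l') (Fin l) ℂ} {M : Matrix (Fin l) (Fin m × Fin n) ℂ}
    {a : MatQ} {t : TenQ} (hA : MatRep A a) (hM : TenRep M t) :
    TenRep (A * M) (t.mulLeft l a) := by
  intro hok
  simp only [TenQ.mulLeft, cond_false_eq_true_iff] at hok
  obtain ⟨h1, h2⟩ := hA hok.1
  obtain ⟨h3, h4⟩ := hM hok.2
  have hD : 0 < Nat.mul a.D t.D := Nat.mul_pos h1 h3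
  refine ⟨hD, fun k i j => ?_⟩
  rw [Matrix.mul_apply]
  refine (Rep2.sumN (B := Nat.mul a.B t.B) (g := fun k' => Nat.mul (a.v k k') (t.v k' i j))
    (g' := fun k' => Nat.mul (a.w k k') (t.w k' i j)) hD fun k' => ?_).mod
  exact ⟨(h2 k k').1.mul (h4 k' i j).1, by rw [star_mul']; exact (h2 k k').2.mul (h4 k' i j).2⟩

theorem mulFst {m' : ℕ} {M : Matrix (Fin l) (Fin m × Fin n) ℂ} {A : Matrix (Fin m) (Fin m') ℂ}
    {t : TenQ} {a : MatQ} (hM : TenRep M t) (hA : MatRep A a) :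
    TenRep (M * (A ⊗ₖ (1 : Matrix (Fin n) (Fin n) ℂ))) (t.mulFst m a) := by
  intro hok
  simp only [TenQ.mulFst, cond_false_eq_true_iff] at hok
  obtain ⟨h1, h2⟩ := hM hok.1
  obtain ⟨h3, h4⟩ := hA hok.2
  have hD : 0 < Nat.mul t.D a.D := Nat.mul_pos h1 h3
  refine ⟨hD, fun k i j => ?_⟩
  have e : (M * (A ⊗ₖ (1 : Matrix (Fin n) (Fin n) ℂ))) k (i, j) = ∑ i', M k (i', j) * A i' i := by
    rw [Matrix.mul_apply, Fintype.sum_prod_type]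
    simp [Matrix.one_apply]
  rw [e]
  refine (Rep2.sumN (B := Nat.mul t.B a.B) (g := fun i' => Nat.mul (t.v k i' j) (a.v i' i))
    (g' := fun i' => Nat.mul (t.w k i' j) (a.w i' i)) hD fun i' => ?_).mod
  exact ⟨(h2 k i' j).1.mul (h4 i' i).1, by rw [star_mul']; exact (h2 k i' j).2.mul (h4 i' i).2⟩

theorem mulSnd {n' : ℕ} {M : Matrix (Fin l) (Fin m × Fin n) ℂ} {A : Matrix (Fin n) (Fin n') ℂ}
    {t : TenQ} {a : MatQ} (hM : TenRep M t) (hA : MatRep A a) :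
    TenRep (M * ((1 : Matrix (Fin m) (Fin m) ℂ) ⊗ₖ A)) (t.mulSnd n a) := by
  intro hok
  simp only [TenQ.mulSnd, cond_false_eq_true_iff] at hok
  obtain ⟨h1, h2⟩ := hM hok.1
  obtain ⟨h3, h4⟩ := hA hok.2
  have hD : 0 < Nat.mul t.D a.D := Nat.mul_pos h1 h3
  refine ⟨hD, fun k i j => ?_⟩
  have e : (M * ((1 : Matrix (Fin m) (Fin m) ℂ) ⊗ₖ A)) k (i, j) = ∑ j', M k (i, j') * A j' j := by
    rw [Matrix.mul_apply, Fintype.sum_prod_type_right]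
    simp [Matrix.one_apply]
  rw [e]
  refine (Rep2.sumN (B := Nat.mul t.B a.B) (g := fun j' => Nat.mul (t.v k i j') (a.v j' j))
    (g' := fun j' => Nat.mul (t.w k i j') (a.w j' j)) hD fun j' => ?_).mod
  exact ⟨(h2 k i j').1.mul (h4 j' j).1, by rw [star_mul']; exact (h2 k i j').2.mul (h4 j' j).2⟩

theorem mulKron {m' n' : ℕ} {M : Matrix (Fin l) (Fin m × Fin n) ℂ} {A : Matrix (Fin m) (Fin m') ℂ}
    {C : Matrix (Fin n) (Fin n') ℂ} {t : TenQ} {a c : MatQ} (hM : TenRep M t) (hA : MatRep A a)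
    (hC : MatRep C c) : TenRep (M * (A ⊗ₖ C)) ((t.mulFst m a).mulSnd n c) := by
  have : A ⊗ₖ C = (A ⊗ₖ (1 : Matrix (Fin n) (Fin n) ℂ)) * ((1 : Matrix (Fin m') (Fin m') ℂ) ⊗ₖ C) := by
    rw [← Matrix.mul_kronecker_mul, Matrix.mul_one, Matrix.one_mul]
  rw [this, ← Matrix.mul_assoc]
  exact (hM.mulFst hA).mulSnd hC

theorem gram {l' : ℕ} {M : Matrix (Fin l) (Fin m × Fin n) ℂ} {N : Matrix (Fin l') (Fin m × Fin n) ℂ}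
    {t s : TenQ} (hM : TenRep M t) (hN : TenRep N s) : MatRep (M * Nᴴ) (t.gram m n s) := by
  intro hok
  simp only [TenQ.gram, cond_false_eq_true_iff] at hok
  obtain ⟨h1, h2⟩ := hM hok.1
  obtain ⟨h3, h4⟩ := hN hok.2
  have hD : 0 < Nat.mul t.D s.D := Nat.mul_pos h1 h3
  refine ⟨hD, fun k k' => ?_⟩
  rw [Matrix.mul_apply, Fintype.sum_prod_type]
  refine (Rep2.sumN (B := Nat.mul n (Nat.mul t.B s.B))
    (g := fun i => PSL27.sumN n fun j => Nat.mul (t.v k i j) (s.w k' i j))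
    (g' := fun i => PSL27.sumN n fun j => Nat.mul (t.w k i j) (s.v k' i j)) hD fun i => ?_).mod
  refine Rep2.sumN (B := Nat.mul t.B s.B) (g := fun j => Nat.mul (t.v k i j) (s.w k' i j))
    (g' := fun j => Nat.mul (t.w k i j) (s.v k' i j)) hD fun j => ?_
  have h5 := (h4 k' i j).star
  exact ⟨(h2 k i j).1.mul h5.1, by
    rw [star_mul']; exact (h2 k i j).2.mul h5.2⟩

theorem swap {M : Matrix (Fin l) (Fin m × Fin n) ℂ} {t : TenQ} (hM : TenRep M t) :
    TenRep (M.submatrix id Prod.swap) t.swap := fun hok =>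
  ⟨(hM hok).1, fun k i j => (hM hok).2 k j i⟩

theorem neg {M : Matrix (Fin l) (Fin m × Fin n) ℂ} {t : TenQ} (hM : TenRep M t) :
    TenRep (-M) t.neg := fun hok =>
  ⟨(hM hok).1, fun k i j => ⟨((hM hok).2 k i j).1.neg, by
    rw [Matrix.neg_apply, star_neg]; exact ((hM hok).2 k i j).2.neg⟩⟩

theorem zero : TenRep (0 : Matrix (Fin l) (Fin m × Fin n) ℂ) TenQ.zero := fun _ =>
  ⟨Nat.one_pos, fun _ _ _ => Rep2.zero Nat.one_pos 0⟩

theorem eq {M N : Matrix (Fin l) (Fin m × Fin n) ℂ} {a b : TenQ} (hM : TenRep M a) (hN : TenRep N b)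
    (h : a.eqv l m n b = true) : M = N := by
  simp only [TenQ.eqv, cond_false_eq_true_iff, allN_iff, allN2_iff] at h
  ext k ⟨i, j⟩
  exact ((hM h.1.1).2 k i j).1.eq_of_check ((hN h.1.2).2 k i j).1 h.2.1 (h.2.2 k k.2 i i.2 j j.2)

end TenRep
end
end PSL27

namespace PSL27
open Matrix
open scoped Kronecker MatrixGroups
open Complex (I exp)
open IrrepCode

noncomputable section

/-! ### Words in two generators -/

/-- The value of a word: `true` stands for the first letter, `false` for the second one. -/
def evalWord {M : Type} [Monoid M] (w : List Bool) (x y : M) : M :=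
  (w.map fun t => cond t x y).prod

theorem evalWord_nil {M : Type} [Monoid M] (x y : M) : evalWord [] x y = 1 := rfl

theorem evalWord_cons {M : Type} [Monoid M] (t : Bool) (w : List Bool) (x y : M) :
    evalWord (t :: w) x y = cond t x y * evalWord w x y := by simp [evalWord]

theorem map_evalWord {M N : Type} [Monoid M] [Monoid N] (f : M →* N) (w : List Bool) (x y : M) :
    f (evalWord w x y) = evalWord w (f x) (f y) := by
  induction w with
  | nil => exact map_one f
  | cons t w ih => rw [evalWord_cons, evalWord_cons, map_mul, ih]; cases t <;> rfl

def MatQ.word (n : ℕ) (a b : MatQ) (w : List Bool) : MatQ :=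
  List.rec MatQ.one (fun t _ s => MatQ.mul n (cond t a b) s) w

theorem MatRep.word {n : ℕ} {A B : Matrix (Fin n) (Fin n) ℂ} {a b : MatQ} (hA : MatRep A a)
    (hB : MatRep B b) (w : List Bool) : MatRep (evalWord w A B) (MatQ.word n a b w) := by
  induction w with
  | nil => exact MatRep.one
  | cons t w ih =>
    rw [evalWord_cons]
    cases t
    · exact hB.mul ih
    · exact hA.mul ih

/-- The words `A²`, `B³`, `(AB)⁷`, `[A, B]⁴` (with `A⁻¹ = A`, `B⁻¹ = B²`). -/
def relators : List (List Bool) :=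
  [[true, true], [false, false, false],
    [true, false, true, false, true, false, true, false, true, false, true, false, true, false],
    [true, false, true, false, false, true, false, true, false, false,
      true, false, true, false, false, true, false, true, false, false]]

/-! ### Numerical models of adapted bases -/

/-- The data of an adapted basis in a form suited for computation. -/
structure Model {ι : Type} [Fintype ι] [DecidableEq ι] [IrrepCode ι] (D : AdaptedBasis ι) where
  elems : List ι
  sum_elems : ∀ {M : Type} [AddCommMonoid M] (f : ι → M), ∑ a, f a = (elems.map f).sum
  mem_elems : ∀ a, a ∈ elems
  blk : GIrrep → ℕ → ι
  pos : GIrrep → ℕ → ℕ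
  phase : GIrrep → ι → ℂ
  phaseQ : GIrrep → ι → Q
  phase_rep : ∀ X a, QRep (phase X a) (phaseQ X a)
  pos_lt : ∀ X, ∀ x : Fin X.dim, pos X x < D.dim (blk X x)
  proj_apply : ∀ X a i, ∀ x : Fin X.dim,
    D.proj X a i x = if blk X x = a ∧ pos X x = i then phase X a else 0
  gen₁ : ∀ x, HasMat (D.gen₁ x)
  gen₂ : ∀ x, HasMat (D.gen₂ x)
  conjMat : ∀ x, HasMat (D.conjMat x)
  matA : ∀ X, HasMat (D.matA X)
  matB : ∀ X, HasMat (D.matB X)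
  cg : ∀ x y z k, HasBil (D.cg x y z k)
  table : ∀ X Y, HasTable (D.table X Y)
  word₁ : List Bool
  word₂ : List Bool
  phD : ℕ
  phB : ℕ
  cgD : ℕ
  cgB : ℕ

def allG (p : GIrrep → Bool) : Bool := allL [.g1, .g3, .g3b, .g6, .g7, .g8] p

theorem allG_iff {p : GIrrep → Bool} : allG p = true ↔ ∀ X, p X = true := by
  rw [allG, allL_iff]
  exact ⟨fun h X => h X (by cases X <;> simp), fun h X _ => h X⟩

def allLabel (p : Label → Bool) : Bool := allL [.n, .s, .a] p

theorem allLabel_iff {p : Label → Bool} : allLabel p = true ↔ ∀ X, p X = true := by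
  rw [allLabel, allL_iff]
  exact ⟨fun h X => h X (by cases X <;> simp), fun h X _ => h X⟩

namespace Model

variable {ι : Type} [Fintype ι] [DecidableEq ι] [IrrepCode ι] {D : AdaptedBasis ι} (m : Model D)

def allI (p : ι → Bool) : Bool := allL m.elems p

theorem allI_iff {p : ι → Bool} : m.allI p = true ↔ ∀ a, p a = true := by
  rw [allI, allL_iff]
  exact ⟨fun h X => h X (m.mem_elems X), fun h X _ => h X⟩

def eqI (a b : ι) : Bool := Nat.beq (code a) (code b)

theorem eqI_iff {a b : ι} : eqI a b = true ↔ a = b := by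
  rw [eqI, natBeq_iff]
  exact ⟨code_inj _ _, fun h => h ▸ rfl⟩

def memI (a : ι) (l : List ι) : Bool := anyL l fun b => eqI a b

theorem memI_iff {a : ι} {l : List ι} : memI a l = true ↔ a ∈ l := by
  rw [memI, anyL_iff]; simp [eqI_iff]

theorem memI_eq_false_iff {a : ι} {l : List ι} : memI a l = false ↔ a ∉ l := by
  rw [← memI_iff, Bool.not_eq_true]

def A (X : GIrrep) : MatQ := MatQ.ofQ X.dim X.dim (m.matA X).q
def B (X : GIrrep) : MatQ := MatQ.ofQ X.dim X.dim (m.matB X).q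
def G₁ (x : ι) : MatQ := MatQ.ofQ (D.dim x) (D.dim x) (m.gen₁ x).q
def G₂ (x : ι) : MatQ := MatQ.ofQ (D.dim x) (D.dim x) (m.gen₂ x).q
def K (x : ι) : MatQ := MatQ.ofQ (D.dim (D.bar x)) (D.dim x) (m.conjMat x).q
def C (x y z : ι) (k : Label) : TenQ :=
  TenQ.ofDB (D.dim z) (D.dim x) (D.dim y) m.cgD m.cgB (m.cg x y z k).q

def P (X : GIrrep) (a : ι) : MatQ where
  ok := cond (Nat.ble 1 m.phD) (MatQ.entryOk m.phD m.phB (m.phaseQ X a)) false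
  D := m.phD
  B := m.phB
  v i x := cond (eqI (m.blk X x) a) (cond (Nat.beq (m.pos X x) i) (m.phaseQ X a).v 0) 0
  w i x := cond (eqI (m.blk X x) a) (cond (Nat.beq (m.pos X x) i) (m.phaseQ X a).w 0) 0

theorem repA (X : GIrrep) : MatRep (D.matA X) (m.A X) := MatRep.ofQ (m.matA X).h
theorem repB (X : GIrrep) : MatRep (D.matB X) (m.B X) := MatRep.ofQ (m.matB X).h
theorem repG₁ (x : ι) : MatRep (D.gen₁ x) (m.G₁ x) := MatRep.ofQ (m.gen₁ x).h
theorem repG₂ (x : ι) : MatRep (D.gen₂ x) (m.G₂ x) := MatRep.ofQ (m.gen₂ x).h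
theorem repK (x : ι) : MatRep (D.conjMat x) (m.K x) := MatRep.ofQ (m.conjMat x).h
theorem repC (x y z : ι) (k : Label) : TenRep (D.cg x y z k) (m.C x y z k) :=
  TenRep.ofDB (m.cg x y z k).h _ _

theorem repPhase {X : GIrrep} {a : ι} (h : (m.P X a).ok = true) :
    0 < m.phD ∧ Rep2 (m.phase X a) m.phD m.phB (m.phaseQ X a).v (m.phaseQ X a).w := by
  simp only [P, MatQ.entryOk, cond_false_eq_true_iff, natBle_iff, natBeq_iff] at h
  exact ⟨h.1, ((m.phase_rep X a).rep2_of_grade_zero h.2.1).rescale h.2.2.1 h.1 h.2.2.2⟩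

theorem repP (X : GIrrep) (a : ι) : MatRep (D.proj X a) (m.P X a) := by
  intro hok
  obtain ⟨h0, h1⟩ := m.repPhase hok
  refine ⟨h0, fun i x => ?_⟩
  rw [m.proj_apply]
  simp only [P, eqI, natBeq_eq_decide]
  by_cases e : m.blk X x = a
  · by_cases e' : m.pos X x = i
    · simpa [e, e'] using h1
    · simpa [e, e'] using Rep2.zero h0 _
  · have : code (m.blk X x) ≠ code a := fun h => e (code_inj _ _ h)
    simpa [e, this] using Rep2.zero h0 _

/-! #### Checks -/

def checkMat : Bool := allG fun X =>
  cond (allL relators fun w => ((m.A X).word X.dim (m.B X) w).eqv X.dim X.dim MatQ.one)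
    (cond (((m.A X).mul X.dim (m.A X).adj).eqv X.dim X.dim MatQ.one)
      (((m.B X).mul X.dim (m.B X).adj).eqv X.dim X.dim MatQ.one) false) false

def checkProj : Bool := allG fun X =>
  cond (m.allI fun a => cond (memI a (D.content X))
      (((m.P X a).mul X.dim (m.P X a).adj).eqv (D.dim a) (D.dim a) MatQ.one)
      ((m.P X a).eqv (D.dim a) X.dim MatQ.zero))
    (cond (m.allI fun a => m.allI fun b => cond (eqI a b) true
        (((m.P X a).mul X.dim (m.P X b).adj).eqv (D.dim a) (D.dim b) MatQ.zero))
      ((MatQ.sum m.elems fun a => (m.P X a).adj.mul (D.dim a) (m.P X a)).eqv X.dim X.dim MatQ.one)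
      false) false

def checkSub : Bool := allG fun X => m.allI fun a =>
  cond (((m.P X a).mul X.dim ((m.A X).word X.dim (m.B X) m.word₁)).eqv (D.dim a) X.dim
      ((m.G₁ a).mul (D.dim a) (m.P X a)))
    (((m.P X a).mul X.dim ((m.A X).word X.dim (m.B X) m.word₂)).eqv (D.dim a) X.dim
      ((m.G₂ a).mul (D.dim a) (m.P X a))) false

def KG (X : GIrrep) : MatQ := MatQ.sum m.elems fun x =>
  ((m.P X.bar (D.bar x)).adj.mul (D.dim (D.bar x)) (m.K x)).mul (D.dim x) (m.P X x).conj

theorem repKG (X : GIrrep) : MatRep (D.conjMatG X) (m.KG X) := by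
  rw [AdaptedBasis.conjMatG, m.sum_elems]
  exact MatRep.sum _ fun x => ((m.repP _ _).adj.mul (m.repK x)).mul (m.repP X x).conj

def checkConj : Bool := allG fun X =>
  cond (((m.KG X).mul X.dim (m.A X).conj).eqv X.bar.dim X.dim ((m.A X.bar).mul X.bar.dim (m.KG X)))
    (((m.KG X).mul X.dim (m.B X).conj).eqv X.bar.dim X.dim ((m.B X.bar).mul X.bar.dim (m.KG X)))
    false

def checkConjSub : Bool := m.allI fun x =>
  cond (cond (((m.K x).mul (D.dim x) (m.K x).adj).eqv (D.dim (D.bar x)) (D.dim (D.bar x)) MatQ.one)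
      (((m.K x).adj.mul (D.dim (D.bar x)) (m.K x)).eqv (D.dim x) (D.dim x) MatQ.one) false)
    (cond (((m.K x).mul (D.dim x) (m.G₁ x).conj).eqv (D.dim (D.bar x)) (D.dim x)
        ((m.G₁ (D.bar x)).mul (D.dim (D.bar x)) (m.K x)))
      (((m.K x).mul (D.dim x) (m.G₂ x).conj).eqv (D.dim (D.bar x)) (D.dim x)
        ((m.G₂ (D.bar x)).mul (D.dim (D.bar x)) (m.K x))) false) false

def checkGen : Bool := m.allI fun x =>
  cond (((m.G₁ x).mul (D.dim x) (m.G₁ x).adj).eqv (D.dim x) (D.dim x) MatQ.one)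
    (((m.G₂ x).mul (D.dim x) (m.G₂ x).adj).eqv (D.dim x) (D.dim x) MatQ.one) false

/-- Whether `x ⊗ y → z_k` exists. -/
def ex (x y z : ι) (k : Label) : Bool :=
  cond ((m.C x y z k).eqv (D.dim z) (D.dim x) (D.dim y) TenQ.zero) false true

def checkCG : Bool := m.allI fun x => m.allI fun y => m.allI fun z => allLabel fun k =>
  cond ((m.C x y z k).eqv (D.dim z) (D.dim x) (D.dim y) TenQ.zero) true
    (cond (((m.C x y z k).gram (D.dim x) (D.dim y) (m.C x y z k)).eqv (D.dim z) (D.dim z) MatQ.one)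
      (cond ((((m.C x y z k).mulFst (D.dim x) (m.G₁ x)).mulSnd (D.dim y) (m.G₁ y)).eqv
          (D.dim z) (D.dim x) (D.dim y) ((m.C x y z k).mulLeft (D.dim z) (m.G₁ z)))
        ((((m.C x y z k).mulFst (D.dim x) (m.G₂ x)).mulSnd (D.dim y) (m.G₂ y)).eqv
          (D.dim z) (D.dim x) (D.dim y) ((m.C x y z k).mulLeft (D.dim z) (m.G₂ z))) false) false)

def eqK (z z' : ι) (k k' : Label) : Bool := cond (eqI z z') (Nat.beq k.code k'.code) false

def checkCGOrth : Bool := m.allI fun x => m.allI fun y => m.allI fun z => allLabel fun k =>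
  m.allI fun z' => allLabel fun k' => cond (eqK z z' k k') true
    (cond (m.ex x y z k) (cond (m.ex x y z' k')
      (((m.C x y z k).gram (D.dim x) (D.dim y) (m.C x y z' k')).eqv (D.dim z) (D.dim z') MatQ.zero)
      true) true)

def checkCGDim : Bool := m.allI fun x => m.allI fun y =>
  Nat.beq (sumL m.elems fun z => sumL [Label.n, Label.s, Label.a] fun k =>
    cond (m.ex x y z k) (D.dim z) 0) (Nat.mul (D.dim x) (D.dim y))

def checkCGOk : Bool := m.allI fun x => m.allI fun y => m.allI fun z => allLabel fun k =>
  (m.C x y z k).ok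

def checkCGConj : Bool := m.allI fun x => m.allI fun y => m.allI fun z => allLabel fun k =>
  ((m.C x y z k).conj.mulLeft (D.dim z) (m.K z)).eqv (D.dim (D.bar z)) (D.dim x) (D.dim y)
    (((m.C (D.bar x) (D.bar y) (D.bar z) k).mulFst (D.dim (D.bar x)) (m.K x)).mulSnd
      (D.dim (D.bar y)) (m.K y))

end Model

/-! ### The models of the two bases -/

def blkS : GIrrep → ℕ → S4Irrep
  | .g1, _ => .s1₀
  | .g3, _ => .s3₂
  | .g3b, _ => .s3₂
  | .g6, n => cond (Nat.beq n 0) .s1₀ (cond (Nat.ble n 2) .s2 .s3₁)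
  | .g7, n => cond (Nat.beq n 0) .s1₁ (cond (Nat.ble n 3) .s3₁ .s3₂)
  | .g8, n => cond (Nat.ble n 1) .s2 (cond (Nat.ble n 4) .s3₁ .s3₂)

def posS : GIrrep → ℕ → ℕ
  | .g1, n => n
  | .g3, n => n
  | .g3b, n => Nat.mod (Nat.mul 2 n) 3
  | .g6, n => cond (Nat.ble n 2) (Nat.sub n 1) (Nat.sub n 3)
  | .g7, n => cond (Nat.ble n 3) (Nat.sub n 1) (Nat.sub n 4)
  | .g8, n => cond (Nat.ble n 1) n (cond (Nat.ble n 4) (Nat.sub n 2) (Nat.sub n 5))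

def phaseS : GIrrep → S4Irrep → ℂ
  | .g7, .s3₁ => I * b₇c ^ 3
  | .g7, .s3₂ => b₇c ^ 2
  | .g8, .s3₂ => -1
  | _, _ => 1

def blkT : GIrrep → ℕ → T7Irrep
  | .g1, _ => .t1
  | .g3, _ => .t3
  | .g3b, _ => .t3b
  | .g6, n => cond (Nat.ble n 2) .t3 .t3b
  | .g7, n => cond (Nat.beq n 0) .t1 (cond (Nat.ble n 3) .t3 .t3b)
  | .g8, n => cond (Nat.beq n 0) .t1p (cond (Nat.beq n 1) .t1q (cond (Nat.ble n 4) .t3 .t3b))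

def posT : GIrrep → ℕ → ℕ
  | .g1, n => n
  | .g3, n => n
  | .g3b, n => n
  | .g6, n => cond (Nat.ble n 2) n (Nat.sub n 3)
  | .g7, n => cond (Nat.ble n 3) (Nat.sub n 1) (Nat.sub n 4)
  | .g8, n => cond (Nat.ble n 1) 0 (cond (Nat.ble n 4) (Nat.sub n 2) (Nat.sub n 5))

def phaseT : GIrrep → T7Irrep → ℂ
  | .g7, .t1 => -1
  | _, _ => 1

@[reducible] def hasPhaseS (X : GIrrep) (a : S4Irrep) : HasQ (phaseS X a) := by
  cases X <;> cases a <;> (dsimp only [phaseS]; infer_instance)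

@[reducible] def hasPhaseT (X : GIrrep) (a : T7Irrep) : HasQ (phaseT X a) := by
  cases X <;> cases a <;> (dsimp only [phaseT]; infer_instance)

theorem block_apply_eq {m n o : ℕ} {z : ℂ} {p q : Prop} [Decidable p] [Decidable q] {i : Fin m}
    {j : Fin n} (h : (j : ℕ) = o + i ↔ p ∧ q) :
    (block o z : Matrix (Fin m) (Fin n) ℂ) i j = if p ∧ q then z else 0 := by
  simp only [block, Matrix.of_apply, h]

theorem projS_apply (X : GIrrep) (a : S4Irrep) (i : Fin a.dim) (x : Fin X.dim) :
    projS X a i x = if blkS X x = a ∧ posS X x = i then phaseS X a else 0 := by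
  cases X <;> cases a
  all_goals first
    | exact block_apply_eq (by revert i x; decide)
    | exact (if_neg (by revert i x; decide)).symm
    | (fin_cases i <;> fin_cases x <;> simp [projS, blkS, posS, phaseS,
        show Nat.mod 0 3 = 0 from rfl, show Nat.mod 4 3 = 1 from rfl])

theorem projT_apply (X : GIrrep) (a : T7Irrep) (i : Fin a.dim) (x : Fin X.dim) :
    projT X a i x = if blkT X x = a ∧ posT X x = i then phaseT X a else 0 := by
  cases X <;> cases a
  all_goals first
    | exact block_apply_eq (by revert i x; decide)
    | exact (if_neg (by revert i x; decide)).symm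

theorem posS_lt (X : GIrrep) (x : Fin X.dim) : posS X x < (blkS X x).dim := by
  cases X <;> (revert x; decide)

theorem posT_lt (X : GIrrep) (x : Fin X.dim) : posT X x < (blkT X x).dim := by
  cases X <;> (revert x; decide)

def modelS : Model basisS where
  elems := [.s1₀, .s1₁, .s2, .s3₁, .s3₂]
  sum_elems f := by
    have : (Finset.univ : Finset S4Irrep) = {.s1₀, .s1₁, .s2, .s3₁, .s3₂} := rfl
    rw [this]; simp
  mem_elems a := by cases a <;> simp
  blk := blkS
  pos := posS
  phase := phaseS
  phaseQ X a := (hasPhaseS X a).q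
  phase_rep X a := (hasPhaseS X a).h
  pos_lt := posS_lt
  proj_apply := projS_apply
  gen₁ := hasGen₁S
  gen₂ := hasGen₂S
  conjMat := hasConjMatS
  matA := hasMatAS
  matB := hasMatBS
  cg := hasCGS
  table := hasTableS
  word₁ := [true, false, true, false, false]
  word₂ := [true, false, false, true, false, true, false, true, false, false, true, false, true, false]
  phD := 64
  phB := 2744
  cgD := 6
  cgB := 8

def modelT : Model basisT where
  elems := [.t1, .t1p, .t1q, .t3, .t3b]
  sum_elems f := by
    have : (Finset.univ : Finset T7Irrep) = {.t1, .t1p, .t1q, .t3, .t3b} := rfl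
    rw [this]; simp
  mem_elems a := by cases a <;> simp
  blk := blkT
  pos := posT
  phase := phaseT
  phaseQ X a := (hasPhaseT X a).q
  phase_rep X a := (hasPhaseT X a).h
  pos_lt := posT_lt
  proj_apply := projT_apply
  gen₁ := hasGen₁T
  gen₂ := hasGen₂T
  conjMat := hasConjMatT
  matA := hasMatAT
  matB := hasMatBT
  cg := hasCGT
  table := hasTableT
  word₁ := [true, false]
  word₂ := [true, false, true, false, false, true, false, false, true, false, true, false,
    true, false, false]
  phD := 1
  phB := 1
  cgD := 6
  cgB := 8

end
end PSL27

namespace PSL27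
open Matrix
open scoped Kronecker MatrixGroups
open Complex (I exp)
open IrrepCode

noncomputable section

namespace Model

variable {ι : Type} [Fintype ι] [DecidableEq ι] [IrrepCode ι] {D : AdaptedBasis ι} (m : Model D)

theorem evalWord_relator (h : m.checkMat = true) (X : GIrrep) {w : List Bool} (hw : w ∈ relators) :
    evalWord w (D.matA X) (D.matB X) = 1 := by
  rw [checkMat, allG_iff] at h
  have h1 := (cond_false_eq_true_iff.1 (h X)).1
  exact ((m.repA X).word (m.repB X) w).eq MatRep.one (allL_iff.1 h1 w hw)

theorem matA_mul_star (h : m.checkMat = true) (X : GIrrep) : D.matA X * (D.matA X)ᴴ = 1 := by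
  rw [checkMat, allG_iff] at h
  have h1 := cond_false_eq_true_iff.1 (cond_false_eq_true_iff.1 (h X)).2
  exact ((m.repA X).mul (m.repA X).adj).eq MatRep.one h1.1

theorem matB_mul_star (h : m.checkMat = true) (X : GIrrep) : D.matB X * (D.matB X)ᴴ = 1 := by
  rw [checkMat, allG_iff] at h
  have h1 := cond_false_eq_true_iff.1 (cond_false_eq_true_iff.1 (h X)).2
  exact ((m.repB X).mul (m.repB X).adj).eq MatRep.one h1.2

theorem proj_mul_self (h : m.checkProj = true) {X : GIrrep} {a : ι} (ha : a ∈ D.content X) :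
    D.proj X a * (D.proj X a)ᴴ = 1 := by
  rw [checkProj, allG_iff] at h
  have h1 := m.allI_iff.1 (cond_false_eq_true_iff.1 (h X)).1 a
  rw [memI_iff.2 ha] at h1
  exact ((m.repP X a).mul (m.repP X a).adj).eq MatRep.one h1

theorem proj_eq_zero (h : m.checkProj = true) {X : GIrrep} {a : ι} (ha : a ∉ D.content X) :
    D.proj X a = 0 := by
  rw [checkProj, allG_iff] at h
  have h1 := m.allI_iff.1 (cond_false_eq_true_iff.1 (h X)).1 a
  rw [memI_eq_false_iff.2 ha] at h1
  exact (m.repP X a).eq MatRep.zero h1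

theorem proj_mul_of_ne (h : m.checkProj = true) (X : GIrrep) {a b : ι} (hab : a ≠ b) :
    D.proj X a * (D.proj X b)ᴴ = 0 := by
  rw [checkProj, allG_iff] at h
  have h1 := m.allI_iff.1 (m.allI_iff.1
    (cond_false_eq_true_iff.1 (cond_false_eq_true_iff.1 (h X)).2).1 a) b
  have h2 : eqI a b = false := by
    rw [← Bool.not_eq_true, eqI_iff]; exact hab
  rw [h2] at h1
  exact ((m.repP X a).mul (m.repP X b).adj).eq MatRep.zero h1

theorem sum_proj (h : m.checkProj = true) (X : GIrrep) :
    ∑ a, (D.proj X a)ᴴ * D.proj X a = 1 := by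
  rw [checkProj, allG_iff] at h
  have h1 := (cond_false_eq_true_iff.1 (cond_false_eq_true_iff.1 (h X)).2).2
  rw [m.sum_elems]
  exact (MatRep.sum _ fun a => (m.repP X a).adj.mul (m.repP X a)).eq MatRep.one h1

theorem proj_mul_word₁ (h : m.checkSub = true) (X : GIrrep) (a : ι) :
    D.proj X a * evalWord m.word₁ (D.matA X) (D.matB X) = D.gen₁ a * D.proj X a := by
  rw [checkSub, allG_iff] at h
  have h1 := cond_false_eq_true_iff.1 (m.allI_iff.1 (h X) a)
  exact ((m.repP X a).mul ((m.repA X).word (m.repB X) _)).eq ((m.repG₁ a).mul (m.repP X a)) h1.1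

theorem proj_mul_word₂ (h : m.checkSub = true) (X : GIrrep) (a : ι) :
    D.proj X a * evalWord m.word₂ (D.matA X) (D.matB X) = D.gen₂ a * D.proj X a := by
  rw [checkSub, allG_iff] at h
  have h1 := cond_false_eq_true_iff.1 (m.allI_iff.1 (h X) a)
  exact ((m.repP X a).mul ((m.repA X).word (m.repB X) _)).eq ((m.repG₂ a).mul (m.repP X a)) h1.2

theorem conjMatG_matA (h : m.checkConj = true) (X : GIrrep) :
    D.conjMatG X * (D.matA X).map star = D.matA X.bar * D.conjMatG X := by
  rw [checkConj, allG_iff] at h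
  have h1 := cond_false_eq_true_iff.1 (h X)
  exact ((m.repKG X).mul (m.repA X).conj).eq ((m.repA X.bar).mul (m.repKG X)) h1.1

theorem conjMatG_matB (h : m.checkConj = true) (X : GIrrep) :
    D.conjMatG X * (D.matB X).map star = D.matB X.bar * D.conjMatG X := by
  rw [checkConj, allG_iff] at h
  have h1 := cond_false_eq_true_iff.1 (h X)
  exact ((m.repKG X).mul (m.repB X).conj).eq ((m.repB X.bar).mul (m.repKG X)) h1.2

theorem conjMat_mul_star (h : m.checkConjSub = true) (x : ι) :
    D.conjMat x * (D.conjMat x)ᴴ = 1 := by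
  have h1 := cond_false_eq_true_iff.1 (cond_false_eq_true_iff.1 (m.allI_iff.1 h x)).1
  exact ((m.repK x).mul (m.repK x).adj).eq MatRep.one h1.1

theorem star_mul_conjMat (h : m.checkConjSub = true) (x : ι) :
    (D.conjMat x)ᴴ * D.conjMat x = 1 := by
  have h1 := cond_false_eq_true_iff.1 (cond_false_eq_true_iff.1 (m.allI_iff.1 h x)).1
  exact ((m.repK x).adj.mul (m.repK x)).eq MatRep.one h1.2

theorem conjMat_gen₁ (h : m.checkConjSub = true) (x : ι) :
    D.conjMat x * (D.gen₁ x).map star = D.gen₁ (D.bar x) * D.conjMat x := by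
  have h1 := cond_false_eq_true_iff.1 (cond_false_eq_true_iff.1 (m.allI_iff.1 h x)).2
  exact ((m.repK x).mul (m.repG₁ x).conj).eq ((m.repG₁ _).mul (m.repK x)) h1.1

theorem conjMat_gen₂ (h : m.checkConjSub = true) (x : ι) :
    D.conjMat x * (D.gen₂ x).map star = D.gen₂ (D.bar x) * D.conjMat x := by
  have h1 := cond_false_eq_true_iff.1 (cond_false_eq_true_iff.1 (m.allI_iff.1 h x)).2
  exact ((m.repK x).mul (m.repG₂ x).conj).eq ((m.repG₂ _).mul (m.repK x)) h1.2

theorem gen₁_mul_star (h : m.checkGen = true) (x : ι) : D.gen₁ x * (D.gen₁ x)ᴴ = 1 := by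
  have h1 := cond_false_eq_true_iff.1 (m.allI_iff.1 h x)
  exact ((m.repG₁ x).mul (m.repG₁ x).adj).eq MatRep.one h1.1

theorem gen₂_mul_star (h : m.checkGen = true) (x : ι) : D.gen₂ x * (D.gen₂ x)ᴴ = 1 := by
  have h1 := cond_false_eq_true_iff.1 (m.allI_iff.1 h x)
  exact ((m.repG₂ x).mul (m.repG₂ x).adj).eq MatRep.one h1.2

theorem cg_eq_zero {x y z : ι} {k : Label} (h : m.ex x y z k = false) : D.cg x y z k = 0 := by
  rw [ex] at h
  refine (m.repC x y z k).eq TenRep.zero ?_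
  revert h
  cases (m.C x y z k).eqv (D.dim z) (D.dim x) (D.dim y) TenQ.zero <;> simp

theorem checkCG_aux (h : m.checkCG = true) {x y z : ι} {k : Label} (he : m.ex x y z k = true) :
    D.cg x y z k * (D.cg x y z k)ᴴ = 1 ∧
    D.cg x y z k * (D.gen₁ x ⊗ₖ D.gen₁ y) = D.gen₁ z * D.cg x y z k ∧
    D.cg x y z k * (D.gen₂ x ⊗ₖ D.gen₂ y) = D.gen₂ z * D.cg x y z k := by
  have h1 := allLabel_iff.1 (m.allI_iff.1 (m.allI_iff.1 (m.allI_iff.1 h x) y) z) k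
  have h0 : (m.C x y z k).eqv (D.dim z) (D.dim x) (D.dim y) TenQ.zero = false := by
    revert he; rw [ex]
    cases (m.C x y z k).eqv (D.dim z) (D.dim x) (D.dim y) TenQ.zero <;> simp
  rw [h0] at h1
  simp only [cond_false, cond_false_eq_true_iff] at h1
  have hC := m.repC x y z k
  exact ⟨(hC.gram hC).eq MatRep.one h1.1,
    (hC.mulKron (m.repG₁ x) (m.repG₁ y)).eq ((m.repG₁ z |> fun g => TenRep.mulLeft g hC)) h1.2.1,
    (hC.mulKron (m.repG₂ x) (m.repG₂ y)).eq ((m.repG₂ z |> fun g => TenRep.mulLeft g hC)) h1.2.2⟩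

theorem cg_mul_self (h : m.checkCG = true) {x y z : ι} {k : Label} (he : m.ex x y z k = true) :
    D.cg x y z k * (D.cg x y z k)ᴴ = 1 := (m.checkCG_aux h he).1

theorem cg_orthonormal (h : m.checkCG = true) {x y z : ι} {k : Label} (he : D.cg x y z k ≠ 0) :
    D.cg x y z k * (D.cg x y z k)ᴴ = 1 :=
  m.cg_mul_self h (by
    cases e : m.ex x y z k
    · exact absurd (m.cg_eq_zero e) he
    · rfl)

theorem cg_gen₁ (h : m.checkCG = true) (x y z : ι) (k : Label) :
    D.cg x y z k * (D.gen₁ x ⊗ₖ D.gen₁ y) = D.gen₁ z * D.cg x y z k := by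
  cases e : m.ex x y z k
  · rw [m.cg_eq_zero e, Matrix.zero_mul, Matrix.mul_zero]
  · exact (m.checkCG_aux h e).2.1

theorem cg_gen₂ (h : m.checkCG = true) (x y z : ι) (k : Label) :
    D.cg x y z k * (D.gen₂ x ⊗ₖ D.gen₂ y) = D.gen₂ z * D.cg x y z k := by
  cases e : m.ex x y z k
  · rw [m.cg_eq_zero e, Matrix.zero_mul, Matrix.mul_zero]
  · exact (m.checkCG_aux h e).2.2

theorem cg_mul_of_ne (h : m.checkCGOrth = true) (x y : ι) {z z' : ι} {k k' : Label}
    (hne : (z, k) ≠ (z', k')) : D.cg x y z k * (D.cg x y z' k')ᴴ = 0 := by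
  have h1 := allLabel_iff.1 (m.allI_iff.1 (allLabel_iff.1
    (m.allI_iff.1 (m.allI_iff.1 (m.allI_iff.1 h x) y) z) k) z') k'
  cases e : m.ex x y z k
  · rw [m.cg_eq_zero e, Matrix.zero_mul]
  cases e' : m.ex x y z' k'
  · rw [m.cg_eq_zero e', Matrix.conjTranspose_zero, Matrix.mul_zero]
  have h2 : eqK z z' k k' = false := by
    rw [← Bool.not_eq_true, eqK, cond_false_eq_true_iff, eqI_iff, natBeq_iff]
    rintro ⟨rfl, hk⟩
    apply hne
    rw [Prod.mk.injEq]
    refine ⟨rfl, ?_⟩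
    revert hk; cases k <;> cases k' <;> decide
  rw [h2, e, e'] at h1
  exact ((m.repC x y z k).gram (m.repC x y z' k')).eq MatRep.zero h1

theorem conjMat_cg (h : m.checkCGConj = true) (x y z : ι) (k : Label) :
    D.conjMat z * (D.cg x y z k).map star =
      D.cg (D.bar x) (D.bar y) (D.bar z) k * (D.conjMat x ⊗ₖ D.conjMat y) := by
  have h1 := allLabel_iff.1 (m.allI_iff.1 (m.allI_iff.1 (m.allI_iff.1 h x) y) z) k
  exact (TenRep.mulLeft (m.repK z) (m.repC x y z k).conj).eq
    ((m.repC _ _ _ k).mulKron (m.repK x) (m.repK y)) h1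

end Model

/-- Orthonormal families of the right size are complete. -/
theorem sum_conjTranspose_mul_eq_one {κ p : Type} [Fintype κ] [Fintype p] [DecidableEq p]
    (n : κ → ℕ) (M : (i : κ) → Matrix (Fin (n i)) p ℂ) (h1 : ∀ i, M i * (M i)ᴴ = 1)
    (h2 : ∀ i j, i ≠ j → M i * (M j)ᴴ = 0) (hn : ∑ i, n i = Fintype.card p) :
    ∑ i, (M i)ᴴ * M i = 1 := by
  classical
  let W : Matrix (Σ i, Fin (n i)) p ℂ := Matrix.of fun s => M s.1 s.2
  have hW : W * Wᴴ = 1 := by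
    ext ⟨i, k⟩ ⟨j, l⟩
    have e : (W * Wᴴ) ⟨i, k⟩ ⟨j, l⟩ = (M i * (M j)ᴴ) k l := rfl
    rw [e]
    by_cases hij : i = j
    · subst hij
      rw [h1, Matrix.one_apply, Matrix.one_apply]
      simp
    · rw [h2 i j hij, Matrix.zero_apply, Matrix.one_apply_ne]
      intro h; exact hij (congrArg Sigma.fst h)
  have hc : Fintype.card (Σ i, Fin (n i)) = Fintype.card p := by
    rw [Fintype.card_sigma]; simpa using hn
  have hW' : Wᴴ * W = 1 := (Matrix.mul_eq_one_comm_of_card_eq _ _ ℂ hc).1 hW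
  rw [← hW']
  ext a b
  rw [Matrix.sum_apply, Matrix.mul_apply, Fintype.sum_sigma]
  rfl

namespace Model

variable {ι : Type} [Fintype ι] [DecidableEq ι] [IrrepCode ι] {D : AdaptedBasis ι} (m : Model D)

theorem sumL_eq {τ : Type} (l : List τ) (f : τ → ℕ) : sumL l f = (l.map f).sum := by
  induction l with
  | nil => rfl
  | cons t l ih => rw [List.map_cons, List.sum_cons, ← ih]; rfl

theorem sum_label {M : Type} [AddCommMonoid M] (f : Label → M) :
    ∑ k, f k = ([Label.n, Label.s, Label.a].map f).sum := by
  have : (Finset.univ : Finset Label) = {.n, .s, .a} := rfl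
  rw [this]; simp

theorem sum_cg (h1 : m.checkCG = true) (h2 : m.checkCGOrth = true) (h3 : m.checkCGDim = true)
    (x y : ι) : ∑ z, ∑ k, (D.cg x y z k)ᴴ * D.cg x y z k = 1 := by
  have hsub : ∀ {M : Type} [AddCommMonoid M] (f : ι × Label → M),
      (∀ t, m.ex x y t.1 t.2 = false → f t = 0) →
      ∑ t, f t = ∑ t : {t : ι × Label // m.ex x y t.1 t.2 = true}, f t.1 := by
    intro M _ f hf
    rw [← Finset.sum_filter_of_ne (p := fun t : ι × Label => m.ex x y t.1 t.2 = true)]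
    · exact Finset.sum_subtype _ (by simp) _
    · intro t _ ht
      by_contra hne
      exact ht (hf t (Bool.not_eq_true _ ▸ hne))
  rw [← Fintype.sum_prod_type' (f := fun z k => (D.cg x y z k)ᴴ * D.cg x y z k),
    hsub _ fun t ht => by rw [m.cg_eq_zero ht, Matrix.mul_zero]]
  refine sum_conjTranspose_mul_eq_one (κ := {t : ι × Label // m.ex x y t.1 t.2 = true})
    (fun t => D.dim t.1.1) (fun t => D.cg x y t.1.1 t.1.2) (fun t => m.cg_mul_self h1 t.2) ?_ ?_
  · intro s t hst
    exact m.cg_mul_of_ne h2 x y fun h => hst (Subtype.ext h)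
  · have h4 := natBeq_iff.1 (m.allI_iff.1 (m.allI_iff.1 h3 x) y)
    have h5 := hsub (fun t => cond (m.ex x y t.1 t.2) (D.dim t.1) 0) fun t ht => by simp [ht]
    rw [Fintype.card_prod, Fintype.card_fin, Fintype.card_fin]
    refine Eq.trans ?_ (Eq.trans h5.symm ?_)
    · exact Finset.sum_congr rfl fun t _ => by simp [t.2]
    · rw [Fintype.sum_prod_type, m.sum_elems]
      simp only [sum_label]
      simp only [sumL_eq] at h4
      exact h4

end Model
end
end PSL27

namespace PSL27
open Matrix
open scoped Kronecker MatrixGroups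
open Complex (I exp)
open IrrepCode

noncomputable section

namespace Model

variable {ι : Type} [Fintype ι] [DecidableEq ι] [IrrepCode ι] {D : AdaptedBasis ι} (m : Model D)

/-! ### CG matrices of the group -/

theorem sum_proj_mul (X : GIrrep) (x : Fin X.dim) (f : (a : ι) → Fin (D.dim a) → ℂ) :
    ∑ a, ∑ i, D.proj X a i x * f a i =
      m.phase X (m.blk X x) * f (m.blk X x) ⟨m.pos X x, m.pos_lt X x⟩ := by
  rw [Finset.sum_eq_single (m.blk X x), Finset.sum_eq_single ⟨m.pos X x, m.pos_lt X x⟩]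
  · rw [m.proj_apply]; simp
  · intro i _ hi
    rw [m.proj_apply, if_neg, zero_mul]
    rintro ⟨-, h⟩; exact hi (Fin.ext h.symm)
  · simp
  · intro a _ ha
    refine Finset.sum_eq_zero fun i _ => ?_
    rw [m.proj_apply, if_neg, zero_mul]
    rintro ⟨h, -⟩; exact ha h.symm
  · simp

theorem sum_star_proj_mul (X : GIrrep) (x : Fin X.dim) (f : (a : ι) → Fin (D.dim a) → ℂ) :
    ∑ a, ∑ i, star (D.proj X a i x) * f a i =
      star (m.phase X (m.blk X x)) * f (m.blk X x) ⟨m.pos X x, m.pos_lt X x⟩ := by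
  have := congrArg star (m.sum_proj_mul X x fun a i => star (f a i))
  simpa only [star_sum, star_mul', star_star] using this

theorem contraction_apply (X Y : GIrrep) (E : ι → ι → ι → Label → ℂ) (c : ι) (l : Fin (D.dim c))
    (x : Fin X.dim) (y : Fin Y.dim) :
    D.contraction X Y E c 1 1 l (x, y) =
      m.phase X (m.blk X x) * (m.phase Y (m.blk Y y) * ∑ k, E c (m.blk X x) (m.blk Y y) k *
        D.cg (m.blk X x) (m.blk Y y) c k l
          (⟨m.pos X x, m.pos_lt X x⟩, ⟨m.pos Y y, m.pos_lt Y y⟩)) := by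
  rw [← m.sum_proj_mul X x fun a i => m.phase Y (m.blk Y y) * ∑ k, E c a (m.blk Y y) k *
        D.cg a (m.blk Y y) c k l (i, ⟨m.pos Y y, m.pos_lt Y y⟩)]
  simp only [AdaptedBasis.contraction, Matrix.sum_apply]
  refine Finset.sum_congr rfl fun a _ => ?_
  have h : ∀ i, m.phase Y (m.blk Y y) * ∑ k, E c a (m.blk Y y) k *
        D.cg a (m.blk Y y) c k l (i, ⟨m.pos Y y, m.pos_lt Y y⟩) =
      ∑ b, ∑ j, D.proj Y b j y * ∑ k, E c a b k * D.cg a b c k l (i, j) := fun i =>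
    (m.sum_proj_mul Y y fun b j => ∑ k, E c a b k * D.cg a b c k l (i, j)).symm
  simp only [h, Finset.mul_sum]
  refine Eq.trans ?_ Finset.sum_comm
  refine Finset.sum_congr rfl fun b _ => ?_
  simp only [Matrix.smul_apply, Matrix.mul_apply, Fintype.sum_prod_type, Matrix.mul_one,
    Matrix.kroneckerMap_apply, smul_eq_mul, Finset.mul_sum]
  refine Eq.trans Finset.sum_comm ?_
  refine Finset.sum_congr rfl fun i _ => ?_
  refine Eq.trans Finset.sum_comm ?_
  refine Finset.sum_congr rfl fun j _ => Finset.sum_congr rfl fun k _ => ?_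
  ring

theorem cgMat_apply (X Y Z : GIrrep) (E : ι → ι → ι → Label → ℂ) (z : Fin Z.dim)
    (x : Fin X.dim) (y : Fin Y.dim) :
    D.cgMat X Y Z E z (x, y) =
      star (m.phase Z (m.blk Z z)) * (m.phase X (m.blk X x) * (m.phase Y (m.blk Y y) *
        ∑ k, E (m.blk Z z) (m.blk X x) (m.blk Y y) k *
          D.cg (m.blk X x) (m.blk Y y) (m.blk Z z) k ⟨m.pos Z z, m.pos_lt Z z⟩
            (⟨m.pos X x, m.pos_lt X x⟩, ⟨m.pos Y y, m.pos_lt Y y⟩))) := by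
  rw [AdaptedBasis.cgMat, Matrix.sum_apply]
  simp only [Matrix.mul_apply, Matrix.conjTranspose_apply, m.contraction_apply]
  exact m.sum_star_proj_mul Z z fun c l => m.phase X (m.blk X x) * (m.phase Y (m.blk Y y) *
    ∑ k, E c (m.blk X x) (m.blk Y y) k * D.cg (m.blk X x) (m.blk Y y) c k l
      (⟨m.pos X x, m.pos_lt X x⟩, ⟨m.pos Y y, m.pos_lt Y y⟩))

def tenV (X Y Z : GIrrep) (q : ChanQ ι) (c a b : ι) (l i j : ℕ) : ℕ :=
  Nat.mod (Nat.mul (m.phaseQ Z c).w (Nat.mul (m.phaseQ X a).v (Nat.mul (m.phaseQ Y b).v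
    (sumL [Label.n, Label.s, Label.a] fun k => Nat.mul (q.v c a b k) ((m.C a b c k).v l i j)))))
    modulus

def tenW (X Y Z : GIrrep) (q : ChanQ ι) (c a b : ι) (l i j : ℕ) : ℕ :=
  Nat.mod (Nat.mul (m.phaseQ Z c).v (Nat.mul (m.phaseQ X a).w (Nat.mul (m.phaseQ Y b).w
    (sumL [Label.n, Label.s, Label.a] fun k => Nat.mul (q.w c a b k) ((m.C a b c k).w l i j)))))
    modulus

def atPos {τ : Type} (X Y Z : GIrrep) (f : ι → ι → ι → ℕ → ℕ → ℕ → τ) (z x y : ℕ) : τ :=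
  forceI (m.blk Z z) fun c => forceI (m.blk X x) fun a => forceI (m.blk Y y) fun b =>
    force (m.pos Z z) fun l => force (m.pos X x) fun i => force (m.pos Y y) fun j => f c a b l i j

/-- The data of the CG matrix of a contraction `X ⊗ Y → Z`, up to the radical. -/
def ten (X Y Z : GIrrep) (q : ChanQ ι) : TenQ where
  ok := q.ok
  D := Nat.mul m.phD (Nat.mul m.phD (Nat.mul m.phD (Nat.mul q.d m.cgD)))
  B := Nat.mul m.phB (Nat.mul m.phB (Nat.mul m.phB
    (Nat.mul [Label.n, Label.s, Label.a].length (Nat.mul q.b m.cgB))))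
  v := m.atPos X Y Z (m.tenV X Y Z q)
  w := m.atPos X Y Z (m.tenW X Y Z q)

theorem P_ok (h : m.checkProj = true) (X : GIrrep) (a : ι) : (m.P X a).ok = true := by
  rw [checkProj, allG_iff] at h
  have h1 := m.allI_iff.1 (cond_false_eq_true_iff.1 (h X)).1 a
  cases e : memI a (D.content X)
  · rw [e] at h1
    exact (cond_false_eq_true_iff.1 (cond_false_eq_true_iff.1 h1).1).1
  · rw [e] at h1
    have h2 := (cond_false_eq_true_iff.1 (cond_false_eq_true_iff.1 h1).1).1
    exact (cond_false_eq_true_iff.1 h2).1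

theorem tenRep (hP : m.checkProj = true) (hC : m.checkCGOk = true) (X Y Z : GIrrep) {q : ChanQ ι}
    {E : ι → ι → ι → Label → ℂ} (hE : q.ok = true →
      ∀ c a b k, Rep2 (E c a b k) q.d q.b (q.v c a b k) (q.w c a b k)) :
    TenRep (D.cgMat X Y Z E) (m.ten X Y Z q) := by
  intro hok
  have hE' := hE hok
  have hp := fun X a => (m.repPhase (m.P_ok hP X a)).2
  have hc : ∀ x y z k, 0 < m.cgD ∧ ∀ l i j, Rep2 (D.cg x y z k l (i, j)) m.cgD m.cgB
      ((m.C x y z k).v l i j) ((m.C x y z k).w l i j) := fun x y z k =>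
    m.repC x y z k (allLabel_iff.1 (m.allI_iff.1 (m.allI_iff.1 (m.allI_iff.1 hC x) y) z) k)
  have hrep : ∀ (z : Fin Z.dim) (x : Fin X.dim) (y : Fin Y.dim),
      Rep2 (D.cgMat X Y Z E z (x, y)) (m.ten X Y Z q).D (m.ten X Y Z q).B
        ((m.ten X Y Z q).v z x y) ((m.ten X Y Z q).w z x y) := by
    intro z x y
    rw [m.cgMat_apply, sum_label]
    simp only [ten, atPos, force_eq, forceI_eq, tenV, tenW]
    have hs := Rep2.sumL (Nat.mul_pos (hE' (m.blk Z z) (m.blk X x) (m.blk Y y) Label.n).1.1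
        (hc (m.blk X x) (m.blk Y y) (m.blk Z z) .n).1)
      (l := [Label.n, Label.s, Label.a]) (B := Nat.mul q.b m.cgB)
      (f := fun k => E (m.blk Z z) (m.blk X x) (m.blk Y y) k *
          D.cg (m.blk X x) (m.blk Y y) (m.blk Z z) k ⟨m.pos Z z, m.pos_lt Z z⟩
            (⟨m.pos X x, m.pos_lt X x⟩, ⟨m.pos Y y, m.pos_lt Y y⟩))
      (g := fun k => Nat.mul (q.v (m.blk Z z) (m.blk X x) (m.blk Y y) k)
        ((m.C (m.blk X x) (m.blk Y y) (m.blk Z z) k).v (m.pos Z z) (m.pos X x) (m.pos Y y)))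
      (g' := fun k => Nat.mul (q.w (m.blk Z z) (m.blk X x) (m.blk Y y) k)
        ((m.C (m.blk X x) (m.blk Y y) (m.blk Z z) k).w (m.pos Z z) (m.pos X x) (m.pos Y y)))
      fun k _ => by
        have h1 := hE' (m.blk Z z) (m.blk X x) (m.blk Y y) k
        have h2 := (hc (m.blk X x) (m.blk Y y) (m.blk Z z) k).2 ⟨m.pos Z z, m.pos_lt Z z⟩
          ⟨m.pos X x, m.pos_lt X x⟩ ⟨m.pos Y y, m.pos_lt Y y⟩
        exact ⟨h1.1.mul h2.1, by rw [star_mul']; exact h1.2.mul h2.2⟩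
    have h1 := (hp Z (m.blk Z z)).star
    have h2 := hp X (m.blk X x)
    have h3 := hp Y (m.blk Y y)
    refine Rep2.mod ⟨h1.1.mul (h2.1.mul (h3.1.mul hs.1)), ?_⟩
    simp only [star_mul' (R := ℂ)]
    exact h1.2.mul (h2.2.mul (h3.2.mul hs.2))
  refine ⟨?_, hrep⟩
  have h0 := (m.repPhase (m.P_ok hP .g1 (m.blk .g1 0))).1
  exact Nat.mul_pos h0 (Nat.mul_pos h0 (Nat.mul_pos h0 (Nat.mul_pos
    (hE' (m.blk .g1 0) (m.blk .g1 0) (m.blk .g1 0) .n).1.1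
    (hc (m.blk .g1 0) (m.blk .g1 0) (m.blk .g1 0) .n).1)))

theorem cgMat_smul (X Y Z : GIrrep) (r : ℂ) (E : ι → ι → ι → Label → ℂ) :
    D.cgMat X Y Z (fun c a b k => r * E c a b k) = r • D.cgMat X Y Z E := by
  simp only [AdaptedBasis.cgMat, AdaptedBasis.contraction, Finset.smul_sum, Matrix.mul_sum,
    smul_smul, Matrix.mul_smul]

/-! ### Checks of the tables -/

/-- The sum `∑ E_{c,ab} E'_{c,ab}^*`. -/
def gramE (q q' : ChanQ ι) (c : ι) : ℕ :=
  sumL m.elems fun a => sumL m.elems fun b => sumL [Label.n, Label.s, Label.a] fun k =>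
    Nat.mul (q.v c a b k) (q'.w c a b k)

/-- The data of the square of a radical. -/
def radicalSq : ℕ → Q
  | 0 => Q.nat 1
  | 1 => Q.nat 5
  | 2 => Q.nat 13
  | _ => HasQ.q (3 + rt 2)

def gramD (q q' : ChanQ ι) : ℕ := Nat.mul q.d q'.d

def gramB (q q' : ChanQ ι) : ℕ := Nat.mul m.elems.length (Nat.mul m.elems.length
  (Nat.mul [Label.n, Label.s, Label.a].length (Nat.mul q.b q'.b)))

def checkNorm (q : ChanQ ι) : Bool := allL (D.content q.target) fun c =>
  cond (smallN (Nat.mul (radicalSq q.g).d (gramD q q)) (Nat.mul (radicalSq q.g).b (m.gramB q q)) 1 1)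
    (congN (Nat.mul (radicalSq q.g).v (m.gramE q q c)) 1) false

def checkOrth (q q' : ChanQ ι) : Bool := allL (D.content q.target) fun c =>
  cond (smallN (gramD q q') (m.gramB q q') 1 0) (congN (m.gramE q q' c) 0) false

def checkKeys (X Y : GIrrep) (q : ChanQ ι) : Bool := allL q.keys fun t =>
  cond (memI t.1 (D.content q.target)) (cond (memI t.2.1 (D.content X))
    (cond (memI t.2.2.1 (D.content Y)) (m.ex t.2.1 t.2.2.1 t.1 t.2.2.2) false) false) false

def checkInt (X Y : GIrrep) (q : ChanQ ι) : Bool :=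
  cond ((((m.ten X Y q.target q).mulFst X.dim (m.A X)).mulSnd Y.dim (m.A Y)).eqv q.target.dim
      X.dim Y.dim ((m.ten X Y q.target q).mulLeft q.target.dim (m.A q.target)))
    ((((m.ten X Y q.target q).mulFst X.dim (m.B X)).mulSnd Y.dim (m.B Y)).eqv q.target.dim
      X.dim Y.dim ((m.ten X Y q.target q).mulLeft q.target.dim (m.B q.target))) false

def pairL {τ : Type} (l : List τ) (p : τ → τ → Bool) : Bool :=
  List.rec true (fun t l r => cond (allL l (p t)) r false) l

def checkTable (X Y : GIrrep) : Bool :=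
  cond (allL (m.table X Y).L fun q => cond q.ok (cond (m.checkKeys X Y q)
      (cond (m.checkNorm q) (m.checkInt X Y q) false) false) false)
    (cond (pairL (m.table X Y).L m.checkOrth)
      (cond (Nat.beq (m.table X Y).L.length 0) true (Nat.beq
        (sumL (m.table X Y).L fun q => q.target.dim) (Nat.mul X.dim Y.dim))) false) false

def checkSymm (X : GIrrep) : Bool := allL (m.table X X).L fun q =>
  cond (Nat.beq q.sym.code 0) true (cond (Nat.beq q.sym.code 1)
    ((m.ten X X q.target q).swap.eqv q.target.dim X.dim X.dim (m.ten X X q.target q))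
    ((m.ten X X q.target q).swap.eqv q.target.dim X.dim X.dim (m.ten X X q.target q).neg))

def gcode : GIrrep → ℕ
  | .g1 => 0 | .g3 => 1 | .g3b => 2 | .g6 => 3 | .g7 => 4 | .g8 => 5

def checkConjEmb (X Y : GIrrep) : Bool :=
  cond (Nat.beq (m.table X.bar Y.bar).L.length 0) true
    (allL (m.table X Y).L fun q => anyL (m.table X.bar Y.bar).L fun q' =>
      cond (cond (Nat.beq (gcode q'.target) (gcode q.target.bar)) (cond (Nat.beq q'.sym.code q.sym.code)
          (cond (Nat.beq q'.mult q.mult) (cond (Nat.beq q'.g q.g) (cond q'.ok (cond q.ok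
            (smallN q'.d q'.b q.d q.b) false) false) false) false) false) false)
        (m.allI fun c => m.allI fun a => m.allI fun b => allLabel fun k =>
          congN (q'.v (D.bar c) (D.bar a) (D.bar b) k) (q.w c a b k)) false)

def checkSelfConj : Bool := allL (m.table .g3 .g3b).L fun q =>
  cond (cond (Nat.beq (gcode q.target.bar) (gcode q.target)) q.ok false)
    ((m.ten .g3b .g3 q.target (q.conj D.bar)).swap.eqv q.target.dim 3 3 (m.ten .g3 .g3b q.target q))
    false

end Model
end
end PSL27

namespace PSL27
open Matrix
open scoped Kronecker MatrixGroups
open Complex (I exp)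
open IrrepCode

noncomputable section

namespace Model

variable {ι : Type} [Fintype ι] [DecidableEq ι] [IrrepCode ι] {D : AdaptedBasis ι}

/-- All checks of the data succeed. -/
structure Valid (m : Model D) : Prop where
  mat : m.checkMat = true
  proj : m.checkProj = true
  sub : m.checkSub = true
  conj : m.checkConj = true
  conjSub : m.checkConjSub = true
  gen : m.checkGen = true
  cg : m.checkCG = true
  cgOrth : m.checkCGOrth = true
  cgDim : m.checkCGDim = true
  cgOk : m.checkCGOk = true
  cgConj : m.checkCGConj = true
  table : ∀ X Y, m.checkTable X Y = true
  symm : ∀ X, m.checkSymm X = true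
  conjEmb : ∀ X Y, m.checkConjEmb X Y = true
  selfConj : m.checkSelfConj = true
  dim_pos : ∀ x, 0 < D.dim x
  bar_bar : ∀ x, D.bar (D.bar x) = x
  nodup : ∀ X, (D.content X).Nodup

variable {m : Model D}

theorem rep_radicalSq {g : ℕ} :
    Rep (radical g * radical g) (radicalSq g).d (radicalSq g).b (radicalSq g).v := by
  match g with
  | 0 => exact (show radical 0 * radical 0 = 1 by simp [radical]) ▸ (QRep.nat_one.rep2_of_grade_zero rfl).1
  | 1 =>
    have : radical 1 * radical 1 = ((5 : ℕ) : ℂ) := by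
      simp only [radical]; rw [rt, ← Complex.ofReal_mul, Real.mul_self_sqrt (by norm_num)]; norm_num
    exact this ▸ ((QRep.nat 5).rep2_of_grade_zero rfl).1
  | 2 =>
    have : radical 2 * radical 2 = ((13 : ℕ) : ℂ) := by
      simp only [radical]; rw [rt, ← Complex.ofReal_mul, Real.mul_self_sqrt (by norm_num)]; norm_num
    exact this ▸ ((QRep.nat 13).rep2_of_grade_zero rfl).1
  | (g + 3) =>
    have : radical (g + 3) * radical (g + 3) = 3 + rt 2 := by
      simp only [radical, rootA]
      rw [rt, ← Complex.ofReal_mul, Real.mul_self_sqrt (by positivity), rt]; push_cast; ring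
    rw [this]
    have h : (radicalSq (g + 3)).g = 0 := by
      show (HasQ.q (3 + rt 2)).g = 0
      decide +kernel
    exact ((inferInstance : HasQ (3 + rt 2)).h.rep2_of_grade_zero h).1

theorem exists_of_forall₂ {σ τ : Type*} {R : σ → τ → Prop} {l : List σ} {L : List τ}
    (h : List.Forall₂ R l L) {s : σ} (hs : s ∈ l) : ∃ t ∈ L, R s t := by
  induction h with
  | nil => simp at hs
  | cons h0 _ ih =>
    rcases List.mem_cons.1 hs with rfl | h1
    · exact ⟨_, by simp, h0⟩
    · obtain ⟨q, hq, hq'⟩ := ih h1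
      exact ⟨q, by simp [hq], hq'⟩

theorem pairwise_of_forall₂ {σ τ : Type*} {R : σ → τ → Prop} {p : τ → τ → Prop} {l : List σ}
    {L : List τ} (h : List.Forall₂ R l L) (hp : L.Pairwise p) :
    l.Pairwise fun s s' => ∃ t ∈ L, ∃ t' ∈ L, R s t ∧ R s' t' ∧ p t t' := by
  induction h with
  | nil => exact List.Pairwise.nil
  | @cons s t l L h0 h1 ih =>
    rw [List.pairwise_cons] at hp ⊢
    refine ⟨fun s' hs' => ?_, (ih hp.2).imp ?_⟩
    · obtain ⟨t', ht', hr⟩ := exists_of_forall₂ h1 hs'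
      exact ⟨t, by simp, t', by simp [ht'], h0, hr, hp.1 t' ht'⟩
    · rintro a b ⟨t, ht, t', ht', h⟩
      exact ⟨t, by simp [ht], t', by simp [ht'], h⟩

theorem map_of_forall₂ {σ τ υ : Type*} {R : σ → τ → Prop} {f : σ → υ} {g : τ → υ} {l : List σ}
    {L : List τ} (h : List.Forall₂ R l L) (hR : ∀ s t, R s t → f s = g t) : l.map f = L.map g := by
  induction h with
  | nil => rfl
  | cons h0 _ ih => rw [List.map_cons, List.map_cons, ih, hR _ _ h0]

theorem exists_rep {X Y : GIrrep} {ch : Channel ι} (hch : ch ∈ D.table X Y) :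
    ∃ q ∈ (m.table X Y).L, ChanRep ch q :=
  exists_of_forall₂ (m.table X Y).h hch

theorem exists_emb {ch : Channel ι} {q : ChanQ ι} (h : ChanRep ch q) (hok : q.ok = true) :
    ∃ E : ι → ι → ι → Label → ℂ, (ch.emb = fun c a b k => radical q.g * E c a b k) ∧
      ∀ c a b k, Rep2 (E c a b k) q.d q.b (q.v c a b k) (q.w c a b k) := by
  choose E h1 h2 using h.rep hok
  exact ⟨E, by funext c a b k; exact h1 c a b k, h2⟩

/-- The sum `∑ E_{c,ab} E'_{c,ab}^*`. -/
def gramSum (E E' : ι → ι → ι → Label → ℂ) (c : ι) : ℂ :=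
  ∑ a, ∑ b, ∑ k, E c a b k * star (E' c a b k)

theorem gramSum_rep {E E' : ι → ι → ι → Label → ℂ} {q q' : ChanQ ι}
    (h : ∀ c a b k, Rep2 (E c a b k) q.d q.b (q.v c a b k) (q.w c a b k))
    (h' : ∀ c a b k, Rep2 (E' c a b k) q'.d q'.b (q'.v c a b k) (q'.w c a b k)) (c : ι) :
    Rep (gramSum E E' c) (gramD q q') (m.gramB q q') (m.gramE q q' c) := by
  have hD : 0 < gramD q q' := Nat.mul_pos (h c c c .n).1.1 (h' c c c .n).1.1
  rw [gramSum, m.sum_elems]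
  refine Rep.sumL hD fun a _ => ?_
  rw [m.sum_elems]
  refine Rep.sumL hD fun b _ => ?_
  rw [sum_label]
  exact Rep.sumL hD fun k _ => (h c a b k).1.mul (h' c a b k).2

theorem checkTable_chan (hm : m.Valid) {X Y : GIrrep} {q : ChanQ ι} (hq : q ∈ (m.table X Y).L) :
    q.ok = true ∧ m.checkKeys X Y q = true ∧ m.checkNorm q = true ∧ m.checkInt X Y q = true := by
  have h := (cond_false_eq_true_iff.1 (hm.table X Y)).1
  have h1 := allL_iff.1 h q hq
  simpa only [cond_false_eq_true_iff] using h1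

theorem emb_support (hm : m.Valid) {X Y : GIrrep} {ch : Channel ι} (hch : ch ∈ D.table X Y)
    {c a b : ι} {k : Label} (hne : ch.emb c a b k ≠ 0) :
    c ∈ D.content ch.target ∧ a ∈ D.content X ∧ b ∈ D.content Y ∧ m.ex a b c k = true := by
  obtain ⟨q, hq, hr⟩ := exists_rep (m := m) hch
  have h1 := allL_iff.1 (checkTable_chan hm hq).2.1 _ (hr.keys c a b k hne)
  simp only [cond_false_eq_true_iff, memI_iff] at h1
  rw [hr.target]; exact h1

theorem ex_ne_zero (hm : m.Valid) {a b c : ι} {k : Label} (h : m.ex a b c k = true) :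
    D.cg a b c k ≠ 0 := by
  intro h0
  have h1 := m.cg_mul_self hm.cg h
  rw [h0, Matrix.zero_mul] at h1
  have := congrFun (congrFun h1 ⟨0, hm.dim_pos c⟩) ⟨0, hm.dim_pos c⟩
  simp at this

theorem gramSum_smul (r s : ℂ) (E E' : ι → ι → ι → Label → ℂ) (c : ι) :
    gramSum (fun c a b k => r * E c a b k) (fun c a b k => s * E' c a b k) c =
      r * star s * gramSum E E' c := by
  simp only [gramSum, Finset.mul_sum, star_mul']
  refine Finset.sum_congr rfl fun a _ => Finset.sum_congr rfl fun b _ =>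
    Finset.sum_congr rfl fun k _ => by ring

theorem gramSum_self (hm : m.Valid) {X Y : GIrrep} {ch : Channel ι} (hch : ch ∈ D.table X Y)
    {c : ι} (hc : c ∈ D.content ch.target) : gramSum ch.emb ch.emb c = 1 := by
  obtain ⟨q, hq, hr⟩ := exists_rep (m := m) hch
  obtain ⟨hok, -, hn, -⟩ := checkTable_chan hm hq
  obtain ⟨E, h1, h2⟩ := exists_emb hr hok
  have h3 := cond_false_eq_true_iff.1 (allL_iff.1 hn c (hr.target ▸ hc))
  rw [h1, gramSum_smul, star_radical]
  exact (rep_radicalSq.mul (gramSum_rep (m := m) h2 h2 c)).eq_of_check Rep2.one.1 h3.1 h3.2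

theorem pairL_iff {τ : Type} {l : List τ} {p : τ → τ → Bool} :
    pairL l p = true ↔ l.Pairwise fun s t => p s t = true := by
  induction l with
  | nil => simp [pairL]
  | cons t l ih =>
    have : pairL (t :: l) p = cond (allL l (p t)) (pairL l p) false := rfl
    rw [this, cond_false_eq_true_iff, allL_iff, ih, List.pairwise_cons]

theorem gramSum_pairwise (hm : m.Valid) (X Y : GIrrep) : (D.table X Y).Pairwise fun ch ch' =>
    ∀ c ∈ D.content ch.target, gramSum ch.emb ch'.emb c = 0 := by
  have h0 := pairL_iff.1 (cond_false_eq_true_iff.1 (cond_false_eq_true_iff.1 (hm.table X Y)).2).1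
  refine (pairwise_of_forall₂ (m.table X Y).h h0).imp ?_
  rintro ch ch' ⟨q, hq, q', hq', hr, hr', h⟩ c hc
  obtain ⟨E, e1, e2⟩ := exists_emb hr (checkTable_chan hm hq).1
  obtain ⟨E', e1', e2'⟩ := exists_emb hr' (checkTable_chan hm hq').1
  have h3 := cond_false_eq_true_iff.1 (allL_iff.1 h c (hr.target ▸ hc))
  rw [e1, e1', gramSum_smul,
    (gramSum_rep (m := m) e2 e2' c).eq_of_check (Rep.zero Nat.one_pos 0) h3.1 h3.2, mul_zero]

theorem contraction_eq_sum (X Y : GIrrep) (E : ι → ι → ι → Label → ℂ) (c : ι)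
    (R : Matrix (Fin X.dim) (Fin X.dim) ℂ) (S : Matrix (Fin Y.dim) (Fin Y.dim) ℂ) :
    D.contraction X Y E c R S = ∑ t : ι × ι × Label, E c t.1 t.2.1 t.2.2 •
      (D.cg t.1 t.2.1 c t.2.2 * ((D.proj X t.1 * R) ⊗ₖ (D.proj Y t.2.1 * S))) := by
  simp only [AdaptedBasis.contraction, Fintype.sum_prod_type]

theorem contraction_one (X Y : GIrrep) (E : ι → ι → ι → Label → ℂ) (c : ι) :
    D.contraction X Y E c 1 1 = ∑ t : ι × ι × Label, E c t.1 t.2.1 t.2.2 •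
      (D.cg t.1 t.2.1 c t.2.2 * (D.proj X t.1 ⊗ₖ D.proj Y t.2.1)) := by
  simp only [contraction_eq_sum, Matrix.mul_one]

theorem kron_proj_mul (hm : m.Valid) {X Y : GIrrep} {a b : ι} (ha : a ∈ D.content X)
    (hb : b ∈ D.content Y) : D.proj X a ⊗ₖ D.proj Y b *
      (D.proj X a ⊗ₖ D.proj Y b)ᴴ = 1 := by
  rw [Matrix.conjTranspose_kronecker, ← Matrix.mul_kronecker_mul,
    m.proj_mul_self hm.proj ha, m.proj_mul_self hm.proj hb, Matrix.one_kronecker_one]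

theorem contraction_mul (hm : m.Valid) {X Y : GIrrep} {E E' : ι → ι → ι → Label → ℂ}
    (hE : ∀ c a b k, E c a b k ≠ 0 → a ∈ D.content X ∧ b ∈ D.content Y ∧ m.ex a b c k = true)
    (c : ι) : D.contraction X Y E c 1 1 * (D.contraction X Y E' c 1 1)ᴴ = gramSum E E' c • 1 := by
  have hg : gramSum E E' c = ∑ t : ι × ι × Label, E c t.1 t.2.1 t.2.2 * star (E' c t.1 t.2.1 t.2.2) := by
    simp only [gramSum, Fintype.sum_prod_type]
  rw [contraction_one, contraction_one, hg, Matrix.conjTranspose_sum, Matrix.sum_mul,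
    Finset.sum_smul]
  refine Finset.sum_congr rfl fun t _ => ?_
  rw [Matrix.mul_sum]
  by_cases h0 : E c t.1 t.2.1 t.2.2 = 0
  · simp [h0]
  obtain ⟨ha, hb, hx⟩ := hE _ _ _ _ h0
  rw [Finset.sum_eq_single t]
  · rw [Matrix.conjTranspose_smul, Matrix.conjTranspose_mul, Matrix.smul_mul, Matrix.mul_smul,
      smul_smul, Matrix.mul_assoc, ← Matrix.mul_assoc _ _ (D.cg _ _ _ _)ᴴ,
      kron_proj_mul hm ha hb, Matrix.one_mul, m.cg_mul_self hm.cg hx]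
  · rintro t' - hne
    rw [Matrix.conjTranspose_smul, Matrix.conjTranspose_mul, Matrix.smul_mul, Matrix.mul_smul,
      Matrix.mul_assoc, ← Matrix.mul_assoc _ _ (D.cg _ _ _ _)ᴴ]
    suffices h : D.cg t.1 t.2.1 c t.2.2 * ((D.proj X t.1) ⊗ₖ (D.proj Y t.2.1) *
        ((D.proj X t'.1) ⊗ₖ (D.proj Y t'.2.1))ᴴ * (D.cg t'.1 t'.2.1 c t'.2.2)ᴴ) = 0 by
      rw [h, smul_zero, smul_zero]
    obtain ⟨a, b, k⟩ := t
    obtain ⟨a', b', k'⟩ := t'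
    dsimp only at *
    by_cases h1 : a = a'
    · by_cases h2 : b = b'
      · subst h1 h2
        have h3 : k ≠ k' := by rintro rfl; exact hne rfl
        rw [kron_proj_mul hm ha hb, Matrix.one_mul]
        exact m.cg_mul_of_ne hm.cgOrth a b fun h => h3 (congrArg Prod.snd h)
      · rw [
          Matrix.conjTranspose_kronecker, ← Matrix.mul_kronecker_mul,
          m.proj_mul_of_ne hm.proj Y h2, Matrix.kronecker_zero, Matrix.zero_mul, Matrix.mul_zero]
    · rw [
        Matrix.conjTranspose_kronecker, ← Matrix.mul_kronecker_mul,
        m.proj_mul_of_ne hm.proj X h1, Matrix.zero_kronecker, Matrix.zero_mul, Matrix.mul_zero]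
  · simp

theorem contraction_mul_of_ne (hm : m.Valid) {X Y : GIrrep} {E E' : ι → ι → ι → Label → ℂ}
    (hE : ∀ c a b k, E c a b k ≠ 0 → a ∈ D.content X ∧ b ∈ D.content Y ∧ m.ex a b c k = true)
    {c c' : ι} (hc : c ≠ c') :
    D.contraction X Y E c 1 1 * (D.contraction X Y E' c' 1 1)ᴴ = 0 := by
  rw [contraction_one, contraction_one, Matrix.conjTranspose_sum, Matrix.sum_mul]
  refine Finset.sum_eq_zero fun t _ => ?_
  rw [Matrix.mul_sum]
  by_cases h0 : E c t.1 t.2.1 t.2.2 = 0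
  · simp [h0]
  obtain ⟨ha, hb, hx⟩ := hE _ _ _ _ h0
  refine Finset.sum_eq_zero fun t' _ => ?_
  rw [Matrix.conjTranspose_smul, Matrix.conjTranspose_mul, Matrix.smul_mul, Matrix.mul_smul,
    Matrix.mul_assoc, ← Matrix.mul_assoc _ _ (D.cg _ _ _ _)ᴴ]
  suffices h : D.cg t.1 t.2.1 c t.2.2 * ((D.proj X t.1) ⊗ₖ (D.proj Y t.2.1) *
      ((D.proj X t'.1) ⊗ₖ (D.proj Y t'.2.1))ᴴ * (D.cg t'.1 t'.2.1 c' t'.2.2)ᴴ) = 0 by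
    rw [h, smul_zero, smul_zero]
  obtain ⟨a, b, k⟩ := t
  obtain ⟨a', b', k'⟩ := t'
  dsimp only at *
  by_cases h1 : a = a'
  · by_cases h2 : b = b'
    · subst h1 h2
      rw [kron_proj_mul hm ha hb, Matrix.one_mul]
      exact m.cg_mul_of_ne hm.cgOrth a b fun h => hc (congrArg Prod.fst h)
    · rw [
        Matrix.conjTranspose_kronecker, ← Matrix.mul_kronecker_mul,
        m.proj_mul_of_ne hm.proj Y h2, Matrix.kronecker_zero, Matrix.zero_mul, Matrix.mul_zero]
  · rw [
      Matrix.conjTranspose_kronecker, ← Matrix.mul_kronecker_mul,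
      m.proj_mul_of_ne hm.proj X h1, Matrix.zero_kronecker, Matrix.zero_mul, Matrix.mul_zero]

theorem cgMat_mul (hm : m.Valid) {X Y : GIrrep} (Z Z' : GIrrep) {E E' : ι → ι → ι → Label → ℂ}
    (hE : ∀ c a b k, E c a b k ≠ 0 → a ∈ D.content X ∧ b ∈ D.content Y ∧ m.ex a b c k = true) :
    D.cgMat X Y Z E * (D.cgMat X Y Z' E')ᴴ =
      ∑ c, gramSum E E' c • ((D.proj Z c)ᴴ * D.proj Z' c) := by
  rw [AdaptedBasis.cgMat, AdaptedBasis.cgMat, Matrix.conjTranspose_sum, Matrix.sum_mul]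
  refine Finset.sum_congr rfl fun c _ => ?_
  rw [Matrix.mul_sum, Finset.sum_eq_single c]
  · rw [Matrix.conjTranspose_mul, Matrix.conjTranspose_conjTranspose, Matrix.mul_assoc,
      ← Matrix.mul_assoc _ _ (D.proj Z' c), contraction_mul hm hE, Matrix.smul_mul, Matrix.one_mul,
      Matrix.mul_smul]
  · intro c' _ hc'
    rw [Matrix.conjTranspose_mul, Matrix.conjTranspose_conjTranspose, Matrix.mul_assoc,
      ← Matrix.mul_assoc _ _ (D.proj Z' c'), contraction_mul_of_ne hm hE hc'.symm, Matrix.zero_mul,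
      Matrix.mul_zero]
  · simp

theorem cgMat_mul_self (hm : m.Valid) {X Y : GIrrep} {ch : Channel ι} (hch : ch ∈ D.table X Y) :
    D.cgMat X Y ch.target ch.emb * (D.cgMat X Y ch.target ch.emb)ᴴ = 1 := by
  rw [cgMat_mul hm _ _ fun c a b k h => (emb_support hm hch h).2, ← m.sum_proj hm.proj]
  refine Finset.sum_congr rfl fun c _ => ?_
  by_cases hc : c ∈ D.content ch.target
  · rw [gramSum_self hm hch hc, one_smul]
  · rw [m.proj_eq_zero hm.proj hc, Matrix.mul_zero, smul_zero]

theorem cgMat_pairwise (hm : m.Valid) (X Y : GIrrep) : (D.table X Y).Pairwise fun ch ch' =>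
    D.cgMat X Y ch.target ch.emb * (D.cgMat X Y ch'.target ch'.emb)ᴴ = 0 := by
  refine (gramSum_pairwise hm X Y).imp_of_mem fun {ch ch'} hch _ h => ?_
  rw [cgMat_mul hm _ _ fun c a b k h => (emb_support hm hch h).2]
  refine Finset.sum_eq_zero fun c _ => ?_
  by_cases hc : c ∈ D.content ch.target
  · rw [h c hc, zero_smul]
  · rw [m.proj_eq_zero hm.proj hc, Matrix.conjTranspose_zero, Matrix.zero_mul, smul_zero]

theorem sum_map_eq_sum_getElem {σ M : Type*} [AddCommMonoid M] (l : List σ) (f : σ → M) :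
    (l.map f).sum = ∑ i : Fin l.length, f l[i] := by
  rw [← List.sum_ofFn]
  congr 1
  exact List.ext_getElem (by simp) (by simp)

theorem sum_cgMat (hm : m.Valid) {X Y : GIrrep} (h : D.table X Y ≠ []) :
    ((D.table X Y).map fun ch =>
      (D.cgMat X Y ch.target ch.emb)ᴴ * D.cgMat X Y ch.target ch.emb).sum = 1 := by
  have hdim : ((D.table X Y).map fun ch => ch.target.dim).sum = X.dim * Y.dim := by
    have h0 := (cond_false_eq_true_iff.1 (cond_false_eq_true_iff.1 (hm.table X Y)).2).2
    have e : (D.table X Y).map (fun ch => ch.target.dim) =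
        (m.table X Y).L.map fun q => q.target.dim :=
      map_of_forall₂ (m.table X Y).h fun _ _ h => by rw [h.target]
    have hlen : (m.table X Y).L.length ≠ 0 := by
      rw [← (m.table X Y).h.length_eq]; simpa using h
    rw [e]
    cases e0 : Nat.beq (m.table X Y).L.length 0
    · rw [e0, cond_false, natBeq_iff, sumL_eq] at h0; exact h0
    · exact absurd (natBeq_iff.1 e0) hlen
  have hget := List.pairwise_iff_getElem.1 (cgMat_pairwise hm X Y)
  rw [sum_map_eq_sum_getElem]
  refine sum_conjTranspose_mul_eq_one (κ := Fin (D.table X Y).length)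
    (fun i => (D.table X Y)[i].target.dim)
    (fun i => D.cgMat X Y (D.table X Y)[i].target (D.table X Y)[i].emb)
    (fun i => cgMat_mul_self hm (List.getElem_mem _)) (fun i j hij => ?_) ?_
  · rcases lt_or_gt_of_ne hij with hlt | hlt
    · exact hget i j i.2 j.2 hlt
    · have := congrArg Matrix.conjTranspose (hget j i j.2 i.2 hlt)
      rwa [Matrix.conjTranspose_mul, Matrix.conjTranspose_conjTranspose,
        Matrix.conjTranspose_zero] at this
  · rw [Fintype.card_prod, Fintype.card_fin, Fintype.card_fin, ← hdim, sum_map_eq_sum_getElem]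

/-! ### Intertwining, symmetry, conjugation -/

theorem cgMat_mat (hm : m.Valid) {X Y : GIrrep} {ch : Channel ι} (hch : ch ∈ D.table X Y) :
    D.cgMat X Y ch.target ch.emb * (D.matA X ⊗ₖ D.matA Y) =
      D.matA ch.target * D.cgMat X Y ch.target ch.emb ∧
    D.cgMat X Y ch.target ch.emb * (D.matB X ⊗ₖ D.matB Y) =
      D.matB ch.target * D.cgMat X Y ch.target ch.emb := by
  obtain ⟨q, hq, hr⟩ := exists_rep (m := m) hch
  obtain ⟨hok, -, -, hi⟩ := checkTable_chan hm hq
  obtain ⟨E, h1, h2⟩ := exists_emb hr hok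
  obtain ⟨i1, i2⟩ := cond_false_eq_true_iff.1 hi
  have ht := m.tenRep hm.proj hm.cgOk X Y q.target (E := E) (q := q) fun _ => h2
  rw [h1, hr.target, cgMat_smul, Matrix.smul_mul, Matrix.mul_smul, Matrix.smul_mul, Matrix.mul_smul]
  exact ⟨congrArg _ ((ht.mulKron (m.repA X) (m.repA Y)).eq (TenRep.mulLeft (m.repA _) ht) i1),
    congrArg _ ((ht.mulKron (m.repB X) (m.repB Y)).eq (TenRep.mulLeft (m.repB _) ht) i2)⟩

theorem cgMat_symm (hm : m.Valid) {X : GIrrep} {ch : Channel ι} (hch : ch ∈ D.table X X)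
    (hs : ch.sym = Label.s) :
    (D.cgMat X X ch.target ch.emb).submatrix id Prod.swap = D.cgMat X X ch.target ch.emb := by
  obtain ⟨q, hq, hr⟩ := exists_rep (m := m) hch
  obtain ⟨hok, -, -, -⟩ := checkTable_chan hm hq
  obtain ⟨E, h1, h2⟩ := exists_emb hr hok
  have h3 := allL_iff.1 (hm.symm X) q hq
  rw [← hr.sym, hs] at h3
  have ht := m.tenRep hm.proj hm.cgOk X X q.target (E := E) (q := q) fun _ => h2
  have h4 := ht.swap.eq ht h3
  rw [h1, hr.target, cgMat_smul]
  exact congrArg (radical q.g • ·) h4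

theorem cgMat_antisymm (hm : m.Valid) {X : GIrrep} {ch : Channel ι} (hch : ch ∈ D.table X X)
    (hs : ch.sym = Label.a) :
    (D.cgMat X X ch.target ch.emb).submatrix id Prod.swap = -D.cgMat X X ch.target ch.emb := by
  obtain ⟨q, hq, hr⟩ := exists_rep (m := m) hch
  obtain ⟨hok, -, -, -⟩ := checkTable_chan hm hq
  obtain ⟨E, h1, h2⟩ := exists_emb hr hok
  have h3 := allL_iff.1 (hm.symm X) q hq
  rw [← hr.sym, hs] at h3
  have ht := m.tenRep hm.proj hm.cgOk X X q.target (E := E) (q := q) fun _ => h2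
  have h4 := ht.swap.eq ht.neg h3
  rw [h1, hr.target, cgMat_smul, ← smul_neg]
  exact congrArg (radical q.g • ·) h4

theorem gcode_inj {X Y : GIrrep} (h : gcode X = gcode Y) : X = Y := by
  revert h; cases X <;> cases Y <;> decide

theorem label_code_inj {k k' : Label} (h : k.code = k'.code) : k = k' := by
  revert h; cases k <;> cases k' <;> decide

theorem exists_conj_emb (hm : m.Valid) {X Y : GIrrep} (h : D.table X.bar Y.bar ≠ []) {ch : Channel ι}
    (hch : ch ∈ D.table X Y) : ∃ ch' ∈ D.table X.bar Y.bar, ch'.target = ch.target.bar ∧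
      ch'.sym = ch.sym ∧ ch'.mult = ch.mult ∧
      ∀ c a b k, ch'.emb (D.bar c) (D.bar a) (D.bar b) k = star (ch.emb c a b k) := by
  obtain ⟨q, hq, hr⟩ := exists_rep (m := m) hch
  have h0 := hm.conjEmb X Y
  rw [checkConjEmb] at h0
  have hlen : (m.table X.bar Y.bar).L.length ≠ 0 := by
    rw [← (m.table X.bar Y.bar).h.length_eq]; simpa using h
  have hf : Nat.beq (m.table X.bar Y.bar).L.length 0 = false := by
    rw [← Bool.not_eq_true, natBeq_iff]; exact hlen
  rw [hf, cond_false] at h0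
  obtain ⟨q', hq', h1⟩ := anyL_iff.1 (allL_iff.1 h0 q hq)
  simp only [cond_false_eq_true_iff, natBeq_iff] at h1
  obtain ⟨⟨e1, e2, e3, e4, e5, e6, e7⟩, h2⟩ := h1
  obtain ⟨ch', hch', hr'⟩ := exists_of_forall₂ (List.Forall₂.flip (m.table X.bar Y.bar).h) hq'
  refine ⟨ch', hch', ?_, ?_, ?_, fun c a b k => ?_⟩
  · rw [hr'.target, hr.target]; exact gcode_inj e1
  · rw [hr'.sym, hr.sym]; exact label_code_inj e2
  · rw [hr'.mult, hr.mult]; exact e3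
  · obtain ⟨E, f1, f2⟩ := exists_emb hr e6
    obtain ⟨E', f1', f2'⟩ := exists_emb hr' e5
    have h3 := allLabel_iff.1 (m.allI_iff.1 (m.allI_iff.1 (m.allI_iff.1 h2 c) a) b) k
    rw [f1, f1']
    simp only [star_mul', star_radical, e4]
    rw [(f2' (D.bar c) (D.bar a) (D.bar b) k).1.eq_of_check (f2 c a b k).2 e7 h3]

theorem self_conj (hm : m.Valid) {ch : Channel ι} (hch : ch ∈ D.table .g3 .g3b) :
    ch.target = ch.target.bar ∧
      (D.cgMat .g3b .g3 ch.target (ch.conj D.bar).emb).submatrix id Prod.swap =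
        D.cgMat .g3 .g3b ch.target ch.emb := by
  obtain ⟨q, hq, hr⟩ := exists_rep (m := m) hch
  have h0 := allL_iff.1 hm.selfConj q hq
  simp only [cond_false_eq_true_iff, natBeq_iff] at h0
  obtain ⟨⟨h1, hok⟩, h2⟩ := h0
  refine ⟨?_, ?_⟩
  · rw [hr.target]; exact (gcode_inj h1).symm
  · obtain ⟨E, f1, f2⟩ := exists_emb hr hok
    obtain ⟨t, σ, μ, F⟩ := ch
    have htgt : t = q.target := hr.target
    dsimp only at f1
    subst f1 htgt
    have e : (Channel.conj D.bar ⟨q.target, σ, μ, fun c a b k => radical q.g * E c a b k⟩).emb =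
        fun c a b k => radical q.g * star (E (D.bar c) (D.bar a) (D.bar b) k) := by
      funext c a b k
      simp only [Channel.conj, star_mul', star_radical]
    have ht := m.tenRep hm.proj hm.cgOk .g3 .g3b q.target (E := E) (q := q) fun _ => f2
    have ht' := m.tenRep hm.proj hm.cgOk .g3b .g3 q.target (q := q.conj D.bar)
      (E := fun c a b k => star (E (D.bar c) (D.bar a) (D.bar b) k)) fun _ c a b k => (f2 _ _ _ _).star
    rw [e, cgMat_smul, cgMat_smul]
    exact congrArg (radical q.g • ·) (ht'.swap.eq ht h2)

end Model
end
end PSL27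

namespace PSL27
open Matrix
open scoped Kronecker MatrixGroups
open Complex (I exp)
open IrrepCode GIrrep S4Irrep T7Irrep

noncomputable section

theorem modelS_mat : modelS.checkMat = true := by decide +kernel

theorem modelS_proj : modelS.checkProj = true := by decide +kernel

theorem modelS_sub : modelS.checkSub = true := by decide +kernel

theorem modelS_conj : modelS.checkConj = true := by decide +kernel

theorem modelS_conjSub : modelS.checkConjSub = true := by decide +kernel

theorem modelS_gen : modelS.checkGen = true := by decide +kernel

theorem modelS_cg : modelS.checkCG = true := by decide +kernel

theorem modelS_cgOrth : modelS.checkCGOrth = true := by decide +kernel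

theorem modelS_cgDim : modelS.checkCGDim = true := by decide +kernel

theorem modelS_cgOk : modelS.checkCGOk = true := by decide +kernel

theorem modelS_cgConj : modelS.checkCGConj = true := by decide +kernel

theorem modelS_selfConj : modelS.checkSelfConj = true := by decide +kernel

theorem modelS_table_g1 (Y : GIrrep) : modelS.checkTable g1 Y = true := by
  cases Y <;> decide +kernel

theorem modelS_table_g3 (Y : GIrrep) : modelS.checkTable g3 Y = true := by
  cases Y <;> decide +kernel

theorem modelS_table_g3b (Y : GIrrep) : modelS.checkTable g3b Y = true := by
  cases Y <;> decide +kernel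

theorem modelS_table_g6 (Y : GIrrep) : modelS.checkTable g6 Y = true := by
  cases Y <;> decide +kernel

theorem modelS_table_g7 (Y : GIrrep) : modelS.checkTable g7 Y = true := by
  cases Y <;> decide +kernel

theorem modelS_table_g8 (Y : GIrrep) : modelS.checkTable g8 Y = true := by
  cases Y <;> decide +kernel

theorem modelS_symm (X : GIrrep) : modelS.checkSymm X = true := by
  cases X <;> decide +kernel

theorem modelS_conjEmb (X Y : GIrrep) : modelS.checkConjEmb X Y = true := by
  cases X <;> cases Y <;> decide +kernel

theorem modelS_valid : modelS.Valid where
  mat := modelS_mat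
  proj := modelS_proj
  sub := modelS_sub
  conj := modelS_conj
  conjSub := modelS_conjSub
  gen := modelS_gen
  cg := modelS_cg
  cgOrth := modelS_cgOrth
  cgDim := modelS_cgDim
  cgOk := modelS_cgOk
  cgConj := modelS_cgConj
  selfConj := modelS_selfConj
  symm := modelS_symm
  conjEmb := modelS_conjEmb
  table
    | g1 => modelS_table_g1
    | g3 => modelS_table_g3
    | g3b => modelS_table_g3b
    | g6 => modelS_table_g6
    | g7 => modelS_table_g7
    | g8 => modelS_table_g8
  dim_pos x := by cases x <;> decide
  bar_bar x := by cases x <;> rfl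
  nodup X := nodup_contentS X

theorem modelT_mat : modelT.checkMat = true := by decide +kernel

theorem modelT_proj : modelT.checkProj = true := by decide +kernel

theorem modelT_sub : modelT.checkSub = true := by decide +kernel

theorem modelT_conj : modelT.checkConj = true := by decide +kernel

theorem modelT_conjSub : modelT.checkConjSub = true := by decide +kernel

theorem modelT_gen : modelT.checkGen = true := by decide +kernel

theorem modelT_cg : modelT.checkCG = true := by decide +kernel

theorem modelT_cgOrth : modelT.checkCGOrth = true := by decide +kernel

theorem modelT_cgDim : modelT.checkCGDim = true := by decide +kernel

theorem modelT_cgOk : modelT.checkCGOk = true := by decide +kernel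

theorem modelT_cgConj : modelT.checkCGConj = true := by decide +kernel

theorem modelT_selfConj : modelT.checkSelfConj = true := by decide +kernel

theorem modelT_table_g1 (Y : GIrrep) : modelT.checkTable g1 Y = true := by
  cases Y <;> decide +kernel

theorem modelT_table_g3 (Y : GIrrep) : modelT.checkTable g3 Y = true := by
  cases Y <;> decide +kernel

theorem modelT_table_g3b (Y : GIrrep) : modelT.checkTable g3b Y = true := by
  cases Y <;> decide +kernel

theorem modelT_table_g6 (Y : GIrrep) : modelT.checkTable g6 Y = true := by
  cases Y <;> decide +kernel

theorem modelT_table_g7 (Y : GIrrep) : modelT.checkTable g7 Y = true := by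
  cases Y <;> decide +kernel

theorem modelT_table_g8 (Y : GIrrep) : modelT.checkTable g8 Y = true := by
  cases Y <;> decide +kernel

theorem modelT_symm (X : GIrrep) : modelT.checkSymm X = true := by
  cases X <;> decide +kernel

theorem modelT_conjEmb (X Y : GIrrep) : modelT.checkConjEmb X Y = true := by
  cases X <;> cases Y <;> decide +kernel

theorem modelT_valid : modelT.Valid where
  mat := modelT_mat
  proj := modelT_proj
  sub := modelT_sub
  conj := modelT_conj
  conjSub := modelT_conjSub
  gen := modelT_gen
  cg := modelT_cg
  cgOrth := modelT_cgOrth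
  cgDim := modelT_cgDim
  cgOk := modelT_cgOk
  cgConj := modelT_cgConj
  selfConj := modelT_selfConj
  symm := modelT_symm
  conjEmb := modelT_conjEmb
  table
    | g1 => modelT_table_g1
    | g3 => modelT_table_g3
    | g3b => modelT_table_g3b
    | g6 => modelT_table_g6
    | g7 => modelT_table_g7
    | g8 => modelT_table_g8
  dim_pos x := by cases x <;> decide
  bar_bar x := by cases x <;> rfl
  nodup X := nodup_contentT X

end
end PSL27

namespace PSL27
open Matrix
open scoped Kronecker MatrixGroups
open Complex (I exp)
open IrrepCode

noncomputable section

/-! ### Matrix representations determined on generators -/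

section

variable {G : Type} [Group G] {p q : Type} [Fintype p] [DecidableEq p] [Fintype q] [DecidableEq q]

theorem intertwine_of_closure {s : Set G} (hs : Subgroup.closure s = ⊤) {f : G →* Matrix p p ℂ}
    {f' : G →* Matrix q q ℂ} {M : Matrix q p ℂ} (h : ∀ g ∈ s, M * f g = f' g * M) (g : G) :
    M * f g = f' g * M := by
  have hg : g ∈ Subgroup.closure s := hs ▸ Subgroup.mem_top g
  induction hg using Subgroup.closure_induction with
  | mem x hx => exact h x hx
  | one => simp
  | mul x y _ _ hx hy =>
    rw [map_mul, map_mul, ← Matrix.mul_assoc, hx, Matrix.mul_assoc, hy, Matrix.mul_assoc]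
  | inv x _ hx =>
    have h1 : f x * f x⁻¹ = 1 := by rw [← map_mul, mul_inv_cancel, map_one]
    have h2 : f' x⁻¹ * f' x = 1 := by rw [← map_mul, inv_mul_cancel, map_one]
    calc M * f x⁻¹ = f' x⁻¹ * f' x * (M * f x⁻¹) := by rw [h2, Matrix.one_mul]
      _ = f' x⁻¹ * (M * f x) * f x⁻¹ := by rw [hx]; simp only [Matrix.mul_assoc]
      _ = f' x⁻¹ * M := by
        rw [Matrix.mul_assoc, Matrix.mul_assoc, h1, Matrix.mul_one]

theorem mem_unitary_of_closure {s : Set G} (hs : Subgroup.closure s = ⊤) {f : G →* Matrix p p ℂ}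
    (h : ∀ g ∈ s, f g * (f g)ᴴ = 1) (g : G) : f g ∈ Matrix.unitaryGroup p ℂ := by
  have hg : g ∈ Subgroup.closure s := hs ▸ Subgroup.mem_top g
  induction hg using Subgroup.closure_induction with
  | mem x hx => exact Matrix.mem_unitaryGroup_iff.2 (h x hx)
  | one => rw [map_one]; exact one_mem _
  | mul x y _ _ hx hy => rw [map_mul]; exact mul_mem hx hy
  | inv x _ hx =>
    have h1 : f x * f x⁻¹ = 1 := by rw [← map_mul, mul_inv_cancel, map_one]
    have h2 : f x⁻¹ = star (f x) := by
      rw [← Matrix.one_mul (f x⁻¹), ← Matrix.mem_unitaryGroup_iff'.1 hx, Matrix.mul_assoc, h1,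
        Matrix.mul_one]
    rw [h2]; exact Unitary.star_mem hx

/-- The tensor product of two matrix representations. -/
def kronHom (f : G →* Matrix p p ℂ) (f' : G →* Matrix q q ℂ) : G →* Matrix (p × q) (p × q) ℂ where
  toFun g := f g ⊗ₖ f' g
  map_one' := by simp
  map_mul' x y := by rw [map_mul, map_mul, Matrix.mul_kronecker_mul]

theorem kronHom_apply (f : G →* Matrix p p ℂ) (f' : G →* Matrix q q ℂ) (g : G) :
    kronHom f f' g = f g ⊗ₖ f' g := rfl

theorem map_star_mul {l m n : Type} [Fintype m] (M : Matrix l m ℂ) (N : Matrix m n ℂ) :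
    (M * N).map star = M.map star * N.map star := by
  ext i j
  simp [Matrix.mul_apply]

theorem map_star_one : (1 : Matrix p p ℂ).map star = 1 := by
  ext i j
  by_cases h : i = j
  · subst h; simp
  · simp [h]

theorem map_star_conjTranspose {m n : Type} (M : Matrix m n ℂ) :
    (M.map star)ᴴ = Mᴴ.map star := by ext i j; simp

theorem map_star_kronecker {l m n o : Type} (M : Matrix l m ℂ) (N : Matrix n o ℂ) :
    (M ⊗ₖ N).map star = M.map star ⊗ₖ N.map star := by
  ext ⟨i, j⟩ ⟨k, l⟩
  simp [Matrix.kroneckerMap_apply]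

theorem map_star_sum {κ m n : Type} (s : Finset κ) (M : κ → Matrix m n ℂ) :
    (∑ i ∈ s, M i).map star = ∑ i ∈ s, (M i).map star := by
  ext i j
  simp [Matrix.sum_apply]

theorem map_star_smul {m n : Type} (r : ℂ) (M : Matrix m n ℂ) :
    (r • M).map star = star r • M.map star := by
  ext i j
  simp

/-- The complex conjugate of a matrix representation. -/
def starHom (f : G →* Matrix p p ℂ) : G →* Matrix p p ℂ where
  toFun g := (f g).map star
  map_one' := by rw [map_one, map_star_one]
  map_mul' x y := by rw [map_mul, map_star_mul]

theorem starHom_apply (f : G →* Matrix p p ℂ) (g : G) : starHom f g = (f g).map star := rfl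

end

namespace Model

variable {ι : Type} [Fintype ι] [DecidableEq ι] [IrrepCode ι] {D : AdaptedBasis ι} (m : Model D)

/-- The matrices `Γ_X` are unitary and `Γ_3 = 1`. -/
def checkConjG : Bool :=
  cond (allG fun X => cond (((m.KG X).mul X.dim (m.KG X).adj).eqv X.bar.dim X.bar.dim MatQ.one)
    (((m.KG X).adj.mul X.bar.dim (m.KG X)).eqv X.dim X.dim MatQ.one) false)
    ((m.KG .g3).eqv 3 3 MatQ.one) false

/-- The conventions of the lists. -/
structure Regular : Prop where
  conjG : m.checkConjG = true
  content_bar : ∀ X, ∀ x ∈ D.content X, D.bar x ∈ D.content X.bar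
  covers : ∀ X Y, D.table X Y ≠ [] ∨ D.table Y X ≠ []
  matA_bar : D.matA .g3b = (D.matA .g3).map star
  matB_bar : D.matB .g3b = (D.matB .g3).map star

variable {m}

theorem conjMatG_mul_star (h : m.Regular) (X : GIrrep) :
    D.conjMatG X * (D.conjMatG X)ᴴ = 1 :=
  ((m.repKG X).mul (m.repKG X).adj).eq MatRep.one (cond_false_eq_true_iff.1
    (allG_iff.1 (cond_false_eq_true_iff.1 h.conjG).1 X)).1

theorem star_mul_conjMatG (h : m.Regular) (X : GIrrep) :
    (D.conjMatG X)ᴴ * D.conjMatG X = 1 :=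
  ((m.repKG X).adj.mul (m.repKG X)).eq MatRep.one (cond_false_eq_true_iff.1
    (allG_iff.1 (cond_false_eq_true_iff.1 h.conjG).1 X)).2

theorem conjMatG_three (h : m.Regular) : D.conjMatG .g3 = (1 : Matrix (Fin 3) (Fin 3) ℂ) :=
  (m.repKG .g3).eq MatRep.one (cond_false_eq_true_iff.1 h.conjG).2

theorem conj_proj (hm : m.Valid) (h : m.Regular) (X : GIrrep) (x : ι) :
    D.conjMat x * (D.proj X x).map star = D.proj X.bar (D.bar x) * D.conjMatG X := by
  rw [AdaptedBasis.conjMatG, Matrix.mul_sum, Finset.sum_eq_single x]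
  · by_cases hx : x ∈ D.content X
    · rw [← Matrix.mul_assoc, ← Matrix.mul_assoc, m.proj_mul_self hm.proj (h.content_bar X x hx),
        Matrix.one_mul]
    · rw [m.proj_eq_zero hm.proj hx]
      simp
  · intro y _ hy
    have : D.bar x ≠ D.bar y := fun e => hy (by rw [← hm.bar_bar x, e, hm.bar_bar])
    rw [← Matrix.mul_assoc, ← Matrix.mul_assoc, m.proj_mul_of_ne hm.proj _ this, Matrix.zero_mul,
      Matrix.zero_mul]
  · simp

theorem conjMatG_mul_proj (hm : m.Valid) (h : m.Regular) (X : GIrrep) (x : ι) :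
    D.conjMatG X * ((D.proj X x)ᴴ).map star = (D.proj X.bar (D.bar x))ᴴ * D.conjMat x := by
  have h1 := congrArg Matrix.conjTranspose (conj_proj hm h X x)
  rw [Matrix.conjTranspose_mul, Matrix.conjTranspose_mul, map_star_conjTranspose] at h1
  calc D.conjMatG X * ((D.proj X x)ᴴ).map star
      = D.conjMatG X * (((D.proj X x)ᴴ).map star * (D.conjMat x)ᴴ) * D.conjMat x := by
        rw [Matrix.mul_assoc, Matrix.mul_assoc, m.star_mul_conjMat hm.conjSub, Matrix.mul_one]
    _ = _ := by rw [h1, ← Matrix.mul_assoc, conjMatG_mul_star h, Matrix.one_mul]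

theorem conj_contraction (hm : m.Valid) (h : m.Regular) (X Y : GIrrep)
    (E : ι → ι → ι → Label → ℂ) (c : ι) :
    D.conjMat c * (D.contraction X Y E c 1 1).map star =
      D.contraction X.bar Y.bar (fun c a b k => star (E (D.bar c) (D.bar a) (D.bar b) k)) (D.bar c)
        1 1 * (D.conjMatG X ⊗ₖ D.conjMatG Y) := by
  let φ : ι ≃ ι := ⟨D.bar, D.bar, hm.bar_bar, hm.bar_bar⟩
  rw [contraction_one, contraction_one, map_star_sum, Matrix.mul_sum, Matrix.sum_mul]
  refine Fintype.sum_equiv (φ.prodCongr (φ.prodCongr (Equiv.refl Label))) _ _ fun t => ?_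
  simp only [Equiv.prodCongr_apply, Prod.map, φ, Equiv.coe_fn_mk, Equiv.refl_apply, hm.bar_bar]
  rw [map_star_smul, map_star_mul, map_star_kronecker, Matrix.mul_smul, Matrix.smul_mul,
    ← Matrix.mul_assoc, m.conjMat_cg hm.cgConj, Matrix.mul_assoc, ← Matrix.mul_kronecker_mul,
    conj_proj hm h, conj_proj hm h, Matrix.mul_kronecker_mul, Matrix.mul_assoc]
  rfl

theorem conj_cgMat (hm : m.Valid) (h : m.Regular) (X Y : GIrrep) (ch : Channel ι) :
    D.conjMatG ch.target * (D.cgMat X Y ch.target ch.emb).map star =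
      D.cgMat X.bar Y.bar (ch.conj D.bar).target (ch.conj D.bar).emb *
        (D.conjMatG X ⊗ₖ D.conjMatG Y) := by
  let φ : ι ≃ ι := ⟨D.bar, D.bar, hm.bar_bar, hm.bar_bar⟩
  rw [AdaptedBasis.cgMat, AdaptedBasis.cgMat, map_star_sum, Matrix.mul_sum, Matrix.sum_mul]
  refine Fintype.sum_equiv φ _ _ fun c => ?_
  rw [map_star_mul, ← Matrix.mul_assoc, conjMatG_mul_proj hm h, Matrix.mul_assoc,
    conj_contraction hm h, ← Matrix.mul_assoc]
  rfl

section Group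

variable {G : Type} [Group G] {A B : G} {H : Subgroup G} {h₁ h₂ : H}
  {ρ : (X : GIrrep) → G →* Matrix (Fin X.dim) (Fin X.dim) ℂ}
  {σ : (x : ι) → H →* Matrix (Fin (D.dim x)) (Fin (D.dim x)) ℂ}

variable (m A B h₁ h₂ ρ σ) in
/-- The representations `ρ` and `σ` have the matrices of the model on generators. -/
structure Realizes : Prop where
  closure : Subgroup.closure {A, B} = ⊤
  closure_sub : Subgroup.closure {h₁, h₂} = ⊤
  map_A : ∀ X, ρ X A = D.matA X
  map_B : ∀ X, ρ X B = D.matB X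
  map_gen₁ : ∀ x, σ x h₁ = D.gen₁ x
  map_gen₂ : ∀ x, σ x h₂ = D.gen₂ x
  word₁ : (h₁ : G) = evalWord m.word₁ A B
  word₂ : (h₂ : G) = evalWord m.word₂ A B

theorem forall_mem_pair {τ : Type} {s t : τ} {p : τ → Prop} (hs : p s) (ht : p t) :
    ∀ g ∈ ({s, t} : Set τ), p g := by
  rintro g (rfl | rfl) <;> assumption

theorem Realizes.unitary (hm : m.Valid) (hr : m.Realizes A B h₁ h₂ ρ σ) (X : GIrrep) (g : G) :
    ρ X g ∈ Matrix.unitaryGroup (Fin X.dim) ℂ :=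
  mem_unitary_of_closure hr.closure (forall_mem_pair
    (by rw [hr.map_A]; exact m.matA_mul_star hm.mat X)
    (by rw [hr.map_B]; exact m.matB_mul_star hm.mat X)) g

theorem Realizes.unitary_sub (hm : m.Valid) (hr : m.Realizes A B h₁ h₂ ρ σ) (x : ι) (g : H) :
    σ x g ∈ Matrix.unitaryGroup (Fin (D.dim x)) ℂ :=
  mem_unitary_of_closure hr.closure_sub (forall_mem_pair
    (by rw [hr.map_gen₁]; exact m.gen₁_mul_star hm.gen x)
    (by rw [hr.map_gen₂]; exact m.gen₂_mul_star hm.gen x)) g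

theorem Realizes.proj_mul (hm : m.Valid) (hr : m.Realizes A B h₁ h₂ ρ σ) (X : GIrrep) (x : ι)
    (g : H) : D.proj X x * ρ X g = σ x g * D.proj X x :=
  intertwine_of_closure (f := (ρ X).comp H.subtype) hr.closure_sub (forall_mem_pair
    (by
      rw [MonoidHom.comp_apply, Subgroup.coe_subtype, hr.word₁, map_evalWord, hr.map_A, hr.map_B,
        hr.map_gen₁, m.proj_mul_word₁ hm.sub])
    (by
      rw [MonoidHom.comp_apply, Subgroup.coe_subtype, hr.word₂, map_evalWord, hr.map_A, hr.map_B,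
        hr.map_gen₂, m.proj_mul_word₂ hm.sub])) g

theorem Realizes.isAdapted (hm : m.Valid) (hr : m.Realizes A B h₁ h₂ ρ σ) :
    D.IsAdapted ρ σ where
  nodup := hm.nodup
  proj_eq_zero X x hx := m.proj_eq_zero hm.proj hx
  diag X x hx g := by
    rw [hr.proj_mul hm, Matrix.mul_assoc, m.proj_mul_self hm.proj hx, Matrix.mul_one]
  offdiag X x y hxy g := by
    rw [hr.proj_mul hm, Matrix.mul_assoc, m.proj_mul_of_ne hm.proj X hxy, Matrix.mul_zero]
  complete := m.sum_proj hm.proj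

theorem Realizes.isSubgroupCG (hm : m.Valid) (hr : m.Realizes A B h₁ h₂ ρ σ) :
    D.IsSubgroupCG σ where
  intertwine x y z k := intertwine_of_closure (f := kronHom (σ x) (σ y)) hr.closure_sub
    (forall_mem_pair
      (by
        simp only [kronHom_apply, hr.map_gen₁]; exact m.cg_gen₁ hm.cg x y z k)
      (by
        simp only [kronHom_apply, hr.map_gen₂]; exact m.cg_gen₂ hm.cg x y z k))
  orthonormal x y z k := m.cg_orthonormal hm.cg
  complete := m.sum_cg hm.cg hm.cgOrth hm.cgDim

theorem contraction_eq_mul_kronecker (X Y : GIrrep) (E : ι → ι → ι → Label → ℂ) (c : ι)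
    (R : Matrix (Fin X.dim) (Fin X.dim) ℂ) (S : Matrix (Fin Y.dim) (Fin Y.dim) ℂ) :
    D.contraction X Y E c R S = D.contraction X Y E c 1 1 * (R ⊗ₖ S) := by
  rw [contraction_eq_sum, contraction_one, Matrix.sum_mul]
  refine Finset.sum_congr rfl fun t _ => ?_
  rw [Matrix.smul_mul, Matrix.mul_assoc, Matrix.mul_kronecker_mul]

theorem proj_mul_cgMat (hm : m.Valid) {X Y : GIrrep} {ch : Channel ι} (hch : ch ∈ D.table X Y)
    (c : ι) : D.proj ch.target c * D.cgMat X Y ch.target ch.emb = D.contraction X Y ch.emb c 1 1 := by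
  rw [AdaptedBasis.cgMat, Matrix.mul_sum, Finset.sum_eq_single c]
  · by_cases hc : c ∈ D.content ch.target
    · rw [← Matrix.mul_assoc, m.proj_mul_self hm.proj hc, Matrix.one_mul]
    · rw [m.proj_eq_zero hm.proj hc, Matrix.zero_mul, contraction_one]
      refine (Finset.sum_eq_zero fun t _ => ?_).symm
      have : ch.emb c t.1 t.2.1 t.2.2 = 0 := by
        by_contra h
        exact hc (emb_support hm hch h).1
      rw [this, zero_smul]
  · intro c' _ hc'
    rw [← Matrix.mul_assoc, m.proj_mul_of_ne hm.proj _ hc'.symm, Matrix.zero_mul]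
  · simp

theorem Realizes.intertwine (hm : m.Valid) (hr : m.Realizes A B h₁ h₂ ρ σ) {X Y : GIrrep}
    {ch : Channel ι} (hch : ch ∈ D.table X Y) (g : G) :
    D.cgMat X Y ch.target ch.emb * (ρ X g ⊗ₖ ρ Y g) = ρ ch.target g * D.cgMat X Y ch.target ch.emb :=
  intertwine_of_closure (f := kronHom (ρ X) (ρ Y)) hr.closure
    (forall_mem_pair
      (by
        simp only [kronHom_apply, hr.map_A]; exact (cgMat_mat hm hch).1)
      (by
        simp only [kronHom_apply, hr.map_B]; exact (cgMat_mat hm hch).2)) g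

theorem Realizes.isCompleteTable (hm : m.Valid) (h : m.Regular)
    (hr : m.Realizes A B h₁ h₂ ρ σ) : D.IsCompleteTable ρ where
  contraction X Y ch hch := {
    support := fun c a b k hE =>
      have h1 := emb_support hm hch hE
      ⟨h1.1, h1.2.1, h1.2.2.1, ex_ne_zero hm h1.2.2.2⟩
    defining := fun c g => by
      rw [Matrix.mul_assoc, ← hr.intertwine hm hch, ← Matrix.mul_assoc, proj_mul_cgMat hm hch,
        contraction_eq_mul_kronecker X Y _ c (ρ X g)]
    normalized := fun c hc => by
      have h1 := gramSum_self hm hch hc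
      have h2 : gramSum ch.emb ch.emb c = ((∑ a, ∑ b, ∑ k, ‖ch.emb c a b k‖ ^ 2 : ℝ) : ℂ) := by
        simp only [gramSum, Complex.ofReal_sum, Complex.ofReal_pow]
        refine Finset.sum_congr rfl fun a _ => Finset.sum_congr rfl fun b _ =>
          Finset.sum_congr rfl fun k _ => Complex.mul_conj' _
      exact_mod_cast h2 ▸ h1
    intertwine := hr.intertwine hm hch
    orthonormal := cgMat_mul_self hm hch }
  orthogonal := cgMat_pairwise hm
  covers := h.covers
  complete X Y := sum_cgMat hm
  symmetric X ch := cgMat_symm hm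
  antisymmetric X ch := cgMat_antisymm hm

theorem Realizes.conj_sub (hm : m.Valid) (hr : m.Realizes A B h₁ h₂ ρ σ) (x : ι) (g : H) :
    D.conjMat x * (σ x g).map star = σ (D.bar x) g * D.conjMat x :=
  intertwine_of_closure (f := starHom (σ x)) hr.closure_sub (forall_mem_pair
    (by
      rw [starHom_apply, hr.map_gen₁, hr.map_gen₁, m.conjMat_gen₁ hm.conjSub])
    (by
      rw [starHom_apply, hr.map_gen₂, hr.map_gen₂, m.conjMat_gen₂ hm.conjSub])) g

theorem Realizes.conj (hm : m.Valid) (hr : m.Realizes A B h₁ h₂ ρ σ) (X : GIrrep) (g : G) :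
    D.conjMatG X * (ρ X g).map star = ρ X.bar g * D.conjMatG X :=
  intertwine_of_closure (f := starHom (ρ X)) hr.closure (forall_mem_pair
    (by
      rw [starHom_apply, hr.map_A, hr.map_A, m.conjMatG_matA hm.conj])
    (by
      rw [starHom_apply, hr.map_B, hr.map_B, m.conjMatG_matB hm.conj])) g

theorem Realizes.conj_three (h : m.Regular) (hr : m.Realizes A B h₁ h₂ ρ σ) (g : G) :
    ρ .g3b g = (ρ .g3 g).map star := by
  have := intertwine_of_closure (f := starHom (ρ .g3)) (f' := ρ .g3b)
    (M := (1 : Matrix (Fin 3) (Fin 3) ℂ)) hr.closure (forall_mem_pair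
    (by
      rw [starHom_apply, hr.map_A, hr.map_A, h.matA_bar, Matrix.one_mul, Matrix.mul_one])
    (by
      rw [starHom_apply, hr.map_B, hr.map_B, h.matB_bar, Matrix.one_mul, Matrix.mul_one])) g
  rw [Matrix.one_mul, Matrix.mul_one] at this
  exact this.symm

theorem Realizes.isConjugationCompatible (hm : m.Valid) (h : m.Regular)
    (hr : m.Realizes A B h₁ h₂ ρ σ) : D.IsConjugationCompatible ρ σ where
  bar_bar := hm.bar_bar
  unitary_sub x := ⟨m.conjMat_mul_star hm.conjSub x, m.star_mul_conjMat hm.conjSub x⟩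
  conj_sub x g := by
    rw [hr.conj_sub hm, Matrix.mul_assoc, m.conjMat_mul_star hm.conjSub, Matrix.mul_one]
  conj_cg := m.conjMat_cg hm.cgConj
  unitary X := ⟨conjMatG_mul_star h X, star_mul_conjMatG h X⟩
  conj X g := by
    rw [hr.conj hm, Matrix.mul_assoc, conjMatG_mul_star h, Matrix.mul_one]
  conj_three := hr.conj_three h
  conjMatG_three := conjMatG_three h
  conj_proj := conj_proj hm h
  conj_emb X Y _ h2 ch hch := exists_conj_emb hm h2 hch
  conj_cgMat X Y ch _ := conj_cgMat hm h X Y ch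
  self_conj ch hch := ⟨ch, hch, self_conj hm hch⟩

end Group

end Model

theorem modelS_regular : modelS.Regular where
  conjG := by decide +kernel
  content_bar X := by cases X <;> decide
  covers X Y := by cases X <;> cases Y <;> first | exact .inl (List.cons_ne_nil _ _) | exact .inr (List.cons_ne_nil _ _)
  matA_bar := rfl
  matB_bar := rfl

theorem modelT_regular : modelT.Regular where
  conjG := by decide +kernel
  content_bar X := by cases X <;> decide
  covers X Y := by cases X <;> cases Y <;> first | exact .inl (List.cons_ne_nil _ _) | exact .inr (List.cons_ne_nil _ _)
  matA_bar := rfl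
  matB_bar := rfl

end
end PSL27

namespace PSL27

/-! ### Coset enumeration -/

/-- The action of a word in two letters, applied from left to right. -/
def runWord {X : Type} (f g : X → X) : List Bool → X → X
  | [], q => q
  | true :: w, q => runWord f g w (f q)
  | false :: w, q => runWord f g w (g q)

section

variable {X : Type} (f g : X → X)

theorem runWord_nil (q : X) : runWord f g [] q = q := rfl

theorem runWord_true (w : List Bool) (q : X) : runWord f g (true :: w) q = runWord f g w (f q) := rfl

theorem runWord_false (w : List Bool) (q : X) :
    runWord f g (false :: w) q = runWord f g w (g q) := rfl

end

theorem runWord_eq_smul {Γ X : Type} [Group Γ] [MulAction Γ X] (u v : Γ) (w : List Bool) (q : X) :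
    runWord (fun q => u⁻¹ • q) (fun q => v⁻¹ • q) w q = (evalWord w u v)⁻¹ • q := by
  induction w generalizing q with
  | nil => simp [runWord_nil, evalWord_nil]
  | cons t w ih =>
    cases t
    · rw [runWord_false, ih, evalWord_cons, cond_false, mul_inv_rev, mul_smul]
    · rw [runWord_true, ih, evalWord_cons, cond_true, mul_inv_rev, mul_smul]

theorem evalWord_append {M : Type} [Monoid M] (w w' : List Bool) (x y : M) :
    evalWord (w ++ w') x y = evalWord w x y * evalWord w' x y := by
  induction w with
  | nil => rw [List.nil_append, evalWord_nil, one_mul]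
  | cons t w ih => rw [List.cons_append, evalWord_cons, ih, evalWord_cons, mul_assoc]

theorem evalWord_rotate {Γ : Type} [Group Γ] {u v : Γ} {w : List Bool} (h : evalWord w u v = 1)
    (t : ℕ) : evalWord (w.rotate t) u v = 1 := by
  induction t generalizing w with
  | zero => rwa [List.rotate_zero]
  | succ t ih =>
    cases w with
    | nil => rwa [List.rotate_nil]
    | cons s w =>
      rw [List.rotate_cons_succ]
      apply ih
      rw [evalWord_cons] at h
      rw [evalWord_append, evalWord_cons, evalWord_nil, mul_one]
      exact mul_eq_one_comm.1 h

theorem mem_of_closure_of_forall_mem {Γ X : Type} [Group Γ] [MulAction Γ X] {u v : Γ}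
    (hgen : Subgroup.closure {u, v} = ⊤) {l : List X} (hu : ∀ q ∈ l, u⁻¹ • q ∈ l)
    (hv : ∀ q ∈ l, v⁻¹ • q ∈ l) (γ : Γ) : ∀ q ∈ l, γ⁻¹ • q ∈ l := by
  classical
  have hγ : γ ∈ Subgroup.closure {u, v} := hgen ▸ Subgroup.mem_top γ
  induction hγ using Subgroup.closure_induction with
  | mem x hx =>
    rcases hx with rfl | rfl
    · exact hu
    · exact hv
  | one => simp
  | mul x y _ _ hx hy =>
    intro q hq
    rw [mul_inv_rev, mul_smul]
    exact hy _ (hx _ hq)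
  | inv x _ hx =>
    intro q hq
    have h1 : Set.SurjOn (fun q => x⁻¹ • q) (l.toFinset : Set X) (l.toFinset : Set X) :=
      Finset.surjOn_of_injOn_of_card_le _ (fun q hq => by simpa using hx q (by simpa using hq))
        (fun _ _ _ _ h => MulAction.injective x⁻¹ h) le_rfl
    obtain ⟨q', hq', e⟩ := h1 (by simpa using hq : q ∈ (l.toFinset : Set X))
    rw [inv_inv, ← e, smul_inv_smul]
    simpa using hq'

/-- A group generated by two elements that satisfy the relations `rels` has at most `n` elements. -/
def IsBoundedBy (rels : List (List Bool)) (n : ℕ) : Prop :=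
  ∀ (Γ : Type) [Group Γ] (u v : Γ), Subgroup.closure {u, v} = ⊤ →
    (∀ w ∈ rels, evalWord w u v = 1) → Finite Γ ∧ Nat.card Γ ≤ n

theorem isBoundedBy_of_cosets {rels : List (List Bool)} {w : List Bool} {k n : ℕ} (hk : 0 < k)
    (hpow : ∀ (Γ : Type) [Group Γ] (u v : Γ), (∀ r ∈ rels, evalWord r u v = 1) →
      evalWord w u v ^ k = 1)
    (hcos : ∀ (X : Type) (f g : X → X) (q0 : X), runWord f g w q0 = q0 →
      (∀ q, ∀ r ∈ rels, ∀ t r', r.rotate t = r' → runWord f g r' q = q) →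
      ∃ l : List X, l.length ≤ n ∧ q0 ∈ l ∧ (∀ q ∈ l, f q ∈ l) ∧ ∀ q ∈ l, g q ∈ l) :
    IsBoundedBy rels (k * n) := by
  intro Γ _ u v hgen hrel
  set C := Subgroup.zpowers (evalWord w u v)
  obtain ⟨l, hl, h0, hf, hg⟩ := hcos (Γ ⧸ C) (fun q => u⁻¹ • q) (fun q => v⁻¹ • q)
    ((1 : Γ) : Γ ⧸ C)
    (by
      rw [runWord_eq_smul]
      refine QuotientGroup.eq.2 ?_
      simp only [smul_eq_mul, mul_one, inv_inv]
      exact Subgroup.mem_zpowers _)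
    (fun q r hr t r' e => by
      rw [runWord_eq_smul, ← e, evalWord_rotate (hrel r hr) t, inv_one, one_smul])
  have hall : ∀ q : Γ ⧸ C, q ∈ l := by
    intro q
    obtain ⟨γ, rfl⟩ := QuotientGroup.mk_surjective q
    have h1 := mem_of_closure_of_forall_mem hgen hf hg γ⁻¹ _ h0
    rw [inv_inv] at h1
    have e : γ • ((1 : Γ) : Γ ⧸ C) = (γ : Γ ⧸ C) := by
      show ((γ * 1 : Γ) : Γ ⧸ C) = _
      rw [mul_one]
    rwa [e] at h1
  have hsurj : Function.Surjective fun i : Fin l.length => l[i] := fun q => by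
    obtain ⟨i, hi, e⟩ := List.getElem_of_mem (hall q)
    exact ⟨⟨i, hi⟩, e⟩
  have hfin : Finite (Γ ⧸ C) := Finite.of_surjective _ hsurj
  have hidx : C.index ≤ n := by
    have h1 := Nat.card_le_card_of_surjective _ hsurj
    rw [Nat.card_fin] at h1
    exact h1.trans hl
  have hp := hpow Γ u v hrel
  have hC : Nat.card C ≤ k := by
    rw [Nat.card_zpowers]
    exact Nat.le_of_dvd hk (orderOf_dvd_of_pow_eq_one hp)
  have hC0 : Nat.card C ≠ 0 := by
    rw [Nat.card_zpowers]
    exact (orderOf_pos_iff.2 (isOfFinOrder_iff_pow_eq_one.2 ⟨k, hk, hp⟩)).ne'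
  have hmul := C.card_mul_index
  refine ⟨Nat.finite_of_card_ne_zero ?_, ?_⟩
  · rw [← hmul]
    exact mul_ne_zero hC0 (Subgroup.index_ne_zero_of_finite)
  · rw [← hmul]
    exact Nat.mul_le_mul hC hidx

set_option maxRecDepth 4000 in
theorem exists_cosets_PSL (X : Type) (f g : X → X) (q0 : X) (h0 : runWord f g [true, false] q0 = q0)
    (h : ∀ q, ∀ r ∈ relators, ∀ t r', r.rotate t = r' → runWord f g r' q = q) :
    ∃ l : List X, l.length ≤ 24 ∧ q0 ∈ l ∧ (∀ q ∈ l, f q ∈ l) ∧ ∀ q ∈ l, g q ∈ l := by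
  have r0_0 := fun q => h q [true, true] (by decide) 0 [true, true] rfl
  have r1_0 := fun q => h q [false, false, false] (by decide) 0 [false, false, false] rfl
  have r2_0 := fun q => h q [true, false, true, false, true, false, true, false, true, false, true, false, true, false] (by decide) 0 [true, false, true, false, true, false, true, false, true, false, true, false, true, false] rfl
  have r2_1 := fun q => h q [true, false, true, false, true, false, true, false, true, false, true, false, true, false] (by decide) 1 [false, true, false, true, false, true, false, true, false, true, false, true, false, true] rfl
  have r3_2 := fun q => h q [true, false, true, false, false, true, false, true, false, false, true, false, true, false, false, true, false, true, false, false] (by decide) 2 [true, false, false, true, false, true, false, false, true, false, true, false, false, true, false, true, false, false, true, false] rfl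
  obtain ⟨q1, f0⟩ : ∃ q, f q0 = q := ⟨_, rfl⟩
  have g1 : g q1 = q0 := by rw [← f0]; exact h0
  have f1 : f q1 = q0 := by
    simpa only [runWord_nil, runWord_true, runWord_false, f0] using
      r0_0 q0
  obtain ⟨q2, g0⟩ : ∃ q, g q0 = q := ⟨_, rfl⟩
  have g2 : g q2 = q1 := by
    simpa only [runWord_nil, runWord_true, runWord_false, g1, g0] using
      r1_0 q1
  obtain ⟨q3, f2⟩ : ∃ q, f q2 = q := ⟨_, rfl⟩
  have f3 : f q3 = q2 := by
    simpa only [runWord_nil, runWord_true, runWord_false, f2] using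
      r0_0 q2
  obtain ⟨q4, g3⟩ : ∃ q, g q3 = q := ⟨_, rfl⟩
  obtain ⟨q5, f4⟩ : ∃ q, f q4 = q := ⟨_, rfl⟩
  have f5 : f q5 = q4 := by
    simpa only [runWord_nil, runWord_true, runWord_false, f4] using
      r0_0 q4
  obtain ⟨q6, g4⟩ : ∃ q, g q4 = q := ⟨_, rfl⟩
  have g6 : g q6 = q3 := by
    simpa only [runWord_nil, runWord_true, runWord_false, g3, g4] using
      r1_0 q3
  obtain ⟨q7, g5⟩ : ∃ q, g q5 = q := ⟨_, rfl⟩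
  obtain ⟨q8, f6⟩ : ∃ q, f q6 = q := ⟨_, rfl⟩
  have f8 : f q8 = q6 := by
    simpa only [runWord_nil, runWord_true, runWord_false, f6] using
      r0_0 q6
  obtain ⟨q9, f7⟩ : ∃ q, f q7 = q := ⟨_, rfl⟩
  have f9 : f q9 = q7 := by
    simpa only [runWord_nil, runWord_true, runWord_false, f7] using
      r0_0 q7
  obtain ⟨q10, g7⟩ : ∃ q, g q7 = q := ⟨_, rfl⟩
  have g10 : g q10 = q5 := by
    simpa only [runWord_nil, runWord_true, runWord_false, g5, g7] using
      r1_0 q5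
  obtain ⟨q11, g8⟩ : ∃ q, g q8 = q := ⟨_, rfl⟩
  obtain ⟨q12, g9⟩ : ∃ q, g q9 = q := ⟨_, rfl⟩
  obtain ⟨q13, f10⟩ : ∃ q, f q10 = q := ⟨_, rfl⟩
  have f13 : f q13 = q10 := by
    simpa only [runWord_nil, runWord_true, runWord_false, f10] using
      r0_0 q10
  obtain ⟨q14, f11⟩ : ∃ q, f q11 = q := ⟨_, rfl⟩
  have f14 : f q14 = q11 := by
    simpa only [runWord_nil, runWord_true, runWord_false, f11] using
      r0_0 q11
  obtain ⟨q15, g11⟩ : ∃ q, g q11 = q := ⟨_, rfl⟩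
  have g15 : g q15 = q8 := by
    simpa only [runWord_nil, runWord_true, runWord_false, g8, g11] using
      r1_0 q8
  have g13 : g q13 = q14 := by
    simpa only [runWord_nil, runWord_true, runWord_false, f14, g11, g15, f8, g6, f3, g2, g1, f0, g0, f2, g3, f4, g5, g7, f10] using
      r3_2 q14
  have f12 : f q12 = q15 := by
    simpa only [runWord_nil, runWord_true, runWord_false, g15, f8, g6, f3, g2, f1, g0, f2, g3, f4, g5, f7, g9] using
      r2_1 q15
  have f15 : f q15 = q12 := by
    simpa only [runWord_nil, runWord_true, runWord_false, f12] using
      r0_0 q12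
  obtain ⟨q16, g12⟩ : ∃ q, g q12 = q := ⟨_, rfl⟩
  have g16 : g q16 = q9 := by
    simpa only [runWord_nil, runWord_true, runWord_false, g9, g12] using
      r1_0 q9
  obtain ⟨q17, g14⟩ : ∃ q, g q14 = q := ⟨_, rfl⟩
  have g17 : g q17 = q13 := by
    simpa only [runWord_nil, runWord_true, runWord_false, g13, g14] using
      r1_0 q13
  obtain ⟨q18, f16⟩ : ∃ q, f q16 = q := ⟨_, rfl⟩
  have f18 : f q18 = q16 := by
    simpa only [runWord_nil, runWord_true, runWord_false, f16] using
      r0_0 q16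
  obtain ⟨q19, f17⟩ : ∃ q, f q17 = q := ⟨_, rfl⟩
  have f19 : f q19 = q17 := by
    simpa only [runWord_nil, runWord_true, runWord_false, f17] using
      r0_0 q17
  obtain ⟨q20, g18⟩ : ∃ q, g q18 = q := ⟨_, rfl⟩
  obtain ⟨q21, g19⟩ : ∃ q, g q19 = q := ⟨_, rfl⟩
  obtain ⟨q22, f20⟩ : ∃ q, f q20 = q := ⟨_, rfl⟩
  have g22 : g q22 = q18 := by
    simpa only [runWord_nil, runWord_true, runWord_false, f18, g16, f9, g7, f10, g13, f14, g11, f15, g12, f16, g18, f20] using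
      r2_0 q18
  have f22 : f q22 = q20 := by
    simpa only [runWord_nil, runWord_true, runWord_false, f20] using
      r0_0 q20
  have g20 : g q20 = q22 := by
    simpa only [runWord_nil, runWord_true, runWord_false, g22, g18] using
      r1_0 q22
  obtain ⟨q23, f21⟩ : ∃ q, f q21 = q := ⟨_, rfl⟩
  have g23 : g q23 = q19 := by
    simpa only [runWord_nil, runWord_true, runWord_false, f19, g17, f13, g10, f5, g4, f6, g8, f11, g14, f17, g19, f21] using
      r2_0 q19
  have f23 : f q23 = q21 := by
    simpa only [runWord_nil, runWord_true, runWord_false, f21] using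
      r0_0 q21
  have g21 : g q21 = q23 := by
    simpa only [runWord_nil, runWord_true, runWord_false, g23, g19] using
      r1_0 q23
  exact ⟨[q0, q1, q2, q3, q4, q5, q6, q7, q8, q9, q10, q11, q12, q13, q14, q15, q16, q17, q18, q19, q20, q21, q22, q23], by simp, by simp, by simp [f0, f1, f2, f3, f4, f5, f6, f7, f8, f9, f10, f11, f12, f13, f14, f15, f16, f17, f18, f19, f20, f21, f22, f23], by simp [g0, g1, g2, g3, g4, g5, g6, g7, g8, g9, g10, g11, g12, g13, g14, g15, g16, g17, g18, g19, g20, g21, g22, g23]⟩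

/-- Relators of `S₄`: `a⁴ = b² = (ab)³ = 1`. -/
def relatorsS : List (List Bool) :=
  [[true, true, true, true],
    [false, false],
    [true, false, true, false, true, false]]

theorem exists_cosets_S4 (X : Type) (f g : X → X) (q0 : X) (h0 : runWord f g [true] q0 = q0)
    (h : ∀ q, ∀ r ∈ relatorsS, ∀ t r', r.rotate t = r' → runWord f g r' q = q) :
    ∃ l : List X, l.length ≤ 6 ∧ q0 ∈ l ∧ (∀ q ∈ l, f q ∈ l) ∧ ∀ q ∈ l, g q ∈ l := by
  have r0_0 := fun q => h q [true, true, true, true] (by decide) 0 [true, true, true, true] rfl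
  have r1_0 := fun q => h q [false, false] (by decide) 0 [false, false] rfl
  have r2_1 := fun q => h q [true, false, true, false, true, false] (by decide) 1 [false, true, false, true, false, true] rfl
  have f0 : f q0 = q0 := h0
  obtain ⟨q1, g0⟩ : ∃ q, g q0 = q := ⟨_, rfl⟩
  have g1 : g q1 = q0 := by
    simpa only [runWord_nil, runWord_true, runWord_false, g0] using
      r1_0 q0
  obtain ⟨q2, f1⟩ : ∃ q, f q1 = q := ⟨_, rfl⟩
  obtain ⟨q3, f2⟩ : ∃ q, f q2 = q := ⟨_, rfl⟩
  obtain ⟨q4, g2⟩ : ∃ q, g q2 = q := ⟨_, rfl⟩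
  have f4 : f q4 = q1 := by
    simpa only [runWord_nil, runWord_true, runWord_false, g1, f0, g0, f1, g2] using
      r2_1 q1
  have g4 : g q4 = q2 := by
    simpa only [runWord_nil, runWord_true, runWord_false, g2] using
      r1_0 q2
  have f3 : f q3 = q4 := by
    simpa only [runWord_nil, runWord_true, runWord_false, f4, f1, f2] using
      r0_0 q4
  obtain ⟨q5, g3⟩ : ∃ q, g q3 = q := ⟨_, rfl⟩
  have g5 : g q5 = q3 := by
    simpa only [runWord_nil, runWord_true, runWord_false, g3] using
      r1_0 q3
  have f5 : f q5 = q5 := by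
    simpa only [runWord_nil, runWord_true, runWord_false, g5, f3, g4, f2, g3] using
      r2_1 q5
  exact ⟨[q0, q1, q2, q3, q4, q5], by simp, by simp, by simp [f0, f1, f2, f3, f4, f5], by simp [g0, g1, g2, g3, g4, g5]⟩

/-- Relators of `T₇`: `c⁷ = d³ = 1` and `d² c d c³ = 1`. -/
def relatorsT : List (List Bool) :=
  [[true, true, true, true, true, true, true],
    [false, false, false],
    [false, false, true, false, true, true, true]]

theorem exists_cosets_T7 (X : Type) (f g : X → X) (q0 : X) (h0 : runWord f g [true] q0 = q0)
    (h : ∀ q, ∀ r ∈ relatorsT, ∀ t r', r.rotate t = r' → runWord f g r' q = q) :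
    ∃ l : List X, l.length ≤ 3 ∧ q0 ∈ l ∧ (∀ q ∈ l, f q ∈ l) ∧ ∀ q ∈ l, g q ∈ l := by
  have r1_0 := fun q => h q [false, false, false] (by decide) 0 [false, false, false] rfl
  have r2_3 := fun q => h q [false, false, true, false, true, true, true] (by decide) 3 [false, true, true, true, false, false, true] rfl
  have f0 : f q0 = q0 := h0
  obtain ⟨q1, g0⟩ : ∃ q, g q0 = q := ⟨_, rfl⟩
  obtain ⟨q2, g1⟩ : ∃ q, g q1 = q := ⟨_, rfl⟩
  have g2 : g q2 = q0 := by
    simpa only [runWord_nil, runWord_true, runWord_false, g0, g1] using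
      r1_0 q0
  have f2 : f q2 = q2 := by
    simpa only [runWord_nil, runWord_true, runWord_false, g2, f0, g0, g1] using
      r2_3 q2
  have f1 : f q1 = q1 := by
    simpa only [runWord_nil, runWord_true, runWord_false, g1, f2, g2, g0] using
      r2_3 q1
  exact ⟨[q0, q1, q2], by simp, by simp, by simp [f0, f1, f2], by simp [g0, g1, g2]⟩

theorem isBoundedBy_PSL : IsBoundedBy relators 168 :=
  isBoundedBy_of_cosets (w := [true, false]) (k := 7) (n := 24) (by norm_num)
    (fun Γ _ u v h => by
      have := h _ (by decide : [true, false, true, false, true, false, true, false, true, false,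
        true, false, true, false] ∈ relators)
      simpa [evalWord_cons, evalWord_nil, pow_succ, mul_assoc] using this)
    exists_cosets_PSL

theorem isBoundedBy_S4 : IsBoundedBy relatorsS 24 :=
  isBoundedBy_of_cosets (w := [true]) (k := 4) (n := 6) (by norm_num)
    (fun Γ _ u v h => by
      have := h _ (by decide : [true, true, true, true] ∈ relatorsS)
      simpa [evalWord_cons, evalWord_nil, pow_succ, mul_assoc] using this)
    exists_cosets_S4

theorem isBoundedBy_T7 : IsBoundedBy relatorsT 21 :=
  isBoundedBy_of_cosets (w := [true]) (k := 7) (n := 3) (by norm_num)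
    (fun Γ _ u v h => by
      have := h _ (by decide : [true, true, true, true, true, true, true] ∈ relatorsT)
      simpa [evalWord_cons, evalWord_nil, pow_succ, mul_assoc] using this)
    exists_cosets_T7

/-! ### Homomorphisms out of a group with a presentation -/

theorem closure_fst {G K : Type} [Group G] [Group K] {a b : G} (x y : K)
    (hgen : Subgroup.closure {a, b} = ⊤) (g : G) :
    ∃ k : K, (g, k) ∈ Subgroup.closure {(a, x), (b, y)} := by
  have hg : g ∈ Subgroup.closure {a, b} := hgen ▸ Subgroup.mem_top g
  have h1 : Subgroup.map (MonoidHom.fst G K) (Subgroup.closure {(a, x), (b, y)}) =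
      Subgroup.closure {a, b} := by
    rw [MonoidHom.map_closure, Set.image_pair]; rfl
  rw [← h1] at hg
  obtain ⟨⟨g', k⟩, hk, rfl⟩ := hg
  exact ⟨k, hk⟩

theorem exists_hom_of_bounded {rels : List (List Bool)} {n : ℕ} (hb : IsBoundedBy rels n)
    {G K : Type} [Group G] [Group K] {a b : G} {x y : K} (hgen : Subgroup.closure {a, b} = ⊤)
    (hG : Nat.card G = n) (hab : ∀ w ∈ rels, evalWord w a b = 1)
    (hxy : ∀ w ∈ rels, evalWord w x y = 1) : ∃ φ : G →* K, φ a = x ∧ φ b = y := by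
  set Γ : Subgroup (G × K) := Subgroup.closure {(a, x), (b, y)}
  let u : Γ := ⟨(a, x), Subgroup.subset_closure (by simp)⟩
  let v : Γ := ⟨(b, y), Subgroup.subset_closure (by simp)⟩
  have huv : Subgroup.closure {u, v} = ⊤ := by
    have h1 := Subgroup.closure_closure_coe_preimage (k := ({(a, x), (b, y)} : Set (G × K)))
    rw [← h1]
    congr 1
    ext ⟨g, hg⟩
    simp [u, v, Subtype.ext_iff]
  have hrel : ∀ w ∈ rels, evalWord w u v = 1 := by
    intro w hw
    apply Subtype.ext
    show Γ.subtype (evalWord w u v) = 1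
    rw [map_evalWord]
    apply Prod.ext
    · show MonoidHom.fst G K (evalWord w (a, x) (b, y)) = 1
      rw [map_evalWord]; exact hab w hw
    · show MonoidHom.snd G K (evalWord w (a, x) (b, y)) = 1
      rw [map_evalWord]; exact hxy w hw
  obtain ⟨hfin, hcard⟩ := hb Γ u v huv hrel
  let p : Γ →* G := (MonoidHom.fst G K).comp Γ.subtype
  have hsurj : Function.Surjective p := fun g => by
    obtain ⟨k, hk⟩ := closure_fst x y hgen g
    exact ⟨⟨(g, k), hk⟩, rfl⟩
  have hbij : Function.Bijective p := by
    rw [Nat.bijective_iff_surjective_and_card]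
    exact ⟨hsurj, le_antisymm (hcard.trans hG.ge) (Nat.card_le_card_of_surjective p hsurj)⟩
  let e := MulEquiv.ofBijective p hbij
  refine ⟨((MonoidHom.snd G K).comp Γ.subtype).comp e.symm.toMonoidHom, ?_, ?_⟩
  · have : e.symm a = u := by rw [MulEquiv.symm_apply_eq]; rfl
    show ((e.symm a : Γ) : G × K).2 = x
    rw [this]
  · have : e.symm b = v := by rw [MulEquiv.symm_apply_eq]; rfl
    show ((e.symm b : Γ) : G × K).2 = y
    rw [this]

/-- Elements of a monoid that satisfy the relations of generators of finite order are units. -/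
theorem exists_hom_monoid_of_bounded {rels : List (List Bool)} {n : ℕ} (hb : IsBoundedBy rels n)
    {G M : Type} [Group G] [Monoid M] {a b : G} {x y : M} (hgen : Subgroup.closure {a, b} = ⊤)
    (hG : Nat.card G = n) (hab : ∀ w ∈ rels, evalWord w a b = 1)
    (hxy : ∀ w ∈ rels, evalWord w x y = 1) (hx : IsUnit x) (hy : IsUnit y) :
    ∃ φ : G →* M, φ a = x ∧ φ b = y := by
  obtain ⟨x, rfl⟩ := hx
  obtain ⟨y, rfl⟩ := hy
  obtain ⟨φ, h1, h2⟩ := exists_hom_of_bounded (x := x) (y := y) hb hgen hG hab fun w hw => by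
    apply Units.ext
    rw [Units.val_one, ← hxy w hw]
    exact map_evalWord (Units.coeHom M) w x y
  exact ⟨(Units.coeHom M).comp φ, by simp [h1], by simp [h2]⟩

/-- A group that maps onto distinct elements given by words has at least as many elements. -/
theorem le_card_of_nodup {G K : Type} [Group G] [Finite G] [Group K] (φ : G →* K) (a b : G)
    {W : List (List Bool)} (h : (W.map fun w => evalWord w (φ a) (φ b)).Nodup) :
    W.length ≤ Nat.card G := by
  have h1 : Function.Injective fun i : Fin W.length => evalWord W[i] a b := by
    intro i j hij
    have h2 := congrArg φ hij
    simp only [map_evalWord] at h2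
    have h3 := (List.nodup_iff_injective_get.1 h)
    have h4 := @h3 (i.cast (by simp)) (j.cast (by simp)) (by simpa using h2)
    exact Fin.ext (by simpa using congrArg Fin.val h4)
  have h2 := Nat.card_le_card_of_injective _ h1
  rwa [Nat.card_fin] at h2

end PSL27

namespace PSL27
open Matrix
open scoped Kronecker MatrixGroups

/-! ### The order of `PSL₂(7)` -/

instance : Fact (Nat.Prime 7) := ⟨by norm_num⟩

theorem card_det_eq_one : Fintype.card {t : (ZMod 7 × ZMod 7) × ZMod 7 × ZMod 7 //
    t.1.1 * t.2.2 - t.1.2 * t.2.1 = 1} = 336 := by decide +kernel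

theorem le_card_SL : 336 ≤ Nat.card SL(2, ZMod 7) := by
  rw [← card_det_eq_one, ← Nat.card_eq_fintype_card]
  refine Nat.card_le_card_of_injective (fun t => ⟨!![t.1.1.1, t.1.1.2; t.1.2.1, t.1.2.2], by
    rw [Matrix.det_fin_two_of]; exact t.2⟩) fun s t h => ?_
  have h1 := congrArg Subtype.val h
  have e := fun i j => congrFun (congrFun h1 i) j
  have h00 := e 0 0
  have h01 := e 0 1
  have h10 := e 1 0
  have h11 := e 1 1
  simp at h00 h01 h10 h11
  exact Subtype.ext (Prod.ext (Prod.ext h00 h01) (Prod.ext h10 h11))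

theorem card_center_le : Nat.card (Subgroup.center SL(2, ZMod 7)) ≤ 2 := by
  rw [Nat.card_congr (Matrix.SpecialLinearGroup.center_equiv_rootsOfUnity' (0 : Fin 2)).toEquiv]
  exact card_rootsOfUnity (ZMod 7) _

theorem le_card_PSL : 168 ≤ Nat.card PSL₂7 := by
  have h1 := Subgroup.card_eq_card_quotient_mul_card_subgroup (Subgroup.center SL(2, ZMod 7))
  have h2 := le_card_SL
  have h3 := card_center_le
  have h4 : Nat.card PSL₂7 = Nat.card (SL(2, ZMod 7) ⧸ Subgroup.center SL(2, ZMod 7)) := rfl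
  rw [h4]
  nlinarith

/-! ### Standard pairs -/

section

variable {G : Type} [Group G] {A B : G}

theorem IsStandardPair.inv_A (h : IsStandardPair A B) : A⁻¹ = A :=
  inv_eq_of_mul_eq_one_left (by rw [← pow_two]; exact h.sq)

theorem IsStandardPair.inv_B (h : IsStandardPair A B) : B⁻¹ = B * B :=
  inv_eq_of_mul_eq_one_left (by rw [← pow_two, ← pow_succ]; exact h.cube)

theorem IsStandardPair.evalWord_relator (h : IsStandardPair A B) :
    ∀ w ∈ relators, evalWord w A B = 1 := by
  intro w hw
  simp only [relators, List.mem_cons, List.not_mem_nil, or_false] at hw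
  rcases hw with rfl | rfl | rfl | rfl
  · simpa [evalWord_cons, evalWord_nil, pow_succ, mul_assoc] using h.sq
  · simpa [evalWord_cons, evalWord_nil, pow_succ, mul_assoc] using h.cube
  · simpa [evalWord_cons, evalWord_nil, pow_succ, mul_assoc] using h.mul_pow
  · simpa [evalWord_cons, evalWord_nil, pow_succ, mul_assoc, h.inv_A, h.inv_B] using h.commutator

theorem IsStandardPair.elta_eq (h : IsStandardPair A B) :
    elta A B = evalWord modelS.word₁ A B := by
  simp [elta, modelS, evalWord_cons, evalWord_nil, mul_assoc, h.inv_A, h.inv_B]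

theorem eltb_eq (A B : G) : eltb A B = evalWord modelS.word₂ A B := by
  simp [eltb, modelS, evalWord_cons, evalWord_nil, pow_succ, mul_assoc]

theorem eltc_eq (A B : G) : eltc A B = evalWord modelT.word₁ A B := by
  simp [eltc, modelT, evalWord_cons, evalWord_nil]

theorem eltd_eq (A B : G) : eltd A B = evalWord modelT.word₂ A B := by
  simp [eltd, modelT, evalWord_cons, evalWord_nil, pow_succ, mul_assoc]

end

theorem card_PSL_le {A B : PSL₂7} (h : IsStandardPair A B) : Nat.card PSL₂7 ≤ 168 :=
  (isBoundedBy_PSL PSL₂7 A B h.generate h.evalWord_relator).2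

def slA : SL(2, ZMod 7) := ⟨!![0, 1; 6, 0], by decide⟩

def slB : SL(2, ZMod 7) := ⟨!![0, 1; 6, 1], by decide⟩

theorem mk_eq_one {M : SL(2, ZMod 7)} (h : M = 1 ∨ M = -1) : (QuotientGroup.mk M : PSL₂7) = 1 := by
  refine (QuotientGroup.eq_one_iff M).2 ?_
  rcases h with rfl | rfl
  · exact one_mem _
  · exact Subgroup.mem_center_iff.2 fun N => by simp

theorem isStandardPair_mk : IsStandardPair (QuotientGroup.mk slA : PSL₂7) (QuotientGroup.mk slB) where
  generate := by
    have hT : ∀ c : ZMod 7, ∃ k : ℕ, ((slA * slB) ^ k = Matrix.SpecialLinearGroup.transvection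
        (show (0 : Fin 2) ≠ 1 by decide) c ∨
        (slA * slB) ^ k = -Matrix.SpecialLinearGroup.transvection
        (show (0 : Fin 2) ≠ 1 by decide) c) := by
      intro c
      refine ⟨(6 * c).val, ?_⟩
      revert c
      decide +kernel
    have hU : ∀ c : ZMod 7, ∃ k : ℕ, (slA * (slA * slB) ^ k * slA = Matrix.SpecialLinearGroup.transvection
        (show (1 : Fin 2) ≠ 0 by decide) c ∨
        slA * (slA * slB) ^ k * slA = -Matrix.SpecialLinearGroup.transvection
        (show (1 : Fin 2) ≠ 0 by decide) c) := by
      intro c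
      refine ⟨c.val, ?_⟩
      revert c
      decide +kernel
    have hneg : ∀ M : SL(2, ZMod 7), (QuotientGroup.mk (-M) : PSL₂7) = QuotientGroup.mk M := by
      intro M
      have : (QuotientGroup.mk (-1 * M) : PSL₂7) = QuotientGroup.mk (-1) * QuotientGroup.mk M := rfl
      rw [neg_one_mul] at this
      rw [this, mk_eq_one (.inr rfl), one_mul]
    set K := Subgroup.closure {(QuotientGroup.mk slA : PSL₂7), QuotientGroup.mk slB}
    have hA : (QuotientGroup.mk slA : PSL₂7) ∈ K := Subgroup.subset_closure (by simp)
    have hB : (QuotientGroup.mk slB : PSL₂7) ∈ K := Subgroup.subset_closure (by simp)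
    have hk : ∀ k : ℕ, (QuotientGroup.mk ((slA * slB) ^ k) : PSL₂7) ∈ K := fun k =>
      pow_mem (mul_mem hA hB) k
    have hk' : ∀ k : ℕ, (QuotientGroup.mk (slA * (slA * slB) ^ k * slA) : PSL₂7) ∈ K := fun k =>
      mul_mem (mul_mem hA (hk k)) hA
    rw [eq_top_iff]
    rintro g -
    obtain ⟨M, rfl⟩ := QuotientGroup.mk_surjective g
    refine SL2.transvection_induction (fun M => (QuotientGroup.mk M : PSL₂7) ∈ K) ?_ ?_ M
    · intro i j hij c
      fin_cases i <;> fin_cases j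
      · exact absurd rfl hij
      · obtain ⟨k, h | h⟩ := hT c
        · exact h ▸ hk k
        · have h1 := hk k
          rw [h, hneg] at h1; exact h1
      · obtain ⟨k, h | h⟩ := hU c
        · exact h ▸ hk' k
        · have h1 := hk' k
          rw [h, hneg] at h1; exact h1
      · exact absurd rfl hij
    · intro M N hM hN
      exact mul_mem hM hN
  sq := mk_eq_one (M := slA ^ 2) (by decide)
  cube := mk_eq_one (M := slB ^ 3) (by decide)
  mul_pow := mk_eq_one (M := (slA * slB) ^ 7) (by decide)
  commutator := mk_eq_one (M := (slA * slB * slA⁻¹ * slB⁻¹) ^ 4) (by decide)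

theorem card_PSL : Nat.card PSL₂7 = 168 :=
  le_antisymm (card_PSL_le isStandardPair_mk) le_card_PSL

instance : Finite PSL₂7 := Nat.finite_of_card_ne_zero (by rw [card_PSL]; norm_num)

/-! ### The subgroups -/

/-- The action of the generator on seven points. -/
def permA : Equiv.Perm (Fin 7) :=
  ⟨![0, 5, 3, 2, 4, 1, 6], ![0, 5, 3, 2, 4, 1, 6], by decide, by decide⟩

/-- The action of the generator on seven points. -/
def permB : Equiv.Perm (Fin 7) :=
  ⟨![1, 6, 4, 3, 5, 2, 0], ![6, 0, 5, 3, 2, 4, 1], by decide, by decide⟩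

def permElta : Equiv.Perm (Fin 7) :=
  ⟨![0, 5, 6, 4, 2, 1, 3], ![0, 5, 4, 6, 3, 1, 2], by decide, by decide⟩

def permEltb : Equiv.Perm (Fin 7) :=
  ⟨![0, 4, 2, 3, 1, 6, 5], ![0, 4, 2, 3, 1, 6, 5], by decide, by decide⟩

def permEltc : Equiv.Perm (Fin 7) :=
  ⟨![5, 6, 4, 2, 1, 3, 0], ![6, 4, 3, 5, 2, 0, 1], by decide, by decide⟩

def permEltd : Equiv.Perm (Fin 7) :=
  ⟨![2, 6, 3, 0, 4, 1, 5], ![3, 5, 0, 2, 4, 6, 1], by decide, by decide⟩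

/-- Words for the elements of `S₄`. -/
def wordsS : List (List Bool) :=
  [[], [true], [false], [true, true], [true, false], [false, true], [true, true, true],
    [true, true, false], [true, false, true], [false, true, true], [false, true, false],
    [true, true, true, false], [true, true, false, true], [true, false, true, true],
    [true, false, true, false], [false, true, true, false], [true, true, true, false, true],
    [true, true, false, true, true], [true, true, false, true, false],
    [true, false, true, true, false], [false, true, true, false, true],
    [true, true, true, false, true, true], [true, true, true, false, true, false],
    [true, true, false, true, true, false]]

/-- Words for the elements of `T₇`. -/
def wordsT : List (List Bool) :=
  [[], [true], [false], [true, true], [true, false], [false, true], [false, false],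
    [true, true, true], [true, false, true], [true, false, false], [false, true, true],
    [false, true, false], [false, false, true], [true, true, true, true],
    [true, false, true, true], [true, false, true, false], [true, false, false, true],
    [false, true, true, true], [false, true, false, true], [true, true, true, true, true],
    [false, true, false, true, false]]

section

variable {A B : PSL₂7}

theorem exists_perm (h : IsStandardPair A B) :
    ∃ φ : PSL₂7 →* Equiv.Perm (Fin 7), φ A = permA ∧ φ B = permB :=
  exists_hom_of_bounded isBoundedBy_PSL h.generate card_PSL h.evalWord_relator (by decide +kernel)

theorem closure_pair {G : Type} [Group G] (a b : G)
    (ha : a ∈ Subgroup.closure {a, b} := Subgroup.subset_closure (by simp))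
    (hb : b ∈ Subgroup.closure {a, b} := Subgroup.subset_closure (by simp)) :
    Subgroup.closure {(⟨a, ha⟩ : Subgroup.closure {a, b}), ⟨b, hb⟩} = ⊤ := by
  have h1 := Subgroup.closure_closure_coe_preimage (k := ({a, b} : Set G))
  rw [← h1]
  congr 1
  ext ⟨g, hg⟩
  simp [Subtype.ext_iff]

theorem closure_genA_genB (A B : PSL₂7) : Subgroup.closure {genA A B, genB A B} = ⊤ :=
  closure_pair (elta A B) (eltb A B)

theorem closure_genC_genD (A B : PSL₂7) : Subgroup.closure {genC A B, genD A B} = ⊤ :=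
  closure_pair (eltc A B) (eltd A B)

theorem evalWord_comp {M : Type} [Monoid M] (x y : M) (w w₁ w₂ : List Bool) :
    evalWord w (evalWord w₁ x y) (evalWord w₂ x y) =
      evalWord (w.flatMap fun t => cond t w₁ w₂) x y := by
  induction w with
  | nil => rfl
  | cons t w ih =>
    rw [evalWord_cons, ih, List.flatMap_cons, evalWord_append]
    cases t <;> rfl

theorem IsStandardPair.evalWord_eq_one (h : IsStandardPair A B) {w : List Bool}
    (hw : evalWord w slA slB = 1 ∨ evalWord w slA slB = -1) : evalWord w A B = 1 := by
  obtain ⟨φ, h1, h2⟩ := exists_hom_of_bounded isBoundedBy_PSL isStandardPair_mk.generate card_PSL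
    isStandardPair_mk.evalWord_relator h.evalWord_relator
  rw [← h1, ← h2, ← map_evalWord]
  have h3 := map_evalWord (QuotientGroup.mk' (Subgroup.center SL(2, ZMod 7))) w slA slB
  have h4 : evalWord w (QuotientGroup.mk slA : PSL₂7) (QuotientGroup.mk slB) = 1 :=
    h3.symm.trans (mk_eq_one hw)
  rw [h4, map_one]

theorem IsStandardPair.evalWord_relatorsS (h : IsStandardPair A B) :
    ∀ w ∈ relatorsS, evalWord w (genA A B) (genB A B) = 1 := by
  intro w hw
  apply Subtype.ext
  show (subS4 A B).subtype (evalWord w (genA A B) (genB A B)) = 1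
  rw [map_evalWord]
  show evalWord w (elta A B) (eltb A B) = 1
  rw [h.elta_eq, eltb_eq, evalWord_comp]
  refine h.evalWord_eq_one ?_
  revert w
  decide +kernel

theorem IsStandardPair.evalWord_relatorsT (h : IsStandardPair A B) :
    ∀ w ∈ relatorsT, evalWord w (genC A B) (genD A B) = 1 := by
  intro w hw
  apply Subtype.ext
  show (subT7 A B).subtype (evalWord w (genC A B) (genD A B)) = 1
  rw [map_evalWord]
  show evalWord w (eltc A B) (eltd A B) = 1
  rw [eltc_eq, eltd_eq, evalWord_comp]
  refine h.evalWord_eq_one ?_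
  revert w
  decide +kernel

theorem nodup_wordsS : (wordsS.map fun w => evalWord w permElta permEltb).Nodup := by
  decide +kernel

theorem nodup_wordsT : (wordsT.map fun w => evalWord w permEltc permEltd).Nodup := by
  decide +kernel

theorem IsStandardPair.card_subS4 (h : IsStandardPair A B) : Nat.card (subS4 A B) = 24 := by
  refine le_antisymm (isBoundedBy_S4 _ _ _ (closure_genA_genB A B) h.evalWord_relatorsS).2 ?_
  obtain ⟨φ, h1, h2⟩ := exists_perm h
  refine le_card_of_nodup (φ.comp (subS4 A B).subtype) (genA A B) (genB A B) (W := wordsS) ?_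
  have e1 : φ.comp (subS4 A B).subtype (genA A B) = permElta := by
    show φ (elta A B) = _
    rw [h.elta_eq, map_evalWord, h1, h2]; decide +kernel
  have e2 : φ.comp (subS4 A B).subtype (genB A B) = permEltb := by
    show φ (eltb A B) = _
    rw [eltb_eq, map_evalWord, h1, h2]; decide +kernel
  rw [e1, e2]
  exact nodup_wordsS

theorem IsStandardPair.card_subT7 (h : IsStandardPair A B) : Nat.card (subT7 A B) = 21 := by
  refine le_antisymm (isBoundedBy_T7 _ _ _ (closure_genC_genD A B) h.evalWord_relatorsT).2 ?_
  obtain ⟨φ, h1, h2⟩ := exists_perm h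
  refine le_card_of_nodup (φ.comp (subT7 A B).subtype) (genC A B) (genD A B) (W := wordsT) ?_
  have e1 : φ.comp (subT7 A B).subtype (genC A B) = permEltc := by
    show φ (eltc A B) = _
    rw [eltc_eq, map_evalWord, h1, h2]; decide +kernel
  have e2 : φ.comp (subT7 A B).subtype (genD A B) = permEltd := by
    show φ (eltd A B) = _
    rw [eltd_eq, map_evalWord, h1, h2]; decide +kernel
  rw [e1, e2]
  exact nodup_wordsT

theorem nodup_wordsS_four : (wordsS.map fun w => evalWord w
    (⟨![1, 2, 3, 0], ![3, 0, 1, 2], by decide, by decide⟩ : Equiv.Perm (Fin 4))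
    ⟨![1, 0, 2, 3], ![1, 0, 2, 3], by decide, by decide⟩).Nodup := by
  decide +kernel

theorem IsStandardPair.nonempty_mulEquiv (h : IsStandardPair A B) :
    Nonempty (subS4 A B ≃* Equiv.Perm (Fin 4)) := by
  obtain ⟨φ, h1, h2⟩ := exists_hom_of_bounded isBoundedBy_S4 (closure_genA_genB A B) h.card_subS4
    h.evalWord_relatorsS (x := (⟨![1, 2, 3, 0], ![3, 0, 1, 2], by decide, by decide⟩ :
      Equiv.Perm (Fin 4))) (y := ⟨![1, 0, 2, 3], ![1, 0, 2, 3], by decide, by decide⟩)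
    (by decide +kernel)
  have hcard : Nat.card (Equiv.Perm (Fin 4)) = 24 := by
    rw [Nat.card_eq_fintype_card, Fintype.card_perm]; rfl
  have hsurj : Function.Surjective φ := by
    rw [← MonoidHom.range_eq_top]
    apply Subgroup.eq_top_of_le_card
    rw [hcard]
    have := le_card_of_nodup φ.range.subtype (φ.rangeRestrict (genA A B))
      (φ.rangeRestrict (genB A B)) (W := wordsS) (by
        have e1 : φ.range.subtype (φ.rangeRestrict (genA A B)) = φ (genA A B) := rfl
        have e2 : φ.range.subtype (φ.rangeRestrict (genB A B)) = φ (genB A B) := rfl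
        rw [e1, e2, h1, h2]
        exact nodup_wordsS_four)
    exact this
  refine ⟨MulEquiv.ofBijective φ ?_⟩
  have : Finite (subS4 A B) := inferInstance
  rw [Nat.bijective_iff_surjective_and_card]
  exact ⟨hsurj, h.card_subS4.trans hcard.symm⟩

theorem IsStandardPair.relations_subS4 (h : IsStandardPair A B) :
    elta A B ^ 4 = 1 ∧ eltb A B ^ 2 = 1 ∧ (elta A B * eltb A B) ^ 3 = 1 := by
  have h1 := fun w hw => congrArg (subS4 A B).subtype (h.evalWord_relatorsS w hw)
  simp only [map_evalWord, map_one] at h1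
  refine ⟨?_, ?_, ?_⟩
  · simpa [evalWord_cons, evalWord_nil, pow_succ, mul_assoc, genA, genB] using
      h1 [true, true, true, true] (by decide)
  · simpa [evalWord_cons, evalWord_nil, pow_succ, mul_assoc, genA, genB] using
      h1 [false, false] (by decide)
  · simpa [evalWord_cons, evalWord_nil, pow_succ, mul_assoc, genA, genB] using
      h1 [true, false, true, false, true, false] (by decide)

theorem IsStandardPair.relations_subT7 (h : IsStandardPair A B) :
    eltc A B ^ 7 = 1 ∧ eltd A B ^ 3 = 1 ∧
      (eltd A B)⁻¹ * eltc A B * eltd A B = eltc A B ^ 4 := by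
  have h1 := fun w hw => congrArg (subT7 A B).subtype (h.evalWord_relatorsT w hw)
  simp only [map_evalWord, map_one] at h1
  have hc : eltc A B ^ 7 = 1 := by
    simpa [evalWord_cons, evalWord_nil, pow_succ, mul_assoc, genC, genD] using
      h1 [true, true, true, true, true, true, true] (by decide)
  have hd : eltd A B ^ 3 = 1 := by
    simpa [evalWord_cons, evalWord_nil, pow_succ, mul_assoc, genC, genD] using
      h1 [false, false, false] (by decide)
  refine ⟨hc, hd, ?_⟩
  have h2 : eltd A B * eltd A B * eltc A B * eltd A B * eltc A B ^ 3 = 1 := by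
    simpa [evalWord_cons, evalWord_nil, pow_succ, mul_assoc, genC, genD] using
      h1 [false, false, true, false, true, true, true] (by decide)
  have h3 : (eltd A B)⁻¹ = eltd A B * eltd A B :=
    inv_eq_of_mul_eq_one_left (by rw [← pow_two, ← pow_succ]; exact hd)
  rw [h3, eq_inv_of_mul_eq_one_left h2]
  exact inv_eq_of_mul_eq_one_left (by rw [← pow_add]; exact hc)

end

end PSL27

namespace PSL27
open Matrix

/-! ### Representations of finite groups given by matrices -/

section

variable {G : Type} [Group G]

theorem character_toRep {n : ℕ} (ρ : G →* Matrix (Fin n) (Fin n) ℂ) (g : G) :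
    (toRep ρ).character g = (ρ g).trace :=
  Matrix.trace_toLin'_eq (ρ g)

/-- The commutant of `ρ` consists of the scalars. -/
def HasScalarCommutant {n : ℕ} (ρ : G →* Matrix (Fin n) (Fin n) ℂ) : Prop :=
  ∀ M : Matrix (Fin n) (Fin n) ℂ, (∀ g, M * ρ g = ρ g * M) → ∃ c : ℂ, M = c • 1

theorem HasScalarCommutant.isIrreducible [Finite G] {n : ℕ} {ρ : G →* Matrix (Fin n) (Fin n) ℂ}
    (h : HasScalarCommutant ρ) (hn : 0 < n) : (toRep ρ).IsIrreducible := by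
  have := Fintype.ofFinite G
  have : Nonempty (Fin n) := ⟨⟨0, hn⟩⟩
  refine { exists_pair_ne := ⟨⊥, ⊤, fun e => ?_⟩, eq_bot_or_eq_top := fun W => ?_ }
  · have h1 : (⊥ : Submodule ℂ (Fin n → ℂ)) = ⊤ := congrArg Subrepresentation.toSubmodule e
    exact bot_ne_top h1
  · obtain ⟨f, hf⟩ := W.toSubmodule.subtype.exists_leftInverse_of_injective
      (LinearMap.ker_eq_bot.2 Subtype.coe_injective)
    let p : (Fin n → ℂ) →ₗ[ℂ] (Fin n → ℂ) := W.toSubmodule.subtype ∘ₗ f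
    have hp : ∀ v, p v ∈ W.toSubmodule := fun v => (f v).2
    have hpw : ∀ v ∈ W.toSubmodule, p v = v := fun v hv =>
      congrArg Subtype.val (LinearMap.congr_fun hf ⟨v, hv⟩)
    let P : Matrix (Fin n) (Fin n) ℂ := LinearMap.toMatrix' p
    have hP : ∀ v, P *ᵥ v = p v := fun v => LinearMap.toMatrix'_mulVec p v
    obtain ⟨c, hc⟩ := h (∑ g, ρ g * P * ρ g⁻¹) fun x => by
      rw [Finset.sum_mul, Finset.mul_sum]
      refine Fintype.sum_equiv (Equiv.mulLeft x⁻¹) _ _ fun g => ?_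
      simp only [Equiv.coe_mulLeft, map_mul, _root_.mul_inv_rev, inv_inv]
      rw [← Matrix.mul_assoc, ← Matrix.mul_assoc, ← Matrix.mul_assoc, ← Matrix.mul_assoc,
        ← map_mul, mul_inv_cancel, map_one, Matrix.one_mul]
    have hcv : ∀ v, c • v = ∑ g, ρ g *ᵥ (P *ᵥ (ρ g⁻¹ *ᵥ v)) := fun v => by
      calc c • v = (c • (1 : Matrix (Fin n) (Fin n) ℂ)) *ᵥ v := by
            rw [Matrix.smul_mulVec, Matrix.one_mulVec]
        _ = _ := by
            rw [← hc, Matrix.sum_mulVec]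
            exact Finset.sum_congr rfl fun g _ => by simp only [Matrix.mulVec_mulVec, Matrix.mul_assoc]
    have hmem : ∀ v, c • v ∈ W.toSubmodule := fun v => by
      rw [hcv]
      exact Submodule.sum_mem _ fun g _ => W.apply_mem_toSubmodule g (by rw [hP]; exact hp _)
    have hW : ∀ v ∈ W.toSubmodule, c • v = (Fintype.card G : ℂ) • v := fun v hv => by
      rw [hcv, Finset.sum_congr rfl fun g _ => ?_, Finset.sum_const, Finset.card_univ,
        Nat.cast_smul_eq_nsmul]
      have h1 : ρ g⁻¹ *ᵥ v ∈ W.toSubmodule := W.apply_mem_toSubmodule g⁻¹ hv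
      rw [hP, hpw _ h1, Matrix.mulVec_mulVec, ← map_mul, mul_inv_cancel, map_one,
        Matrix.one_mulVec]
    by_cases hc0 : c = 0
    · left
      apply Subrepresentation.toSubmodule_injective
      refine (Submodule.eq_bot_iff _).2 fun v hv => ?_
      have h1 := hW v hv
      rw [hc0, zero_smul] at h1
      exact (smul_eq_zero.1 h1.symm).resolve_left (by exact_mod_cast Fintype.card_ne_zero)
    · right
      apply Subrepresentation.toSubmodule_injective
      refine (Submodule.eq_top_iff').2 fun v => ?_
      have h1 := W.toSubmodule.smul_mem c⁻¹ (hmem v)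
      rwa [smul_smul, inv_mul_cancel₀ hc0, one_smul] at h1

theorem map_inv_of_unitary {n : ℕ} {ρ : G →* Matrix (Fin n) (Fin n) ℂ}
    (h : ∀ g, ρ g ∈ Matrix.unitaryGroup (Fin n) ℂ) (g : G) : ρ g⁻¹ = (ρ g)ᴴ := by
  have h1 : ρ g * ρ g⁻¹ = 1 := by rw [← map_mul, mul_inv_cancel, map_one]
  rw [← Matrix.one_mul (ρ g⁻¹), ← Matrix.mem_unitaryGroup_iff'.1 (h g), Matrix.mul_assoc, h1,
    Matrix.mul_one, Matrix.star_eq_conjTranspose]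

theorem trace_inv_of_unitary {n : ℕ} {ρ : G →* Matrix (Fin n) (Fin n) ℂ}
    (h : ∀ g, ρ g ∈ Matrix.unitaryGroup (Fin n) ℂ) (g : G) :
    (ρ g⁻¹).trace = star (ρ g).trace := by
  rw [map_inv_of_unitary h, Matrix.trace_conjTranspose]

/-- A matrix that commutes with a diagonal matrix with distinct entries and with a matrix without
zeros on the superdiagonal is a scalar. -/
theorem eq_smul_one_of_commute {n : ℕ} {M P Q : Matrix (Fin n) (Fin n) ℂ}
    (hP : ∀ i j, i ≠ j → P i j = 0) (hPd : ∀ i j, i ≠ j → P i i ≠ P j j)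
    (hQ : ∀ i j : Fin n, j.val = i.val + 1 → Q i j ≠ 0) (hMP : M * P = P * M)
    (hMQ : M * Q = Q * M) : ∃ c : ℂ, M = c • 1 := by
  rcases Nat.eq_zero_or_pos n with rfl | hn
  · exact ⟨0, by ext i; exact i.elim0⟩
  have hPe : P = diagonal fun i => P i i := by
    ext i j
    by_cases hij : i = j
    · subst hij; simp
    · rw [hP i j hij, diagonal_apply_ne _ hij]
  have hM : ∀ i j, i ≠ j → M i j = 0 := by
    intro i j hij
    have h1 := congrFun (congrFun hMP i) j
    rw [hPe, Matrix.mul_diagonal, Matrix.diagonal_mul, mul_comm] at h1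
    by_contra h0
    exact hPd i j hij (mul_right_cancel₀ h0 h1).symm
  have hMe : M = diagonal fun i => M i i := by
    ext i j
    by_cases hij : i = j
    · subst hij; simp
    · rw [hM i j hij, diagonal_apply_ne _ hij]
  have hd : ∀ i j : Fin n, j.val = i.val + 1 → M i i = M j j := by
    intro i j hij
    have h1 := congrFun (congrFun hMQ i) j
    rw [hMe, Matrix.mul_diagonal, Matrix.diagonal_mul, mul_comm] at h1
    exact mul_left_cancel₀ (hQ i j hij) h1
  have hc : ∀ (k : ℕ) (hk : k < n), M ⟨k, hk⟩ ⟨k, hk⟩ = M ⟨0, hn⟩ ⟨0, hn⟩ := by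
    intro k
    induction k with
    | zero => exact fun _ => rfl
    | succ k ih => exact fun hk => (hd ⟨k, by omega⟩ ⟨k + 1, hk⟩ rfl).symm.trans (ih _)
  refine ⟨M ⟨0, hn⟩ ⟨0, hn⟩, ?_⟩
  rw [hMe]
  ext i j
  by_cases hij : i = j
  · subst hij; simp [hc i.val i.2]
  · simp [hij]

theorem eq_zero_of_not_equiv {m n : ℕ} {ρ : G →* Matrix (Fin m) (Fin m) ℂ}
    {ρ' : G →* Matrix (Fin n) (Fin n) ℂ} (h : (toRep ρ).IsIrreducible) (h' : (toRep ρ').IsIrreducible)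
    (hne : ¬ Nonempty ((toRep ρ).Equiv (toRep ρ'))) {M : Matrix (Fin n) (Fin m) ℂ}
    (hM : ∀ g, M * ρ g = ρ' g * M) : M = 0 := by
  let f : (toRep ρ).IntertwiningMap (toRep ρ') := ⟨Matrix.toLin' M, fun g => by
    apply LinearMap.ext
    intro v
    show M *ᵥ (ρ g *ᵥ v) = ρ' g *ᵥ (M *ᵥ v)
    rw [Matrix.mulVec_mulVec, Matrix.mulVec_mulVec, hM]⟩
  have := h
  have := h'
  rcases Representation.IsIrreducible.bijective_or_eq_zero f with hf | hf
  · exact absurd ⟨f.ofBijective hf⟩ hne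
  · have h1 : Matrix.toLin' M = 0 := congrArg Representation.IntertwiningMap.toLinearMap hf
    exact (Matrix.toLin'.map_eq_zero_iff).1 h1

theorem sum_trace_mul_trace_inv [Fintype G] {n : ℕ} {V : Type} [AddCommGroup V] [Module ℂ V]
    [FiniteDimensional ℂ V] {ρ : G →* Matrix (Fin n) (Fin n) ℂ} {τ : Representation ℂ G V}
    (h : (toRep ρ).IsIrreducible) (hτ : τ.IsIrreducible) (c : ℂ)
    (hc : Nonempty (τ.Equiv (toRep ρ)) ∧ c = Nat.card G ∨
      ¬ Nonempty (τ.Equiv (toRep ρ)) ∧ c = 0) :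
    ∑ g, (ρ g).trace * τ.character g⁻¹ = c := by
  have h0 : (Nat.card G : ℂ) ≠ 0 := by
    rw [Nat.card_eq_fintype_card]; exact_mod_cast Fintype.card_ne_zero
  have : Invertible (Nat.card G : ℂ) := invertibleOfNonzero h0
  have := h
  have := hτ
  have h1 := Representation.char_orthonormal (toRep ρ) τ
  simp only [character_toRep] at h1
  rw [inv_mul_eq_iff_eq_mul₀ h0] at h1
  rw [h1]
  rcases hc with ⟨h2, rfl⟩ | ⟨h2, rfl⟩
  · rw [if_pos h2, mul_one]
  · rw [if_neg h2, mul_zero]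

variable {κ : Type} {dim : κ → ℕ} {ρ : (k : κ) → G →* Matrix (Fin (dim k)) (Fin (dim k)) ℂ}

theorem trace_eq_of_equiv {m n : ℕ} {ρ : G →* Matrix (Fin m) (Fin m) ℂ}
    {ρ' : G →* Matrix (Fin n) (Fin n) ℂ} (e : (toRep ρ).Equiv (toRep ρ')) (g : G) :
    (ρ g).trace = (ρ' g).trace := by
  rw [← character_toRep, ← character_toRep, Representation.char_iso e]

theorem dim_eq_of_equiv {m n : ℕ} {ρ : G →* Matrix (Fin m) (Fin m) ℂ}
    {ρ' : G →* Matrix (Fin n) (Fin n) ℂ} (e : (toRep ρ).Equiv (toRep ρ')) : m = n := by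
  have h1 := trace_eq_of_equiv e 1
  rw [map_one, map_one, Matrix.trace_one, Matrix.trace_one, Fintype.card_fin, Fintype.card_fin] at h1
  exact_mod_cast h1

/-- The sum of the irreducible characters multiplied by the dimensions vanishes except at `1`. -/
theorem sum_dim_mul_trace [Fintype G] [Fintype κ] [DecidableEq κ] [DecidableEq G]
    (hu : ∀ k g, ρ k g ∈ Matrix.unitaryGroup (Fin (dim k)) ℂ)
    (hi : ∀ k, (toRep (ρ k)).IsIrreducible)
    (hne : ∀ k l, Nonempty ((toRep (ρ k)).Equiv (toRep (ρ l))) → k = l)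
    (hcard : ∑ k, dim k ^ 2 = Nat.card G) (g : G) :
    ∑ k, (dim k : ℂ) * (ρ k g).trace = if g = 1 then (Nat.card G : ℂ) else 0 := by
  have hS : ∀ g, ∑ k, (dim k : ℂ) * (ρ k g⁻¹).trace = star (∑ k, (dim k : ℂ) * (ρ k g).trace) := by
    intro g
    rw [star_sum]
    refine Finset.sum_congr rfl fun k _ => ?_
    rw [trace_inv_of_unitary (hu k), star_mul', star_natCast]
  have hS1 : ∑ k, (dim k : ℂ) * (ρ k 1).trace = Nat.card G := by
    rw [← hcard]
    push_cast
    refine Finset.sum_congr rfl fun k _ => ?_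
    rw [map_one, Matrix.trace_one, Fintype.card_fin, sq]
  have hSS : ∑ g, (∑ k, (dim k : ℂ) * (ρ k g).trace) * (∑ l, (dim l : ℂ) * (ρ l g⁻¹).trace) =
      (Nat.card G : ℂ) * Nat.card G := by
    have h1 : ∀ k l, ∑ g, (ρ k g).trace * (ρ l g⁻¹).trace = if k = l then (Nat.card G : ℂ) else 0 := by
      intro k l
      have h2 := sum_trace_mul_trace_inv (hi k) (hi l) (if k = l then (Nat.card G : ℂ) else 0) (by
        by_cases hkl : k = l
        · subst hkl
          exact .inl ⟨⟨.refl _⟩, if_pos rfl⟩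
        · exact .inr ⟨fun h => hkl (hne l k h).symm, if_neg hkl⟩)
      simpa only [character_toRep] using h2
    simp only [Finset.sum_mul_sum]
    rw [Finset.sum_comm]
    have h3 : ∀ k, ∑ g, ∑ l, (dim k : ℂ) * (ρ k g).trace * ((dim l : ℂ) * (ρ l g⁻¹).trace) =
        (dim k : ℂ) ^ 2 * Nat.card G := by
      intro k
      rw [Finset.sum_comm]
      have h4 : ∀ l, ∑ g, (dim k : ℂ) * (ρ k g).trace * ((dim l : ℂ) * (ρ l g⁻¹).trace) =
          (dim k * dim l : ℂ) * if k = l then (Nat.card G : ℂ) else 0 := by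
        intro l
        rw [← h1, Finset.mul_sum]
        exact Finset.sum_congr rfl fun g _ => by ring
      simp only [h4, mul_ite, mul_zero, Finset.sum_ite_eq, Finset.mem_univ, if_true]
      ring
    simp only [h3]
    rw [← Finset.sum_mul]
    congr 1
    exact_mod_cast hcard
  set S : G → ℂ := fun g => ∑ k, (dim k : ℂ) * (ρ k g).trace with hSdef
  set F : G → ℂ := fun g => S g - if g = 1 then (Nat.card G : ℂ) else 0 with hF
  have hFF : ∑ g, F g * star (F g) = 0 := by
    have h1 : ∀ g, F g * star (F g) = S g * S g⁻¹ -
        ((if g = 1 then (Nat.card G : ℂ) * S g else 0) + (if g = 1 then (Nat.card G : ℂ) * S g⁻¹ else 0))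
        + if g = 1 then (Nat.card G : ℂ) * Nat.card G else 0 := by
      intro g
      have h2 : star (F g) = S g⁻¹ - if g = 1 then (Nat.card G : ℂ) else 0 := by
        simp only [hF, star_sub, hSdef, hS]
        split_ifs <;> simp
      rw [h2]
      simp only [hF]
      split_ifs <;> ring
    rw [Finset.sum_congr rfl fun g _ => h1 g]
    rw [Finset.sum_add_distrib, Finset.sum_sub_distrib, Finset.sum_add_distrib, hSS]
    simp only [Finset.sum_ite_eq', Finset.mem_univ, if_true, inv_one]
    rw [show S 1 = Nat.card G from hS1]
    ring
  have h2 : ∑ g, Complex.normSq (F g) = 0 := by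
    have h3 : ((∑ g, Complex.normSq (F g) : ℝ) : ℂ) = 0 := by
      rw [← hFF, Complex.ofReal_sum]
      exact Finset.sum_congr rfl fun g _ => (Complex.mul_conj (F g)).symm
    exact_mod_cast h3
  have h3 := (Finset.sum_eq_zero_iff_of_nonneg fun g _ => Complex.normSq_nonneg (F g)).1 h2 g
    (Finset.mem_univ g)
  exact sub_eq_zero.1 (Complex.normSq_eq_zero.1 h3)

theorem isIrrepList_of_scalarCommutant [Finite G] [Fintype κ]
    (hu : ∀ k g, ρ k g ∈ Matrix.unitaryGroup (Fin (dim k)) ℂ) (hdim : ∀ k, 0 < dim k)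
    (hc : ∀ k, HasScalarCommutant (ρ k))
    (hne : ∀ k l, dim k = dim l → (∀ g, (ρ k g).trace = (ρ l g).trace) → k = l)
    (hcard : ∑ k, dim k ^ 2 = Nat.card G) : IsIrrepList ρ := by
  classical
  have := Fintype.ofFinite G
  have hi : ∀ k, (toRep (ρ k)).IsIrreducible := fun k => (hc k).isIrreducible (hdim k)
  have hne' : ∀ k l, Nonempty ((toRep (ρ k)).Equiv (toRep (ρ l))) → k = l := fun k l ⟨e⟩ =>
    hne k l (dim_eq_of_equiv e) (trace_eq_of_equiv e)
  refine ⟨hu, hi, hne', fun V _ _ _ τ hτ => ?_⟩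
  by_contra! hcon
  have h1 : ∑ g, (∑ k, (dim k : ℂ) * (ρ k g).trace) * τ.character g⁻¹ = 0 := by
    simp only [Finset.sum_mul]
    rw [Finset.sum_comm]
    refine Finset.sum_eq_zero fun k _ => ?_
    simp only [mul_assoc]
    rw [← Finset.mul_sum, sum_trace_mul_trace_inv (hi k) hτ 0
      (.inr ⟨not_nonempty_iff.2 (hcon k), rfl⟩), mul_zero]
  simp only [sum_dim_mul_trace hu hi hne' hcard, ite_mul, zero_mul, Finset.sum_ite_eq',
    Finset.mem_univ, if_true, inv_one, Representation.char_one] at h1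
  have h0 : (Nat.card G : ℂ) ≠ 0 := by
    rw [Nat.card_eq_fintype_card]; exact_mod_cast Fintype.card_ne_zero
  have h2 : Module.finrank ℂ V = 0 := by exact_mod_cast (mul_eq_zero.1 h1).resolve_left h0
  have : Subsingleton V := Module.finrank_zero_iff.1 h2
  obtain ⟨W, W', hW⟩ := hτ.exists_pair_ne
  exact hW (Subrepresentation.toSubmodule_injective (Subsingleton.elim _ _))

end

end PSL27

namespace PSL27
open Matrix
open scoped Kronecker MatrixGroups
open Complex (I exp)
open IrrepCode GIrrep S4Irrep T7Irrep

noncomputable section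

/-! ### Numerical inequalities and traces -/

def nonzeroN (d v : ℕ) : Bool := cond (Nat.beq (Nat.mod (Nat.mul d v) modulus) 0) false true

theorem Rep.ne_zero_of_check {z : ℂ} {d b v : ℕ} (h : Rep z d b v) (hv : nonzeroN d v = true) :
    z ≠ 0 := by
  refine h.ne_zero fun h0 => ?_
  have : Nat.beq (Nat.mod (Nat.mul d v) modulus) 0 = true := natBeq_iff.2 h0
  rw [nonzeroN, this] at hv
  exact Bool.false_ne_true hv

def neN (d v d' v' : ℕ) : Bool :=
  nonzeroN (Nat.mul d d') (Nat.add v (Nat.sub modulus (Nat.mod v' modulus)))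

theorem Rep.ne_of_check {z z' : ℂ} {d b v d' b' v' : ℕ} (h : Rep z d b v) (h' : Rep z' d' b' v')
    (hv : neN d v d' v' = true) : z ≠ z' := by
  have h1 := (h'.scale h.1).neg
  rw [mul_comm d' d] at h1
  have h2 := ((h.scale h'.1).add' h1).ne_zero_of_check hv
  exact fun e => h2 (by rw [e, add_neg_cancel])

def MatQ.isNonzero (m n : ℕ) (a : MatQ) : Bool :=
  cond a.ok (cond (allN2 m n fun i j => cond (nonzeroN a.D (a.v i j)) false true) false true) false

theorem MatRep.ne_zero {m n : ℕ} {M : Matrix (Fin m) (Fin n) ℂ} {a : MatQ} (hM : MatRep M a)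
    (h : a.isNonzero m n = true) : M ≠ 0 := by
  rintro rfl
  rw [MatQ.isNonzero, cond_false_eq_true_iff] at h
  have h1 : (allN2 m n fun i j => cond (nonzeroN a.D (a.v i j)) false true) = true := by
    refine allN2_iff.2 fun i hi j hj => ?_
    cases h2 : nonzeroN a.D (a.v i j) with
    | false => rfl
    | true => exact absurd rfl ((((hM h.1).2 ⟨i, hi⟩ ⟨j, hj⟩).1).ne_zero_of_check h2)
  rw [h1] at h
  exact Bool.false_ne_true h.2

def MatQ.tr (n : ℕ) (a : MatQ) : ℕ := sumN n fun i => a.v i i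

theorem MatRep.trace {n : ℕ} {M : Matrix (Fin n) (Fin n) ℂ} {a : MatQ} (hM : MatRep M a)
    (h : a.ok = true) : Rep M.trace a.D (Nat.mul n a.B) (a.tr n) :=
  Rep.sumN (g := fun i => a.v i i) (hM h).1 fun i => ((hM h).2 i i).1

/-- Whether a matrix is diagonal with distinct entries. -/
def MatQ.isRegularDiag (n : ℕ) (a : MatQ) : Bool :=
  cond a.ok (cond (smallN a.D a.B 1 0) (allN2 n n fun i j => cond (Nat.beq i j) true
    (cond (congN (a.v i j) 0) (neN a.D (a.v i i) a.D (a.v j j)) false)) false) false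

theorem MatRep.regularDiag {n : ℕ} {M : Matrix (Fin n) (Fin n) ℂ} {a : MatQ} (hM : MatRep M a)
    (h : a.isRegularDiag n = true) {i j : Fin n} (hij : i ≠ j) : M i j = 0 ∧ M i i ≠ M j j := by
  simp only [MatQ.isRegularDiag, cond_false_eq_true_iff, allN2_iff] at h
  obtain ⟨hok, hs, h1⟩ := h
  have h2 := h1 i i.2 j j.2
  have h3 : Nat.beq i j = false := by
    rw [← Bool.not_eq_true, natBeq_iff]; exact fun e => hij (Fin.ext e)
  rw [h3] at h2
  have h4 := cond_false_eq_true_iff.1 h2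
  exact ⟨((hM hok).2 i j).1.eq_of_check (Rep.zero one_pos 0) hs h4.1,
    ((hM hok).2 i i).1.ne_of_check ((hM hok).2 j j).1 h4.2⟩

/-- Whether a matrix has no zeros on the superdiagonal. -/
def MatQ.hasSuperdiag (n : ℕ) (a : MatQ) : Bool :=
  cond a.ok (allN2 n n fun i j => cond (Nat.beq j (Nat.succ i)) (nonzeroN a.D (a.v i j)) true) false

theorem MatRep.superdiag {n : ℕ} {M : Matrix (Fin n) (Fin n) ℂ} {a : MatQ} (hM : MatRep M a)
    (h : a.hasSuperdiag n = true) {i j : Fin n} (hij : j.val = i.val + 1) : M i j ≠ 0 := by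
  simp only [MatQ.hasSuperdiag, cond_false_eq_true_iff, allN2_iff] at h
  have h2 := h.2 i i.2 j j.2
  exact ((hM h.1).2 i j).1.ne_zero_of_check (cond_true_eq_true_iff.1 h2 (natBeq_iff.2 hij))

namespace Model

variable {ι : Type} [Fintype ι] [DecidableEq ι] [IrrepCode ι] {D : AdaptedBasis ι} (m : Model D)

/-- The relations of the subgroup. -/
def checkRel (rels : List (List Bool)) : Bool := m.allI fun x => allL rels fun w =>
  ((m.G₁ x).word (D.dim x) (m.G₂ x) w).eqv (D.dim x) (D.dim x) MatQ.one

theorem evalWord_gen {rels : List (List Bool)} (h : m.checkRel rels = true) (x : ι) {w : List Bool}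
    (hw : w ∈ rels) : evalWord w (D.gen₁ x) (D.gen₂ x) = 1 :=
  ((m.repG₁ x).word (m.repG₂ x) w).eq MatRep.one (allL_iff.1 (m.allI_iff.1 h x) w hw)

/-- The word `w` is diagonal with distinct entries in all irreps of the subgroup. -/
def checkIrr (w : List Bool) : Bool := m.allI fun x =>
  cond (((m.G₁ x).word (D.dim x) (m.G₂ x) w).isRegularDiag (D.dim x))
    ((m.G₂ x).hasSuperdiag (D.dim x)) false

/-- The matrix `B` connects the components of each irrep. -/
def checkLink : Bool := allG fun X => allL (D.content X) fun x => allL (D.content X) fun y =>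
  cond (eqI x y) true
    (((m.P X x).mul X.dim ((m.B X).mul X.dim (m.P X y).adj)).isNonzero (D.dim x) (D.dim y))

theorem proj_matB_ne_zero (h : m.checkLink = true) {X : GIrrep} {x y : ι} (hx : x ∈ D.content X)
    (hy : y ∈ D.content X) (hxy : x ≠ y) : D.proj X x * (D.matB X * (D.proj X y)ᴴ) ≠ 0 := by
  have h1 := allL_iff.1 (allL_iff.1 (allG_iff.1 h X) x hx) y hy
  have h2 : eqI x y = false := by
    rw [← Bool.not_eq_true, eqI_iff]; exact hxy
  rw [h2] at h1
  exact ((m.repP X x).mul ((m.repB X).mul (m.repP X y).adj)).ne_zero h1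

variable {m} {G : Type} [Group G] {A B : G} {H : Subgroup G} {h₁ h₂ : H}
  {ρ : (X : GIrrep) → G →* Matrix (Fin X.dim) (Fin X.dim) ℂ}
  {σ : (x : ι) → H →* Matrix (Fin (D.dim x)) (Fin (D.dim x)) ℂ}

theorem Realizes.hasScalarCommutant_sub (hr : m.Realizes A B h₁ h₂ ρ σ) {w : List Bool}
    (h : m.checkIrr w = true) (x : ι) : HasScalarCommutant (σ x) := by
  intro M hM
  have h1 := cond_false_eq_true_iff.1 (m.allI_iff.1 h x)
  have h2 := hM (evalWord w h₁ h₂)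
  have h3 := hM h₂
  rw [map_evalWord, hr.map_gen₁, hr.map_gen₂] at h2
  rw [hr.map_gen₂] at h3
  exact eq_smul_one_of_commute
    (fun i j hij => (((m.repG₁ x).word (m.repG₂ x) w).regularDiag h1.1 hij).1)
    (fun i j hij => (((m.repG₁ x).word (m.repG₂ x) w).regularDiag h1.1 hij).2)
    (fun i j hij => (m.repG₂ x).superdiag h1.2 hij) h2 h3

theorem Realizes.mul_projH (hm : m.Valid) (hr : m.Realizes A B h₁ h₂ ρ σ) (X : GIrrep) (x : ι)
    (g : H) : ρ X g * (D.proj X x)ᴴ = (D.proj X x)ᴴ * σ x g := by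
  have h1 := congrArg Matrix.conjTranspose (hr.proj_mul hm X x g⁻¹)
  rw [Matrix.conjTranspose_mul, Matrix.conjTranspose_mul, Subgroup.coe_inv,
    map_inv_of_unitary (hr.unitary hm X), map_inv_of_unitary (hr.unitary_sub hm x),
    Matrix.conjTranspose_conjTranspose, Matrix.conjTranspose_conjTranspose] at h1
  exact h1

theorem Realizes.hasScalarCommutant (hm : m.Valid) (hr : m.Realizes A B h₁ h₂ ρ σ)
    (hl : m.checkLink = true) (hc : ∀ x, HasScalarCommutant (σ x)) (hσ : IsIrrepList σ)
    (X : GIrrep) : HasScalarCommutant (ρ X) := by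
  intro N hN
  have hcomm : ∀ x y, ∀ g : H, D.proj X x * (N * (D.proj X y)ᴴ) * σ y g =
      σ x g * (D.proj X x * (N * (D.proj X y)ᴴ)) := by
    intro x y g
    rw [Matrix.mul_assoc, Matrix.mul_assoc, ← hr.mul_projH hm, ← Matrix.mul_assoc N, hN,
      Matrix.mul_assoc, ← Matrix.mul_assoc, hr.proj_mul hm, Matrix.mul_assoc]
  have hoff : ∀ x y, x ≠ y → D.proj X x * (N * (D.proj X y)ᴴ) = 0 := fun x y hxy =>
    eq_zero_of_not_equiv (hσ.irreducible y) (hσ.irreducible x)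
      (fun e => hxy (hσ.inequivalent y x e).symm) (hcomm x y)
  choose c hc using fun x => hc x _ (hcomm x x)
  have hright : ∀ y, N * (D.proj X y)ᴴ = c y • (D.proj X y)ᴴ := by
    intro y
    rw [← Matrix.one_mul (N * (D.proj X y)ᴴ), ← m.sum_proj hm.proj X, Matrix.sum_mul,
      Finset.sum_eq_single y, Matrix.mul_assoc, hc, Matrix.mul_smul, Matrix.mul_one]
    · intro x _ hxy
      rw [Matrix.mul_assoc, hoff x y hxy, Matrix.mul_zero]
    · simp
  have hNe : N = ∑ y, c y • ((D.proj X y)ᴴ * D.proj X y) := by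
    rw [← Matrix.mul_one N, ← m.sum_proj hm.proj X, Matrix.mul_sum]
    refine Finset.sum_congr rfl fun y _ => ?_
    rw [← Matrix.mul_assoc, hright, Matrix.smul_mul]
  have hleft : ∀ x, D.proj X x * N = c x • D.proj X x := by
    intro x
    by_cases hx : x ∈ D.content X
    · rw [hNe, Matrix.mul_sum, Finset.sum_eq_single x]
      · rw [Matrix.mul_smul, ← Matrix.mul_assoc, m.proj_mul_self hm.proj hx, Matrix.one_mul]
      · intro y _ hxy
        rw [Matrix.mul_smul, ← Matrix.mul_assoc, m.proj_mul_of_ne hm.proj X hxy.symm,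
          Matrix.zero_mul, smul_zero]
      · simp
    · rw [m.proj_eq_zero hm.proj hx, Matrix.zero_mul, smul_zero]
  have heq : ∀ x ∈ D.content X, ∀ y ∈ D.content X, c x = c y := by
    intro x hx y hy
    by_cases hxy : x = y
    · rw [hxy]
    have h1 : D.proj X x * (N * D.matB X * (D.proj X y)ᴴ) =
        D.proj X x * (D.matB X * N * (D.proj X y)ᴴ) := by rw [← hr.map_B, hN]
    rw [Matrix.mul_assoc N, ← Matrix.mul_assoc _ N, hleft, Matrix.mul_assoc (D.matB X), hright,
      Matrix.smul_mul, Matrix.mul_smul, Matrix.mul_smul, ← sub_eq_zero, ← sub_smul] at h1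
    exact sub_eq_zero.1 ((smul_eq_zero.1 h1).resolve_right (m.proj_matB_ne_zero hl hx hy hxy))
  obtain ⟨c₀, hc₀⟩ : ∃ c₀, ∀ x ∈ D.content X, c x = c₀ := by
    rcases hX : D.content X with _ | ⟨x₀, l⟩
    · exact ⟨0, by simp⟩
    · exact ⟨c x₀, fun x hx => heq x (hX ▸ hx) x₀ (by rw [hX]; exact List.mem_cons_self)⟩
  refine ⟨c₀, ?_⟩
  rw [hNe, ← m.sum_proj hm.proj X, Finset.smul_sum]
  refine Finset.sum_congr rfl fun x _ => ?_
  by_cases hx : x ∈ D.content X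
  · rw [hc₀ x hx]
  · rw [m.proj_eq_zero hm.proj hx, Matrix.mul_zero, smul_zero, smul_zero]

end Model

theorem modelS_rel : modelS.checkRel relatorsS = true := by decide +kernel

theorem modelT_rel : modelT.checkRel relatorsT = true := by decide +kernel

theorem modelS_irr : modelS.checkIrr [true, false] = true := by decide +kernel

theorem modelT_irr : modelT.checkIrr [true] = true := by decide +kernel

theorem modelS_link : modelS.checkLink = true := by decide +kernel

theorem modelT_link : modelT.checkLink = true := by decide +kernel

/-! ### Traces that distinguish irreps -/

theorem trace_matS_ne : (basisS.matA g3 * basisS.matB g3).trace ≠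
    (basisS.matA g3b * basisS.matB g3b).trace :=
  (((modelS.repA g3).mul (modelS.repB g3)).trace (by decide +kernel)).ne_of_check
    (((modelS.repA g3b).mul (modelS.repB g3b)).trace (by decide +kernel)) (by decide +kernel)

theorem trace_matT_ne : (basisT.matA g3 * basisT.matB g3).trace ≠
    (basisT.matA g3b * basisT.matB g3b).trace :=
  (((modelT.repA g3).mul (modelT.repB g3)).trace (by decide +kernel)).ne_of_check
    (((modelT.repA g3b).mul (modelT.repB g3b)).trace (by decide +kernel)) (by decide +kernel)

theorem trace_matS_eq_matT (X : GIrrep) : (basisS.matA X * basisS.matB X).trace =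
    (basisT.matA X * basisT.matB X).trace := by
  have h := fun h1 h2 => (((modelS.repA X).mul (modelS.repB X)).trace h1).eq_of_check
    (((modelT.repA X).mul (modelT.repB X)).trace h2)
  cases X <;> exact h (by decide +kernel) (by decide +kernel) (by decide +kernel) (by decide +kernel)

theorem eq_of_trace_matS {X Y : GIrrep} (hd : X.dim = Y.dim)
    (ht : (basisS.matA X * basisS.matB X).trace = (basisS.matA Y * basisS.matB Y).trace) : X = Y := by
  cases X <;> cases Y <;> first
    | rfl
    | exact absurd hd (by decide)
    | exact absurd ht trace_matS_ne
    | exact absurd ht.symm trace_matS_ne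

theorem eq_of_trace_matT {X Y : GIrrep} (hd : X.dim = Y.dim)
    (ht : (basisT.matA X * basisT.matB X).trace = (basisT.matA Y * basisT.matB Y).trace) : X = Y := by
  cases X <;> cases Y <;> first
    | rfl
    | exact absurd hd (by decide)
    | exact absurd ht trace_matT_ne
    | exact absurd ht.symm trace_matT_ne

theorem trace_gen₁S_ne {x y : S4Irrep} (hx : (modelS.G₁ x).ok = true := by decide +kernel)
    (hy : (modelS.G₁ y).ok = true := by decide +kernel)
    (h : neN (modelS.G₁ x).D ((modelS.G₁ x).tr x.dim) (modelS.G₁ y).D ((modelS.G₁ y).tr y.dim) = true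
      := by decide +kernel) : (basisS.gen₁ x).trace ≠ (basisS.gen₁ y).trace :=
  ((modelS.repG₁ x).trace hx).ne_of_check ((modelS.repG₁ y).trace hy) h

theorem trace_gen₁T_ne {x y : T7Irrep} (hx : (modelT.G₁ x).ok = true := by decide +kernel)
    (hy : (modelT.G₁ y).ok = true := by decide +kernel)
    (h : neN (modelT.G₁ x).D ((modelT.G₁ x).tr x.dim) (modelT.G₁ y).D ((modelT.G₁ y).tr y.dim) = true
      := by decide +kernel) : (basisT.gen₁ x).trace ≠ (basisT.gen₁ y).trace :=
  ((modelT.repG₁ x).trace hx).ne_of_check ((modelT.repG₁ y).trace hy) h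

theorem trace_gen₂T_ne {x y : T7Irrep} (hx : (modelT.G₂ x).ok = true := by decide +kernel)
    (hy : (modelT.G₂ y).ok = true := by decide +kernel)
    (h : neN (modelT.G₂ x).D ((modelT.G₂ x).tr x.dim) (modelT.G₂ y).D ((modelT.G₂ y).tr y.dim) = true
      := by decide +kernel) : (basisT.gen₂ x).trace ≠ (basisT.gen₂ y).trace :=
  ((modelT.repG₂ x).trace hx).ne_of_check ((modelT.repG₂ y).trace hy) h

theorem eq_of_trace_genS {x y : S4Irrep} (hd : x.dim = y.dim)
    (ht : (basisS.gen₁ x).trace = (basisS.gen₁ y).trace) : x = y := by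
  cases x <;> cases y <;> first
    | rfl
    | exact absurd hd (by decide)
    | exact absurd ht trace_gen₁S_ne

theorem eq_of_trace_genT {x y : T7Irrep} (hd : x.dim = y.dim)
    (ht : (basisT.gen₁ x).trace = (basisT.gen₁ y).trace)
    (ht' : (basisT.gen₂ x).trace = (basisT.gen₂ y).trace) : x = y := by
  cases x <;> cases y <;> first
    | rfl
    | exact absurd hd (by decide)
    | exact absurd ht trace_gen₁T_ne
    | exact absurd ht' trace_gen₂T_ne

end
end PSL27

namespace PSL27
open Matrix

section

variable {ι : Type} [Fintype ι] [DecidableEq ι] [IrrepCode ι] {D : AdaptedBasis ι} {m : Model D}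

theorem isUnit_of_mul_star {n : ℕ} {M : Matrix (Fin n) (Fin n) ℂ} (h : M * Mᴴ = 1) : IsUnit M :=
  IsUnit.of_mul_eq_one _ h

theorem Model.Valid.exists_realizes (hm : m.Valid) {A B : PSL₂7} (h : IsStandardPair A B)
    {H : Subgroup PSL₂7} {h₁ h₂ : H} {rels : List (List Bool)} {n : ℕ} (hb : IsBoundedBy rels n)
    (hcl : Subgroup.closure {h₁, h₂} = ⊤) (hH : Nat.card H = n)
    (hrel : ∀ w ∈ rels, evalWord w h₁ h₂ = 1) (hmrel : m.checkRel rels = true)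
    (hw₁ : (h₁ : PSL₂7) = evalWord m.word₁ A B) (hw₂ : (h₂ : PSL₂7) = evalWord m.word₂ A B) :
    ∃ ρ σ, m.Realizes A B h₁ h₂ ρ σ := by
  choose ρ hρ using fun X => exists_hom_monoid_of_bounded isBoundedBy_PSL h.generate card_PSL
    h.evalWord_relator (fun w hw => m.evalWord_relator hm.mat X hw)
    (isUnit_of_mul_star (m.matA_mul_star hm.mat X)) (isUnit_of_mul_star (m.matB_mul_star hm.mat X))
  choose σ hσ using fun x => exists_hom_monoid_of_bounded hb hcl hH hrel
    (fun w hw => m.evalWord_gen hmrel x hw)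
    (isUnit_of_mul_star (m.gen₁_mul_star hm.gen x)) (isUnit_of_mul_star (m.gen₂_mul_star hm.gen x))
  exact ⟨ρ, σ, h.generate, hcl, fun X => (hρ X).1, fun X => (hρ X).2, fun x => (hσ x).1,
    fun x => (hσ x).2, hw₁, hw₂⟩

theorem Model.Realizes.isRealizedBy (hm : m.Valid) {A B : PSL₂7} {H : Subgroup PSL₂7} {h₁ h₂ : H}
    {ρ : (X : GIrrep) → PSL₂7 →* Matrix (Fin X.dim) (Fin X.dim) ℂ}
    {σ : (x : ι) → H →* Matrix (Fin (D.dim x)) (Fin (D.dim x)) ℂ}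
    (hr : m.Realizes A B h₁ h₂ ρ σ) {w : List Bool} (hirr : m.checkIrr w = true)
    (hl : m.checkLink = true) (hcard : ∑ x, D.dim x ^ 2 = Nat.card H)
    (hne : ∀ X Y : GIrrep, X.dim = Y.dim →
      (D.matA X * D.matB X).trace = (D.matA Y * D.matB Y).trace → X = Y)
    (hne' : ∀ x y, D.dim x = D.dim y → (D.gen₁ x).trace = (D.gen₁ y).trace →
      (D.gen₂ x).trace = (D.gen₂ y).trace → x = y) :
    D.IsRealizedBy A B h₁ h₂ ρ σ := by
  have hσ : IsIrrepList σ := isIrrepList_of_scalarCommutant (hr.unitary_sub hm) hm.dim_pos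
    (hr.hasScalarCommutant_sub hirr)
    (fun x y hd ht => hne' x y hd (by rw [← hr.map_gen₁, ← hr.map_gen₁, ht])
      (by rw [← hr.map_gen₂, ← hr.map_gen₂, ht])) hcard
  refine ⟨hr.map_A, hr.map_B, hr.map_gen₁, hr.map_gen₂, ?_, hσ⟩
  refine isIrrepList_of_scalarCommutant (hr.unitary hm) (fun X => by cases X <;> decide)
    (hr.hasScalarCommutant hm hl (hr.hasScalarCommutant_sub hirr) hσ)
    (fun X Y hd ht => hne X Y hd ?_) (by rw [card_PSL]; decide)
  rw [← hr.map_A, ← hr.map_B, ← hr.map_A, ← hr.map_B, ← map_mul, ← map_mul, ht]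

end

end PSL27

open PSL27 in
theorem mainTheorem5 :
    (∃ A B : PSL₂7, IsStandardPair A B) ∧
    ∀ A B : PSL₂7, IsStandardPair A B →
      (Nonempty (subS4 A B ≃* Equiv.Perm (Fin 4)) ∧
        elta A B ^ 4 = 1 ∧ eltb A B ^ 2 = 1 ∧ (elta A B * eltb A B) ^ 3 = 1) ∧
      (Nat.card (subT7 A B) = 21 ∧
        eltc A B ^ 7 = 1 ∧ eltd A B ^ 3 = 1 ∧ (eltd A B)⁻¹ * eltc A B * eltd A B = eltc A B ^ 4) ∧
      ∃ (ρS ρT : (X : GIrrep) → PSL₂7 →* Matrix (Fin X.dim) (Fin X.dim) ℂ)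
        (σS : (x : S4Irrep) → subS4 A B →* Matrix (Fin (basisS.dim x)) (Fin (basisS.dim x)) ℂ)
        (σT : (x : T7Irrep) → subT7 A B →* Matrix (Fin (basisT.dim x)) (Fin (basisT.dim x)) ℂ),
        (basisS.IsRealizedBy A B (genA A B) (genB A B) ρS σS ∧ basisS.IsAdapted ρS σS ∧
          basisS.IsSubgroupCG σS ∧ basisS.IsCompleteTable ρS ∧
          basisS.IsConjugationCompatible ρS σS) ∧
        (basisT.IsRealizedBy A B (genC A B) (genD A B) ρT σT ∧ basisT.IsAdapted ρT σT ∧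
          basisT.IsSubgroupCG σT ∧ basisT.IsCompleteTable ρT ∧
          basisT.IsConjugationCompatible ρT σT) ∧
        ∀ X, Nonempty ((toRep (ρS X)).Equiv (toRep (ρT X))) := by
  refine ⟨⟨_, _, isStandardPair_mk⟩, fun A B h => ⟨⟨h.nonempty_mulEquiv, h.relations_subS4⟩,
    ⟨h.card_subT7, h.relations_subT7⟩, ?_⟩⟩
  obtain ⟨ρS, σS, hS⟩ := modelS_valid.exists_realizes h isBoundedBy_S4 (closure_genA_genB A B)
    h.card_subS4 h.evalWord_relatorsS modelS_rel h.elta_eq (eltb_eq A B)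
  obtain ⟨ρT, σT, hT⟩ := modelT_valid.exists_realizes h isBoundedBy_T7 (closure_genC_genD A B)
    h.card_subT7 h.evalWord_relatorsT modelT_rel (eltc_eq A B) (eltd_eq A B)
  have hS' := hS.isRealizedBy modelS_valid modelS_irr modelS_link (by rw [h.card_subS4]; decide)
    (fun _ _ => eq_of_trace_matS) (fun _ _ hd ht _ => eq_of_trace_genS hd ht)
  have hT' := hT.isRealizedBy modelT_valid modelT_irr modelT_link (by rw [h.card_subT7]; decide)
    (fun _ _ => eq_of_trace_matT) (fun _ _ => eq_of_trace_genT)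
  refine ⟨ρS, ρT, σS, σT,
    ⟨hS', hS.isAdapted modelS_valid, hS.isSubgroupCG modelS_valid,
      hS.isCompleteTable modelS_valid modelS_regular,
      hS.isConjugationCompatible modelS_valid modelS_regular⟩,
    ⟨hT', hT.isAdapted modelT_valid, hT.isSubgroupCG modelT_valid,
      hT.isCompleteTable modelT_valid modelT_regular,
      hT.isConjugationCompatible modelT_valid modelT_regular⟩, fun X => ?_⟩
  obtain ⟨Y, ⟨e⟩⟩ := hT'.irreps.exhaustive _ (toRep (ρS X)) (hS'.irreps.irreducible X)
  have hXY : X = Y := by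
    have ht := trace_eq_of_equiv e (A * B)
    rw [map_mul, map_mul, hS.map_A, hS.map_B, hT.map_A, hT.map_B, trace_matS_eq_matT] at ht
    exact eq_of_trace_matT (dim_eq_of_equiv e) ht
  subst hXY
  exact ⟨e⟩
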